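/- **Data.** Let $\nu\ge 2$, $I=\{1,\dots,\nu,\infty\}$, $t_1=0$, $t_2=1$, $t_\infty=\infty$. Let $I=I_{\rm reg}\sqcup I_{\rm un}\sqcup I_{\rm ra}$, and let $n_i=1$ for $i\in I_{\rm reg}$, $n_i\ge2$ for $i\in I_{\rm un}\cup I_{\rm ra}$; put $n=\sum_{i\in I}n_i$. Fix complex numbers $\theta^\pm_{n_i-1,t_i}$ ($i\in I_{\rm reg}\cup I_{\rm un}$) and $\theta_{2n_i-2,t_i}$ ($i\in I_{\rm ra}$) with $$\sum_{i\in I_{\rm reg}\cup I_{\rm un}}(\theta^+_{n_i-1,t_i}+\theta^-_{n_i-1,t_i})+\sum_{i\in I_{\rm ra}}\bigl(\theta_{2n_i-2,t_i}-\tfrac12\bigr)=-1,\qquad \theta^+_{0,t_i}-\theta^-_{0,t_i}\notin\mathbb Z\ (i\in I_{\rm reg}),$$ and fix distinct positions $t_i\in\mathbb C\setminus\{0,1\}$ for $i\in\{3,\dots,\nu\}\cap I_{\rm ra}$. The base $B$ of deformation parameters has the coordinates $t_i$ ($i\in\{3,\dots,\nu\}\setminus I_{\rm ra}$), $\theta^\pm_{l,t_i}$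 ($i\in I_{\rm un}$, $0\le l\le n_i-2$) and $\theta_{l',t_i}$ ($i\in I_{\rm ra}$, $0\le l'\le 2n_i-3$), subject to: $t_1,\dots,t_\nu$ are pairwise distinct, $\theta^+_{0,t_i}\ne\theta^-_{0,t_i}$ ($i\in I_{\rm un}$), $\theta_{1,t_i}\neq0$ ($i\in I_{\rm ra}$). The phase space $M$ consists of the points $b\in B$ together with pairs $(q_j,p_j)\in\mathbb C^2$, $1\le j\le n-3$, where the $q_j$ are pairwise distinct and different from $t_1,\dots,t_\nu$ (the pairs are numbered; the space of unordered pairs is the quotient by the free action of the symmetric group). Let $\pi:M\to B$ be the projection. **The connection.** Put $P(x)=\prod_{i=1}^\nu(x-t_i)^{n_i}$ and consider $d+\Omega$, $\Omega=\begin{pmatrix}0&1/P\\ c_0&d_0\end{pmatrix}dx$, $$c_0=\sum_{i=1}^\nu\frac{C_i(x)}{(x-t_i)^{n_i}}+\sum_{j}\frac{p_j}{x-q_j}+\tilde C(x)+x^{n-3}C_\infty(x),\qquad d_0=\sum_{i=1}^\nu\frac{D_i(x)}{(x-t_i)^{n_i}}-\sum_j\frac1{x-q_j}+D_\infty(x),$$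 with polynomials of degrees $\deg C_i,\deg D_i<n_i$ ($i\le\nu$), $\deg C_\infty<n_\infty$, $\deg D_\infty<n_\infty-1$, $\deg\tilde C<n-3$. The local coordinate is $z=x-t_i$ at $t_i$, $i\le\nu$, and $z=1/x$ at $\infty$, where the trivialisation is changed by $\mathrm{diag}(1,x^{n-2})$. For $A$ and $g$ write $g\cdot A=g^{-1}dg+g^{-1}Ag$. For every point of $M$ there is exactly one such tuple of polynomials for which (a) each $q_j$ is an apparent singularity: the gauge transform of $\Omega$ by $\begin{pmatrix}1&0\\p_j&x-q_j\end{pmatrix}$ is regular at $q_j$; and (b) at each $t_i$, $\Omega$ is equivalent under $GL_2(\mathbb C[[z]])$ to $\mathrm{diag}\bigl(\sum_{l=0}^{n_i-1}\theta^{\pm}_{l,t_i}z^{l-n_i}\bigr)dz$ if $i\notin I_{\rm ra}$, and to $\begin{pmatrix}\alpha&\beta\\ z\beta&\alpha-\frac1{2z}\end{pmatrix}dz$ with $\alpha=\sum_{l=0}^{n_i-1}\frac{\theta_{2l,t_i}}2z^{l-n_i}$, $\beta=\sum_{l=0}^{n_i-2}\frac{\theta_{2l+1,t_i}}2z^{l-n_i}$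 if $i\in I_{\rm ra}$. $\Omega$ denotes this family from now on. **Formal solutions.** On $M$ choose, holomorphically, the following; such choices exist. * For $i\notin I_{\rm ra}$: $\Phi_i\in GL_2(\mathbb C)$ and $\Xi_i=1+\sum_{s\ge1}\xi_sz^s$, all $\xi_s$ with zero diagonal, such that $\Omega^{\rm diag}_{t_i}:=(\Phi_i\Xi_i)\cdot\Omega=\mathrm{diag}\bigl(\sum_{l\ge0}\theta^\pm_{l,t_i}z^{l-n_i}\bigr)dz$, where for $l\le n_i-1$ the coefficients are the given parameters. Put $\psi_i=\Phi_i\Xi_i\exp(-\int\Omega^{\rm diag}_{t_i})$. * For $i\in I_{\rm ra}$: $\Phi_i\in GL_2(\mathbb C)$ and $\Xi_i=1+\sum_{s\ge1}\xi_sz^s$ such that $(\Phi_i\Xi_i)\cdot\Omega=\begin{pmatrix}\alpha&\beta\\ z\beta&\alpha-\frac1{2z}\end{pmatrix}dz$ with formal Laurent series $\alpha,\beta$ of pole order at most $n_i$ whose coefficients at $z^{l-n_i}$ are $\theta_{2l,t_i}/2$ ($l\le n_i-1$) and $\theta_{2l+1,t_i}/2$ ($l\le n_i-2$) respectively, and such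 that $\Phi_i$, the $\xi_s$ with $s\le n_i-2$ and the first column of $\xi_{n_i-1}$ do not depend on $(q,p)$. With $z=\zeta^2$ and $M_\zeta=\begin{pmatrix}1&1\\ \zeta&-\zeta\end{pmatrix}$ put $\Omega^{\rm diag}_{t_i}(\zeta^2)=(\Phi_i\Xi_i(\zeta^2)M_\zeta)\cdot\Omega(\zeta^2)$, whose $(1,1)$-entry is $\sum_{l'\ge0}\theta_{l',t_i}\zeta^{l'-2n_i+1}d\zeta$, and $\psi_{\zeta_i}=\Phi_i\Xi_i(\zeta^2)M_\zeta\exp(-\int\Omega^{\rm diag}_{t_i}(\zeta^2))$. * At $q_j$: $\psi_{q_j}=\begin{pmatrix}1&0\\p_j&1\end{pmatrix}\Xi_{q_j}\begin{pmatrix}1&0\\0&x-q_j\end{pmatrix}$ with $\Xi_{q_j}=1+\sum_{s\ge1}\xi^{q_j}_s(x-q_j)^s$, $(\xi^{q_j}_1)_{21}=0$ and $(d+\Omega)\psi_{q_j}=0$. The primitives are formal, without constant term, and tangent vectors $\delta$ of $M$ act on Laurent series with $x$ held fixed, so that $\delta((x-a)^k)=-k\,\delta(a)(x-a)^{k-1}$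 and $\delta(\log(x-a))=-\delta(a)/(x-a)$. The isomonodromy 2-form is $$\hat\omega(\delta_1,\delta_2)=\tfrac12\sum_{i\notin I_{\rm ra}}\operatorname{res}_{t_i}\mathrm{Tr}\bigl(\delta\Omega\wedge\delta\psi_i\,\psi_i^{-1}\bigr)+\tfrac14\sum_{i\in I_{\rm ra}}\operatorname{res}_{\zeta=0}\mathrm{Tr}\bigl(\delta\Omega(\zeta^2)\wedge\delta\psi_{\zeta_i}\psi_{\zeta_i}^{-1}\bigr)+\tfrac12\sum_{j=1}^{n-3}\operatorname{res}_{q_j}\mathrm{Tr}\bigl(\delta\Omega\wedge\delta\psi_{q_j}\psi_{q_j}^{-1}\bigr),$$ where $\delta\Omega\wedge\delta\psi\,\psi^{-1}=\delta_1(\Omega)\delta_2(\psi)\psi^{-1}-\delta_1(\psi)\psi^{-1}\delta_2(\Omega)$. **Hamiltonians.** Put $$H_{\theta^\pm_{l,t_i}}=\frac{\theta^\pm_{2n_i-l-2,t_i}}{n_i-l-1}\ (i\in I_{\rm un},\,0\le l\le n_i-2),\qquad H_{t_i}=\sum_{l=0}^{n_i-1}\bigl(\theta^+_{l,t_i}\theta^+_{2n_i-l-1,t_i}+\theta^-_{l,t_i}\theta^-_{2n_i-l-1,t_i}\bigr)\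 (3\le i\le\nu,\ i\notin I_{\rm ra}),$$ $$H_{\theta_{l',t_i}}=\frac{\theta_{4(n_i-1)-l',t_i}}{2(n_i-1)-l'}\ (i\in I_{\rm ra},\,1\le l'\le 2n_i-3),\qquad H_{\theta_{0,t_i}}=\frac{\theta_{4(n_i-1),t_i}}{2(n_i-1)}-\frac{\theta_{2n_i-1,t_i}}{2\theta_{1,t_i}}\ (i\in I_{\rm ra}),$$ $$\eta_j=\frac{p_j}{P(q_j)}-\sum_{i=1}^\nu\frac{D_i(q_j)}{(q_j-t_i)^{n_i}}-D_\infty(q_j).$$ **Theorem.** For all such choices the functions $\eta_j$ and the Hamiltonians are holomorphic on $M$, and with $$\hat\omega'=\sum_{j=1}^{n-3}d\eta_j\wedge dq_j+\sum_{i\in I_{\rm un}}\sum_{l=0}^{n_i-2}\sum_{\pm}dH_{\theta^\pm_{l,t_i}}\wedge d\theta^\pm_{l,t_i}+\sum_{i\in I_{\rm ra}}\sum_{l'=0}^{2n_i-3}dH_{\theta_{l',t_i}}\wedge d\theta_{l',t_i}+\sum_{\substack{3\le i\le\nu\\ i\notin I_{\rm ra}}}dH_{t_i}\wedge dt_i$$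 (where $(df\wedge dg)(\delta_1,\delta_2)=\delta_1(f)\delta_2(g)-\delta_2(f)\delta_1(g)$), the difference $\hat\omega-\hat\omega'$ is a holomorphic section of $\pi^*\Omega^2_B$: there is a holomorphic map $\tau$ from $M$ to the alternating 2-forms on the tangent space of $B$ with $(\hat\omega-\hat\omega')_m(\delta_1,\delta_2)=\tau_m(d\pi\,\delta_1,d\pi\,\delta_2)$ for all $m\in M$ and all tangent vectors $\delta_1,\delta_2$ of $M$ at $m$. -/

import Mathlib

open scoped Matrix
open Polynomial

namespace Isomonodromy

noncomputable section

/-! ### Deformation parameters and the extended phase space -/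

/-- The three types of singular points: regular, unramified irregular, ramified irregular. -/
inductive Kind
  | reg
  | un
  | ra
  deriving DecidableEq

/-- The discrete data and the constants of a family of connections with poles
`t_1 = 0, t_2 = 1, t_3, …, t_ν, t_∞ = ∞`.  The index set of the poles is `Option (Fin ν)`:
`none` is the point `∞`, `some i` is the `(i+1)`-st finite point.  The signs `+` and `-` are
written `0` and `1` in `Fin 2`. -/
structure SingularData (ν : ℕ) where
  /-- there are at least the finite poles `0` and `1` -/
  two_le : 2 ≤ ν
  /-- the type of each pole -/
  kind : Option (Fin ν) → Kind
  /-- the order `n_i` of each pole -/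
  ord : Option (Fin ν) → ℕ
  ord_reg : ∀ i, kind i = Kind.reg → ord i = 1
  ord_irr : ∀ i, kind i ≠ Kind.reg → 2 ≤ ord i
  /-- the residue exponents `θ^±_{n_i - 1}` at the regular and unramified poles -/
  res : Option (Fin ν) → Fin 2 → ℂ
  /-- the residue exponents `θ_{2 n_i - 2}` at the ramified poles -/
  resRa : Option (Fin ν) → ℂ
  /-- the Fuchs relation -/
  fuchs : ∑ i, (if kind i = Kind.ra then resRa i - 1 / 2 else res i 0 + res i 1) = -1
  /-- non-resonance at the regular poles -/
  nonres : ∀ i, kind i = Kind.reg → ∀ k : ℤ, res i 0 - res i 1 ≠ k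
  /-- the fixed positions of the ramified poles among `t_3, …, t_ν` -/
  tra : Fin ν → ℂ
  tra_ne : ∀ i : Fin ν, 2 ≤ i.val → kind (some i) = Kind.ra → tra i ≠ 0 ∧ tra i ≠ 1
  tra_inj : ∀ i j : Fin ν, 2 ≤ i.val → 2 ≤ j.val → kind (some i) = Kind.ra →
    kind (some j) = Kind.ra → tra i = tra j → i = j

variable {ν : ℕ} (S : SingularData ν)

/-- `n`, the degree of the polar divisor. -/
def SingularData.deg : ℕ := ∑ i, S.ord i

/-- `n - 3`, the number of apparent singularities. -/
def SingularData.numApp : ℕ := S.deg - 3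

/-- The number of free `θ^+_l` at the pole `i`: the range of `l` is `0, …, n_i - 2`
at an unramified pole. -/
def SingularData.unLen (i : Option (Fin ν)) : ℕ :=
  if S.kind i = Kind.un then S.ord i - 1 else 0

/-- The number of free `θ_l'` at the pole `i`: the range of `l'` is `0, …, 2 n_i - 3`
at a ramified pole. -/
def SingularData.raLen (i : Option (Fin ν)) : ℕ :=
  if S.kind i = Kind.ra then 2 * S.ord i - 2 else 0

/-- The indices of the movable poles: `t_3, …, t_ν` without the ramified ones. -/
abbrev SingularData.Mov : Type := {i : Fin ν // 2 ≤ i.val ∧ S.kind (some i) ≠ Kind.ra}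

/-- Indices of the unramified exponents `θ^±_{l, t_i}`. -/
abbrev SingularData.ThUn : Type := Σ i : Option (Fin ν), Fin (S.unLen i) × Fin 2

/-- Indices of the ramified exponents `θ_{l', t_i}`. -/
abbrev SingularData.ThRa : Type := Σ i : Option (Fin ν), Fin (S.raLen i)

/-- The affine space of the deformation parameters
`((t_i)_i, (θ^±_{l,t_i})_{i,l}, (θ_{l',t_i})_{i,l'})`. -/
abbrev SingularData.Base : Type := (S.Mov → ℂ) × (S.ThUn → ℂ) × (S.ThRa → ℂ)

/-- The affine space with the coordinates `((q, p), b)`; the projection to the deformation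
parameters is `Prod.snd`. -/
abbrev SingularData.Total : Type := ((Fin S.numApp → ℂ) × (Fin S.numApp → ℂ)) × S.Base

variable {S}

/-- The position `t_i` of a finite pole. -/
def pos (b : S.Base) (i : Fin ν) : ℂ :=
  if i.val = 0 then 0 else if i.val = 1 then 1
  else if h : 2 ≤ i.val ∧ S.kind (some i) ≠ Kind.ra then b.1 ⟨i, h⟩ else S.tra i

/-- `θ^±_{l,t_i}` for `l ≤ n_i - 1` at a regular or unramified pole. -/
def thetaUn (b : S.Base) (i : Option (Fin ν)) (l : ℕ) (s : Fin 2) : ℂ :=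
  if h : l < S.unLen i then b.2.1 ⟨i, ⟨l, h⟩, s⟩ else S.res i s

/-- `θ_{l',t_i}` for `l' ≤ 2 n_i - 2` at a ramified pole. -/
def thetaRa (b : S.Base) (i : Option (Fin ν)) (l : ℕ) : ℂ :=
  if h : l < S.raLen i then b.2.2 ⟨i, ⟨l, h⟩⟩ else S.resRa i

/-- The coordinate `q_j`. -/
def qc (m : S.Total) (j : Fin S.numApp) : ℂ := m.1.1 j

/-- The coordinate `p_j`. -/
def pc (m : S.Total) (j : Fin S.numApp) : ℂ := m.1.2 j

variable (S) in
/-- The extended moduli space: the poles are distinct, the `q_j` are distinct and different from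
the poles, the leading exponents satisfy `θ^+_0 ≠ θ^-_0` (unramified) and `θ_1 ≠ 0` (ramified).
The pairs `(q_j, p_j)` are numbered. -/
def phaseSpace : Set S.Total :=
  {m | Function.Injective (pos m.2) ∧ Function.Injective (qc m) ∧
    (∀ j i, qc m j ≠ pos m.2 i) ∧
    (∀ i, S.kind i = Kind.un → thetaUn m.2 i 0 0 ≠ thetaUn m.2 i 0 1) ∧
    (∀ i, S.kind i = Kind.ra → thetaRa m.2 i 1 ≠ 0)}

/-! ### Formal Laurent series and formal gauge transformations -/

/-- The field of formal Laurent series `ℂ((z))`. -/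
abbrev Laur : Type := LaurentSeries ℂ

/-- 2×2 matrices of formal Laurent series. -/
abbrev LMat : Type := Matrix (Fin 2) (Fin 2) Laur

/-- 2×2 complex matrices. -/
abbrev CMat : Type := Matrix (Fin 2) (Fin 2) ℂ

/-- The local coordinate `z`. -/
def zvar : Laur := HahnSeries.single 1 1

/-- The constant Laurent series `c`. -/
def cst (c : ℂ) : Laur := HahnSeries.C c

/-- The Laurent series with given coefficients (zero if they are not bounded below). -/
def ofCoeff (f : ℤ → ℂ) : Laur :=
  open scoped Classical in
  if h : BddBelow (Function.support f) then HahnSeries.ofSuppBddBelow f h else 0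

/-- The matrix of formal power series `∑_{s ≥ 0} X_s z^s`. -/
def seriesMat (X : ℕ → CMat) : LMat :=
  fun a b => HahnSeries.ofPowerSeries ℤ ℂ (PowerSeries.mk fun s => X s a b)

/-- A constant matrix. -/
def cstMat (X : CMat) : LMat := X.map cst

/-- Entrywise `d/dz`. -/
def ddz (A : LMat) : LMat := A.map (LaurentSeries.derivative ℂ)

/-- The gauge transform `g⁻¹ g' + g⁻¹ A g` of the connection `d + A dz` by `g`. -/
def gaugeTransform (g A : LMat) : LMat := g⁻¹ * ddz g + g⁻¹ * A * g

/-- The substitution `z = ζ²`. -/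
def sqSubst : Laur →+* Laur :=
  HahnSeries.embDomainRingHom (AddMonoidHom.mulLeft (2 : ℤ))
    (fun a b h => by simpa using h) (fun a b => by simp)

/-- The pull-back of the matrix one-form `A dz` under `z = ζ²`, as a multiple of `dζ`. -/
def ramify (A : LMat) : LMat := fun a b => sqSubst (A a b) * (2 * zvar)

/-- The matrix `M_ζ` which diagonalises `[[α, β], [ζ² β, α - 1/2 ζ⁻²]]`. -/
def matM : LMat := !![1, 1; zvar, -zvar]

/-! ### The normal form of the connection -/

/-- The polynomials `((C_i, D_i)_{i ∈ I}, C̃)`; at a finite pole, `C_i` and `D_i` are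
the polynomials `C_i(x)`, `D_i(x)` in the global variable `x`. -/
structure CoeffTuple (ν : ℕ) where
  /-- the polynomials `C_i` -/
  C : Option (Fin ν) → ℂ[X]
  /-- the polynomials `D_i` -/
  D : Option (Fin ν) → ℂ[X]
  /-- the polynomial `C̃` -/
  Ct : ℂ[X]

/-- `P(x) = ∏_{i=1}^ν (x - t_i)^{n_i}`. -/
def polyP (b : S.Base) : ℂ[X] := ∏ i : Fin ν, (X - C (pos b i)) ^ S.ord (some i)

/-- The entry `c₀(x) = ∑ C_i(x)/(x-t_i)^{n_i} + ∑ p_j/(x-q_j) + C̃(x) + x^{n-3} C_∞(x)`. -/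
def entryC (m : S.Total) (c : CoeffTuple ν) (x : Laur) : Laur :=
  ∑ i : Fin ν, aeval x (c.C (some i)) / (x - cst (pos m.2 i)) ^ S.ord (some i)
    + ∑ j, cst (pc m j) / (x - cst (qc m j)) + aeval x c.Ct + x ^ S.numApp * aeval x (c.C none)

/-- The entry `d₀(x) = ∑ D_i(x)/(x-t_i)^{n_i} - ∑ 1/(x-q_j) + D_∞(x)`. -/
def entryD (m : S.Total) (c : CoeffTuple ν) (x : Laur) : Laur :=
  ∑ i : Fin ν, aeval x (c.D (some i)) / (x - cst (pos m.2 i)) ^ S.ord (some i)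
    - ∑ j, 1 / (x - cst (qc m j)) + aeval x (c.D none)

/-- The connection matrix `[[0, 1/P], [c₀, d₀]]` (a multiple of `dx`) at the Laurent series `x`. -/
def connMatrix (m : S.Total) (c : CoeffTuple ν) (x : Laur) : LMat :=
  !![0, 1 / aeval x (polyP m.2); entryC m c x, entryD m c x]

/-- The connection matrix near a finite point `a`, in the coordinate `z = x - a`. -/
def connAt (m : S.Total) (c : CoeffTuple ν) (a : ℂ) : LMat := connMatrix m c (cst a + zvar)

/-- The connection matrix near `∞`, in the coordinate `z = 1/x` and after the change of
trivialisation by `diag(1, x^{n-2})` that extends the bundle over `∞`. -/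
def connInfty (m : S.Total) (c : CoeffTuple ν) : LMat :=
  gaugeTransform !![1, 0; 0, (zvar⁻¹) ^ (S.deg - 2)] (-(zvar⁻¹) ^ 2 • connMatrix m c zvar⁻¹)

/-- The connection matrix near the pole `t_i`. -/
def connPole (m : S.Total) (c : CoeffTuple ν) : Option (Fin ν) → LMat
  | some i => connAt m c (pos m.2 i)
  | none => connInfty m c

/-- The formal normal form `diag(∑_l θ^+_l z^{l-n_i}, ∑_l θ^-_l z^{l-n_i})`, `0 ≤ l ≤ n_i - 1`, at
a regular or unramified pole. -/
def formalUn (b : S.Base) (i : Option (Fin ν)) : LMat :=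
  Matrix.diagonal fun s => ∑ l ∈ Finset.range (S.ord i),
    HahnSeries.single ((l : ℤ) - S.ord i) (thetaUn b i l s)

/-- The matrix `[[α, β], [z β, α - 1/(2z)]]`. -/
def ramShape (α β : Laur) : LMat := !![α, β; zvar * β, α - cst (1 / 2) * zvar⁻¹]

/-- The formal normal form `[[α, β], [z β, α - 1/(2z)]]` at a ramified pole, with
`α = ∑_{l ≤ n_i-1} (θ_{2l}/2) z^{l-n_i}` and `β = ∑_{l ≤ n_i-2} (θ_{2l+1}/2) z^{l-n_i}`. -/
def formalRa (b : S.Base) (i : Option (Fin ν)) : LMat :=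
  ramShape
    (∑ l ∈ Finset.range (S.ord i),
      HahnSeries.single ((l : ℤ) - S.ord i) (thetaRa b i (2 * l) / 2))
    (∑ l ∈ Finset.range (S.ord i - 1),
      HahnSeries.single ((l : ℤ) - S.ord i) (thetaRa b i (2 * l + 1) / 2))

/-- The formal type prescribed by `θ` at the pole `i`. -/
def formalType (b : S.Base) (i : Option (Fin ν)) : LMat :=
  if S.kind i = Kind.ra then formalRa b i else formalUn b i

/-- `d + A dz` is equivalent to `d + B dz` under `GL_2(ℂ[[z]])`. -/
def FormallyEquivalent (A B : LMat) : Prop :=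
  ∃ G : ℕ → CMat, (G 0).det ≠ 0 ∧ gaugeTransform (seriesMat G) A = B

/-- The matrix of Laurent series `A` has no polar part. -/
def IsRegularMat (A : LMat) : Prop := ∀ a b, ∀ k : ℤ, k < 0 → (A a b).coeff k = 0

/-- The tuple defines the connection with apparent singularities `(q_j, p_j)` (the elementary
transform at `q_j` in the direction `(1, p_j)` is regular) and with the local exponents of `m`. -/
structure IsNormalForm (m : S.Total) (c : CoeffTuple ν) : Prop where
  deg_C : ∀ i, (c.C i).degree < (S.ord i : ℕ)
  deg_D : ∀ i : Fin ν, (c.D (some i)).degree < (S.ord (some i) : ℕ)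
  deg_D_infty : (c.D none).degree < ((S.ord none - 1 : ℕ) : WithBot ℕ)
  deg_Ct : c.Ct.degree < (S.numApp : ℕ)
  apparent : ∀ j, IsRegularMat
    (gaugeTransform !![1, 0; cst (pc m j), zvar] (connAt m c (qc m j)))
  formal : ∀ i, FormallyEquivalent (connPole m c i) (formalType m.2 i)

/-- The tuple of polynomials of the connection that belongs to the point `m`. -/
def normalForm (m : S.Total) : CoeffTuple ν :=
  letI : Nonempty (CoeffTuple ν) := ⟨⟨0, 0, 0⟩⟩
  Classical.epsilon (IsNormalForm m)

/-- The connection matrix `Ω` at the pole `t_i`. -/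
def omPole (i : Option (Fin ν)) (m : S.Total) : LMat := connPole m (normalForm m) i

/-- The connection matrix `Ω` at the apparent singularity `q_j`. -/
def omApp (j : Fin S.numApp) (m : S.Total) : LMat := connAt m (normalForm m) (qc m j)

/-! ### Formal solutions -/

variable (S) in
/-- A choice, at every point of the phase space, of compatible framings `Φ_i`, of formal
transformations `Ξ_i = ∑ ξ_s z^s` at the poles, and of the series `Ξ_{q_j}`. -/
structure Frames where
  /-- the compatible framings -/
  Phi : Option (Fin ν) → S.Total → CMat
  /-- the coefficients `ξ_s` of the formal transformations -/
  Xi : Option (Fin ν) → ℕ → S.Total → CMat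
  /-- the coefficients of `Ξ_{q_j}` -/
  XiQ : Fin S.numApp → ℕ → S.Total → CMat

/-- `Φ_i Ξ_i`. -/
def frameZ (F : Frames S) (i : Option (Fin ν)) (m : S.Total) : LMat :=
  cstMat (F.Phi i m) * seriesMat fun s => F.Xi i s m

/-- `Φ_i Ξ_i(ζ²) M_ζ`. -/
def frameZeta (F : Frames S) (i : Option (Fin ν)) (m : S.Total) : LMat :=
  (frameZ F i m).map sqSubst * matM

/-- `ψ_{q_j} = Φ_{q_j} Ξ_{q_j} Λ_{q_j}` in the coordinate `z = x - q_j`. -/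
def psiQ (F : Frames S) (j : Fin S.numApp) (m : S.Total) : LMat :=
  cstMat !![1, 0; pc m j, 1] * (seriesMat fun s => F.XiQ j s m) * !![1, 0; 0, zvar]

/-- `Ω^diag` at a regular or unramified pole. -/
def omDiag (F : Frames S) (i : Option (Fin ν)) (m : S.Total) : LMat :=
  gaugeTransform (frameZ F i m) (omPole i m)

/-- `Ω^diag(ζ²)` at a ramified pole. -/
def omDiagZeta (F : Frames S) (i : Option (Fin ν)) (m : S.Total) : LMat :=
  gaugeTransform (frameZeta F i m) (ramify (omPole i m))

/-- The coefficient `θ^±_{l,t_i}` of `Ω^diag`, for all `l ≥ 0`. -/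
def thetaHat (F : Frames S) (i : Option (Fin ν)) (l : ℕ) (s : Fin 2) (m : S.Total) : ℂ :=
  (omDiag F i m s s).coeff ((l : ℤ) - S.ord i)

/-- The coefficient `θ_{l',t_i}` of `Ω^diag(ζ²)`, for all `l' ≥ 0`. -/
def thetaHatRa (F : Frames S) (i : Option (Fin ν)) (l : ℕ) (m : S.Total) : ℂ :=
  (omDiagZeta F i m 0 0).coeff ((l : ℤ) - 2 * S.ord i + 1)

/-- Every entry of `f` is holomorphic on the phase space. -/
def HolMat (f : S.Total → CMat) : Prop :=
  ∀ a b, AnalyticOnNhd ℂ (fun m => f m a b) (phaseSpace S)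

/-- At a regular or unramified pole: `ξ_s` has zero diagonal for `s > 0` and `Φ_i Ξ_i` brings the
connection to a diagonal form whose polar part is the one given by the `θ^±_{l,t_i}`. -/
structure IsCompatibleUn (F : Frames S) (i : Option (Fin ν)) (m : S.Total) : Prop where
  diag_zero : ∀ s, 0 < s → ∀ a, F.Xi i s m a a = 0
  isDiag : (omDiag F i m).IsDiag
  below : ∀ k : ℤ, k < -(S.ord i : ℤ) → ∀ s, (omDiag F i m s s).coeff k = 0
  theta : ∀ l < S.ord i, ∀ s, thetaHat F i l s m = thetaUn m.2 i l s

/-- At a ramified pole: `Φ_i Ξ_i` brings the connection to the form `[[α, β], [z β, α - 1/(2z)]]`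
with polar parts given by the `θ_{l',t_i}`. -/
def IsCompatibleRa (F : Frames S) (i : Option (Fin ν)) (m : S.Total) : Prop :=
  ∃ α β : Laur, gaugeTransform (frameZ F i m) (omPole i m) = ramShape α β ∧
    (∀ k : ℤ, k < -(S.ord i : ℤ) → α.coeff k = 0 ∧ β.coeff k = 0) ∧
    (∀ l < S.ord i, α.coeff ((l : ℤ) - S.ord i) = thetaRa m.2 i (2 * l) / 2) ∧
    (∀ l < S.ord i - 1, β.coeff ((l : ℤ) - S.ord i) = thetaRa m.2 i (2 * l + 1) / 2)

/-- The normalisation at a ramified pole: `Φ_i`, the `ξ_s` with `s ≤ n_i - 2`, and the first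
column of `ξ_{n_i - 1}` do not depend on `(q, p)`. -/
structure IsNormalizedRa (F : Frames S) (i : Option (Fin ν)) (m m' : S.Total) : Prop where
  phi : F.Phi i m = F.Phi i m'
  xi : ∀ s, s + 2 ≤ S.ord i → F.Xi i s m = F.Xi i s m'
  col : ∀ a, F.Xi i (S.ord i - 1) m a 0 = F.Xi i (S.ord i - 1) m' a 0

/-- At an apparent singularity: `Ξ_{q_j} = 1 + O(z)`, `(ξ_1)_{21} = 0` and
`ψ_{q_j}' + Ω ψ_{q_j} = 0`. -/
structure IsCompatibleQ (F : Frames S) (j : Fin S.numApp) (m : S.Total) : Prop where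
  zero : F.XiQ j 0 m = 1
  one : F.XiQ j 1 m 1 0 = 0
  sol : ddz (psiQ F j m) + omApp j m * psiQ F j m = 0

/-- A holomorphic choice of the formal solutions at all poles and apparent singularities. -/
structure Frames.IsCompatible (F : Frames S) : Prop where
  hol_Phi : ∀ i, HolMat (F.Phi i)
  hol_Xi : ∀ i s, HolMat (F.Xi i s)
  hol_XiQ : ∀ j s, HolMat (F.XiQ j s)
  det_ne : ∀ i, ∀ m ∈ phaseSpace S, (F.Phi i m).det ≠ 0
  xi_zero : ∀ i, ∀ m ∈ phaseSpace S, F.Xi i 0 m = 1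
  un : ∀ i, S.kind i ≠ Kind.ra → ∀ m ∈ phaseSpace S, IsCompatibleUn F i m
  ra : ∀ i, S.kind i = Kind.ra → ∀ m ∈ phaseSpace S, IsCompatibleRa F i m
  ra_norm : ∀ i, S.kind i = Kind.ra → ∀ m ∈ phaseSpace S, ∀ m' ∈ phaseSpace S, m.2 = m'.2 →
    IsNormalizedRa F i m m'
  app : ∀ j, ∀ m ∈ phaseSpace S, IsCompatibleQ F j m

/-! ### Variations and the isomonodromy two-form -/

/-- The variation at `m` in the direction `v`, for fixed `x`, of a family `f` of Laurent series in
`z = x - a(m)`: if `f = ∑ f_k(m) z^k` then `δ f = ∑ δ(f_k) z^k - δ(a) ∂f/∂z`. -/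
def varL (a : S.Total → ℂ) (f : S.Total → Laur) (m v : S.Total) : Laur :=
  ofCoeff (fun k => fderiv ℂ (fun m' => (f m').coeff k) m v)
    - cst (fderiv ℂ a m v) * LaurentSeries.derivative ℂ (f m)

/-- The entrywise variation of a family of matrices of Laurent series. -/
def varMat (a : S.Total → ℂ) (A : S.Total → LMat) (m v : S.Total) : LMat :=
  fun r s => varL a (fun m' => A m' r s) m v

/-- The variation of the formal primitive `∫ f dz`, where `f` has a constant residue `ρ`: the
power part is varied coefficientwise and `δ(ρ log(x - a)) = -ρ δ(a) z⁻¹`. -/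
def varPrim (a : S.Total → ℂ) (f : S.Total → Laur) (m v : S.Total) : Laur :=
  varL a (fun m' => ofCoeff fun k => if k = 0 then 0 else (f m').coeff (k - 1) / k) m v
    - cst (fderiv ℂ a m v * (f m).coeff (-1)) * zvar⁻¹

/-- `δ(ψ) ψ⁻¹ = δ(g) g⁻¹ - g δ(Λ) g⁻¹` for the formal solution `ψ = g exp(-Λ)`, where
`Λ = ∫ B dz` is diagonal. -/
def logVar (a : S.Total → ℂ) (g B : S.Total → LMat) (m v : S.Total) : LMat :=
  varMat a g m v * (g m)⁻¹
    - g m * Matrix.diagonal (fun s => varPrim a (fun m' => B m' s s) m v) * (g m)⁻¹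

/-- The residue of `Tr(δ(Ω) ∧ δ(ψ)ψ⁻¹) = Tr(δ₁(Ω) δ₂(ψ)ψ⁻¹ - δ₁(ψ)ψ⁻¹ δ₂(Ω))`. -/
def resWedge (dOm dPsi : S.Total → LMat) (v₁ v₂ : S.Total) : ℂ :=
  (Matrix.trace (dOm v₁ * dPsi v₂ - dPsi v₁ * dOm v₂)).coeff (-1)

/-- The centre of the local coordinate at a pole: `t_i` at a finite pole, and `0` (a constant) at
`∞`, where the coordinate is `1/x`. -/
def center (i : Option (Fin ν)) (m : S.Total) : ℂ :=
  match i with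
  | some i => pos m.2 i
  | none => 0

/-- The isomonodromy 2-form `ω̂`. -/
def omegaHat (F : Frames S) (m v₁ v₂ : S.Total) : ℂ :=
  (1 / 2) * ∑ i with S.kind i ≠ Kind.ra,
      resWedge (varMat (center i) (omPole i) m)
        (logVar (center i) (frameZ F i) (omDiag F i) m) v₁ v₂
  + (1 / 4) * ∑ i with S.kind i = Kind.ra,
      resWedge (varMat 0 (fun m' => ramify (omPole i m')) m)
        (logVar 0 (frameZeta F i) (omDiagZeta F i) m) v₁ v₂
  + (1 / 2) * ∑ j,
      resWedge (varMat (fun m' => qc m' j) (omApp j) m)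
        (fun v => varMat (fun m' => qc m' j) (psiQ F j) m v * (psiQ F j m)⁻¹) v₁ v₂

/-! ### Hamiltonians and the explicit two-form -/

/-- The Hamiltonian of `θ^±_{l,t_i}`, the coefficient of `z^{n_i - l - 1}` in `∫ Ω^diag`. -/
def hamUn (F : Frames S) (i : Option (Fin ν)) (l : ℕ) (s : Fin 2) (m : S.Total) : ℂ :=
  thetaHat F i (2 * S.ord i - l - 2) s m / ((S.ord i : ℂ) - l - 1)

/-- The Hamiltonian of `t_i`. -/
def hamT (F : Frames S) (i : Fin ν) (m : S.Total) : ℂ :=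
  ∑ l ∈ Finset.range (S.ord (some i)), ∑ s : Fin 2,
    thetaHat F (some i) l s m * thetaHat F (some i) (2 * S.ord (some i) - l - 1) s m

/-- The Hamiltonian of `θ_{l',t_i}`, with the correction term for `l' = 0`. -/
def hamRa (F : Frames S) (i : Option (Fin ν)) (l : ℕ) (m : S.Total) : ℂ :=
  thetaHatRa F i (4 * (S.ord i - 1) - l) m / (2 * ((S.ord i : ℂ) - 1) - l)
    - if l = 0 then thetaHatRa F i (2 * S.ord i - 1) m / (2 * thetaHatRa F i 1 m) else 0

/-- `η_j = p_j / P(q_j) - ∑ D_i(q_j)/(q_j - t_i)^{n_i} - D_∞(q_j)`. -/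
def eta (j : Fin S.numApp) (m : S.Total) : ℂ :=
  pc m j / (polyP m.2).eval (qc m j)
    - ∑ i : Fin ν, ((normalForm m).D (some i)).eval (qc m j)
        / (qc m j - pos m.2 i) ^ S.ord (some i)
    - ((normalForm m).D none).eval (qc m j)

/-- `(df ∧ dg)(v₁, v₂) = df(v₁) dg(v₂) - df(v₂) dg(v₁)` at the point `m`. -/
def wedgeD (f g : S.Total → ℂ) (m v₁ v₂ : S.Total) : ℂ :=
  fderiv ℂ f m v₁ * fderiv ℂ g m v₂ - fderiv ℂ f m v₂ * fderiv ℂ g m v₁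

/-- The explicit 2-form `ω̂'`. -/
def omegaExplicit (F : Frames S) (m v₁ v₂ : S.Total) : ℂ :=
  ∑ j, wedgeD (eta j) (fun m' => qc m' j) m v₁ v₂
  + ∑ i with S.kind i = Kind.un, ∑ l ∈ Finset.range (S.ord i - 1), ∑ s : Fin 2,
      wedgeD (hamUn F i l s) (fun m' => thetaUn m'.2 i l s) m v₁ v₂
  + ∑ i with S.kind i = Kind.ra, ∑ l ∈ Finset.range (2 * S.ord i - 2),
      wedgeD (hamRa F i l) (fun m' => thetaRa m'.2 i l) m v₁ v₂
  + ∑ i : Fin ν with 2 ≤ i.val ∧ S.kind (some i) ≠ Kind.ra,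
      wedgeD (hamT F i) (fun m' => pos m'.2 i) m v₁ v₂

end

end Isomonodromy

/-!
The statement is local on the phase space `M`, and so is its proof.

*Normal form.*  The `(0, 1)`-entry of the connection at a pole is the explicit series `f = leadF`.
Trace modulo regular terms and determinant modulo terms of order `-n_i` are invariants of the
formal equivalence class (`gauge_invariants`), so the formal types prescribe the polar parts of
`d₀` and `c₀` at every pole, that is, the polynomials `D_i` and `C_i`; the Fuchs relation matches
the residue of `d₀` at infinity.  What remains is `C̃`, found by Lagrange interpolation from the
conditions at the `q_j`.  This gives `explicitTuple`, which is holomorphic in the parameters.  That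
it has the prescribed formal types and that holomorphic formal solutions exist are proved together:
with a cyclic vector, the gauge transformation to normal form is built from a solution of a
Riccati equation (`riccatiUn`, `ramEq`), whose coefficients are determined recursively because the
leading exponents are distinct, or `θ_1 ≠ 0` (`exists_unram_frame`, `exists_ram_frame`).

*Comparison of the 2-forms.*  Both forms are alternating, bilinear and holomorphic.  The difference
is a section of the pull-back of the 2-forms on the base as soon as it vanishes when the first
argument `δ₁` is tangent to the fibre (`IsForm.exists_section`), and for such a `δ₁` every residue
is computed separately.  At a pole the polar part of `Ω` depends on the base only, so `δ₁Ω` is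
regular.  With `Y = δψ ψ⁻¹`, a formal solution satisfies `δΩ = -Y' - [Ω, Y]`, so that the residue of
`Tr(δ₁Ω Y₂ - Y₁ δ₂Ω)` is twice that of `Tr(δ₁Ω Y₂)` (`residue_wedge`); after conjugation by the frame
only the diagonal part survives, and pairing the regular terms of `δ₁Ω^diag` with the polar terms of
`∫ δ₂Ω^diag` produces `∑ δ₁H δ₂θ` and `δ₁H_t δ₂t` (`unram_contribution`).  At a ramified pole the
normalisation leaves one more term, which is the correction in the Hamiltonian of `θ_0`
(`ram_contribution`).  At `q_j` the elementary transform makes the connection regular, and the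
residue is `δ₁η̃ δ₂q - δ₂η̃ δ₁q` for all `δ₁, δ₂`, where `η̃_j - η_j = ∑_{k ≠ j} 1/(q_j - q_k)`
(`apparent_contribution`); these extra terms cancel in the sum over `j` (`sum_wedgeD_pairSum`).
-/

namespace Isomonodromy

noncomputable section

/-! ### Orders and coefficients of formal Laurent series -/

/-- `f = O(z^N)`: all coefficients of `f` below `N` vanish. -/
def OrdGE (N : ℤ) (f : Laur) : Prop := ∀ k < N, f.coeff k = 0

/-- The derivative `d/dz` of a Laurent series. -/
abbrev dz (f : Laur) : Laur := LaurentSeries.derivative ℂ f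

lemma dz_coeff (f : Laur) (k : ℤ) : (dz f).coeff k = (k + 1) * f.coeff (k + 1) := by
  simp [dz]

lemma OrdGE.mono {N M : ℤ} {f : Laur} (h : OrdGE N f) (hM : M ≤ N) : OrdGE M f :=
  fun k hk => h k (by omega)

lemma ordGE_zero (N : ℤ) : OrdGE N 0 := fun _ _ => rfl

lemma OrdGE.add {N : ℤ} {f g : Laur} (hf : OrdGE N f) (hg : OrdGE N g) : OrdGE N (f + g) :=
  fun k hk => by simp [hf k hk, hg k hk]

lemma OrdGE.neg {N : ℤ} {f : Laur} (hf : OrdGE N f) : OrdGE N (-f) :=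
  fun k hk => by simp [hf k hk]

lemma OrdGE.sub {N : ℤ} {f g : Laur} (hf : OrdGE N f) (hg : OrdGE N g) : OrdGE N (f - g) :=
  fun k hk => by simp [hf k hk, hg k hk]

lemma coeff_finsetSum {ι : Type*} (s : Finset ι) (f : ι → Laur) (k : ℤ) :
    (∑ i ∈ s, f i).coeff k = ∑ i ∈ s, (f i).coeff k := by
  classical
  induction s using Finset.induction_on with
  | empty => simp
  | insert a s ha ih => simp [Finset.sum_insert ha, ih]

lemma ordGE_sum {ι : Type*} {N : ℤ} (s : Finset ι) (f : ι → Laur)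
    (h : ∀ i ∈ s, OrdGE N (f i)) : OrdGE N (∑ i ∈ s, f i) := fun k hk => by
  rw [coeff_finsetSum]
  exact Finset.sum_eq_zero fun i hi => h i hi k hk

lemma exists_ordGE (f : Laur) : ∃ N, OrdGE N f :=
  ⟨f.order, fun _ hk => HahnSeries.coeff_eq_zero_of_lt_order hk⟩

/-- The Cauchy product, with the summation range determined by lower bounds of the orders. -/
lemma coeff_mul_Icc {N M : ℤ} {f g : Laur} (hf : OrdGE N f) (hg : OrdGE M g) (k : ℤ) :
    (f * g).coeff k = ∑ i ∈ Finset.Icc N (k - M), f.coeff i * g.coeff (k - i) := by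
  rw [HahnSeries.coeff_mul]
  have h1 : ∀ ij ∈ Finset.antidiagonal f.isPWO_support g.isPWO_support k,
      ij.1 ∈ Finset.Icc N (k - M) := by
    rintro ⟨i, j⟩ hij
    simp only [Finset.mem_antidiagonal, HahnSeries.mem_support] at hij
    obtain ⟨hi, hj, hk⟩ := hij
    have : N ≤ i := by
      by_contra h
      exact hi (hf i (by omega))
    have : M ≤ j := by
      by_contra h
      exact hj (hg j (by omega))
    simp only [Finset.mem_Icc]
    omega
  refine Finset.sum_bij_ne_zero (fun ij _ _ => ij.1) (fun ij h _ => h1 ij h) ?_ ?_ ?_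
  · rintro ⟨i, j⟩ h - ⟨i', j'⟩ h' - e
    simp only [Finset.mem_antidiagonal] at h h'
    ext
    · exact e
    · dsimp only at e ⊢
      omega
  · intro i hi hne
    refine ⟨(i, k - i), ?_, by simpa using hne, rfl⟩
    simp only [Finset.mem_antidiagonal, HahnSeries.mem_support]
    refine ⟨left_ne_zero_of_mul hne, right_ne_zero_of_mul hne, by ring⟩
  · rintro ⟨i, j⟩ h -
    simp only [Finset.mem_antidiagonal] at h
    obtain ⟨-, -, rfl⟩ := h
    simp

lemma OrdGE.mul' {N M : ℤ} {f g : Laur} (hf : OrdGE N f) (hg : OrdGE M g) :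
    OrdGE (N + M) (f * g) := fun k hk => by
  rw [coeff_mul_Icc hf hg, Finset.Icc_eq_empty (by omega), Finset.sum_empty]

lemma OrdGE.mul {N M K : ℤ} {f g : Laur} (hf : OrdGE N f) (hg : OrdGE M g) (h : K ≤ N + M) :
    OrdGE K (f * g) := (hf.mul' hg).mono h

lemma coeff_mul_lead {N M : ℤ} {f g : Laur} (hf : OrdGE N f) (hg : OrdGE M g) {k : ℤ}
    (hk : k = N + M) : (f * g).coeff k = f.coeff N * g.coeff M := by
  subst hk
  rw [coeff_mul_Icc hf hg, show N + M - M = N by ring]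
  simp

/-- Extracts the lowest coefficient after cancelling the part of higher order. -/
lemma coeff_eq_of_sub {N : ℤ} {f g : Laur} (h : OrdGE N (f - g)) {k : ℤ} (hk : k < N) :
    f.coeff k = g.coeff k := by
  have := h k hk
  rw [HahnSeries.coeff_sub] at this
  exact sub_eq_zero.mp this

lemma ordGE_cst (c : ℂ) : OrdGE 0 (cst c) := fun k hk => by
  simp [cst, HahnSeries.C_apply, ne_of_lt hk]

lemma cst_coeff_zero (c : ℂ) : (cst c).coeff 0 = c := by simp [cst]

lemma ordGE_one : OrdGE 0 (1 : Laur) := by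
  simpa [cst] using ordGE_cst 1

lemma ordGE_single (n : ℤ) (c : ℂ) : OrdGE n (HahnSeries.single n c : Laur) := fun k hk => by
  simp [ne_of_lt hk]

lemma cst_mul_coeff (c : ℂ) (f : Laur) (k : ℤ) : (cst c * f).coeff k = c * f.coeff k := by
  simp [cst]

@[simp] lemma cst_zero : cst 0 = 0 := by simp [cst]
@[simp] lemma cst_one : cst 1 = 1 := by simp [cst]
lemma cst_add (a b : ℂ) : cst (a + b) = cst a + cst b := by simp [cst]
lemma cst_sub (a b : ℂ) : cst (a - b) = cst a - cst b := by simp [cst]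
lemma cst_mul (a b : ℂ) : cst (a * b) = cst a * cst b := by simp [cst]
lemma cst_neg (a : ℂ) : cst (-a) = -cst a := by simp [cst]

lemma cst_ne_zero {a : ℂ} (h : a ≠ 0) : cst a ≠ 0 := HahnSeries.C_ne_zero h

lemma OrdGE.cst_mul {N : ℤ} {f : Laur} (h : OrdGE N f) (c : ℂ) : OrdGE N (cst c * f) :=
  (ordGE_cst c).mul h (by omega)

lemma zvar_ne_zero : zvar ≠ 0 := by simp [zvar]

lemma zvar_zpow (n : ℤ) : zvar ^ n = HahnSeries.single n (1 : ℂ) := by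
  cases n with
  | ofNat n => simp [zvar]
  | negSucc n =>
    rw [zpow_negSucc, zvar, HahnSeries.single_pow, HahnSeries.inv_single, Int.negSucc_eq]
    simp

lemma zvar_inv : zvar⁻¹ = zvar ^ (-1 : ℤ) := by simp

lemma single_eq (n : ℤ) (c : ℂ) : (HahnSeries.single n c : Laur) = cst c * zvar ^ n := by
  rw [zvar_zpow, cst, HahnSeries.C_apply, HahnSeries.single_mul_single]; simp

lemma zpow_mul_coeff (n : ℤ) (f : Laur) (k : ℤ) : (zvar ^ n * f).coeff k = f.coeff (k - n) := by
  rw [zvar_zpow, HahnSeries.coeff_single_mul]; simp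

lemma zvar_mul_coeff (f : Laur) (k : ℤ) : (zvar * f).coeff k = f.coeff (k - 1) := by
  simpa using zpow_mul_coeff 1 f k

lemma zpow_coeff (n k : ℤ) : (zvar ^ n).coeff k = if k = n then 1 else 0 := by
  rw [zvar_zpow, HahnSeries.coeff_single]; simp [eq_comm]

lemma ordGE_zpow (n : ℤ) : OrdGE n (zvar ^ n) := by
  rw [zvar_zpow]; exact ordGE_single n 1

lemma ordGE_zvar : OrdGE 1 zvar := by simpa using ordGE_zpow 1

lemma ordGE_zvar_inv : OrdGE (-1) zvar⁻¹ := by simpa using ordGE_zpow (-1)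

lemma ordGE_zpow_mul {N : ℤ} {n : ℤ} {f : Laur} : OrdGE N (zvar ^ n * f) ↔ OrdGE (N - n) f := by
  constructor
  · intro h k hk
    have := h (k + n) (by omega)
    rwa [zpow_mul_coeff, add_sub_cancel_right] at this
  · intro h
    exact (ordGE_zpow n).mul h (by omega)

lemma OrdGE.pow {f : Laur} (hf : OrdGE 0 f) (n : ℕ) : OrdGE 0 (f ^ n) := by
  induction n with
  | zero => simpa using ordGE_one
  | succ n ih => rw [pow_succ]; exact ih.mul hf (by omega)

/-- Inversion of a Laurent series with non-vanishing leading coefficient. -/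
lemma OrdGE.inv_lead {N : ℤ} {f : Laur} (hf : OrdGE N f) (h : f.coeff N ≠ 0) :
    OrdGE (-N) f⁻¹ ∧ f⁻¹.coeff (-N) = (f.coeff N)⁻¹ := by
  have hne : f ≠ 0 := by
    rintro rfl
    simp at h
  have ho : OrdGE (-N) f⁻¹ := by
    set M := f⁻¹.order with hM
    have h1 : OrdGE M f⁻¹ := fun _ hk => HahnSeries.coeff_eq_zero_of_lt_order hk
    have h2 : f⁻¹.coeff M ≠ 0 := by
      rw [hM, ← HahnSeries.leadingCoeff_eq]
      exact HahnSeries.leadingCoeff_ne_zero.mpr (inv_ne_zero hne)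
    have h3 := coeff_mul_lead hf h1 (k := N + M) rfl
    rw [mul_inv_cancel₀ hne, HahnSeries.coeff_one] at h3
    have h4 : N + M = 0 := by
      by_contra h5
      rw [if_neg h5] at h3
      exact mul_ne_zero h h2 h3.symm
    exact h1.mono (by omega)
  refine ⟨ho, ?_⟩
  have h3 := coeff_mul_lead hf ho (k := 0) (by ring)
  rw [mul_inv_cancel₀ hne, HahnSeries.coeff_one, if_pos rfl] at h3
  exact eq_inv_of_mul_eq_one_right h3.symm

lemma OrdGE.inv {N : ℤ} {f : Laur} (hf : OrdGE N f) (h : f.coeff N ≠ 0) : OrdGE (-N) f⁻¹ :=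
  (hf.inv_lead h).1

lemma ne_zero_of_coeff {f : Laur} {N : ℤ} (h : f.coeff N ≠ 0) : f ≠ 0 := by
  rintro rfl
  simp at h

/-! ### The derivative and the residue -/

lemma OrdGE.dz {N : ℤ} {f : Laur} (h : OrdGE N f) : OrdGE (N - 1) (dz f) := fun k hk => by
  rw [dz_coeff, h (k + 1) (by omega), mul_zero]

lemma OrdGE.dz_zero {f : Laur} (h : OrdGE 0 f) : OrdGE 0 (Isomonodromy.dz f) := fun k hk => by
  rw [dz_coeff]
  rcases eq_or_ne k (-1) with rfl | h'
  · simp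
  · rw [h (k + 1) (by omega), mul_zero]

/-- A residue of a derivative vanishes. -/
lemma dz_coeff_neg_one (f : Laur) : (dz f).coeff (-1) = 0 := by
  rw [dz_coeff]; simp

lemma dz_mul (f g : Laur) : dz (f * g) = dz f * g + f * dz g := by
  obtain ⟨N, hf⟩ := exists_ordGE f
  obtain ⟨M, hg⟩ := exists_ordGE g
  ext k
  rw [dz_coeff, HahnSeries.coeff_add, coeff_mul_Icc hf hg, coeff_mul_Icc hf.dz hg,
    coeff_mul_Icc hf hg.dz]
  have e1 : Finset.Icc (N - 1) (k - M) = (Finset.Icc N (k + 1 - M)).image (fun i => i - 1) := by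
    ext i
    simp only [Finset.mem_Icc, Finset.mem_image]
    constructor
    · intro h
      exact ⟨i + 1, by omega, by omega⟩
    · rintro ⟨j, h, rfl⟩
      omega
  rw [e1, Finset.sum_image (by intro a _ b _ h; simpa using h),
    show k - (M - 1) = k + 1 - M by ring, Finset.mul_sum, ← Finset.sum_add_distrib]
  refine Finset.sum_congr rfl fun i _ => ?_
  rw [dz_coeff, dz_coeff, show k - (i - 1) = k + 1 - i by ring,
    show k - i + 1 = k + 1 - i by ring, show i - 1 + 1 = i by ring]
  push_cast
  ring

lemma dz_add (f g : Laur) : dz (f + g) = dz f + dz g := map_add _ f g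
lemma dz_sub (f g : Laur) : dz (f - g) = dz f - dz g := map_sub _ f g
lemma dz_neg (f : Laur) : dz (-f) = -dz f := map_neg _ f
@[simp] lemma dz_zero : dz 0 = 0 := map_zero _

@[simp] lemma dz_cst (c : ℂ) : dz (cst c) = 0 := by
  ext k
  rw [dz_coeff, cst, HahnSeries.C_apply, HahnSeries.coeff_single]
  split_ifs with h
  · have : (k : ℂ) + 1 = 0 := by exact_mod_cast h
    simp [this]
  · simp

@[simp] lemma dz_one : dz 1 = 0 := by
  rw [← cst_one, dz_cst]

lemma dz_zpow (n : ℤ) : dz (zvar ^ n) = cst n * zvar ^ (n - 1) := by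
  ext k
  rw [dz_coeff, cst_mul_coeff, zpow_coeff, zpow_coeff]
  by_cases h : k + 1 = n
  · rw [if_pos h, if_pos (by omega), ← h]
    push_cast
    ring
  · rw [if_neg h, if_neg (by omega)]
    ring

@[simp] lemma dz_zvar : dz zvar = 1 := by
  have := dz_zpow 1
  simpa using this

lemma dz_inv {f : Laur} (h : f ≠ 0) : dz f⁻¹ = -(dz f) * (f⁻¹) ^ 2 := by
  have h1 := dz_mul f f⁻¹
  rw [mul_inv_cancel₀ h, dz_one] at h1
  have h2 : f * dz f⁻¹ = -(dz f * f⁻¹) := by linear_combination -h1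
  have h3 : dz f⁻¹ = f⁻¹ * (f * dz f⁻¹) := by rw [← mul_assoc, inv_mul_cancel₀ h, one_mul]
  rw [h3, h2]; ring

/-! ### Values at `z = 0` -/

/-- `f` is a formal power series with constant term `r`. -/
def Val (f : Laur) (r : ℂ) : Prop := OrdGE 0 f ∧ f.coeff 0 = r

lemma Val.add {f g : Laur} {r s : ℂ} (hf : Val f r) (hg : Val g s) : Val (f + g) (r + s) :=
  ⟨hf.1.add hg.1, by rw [HahnSeries.coeff_add, hf.2, hg.2]⟩

lemma Val.sub {f g : Laur} {r s : ℂ} (hf : Val f r) (hg : Val g s) : Val (f - g) (r - s) :=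
  ⟨hf.1.sub hg.1, by rw [HahnSeries.coeff_sub, hf.2, hg.2]⟩

lemma Val.neg {f : Laur} {r : ℂ} (hf : Val f r) : Val (-f) (-r) :=
  ⟨hf.1.neg, by rw [HahnSeries.coeff_neg, hf.2]⟩

lemma Val.mul {f g : Laur} {r s : ℂ} (hf : Val f r) (hg : Val g s) : Val (f * g) (r * s) :=
  ⟨hf.1.mul hg.1 (by omega), by rw [coeff_mul_lead hf.1 hg.1 (by ring), hf.2, hg.2]⟩

lemma val_cst (c : ℂ) : Val (cst c) c := ⟨ordGE_cst c, cst_coeff_zero c⟩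

lemma val_one : Val 1 1 := by simpa using val_cst 1

lemma val_zero : Val 0 0 := by simpa using val_cst 0

lemma val_zvar : Val zvar 0 := ⟨ordGE_zvar.mono (by omega), ordGE_zvar 0 (by omega)⟩

lemma Val.pow {f : Laur} {r : ℂ} (hf : Val f r) (n : ℕ) : Val (f ^ n) (r ^ n) := by
  induction n with
  | zero => simpa using val_one
  | succ n ih => simpa only [pow_succ] using ih.mul hf

lemma Val.inv {f : Laur} {r : ℂ} (hf : Val f r) (h : r ≠ 0) : Val f⁻¹ r⁻¹ := by
  obtain ⟨h1, h2⟩ := hf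
  have := h1.inv_lead (by rwa [h2])
  rw [neg_zero, h2] at this
  exact this

lemma Val.div {f g : Laur} {r s : ℂ} (hf : Val f r) (hg : Val g s) (h : s ≠ 0) :
    Val (f / g) (r / s) := by
  rw [div_eq_mul_inv, div_eq_mul_inv]
  exact hf.mul (hg.inv h)

lemma val_sum {ι : Type*} (s : Finset ι) (f : ι → Laur) (r : ι → ℂ)
    (h : ∀ i ∈ s, Val (f i) (r i)) : Val (∑ i ∈ s, f i) (∑ i ∈ s, r i) :=
  ⟨ordGE_sum s f fun i hi => (h i hi).1, by
    rw [coeff_finsetSum]; exact Finset.sum_congr rfl fun i hi => (h i hi).2⟩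

lemma val_prod {ι : Type*} (s : Finset ι) (f : ι → Laur) (r : ι → ℂ)
    (h : ∀ i ∈ s, Val (f i) (r i)) : Val (∏ i ∈ s, f i) (∏ i ∈ s, r i) := by
  classical
  induction s using Finset.induction_on with
  | empty => simpa using val_one
  | insert a s ha ih =>
    rw [Finset.prod_insert ha, Finset.prod_insert ha]
    exact (h a (by simp)).mul (ih fun i hi => h i (by simp [hi]))

/-- The algebra structure of `Laur` that `aeval` uses is the one inherited from power series. -/
lemma algebraMap_eq_cst (c : ℂ) : algebraMap ℂ Laur c = cst c := by
  rw [HahnSeries.algebraMap_apply', PowerSeries.algebraMap_apply, HahnSeries.ofPowerSeries_C]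
  rfl

lemma val_aeval {x : Laur} {a : ℂ} (hx : Val x a) (p : ℂ[X]) : Val (aeval x p) (p.eval a) := by
  induction p using Polynomial.induction_on' with
  | add p q hp hq =>
    rw [map_add, eval_add]
    exact hp.add hq
  | monomial n c =>
    rw [aeval_monomial, eval_monomial, algebraMap_eq_cst]
    exact (val_cst c).mul (hx.pow n)

lemma Val.ordGE_one_sub {f : Laur} {r : ℂ} (h : Val f r) : OrdGE 1 (f - cst r) := fun k hk => by
  rw [HahnSeries.coeff_sub]
  rcases eq_or_ne k 0 with rfl | h'
  · rw [h.2, cst_coeff_zero, sub_self]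
  · rw [h.1 k (by omega), ordGE_cst r k (by omega), sub_zero]

lemma Val.ordGE_one {f : Laur} (h : Val f 0) : OrdGE 1 f := by
  simpa using h.ordGE_one_sub

lemma OrdGE.val {f : Laur} (h : OrdGE 0 f) : Val f (f.coeff 0) := ⟨h, rfl⟩

/-! ### The substitution `z = ζ²` -/

lemma sqSubst_coeff_even (f : Laur) (k : ℤ) : (sqSubst f).coeff (2 * k) = f.coeff k := by
  unfold sqSubst
  exact HahnSeries.embDomain_mk_coeff _ _

lemma sqSubst_coeff_odd (f : Laur) (k : ℤ) (h : ∀ j, k ≠ 2 * j) : (sqSubst f).coeff k = 0 := by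
  unfold sqSubst
  refine HahnSeries.embDomain_of_notMem_range ?_
  rintro ⟨j, hj⟩
  exact h j hj.symm

lemma sqSubst_ordGE {N : ℤ} {f : Laur} (h : OrdGE N f) : OrdGE (2 * N) (sqSubst f) := by
  intro k hk
  rcases Int.even_or_odd' k with ⟨j, rfl | rfl⟩
  · rw [sqSubst_coeff_even, h j (by omega)]
  · exact sqSubst_coeff_odd f _ fun i => by omega

lemma dz_sqSubst (f : Laur) : dz (sqSubst f) = sqSubst (dz f) * (2 * zvar) := by
  ext k
  have e : sqSubst (dz f) * (2 * zvar) = cst 2 * (zvar * sqSubst (dz f)) := by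
    have : cst 2 = 2 := by rw [cst, map_ofNat]
    rw [this]; ring
  rw [e, dz_coeff, cst_mul_coeff, zvar_mul_coeff]
  rcases Int.even_or_odd' k with ⟨j, rfl | rfl⟩
  · rw [sqSubst_coeff_odd _ _ fun i => by omega, sqSubst_coeff_odd _ _ fun i => by omega]
    ring
  · rw [show 2 * j + 1 + 1 = 2 * (j + 1) by ring, show 2 * j + 1 - 1 = 2 * j by ring,
      sqSubst_coeff_even, sqSubst_coeff_even, dz_coeff]
    push_cast
    ring

lemma sqSubst_zvar : sqSubst zvar = zvar ^ 2 := by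
  ext k
  rw [← zpow_natCast, zpow_coeff]
  rcases Int.even_or_odd' k with ⟨j, rfl | rfl⟩
  · have := zpow_coeff 1 j
    rw [sqSubst_coeff_even]
    rw [zpow_one] at this
    rw [this]
    congr 1
    simp
  · rw [sqSubst_coeff_odd _ _ fun i => by omega, if_neg (by omega)]

lemma sqSubst_cst (c : ℂ) : sqSubst (cst c) = cst c := HahnSeries.embDomainRingHom_C

/-! ### Laurent series with prescribed coefficients -/

lemma ofCoeff_coeff {f : ℤ → ℂ} {N : ℤ} (h : ∀ k < N, f k = 0) (k : ℤ) :
    (ofCoeff f).coeff k = f k := by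
  have hb : BddBelow (Function.support f) := ⟨N, fun k hk => by
    by_contra h'
    exact hk (h k (by omega))⟩
  rw [ofCoeff, dif_pos hb]
  rfl

/-- The power series with the given coefficients. -/
def ser (β : ℕ → ℂ) : Laur := HahnSeries.ofPowerSeries ℤ ℂ (PowerSeries.mk β)

lemma ser_coeff (β : ℕ → ℂ) (k : ℕ) : (ser β).coeff k = β k := by
  simp [ser]

lemma ser_ordGE (β : ℕ → ℂ) : OrdGE 0 (ser β) := fun k hk => by
  unfold ser
  rw [HahnSeries.ofPowerSeries_apply, HahnSeries.embDomain_of_notMem_range]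
  rintro ⟨j, hj⟩
  have : (j : ℤ) = k := hj
  omega

lemma ser_coeff_zero (β : ℕ → ℂ) : (ser β).coeff 0 = β 0 := by simpa using ser_coeff β 0

lemma ser_self {f : Laur} (h : OrdGE 0 f) : ser (fun k => f.coeff k) = f := by
  ext k
  rcases lt_or_ge k 0 with hk | hk
  · rw [ser_ordGE _ k hk, h k hk]
  · lift k to ℕ using hk
    rw [ser_coeff]

lemma ext_nat {f g : Laur} (hf : OrdGE 0 f) (hg : OrdGE 0 g)
    (h : ∀ k : ℕ, f.coeff k = g.coeff k) : f = g := by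
  rw [← ser_self hf, ← ser_self hg]
  simp [h]

/-! ### Holomorphic families of Laurent series -/

section Families

variable {E : Type*} [NormedAddCommGroup E] [NormedSpace ℂ E] {U : Set E}

/-- A family of Laurent series whose coefficients are holomorphic on `U` and whose pole order is
bounded on `U`. -/
structure HolFam (U : Set E) (f : E → Laur) : Prop where
  an : ∀ k, AnalyticOnNhd ℂ (fun m => (f m).coeff k) U
  bdd : ∃ N, ∀ m ∈ U, OrdGE N (f m)

lemma HolFam.congr (hU : IsOpen U) {f g : E → Laur} (hf : HolFam U f) (h : ∀ m ∈ U, f m = g m) :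
    HolFam U g where
  an k := (hf.an k).congr hU fun m hm => by simp only [h m hm]
  bdd := by
    obtain ⟨N, hN⟩ := hf.bdd
    exact ⟨N, fun m hm => h m hm ▸ hN m hm⟩

lemma HolFam.add {f g : E → Laur} (hf : HolFam U f) (hg : HolFam U g) :
    HolFam U (fun m => f m + g m) where
  an k := by
    simp only [HahnSeries.coeff_add]
    exact (hf.an k).add (hg.an k)
  bdd := by
    obtain ⟨N, hN⟩ := hf.bdd
    obtain ⟨M, hM⟩ := hg.bdd
    exact ⟨min N M, fun m hm =>
      ((hN m hm).mono (min_le_left _ _)).add ((hM m hm).mono (min_le_right _ _))⟩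

lemma HolFam.neg {f : E → Laur} (hf : HolFam U f) : HolFam U (fun m => -f m) where
  an k := by
    simp only [HahnSeries.coeff_neg]
    exact (hf.an k).neg
  bdd := by
    obtain ⟨N, hN⟩ := hf.bdd
    exact ⟨N, fun m hm => (hN m hm).neg⟩

lemma HolFam.sub {f g : E → Laur} (hf : HolFam U f) (hg : HolFam U g) :
    HolFam U (fun m => f m - g m) := by
  simpa only [sub_eq_add_neg] using hf.add hg.neg

lemma holFam_const (f : Laur) : HolFam U (fun _ => f) where
  an k := analyticOnNhd_const
  bdd := by
    obtain ⟨N, hN⟩ := exists_ordGE f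
    exact ⟨N, fun _ _ => hN⟩

lemma holFam_cst {a : E → ℂ} (ha : AnalyticOnNhd ℂ a U) : HolFam U (fun m => cst (a m)) where
  an k := by
    rcases eq_or_ne k 0 with rfl | h
    · simpa only [cst_coeff_zero] using ha
    · have : (fun m => (cst (a m)).coeff k) = fun _ => 0 := by
        funext m
        simp [cst, h]
      rw [this]
      exact analyticOnNhd_const
  bdd := ⟨0, fun m _ => ordGE_cst _⟩

lemma holFam_single {a : E → ℂ} (ha : AnalyticOnNhd ℂ a U) (n : ℤ) :
    HolFam U (fun m => HahnSeries.single n (a m)) where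
  an k := by
    by_cases h : k = n
    · subst h
      simpa using ha
    · have : (fun m => (HahnSeries.single n (a m) : Laur).coeff k) = fun _ => 0 := by
        funext m
        simp [h]
      rw [this]
      exact analyticOnNhd_const
  bdd := ⟨n, fun m _ => ordGE_single _ _⟩

lemma HolFam.sum {ι : Type*} (s : Finset ι) {f : ι → E → Laur}
    (h : ∀ i ∈ s, HolFam U (f i)) : HolFam U (fun m => ∑ i ∈ s, f i m) := by
  classical
  induction s using Finset.induction_on with
  | empty => simpa using holFam_const 0
  | insert a s ha ih =>
    simp only [Finset.sum_insert ha]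
    exact (h a (by simp)).add (ih fun i hi => h i (by simp [hi]))

lemma HolFam.mul (hU : IsOpen U) {f g : E → Laur} (hf : HolFam U f) (hg : HolFam U g) :
    HolFam U (fun m => f m * g m) := by
  obtain ⟨N, hN⟩ := hf.bdd
  obtain ⟨M, hM⟩ := hg.bdd
  refine ⟨fun k => ?_, N + M, fun m hm => (hN m hm).mul' (hM m hm)⟩
  have h1 : AnalyticOnNhd ℂ
      (fun m => ∑ i ∈ Finset.Icc N (k - M), (f m).coeff i * (g m).coeff (k - i)) U :=
    Finset.analyticOnNhd_fun_sum _ fun i _ => (hf.an i).mul (hg.an (k - i))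
  exact h1.congr hU fun m hm => (coeff_mul_Icc (hN m hm) (hM m hm) k).symm

lemma HolFam.pow (hU : IsOpen U) {f : E → Laur} (hf : HolFam U f) (n : ℕ) :
    HolFam U (fun m => f m ^ n) := by
  induction n with
  | zero => simpa using holFam_const 1
  | succ n ih => simpa only [pow_succ] using ih.mul hU hf

lemma HolFam.prod (hU : IsOpen U) {ι : Type*} (s : Finset ι) {f : ι → E → Laur}
    (h : ∀ i ∈ s, HolFam U (f i)) : HolFam U (fun m => ∏ i ∈ s, f i m) := by
  classical
  induction s using Finset.induction_on with
  | empty => simpa using holFam_const 1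
  | insert a s ha ih =>
    simp only [Finset.prod_insert ha]
    exact (h a (by simp)).mul hU (ih fun i hi => h i (by simp [hi]))

lemma HolFam.dz {f : E → Laur} (hf : HolFam U f) : HolFam U (fun m => dz (f m)) where
  an k := by
    simp only [dz_coeff]
    exact analyticOnNhd_const.mul (hf.an _)
  bdd := by
    obtain ⟨N, hN⟩ := hf.bdd
    exact ⟨N - 1, fun m hm => (hN m hm).dz⟩

lemma HolFam.sqSubst {f : E → Laur} (hf : HolFam U f) : HolFam U (fun m => sqSubst (f m)) where
  an k := by
    rcases Int.even_or_odd' k with ⟨j, rfl | rfl⟩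
    · simpa only [sqSubst_coeff_even] using hf.an j
    · have : (fun m => (Isomonodromy.sqSubst (f m)).coeff (2 * j + 1)) = fun _ => 0 := by
        funext m
        exact sqSubst_coeff_odd _ _ fun i => by omega
      rw [this]
      exact analyticOnNhd_const
  bdd := by
    obtain ⟨N, hN⟩ := hf.bdd
    exact ⟨2 * N, fun m hm => sqSubst_ordGE (hN m hm)⟩

lemma holFam_ser {β : ℕ → E → ℂ} (h : ∀ k, AnalyticOnNhd ℂ (β k) U) :
    HolFam U (fun m => ser fun k => β k m) where
  an k := by
    rcases lt_or_ge k 0 with hk | hk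
    · have : (fun m => (ser fun k => β k m).coeff k) = fun _ => 0 := by
        funext m
        exact ser_ordGE _ k hk
      rw [this]
      exact analyticOnNhd_const
    · lift k to ℕ using hk
      simpa only [ser_coeff] using h k
  bdd := ⟨0, fun m _ => ser_ordGE _⟩

/-- The Cauchy product of series with known orders, indexed from the lowest coefficient. -/
lemma coeff_mul_nat {N M : ℤ} {f g : Laur} (hf : OrdGE N f) (hg : OrdGE M g) (n : ℕ) :
    (f * g).coeff (N + M + n)
      = ∑ j ∈ Finset.range (n + 1), f.coeff (N + j) * g.coeff (M + (n - j : ℕ)) := by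
  rw [coeff_mul_Icc hf hg]
  symm
  refine Finset.sum_bij (fun j _ => N + (j : ℤ)) ?_ ?_ ?_ ?_
  · intro j hj
    simp only [Finset.mem_range, Finset.mem_Icc] at hj ⊢
    omega
  · intro a _ b _ h
    omega
  · intro i hi
    simp only [Finset.mem_Icc] at hi
    refine ⟨(i - N).toNat, ?_, ?_⟩
    · simp only [Finset.mem_range]
      omega
    · omega
  · intro j hj
    simp only [Finset.mem_range] at hj
    congr 2
    omega

/-- A holomorphic family of Laurent series of constant order, hence with holomorphic inverse. -/
def UnitFam (U : Set E) (f : E → Laur) : Prop :=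
  HolFam U f ∧ ∃ N, ∀ m ∈ U, OrdGE N (f m) ∧ (f m).coeff N ≠ 0

lemma UnitFam.ne_zero {f : E → Laur} (hf : UnitFam U f) {m : E} (hm : m ∈ U) : f m ≠ 0 := by
  obtain ⟨-, N, hN⟩ := hf
  exact ne_zero_of_coeff (hN m hm).2

lemma UnitFam.inv (hU : IsOpen U) {f : E → Laur} (hf : UnitFam U f) :
    UnitFam U (fun m => (f m)⁻¹) := by
  obtain ⟨hf, N, hN⟩ := hf
  have hinv := fun m hm => (hN m hm).1.inv_lead (hN m hm).2
  have key : ∀ n : ℕ, AnalyticOnNhd ℂ (fun m => (f m)⁻¹.coeff (-N + n)) U := by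
    intro n
    induction n using Nat.strong_induction_on with
    | _ n ih =>
      have h1 : AnalyticOnNhd ℂ (fun m => ((f m).coeff N)⁻¹ * ((1 : Laur).coeff (n : ℤ)
          - ∑ j ∈ Finset.range n, (f m).coeff (N + (j + 1 : ℕ))
            * (f m)⁻¹.coeff (-N + (n - (j + 1) : ℕ)))) U := by
        refine ((hf.an N).inv fun m hm => (hN m hm).2).mul (analyticOnNhd_const.sub ?_)
        refine Finset.analyticOnNhd_fun_sum _ fun j hj => (hf.an _).mul (ih _ ?_)
        have := Finset.mem_range.mp hj
        omega
      refine h1.congr hU fun m hm => ?_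
      have h2 := coeff_mul_nat (hN m hm).1 (hinv m hm).1 n
      rw [mul_inv_cancel₀ (ne_zero_of_coeff (hN m hm).2), Finset.sum_range_succ',
        add_neg_cancel, zero_add] at h2
      simp only [h2, Nat.cast_zero, add_zero, Nat.sub_zero, add_sub_cancel_left]
      rw [← mul_assoc, inv_mul_cancel₀ (hN m hm).2, one_mul]
  refine ⟨⟨fun k => ?_, -N, fun m hm => (hinv m hm).1⟩, -N, fun m hm => ⟨(hinv m hm).1, ?_⟩⟩
  · rcases lt_or_ge k (-N) with hk | hk
    · exact (analyticOnNhd_const (v := (0 : ℂ))).congr hU fun m hm => ((hinv m hm).1 k hk).symm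
    · obtain ⟨n, rfl⟩ : ∃ n : ℕ, k = -N + n := ⟨(k + N).toNat, by omega⟩
      exact key n
  · rw [(hinv m hm).2]
    exact inv_ne_zero (hN m hm).2

lemma UnitFam.mul (hU : IsOpen U) {f g : E → Laur} (hf : UnitFam U f) (hg : UnitFam U g) :
    UnitFam U (fun m => f m * g m) := by
  obtain ⟨hf, N, hN⟩ := hf
  obtain ⟨hg, M, hM⟩ := hg
  refine ⟨hf.mul hU hg, N + M, fun m hm => ⟨(hN m hm).1.mul' (hM m hm).1, ?_⟩⟩
  rw [coeff_mul_lead (hN m hm).1 (hM m hm).1 rfl]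
  exact mul_ne_zero (hN m hm).2 (hM m hm).2

lemma unitFam_const {f : Laur} (h : f ≠ 0) : UnitFam U (fun _ => f) :=
  ⟨holFam_const f, f.order, fun _ _ => ⟨fun _ hk => HahnSeries.coeff_eq_zero_of_lt_order hk, by
    rw [← HahnSeries.leadingCoeff_eq]
    exact HahnSeries.leadingCoeff_ne_zero.mpr h⟩⟩

lemma UnitFam.pow (hU : IsOpen U) {f : E → Laur} (hf : UnitFam U f) (n : ℕ) :
    UnitFam U (fun m => f m ^ n) := by
  induction n with
  | zero => simpa using unitFam_const one_ne_zero
  | succ n ih => simpa only [pow_succ] using ih.mul hU hf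

lemma UnitFam.prod (hU : IsOpen U) {ι : Type*} (s : Finset ι) {f : ι → E → Laur}
    (h : ∀ i ∈ s, UnitFam U (f i)) : UnitFam U (fun m => ∏ i ∈ s, f i m) := by
  classical
  induction s using Finset.induction_on with
  | empty => simpa using unitFam_const one_ne_zero
  | insert a s ha ih =>
    simp only [Finset.prod_insert ha]
    exact (h a (by simp)).mul hU (ih fun i hi => h i (by simp [hi]))

lemma HolFam.div (hU : IsOpen U) {f g : E → Laur} (hf : HolFam U f) (hg : UnitFam U g) :
    HolFam U (fun m => f m / g m) := by
  simpa only [div_eq_mul_inv] using hf.mul hU (hg.inv hU).1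

lemma UnitFam.congr (hU : IsOpen U) {f g : E → Laur} (hf : UnitFam U f)
    (h : ∀ m ∈ U, f m = g m) : UnitFam U g := by
  obtain ⟨hf, N, hN⟩ := hf
  exact ⟨hf.congr hU h, N, fun m hm => h m hm ▸ hN m hm⟩

lemma unitFam_of_val {f : E → Laur} (hf : HolFam U f) {r : E → ℂ}
    (h : ∀ m ∈ U, Val (f m) (r m) ∧ r m ≠ 0) : UnitFam U f :=
  ⟨hf, 0, fun m hm => ⟨(h m hm).1.1, by rw [(h m hm).1.2]; exact (h m hm).2⟩⟩

/-! ### Matrices of families -/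

/-- Every entry of the family of matrices of Laurent series is a holomorphic family. -/
def HolFamMat (U : Set E) (A : E → LMat) : Prop := ∀ a b, HolFam U (fun m => A m a b)

lemma HolFamMat.congr (hU : IsOpen U) {A B : E → LMat} (hA : HolFamMat U A)
    (h : ∀ m ∈ U, A m = B m) : HolFamMat U B := fun a b =>
  (hA a b).congr hU fun m hm => by rw [h m hm]

lemma HolFamMat.mul (hU : IsOpen U) {A B : E → LMat} (hA : HolFamMat U A) (hB : HolFamMat U B) :
    HolFamMat U (fun m => A m * B m) := fun a b => by
  simp only [Matrix.mul_apply]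
  exact HolFam.sum _ fun c _ => (hA a c).mul hU (hB c b)

lemma HolFamMat.add {A B : E → LMat} (hA : HolFamMat U A) (hB : HolFamMat U B) :
    HolFamMat U (fun m => A m + B m) := fun a b => (hA a b).add (hB a b)

lemma HolFamMat.sub {A B : E → LMat} (hA : HolFamMat U A) (hB : HolFamMat U B) :
    HolFamMat U (fun m => A m - B m) := fun a b => (hA a b).sub (hB a b)

lemma HolFamMat.ddz {A : E → LMat} (hA : HolFamMat U A) :
    HolFamMat U (fun m => ddz (A m)) := fun a b => (hA a b).dz

lemma holFamMat_const (A : LMat) : HolFamMat U (fun _ => A) := fun _ _ => holFam_const _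

lemma HolFamMat.det (hU : IsOpen U) {A : E → LMat} (hA : HolFamMat U A) :
    HolFam U (fun m => (A m).det) := by
  simp only [Matrix.det_fin_two]
  exact ((hA 0 0).mul hU (hA 1 1)).sub ((hA 0 1).mul hU (hA 1 0))

lemma inv_fin_two (A : LMat) : A⁻¹ = (A.det)⁻¹ • !![A 1 1, -A 0 1; -A 1 0, A 0 0] := by
  rw [Matrix.inv_def, Ring.inverse_eq_inv', Matrix.adjugate_fin_two]

lemma HolFamMat.inv (hU : IsOpen U) {A : E → LMat} (hA : HolFamMat U A)
    (h : UnitFam U fun m => (A m).det) : HolFamMat U (fun m => (A m)⁻¹) := fun a b => by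
  simp only [inv_fin_two, Matrix.smul_apply, smul_eq_mul]
  refine (h.inv hU).1.mul hU ?_
  fin_cases a <;> fin_cases b
  · exact hA 1 1
  · exact (hA 0 1).neg
  · exact (hA 1 0).neg
  · exact hA 0 0

lemma HolFamMat.gauge (hU : IsOpen U) {g A : E → LMat} (hg : HolFamMat U g)
    (h : UnitFam U fun m => (g m).det) (hA : HolFamMat U A) :
    HolFamMat U (fun m => gaugeTransform (g m) (A m)) :=
  (((hg.inv hU h).mul hU hg.ddz)).add (((hg.inv hU h).mul hU hA).mul hU hg)

lemma HolFamMat.mapSq {A : E → LMat} (hA : HolFamMat U A) :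
    HolFamMat U (fun m => (A m).map sqSubst) := fun a b => (hA a b).sqSubst

lemma HolFamMat.ramify (hU : IsOpen U) {A : E → LMat} (hA : HolFamMat U A) :
    HolFamMat U (fun m => ramify (A m)) := fun a b =>
  (hA a b).sqSubst.mul hU (holFam_const _)

lemma holFamMat_cstMat {X : E → CMat} (h : ∀ a b, AnalyticOnNhd ℂ (fun m => X m a b) U) :
    HolFamMat U (fun m => cstMat (X m)) := fun a b => holFam_cst (h a b)

lemma holFamMat_seriesMat {X : ℕ → E → CMat}
    (h : ∀ s a b, AnalyticOnNhd ℂ (fun m => X s m a b) U) :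
    HolFamMat U (fun m => seriesMat fun s => X s m) := fun a b =>
  holFam_ser (β := fun s m => X s m a b) fun s => h s a b

end Families

/-! ### Variations of families -/

section Variations

variable {ν : ℕ} {S : SingularData ν} {U : Set S.Total}

lemma fderiv_eq_zero_of_eqOn (hU : IsOpen U) {f : S.Total → ℂ} {c : ℂ} {m : S.Total} (hm : m ∈ U)
    (h : ∀ m' ∈ U, f m' = c) : fderiv ℂ f m = 0 := by
  have : f =ᶠ[nhds m] fun _ => c := Filter.eventuallyEq_of_mem (hU.mem_nhds hm) h
  rw [this.fderiv_eq]
  simp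

/-- The coefficientwise variation of a family of Laurent series. -/
def varCoeff (f : S.Total → Laur) (m v : S.Total) : Laur :=
  ofCoeff fun k => fderiv ℂ (fun m' => (f m').coeff k) m v

lemma varCoeff_coeff (hU : IsOpen U) {f : S.Total → Laur} (hf : HolFam U f) {m : S.Total}
    (hm : m ∈ U) (v : S.Total) (k : ℤ) :
    (varCoeff f m v).coeff k = fderiv ℂ (fun m' => (f m').coeff k) m v := by
  obtain ⟨N, hN⟩ := hf.bdd
  refine ofCoeff_coeff (N := N) (fun k hk => ?_) k
  rw [fderiv_eq_zero_of_eqOn hU hm (c := 0) fun m' hm' => hN m' hm' k hk]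
  rfl

lemma varCoeff_ordGE (hU : IsOpen U) {f : S.Total → Laur} (hf : HolFam U f) {m : S.Total}
    (hm : m ∈ U) (v : S.Total) {N : ℤ} (hN : ∀ m' ∈ U, OrdGE N (f m')) :
    OrdGE N (varCoeff f m v) := fun k hk => by
  rw [varCoeff_coeff hU hf hm, fderiv_eq_zero_of_eqOn hU hm (c := 0) fun m' hm' => hN m' hm' k hk]
  rfl

lemma varL_eq (a : S.Total → ℂ) (f : S.Total → Laur) (m v : S.Total) :
    varL a f m v = varCoeff f m v - cst (fderiv ℂ a m v) * dz (f m) := rfl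

lemma varL_coeff (hU : IsOpen U) (a : S.Total → ℂ) {f : S.Total → Laur} (hf : HolFam U f)
    {m : S.Total} (hm : m ∈ U) (v : S.Total) (k : ℤ) :
    (varL a f m v).coeff k = fderiv ℂ (fun m' => (f m').coeff k) m v
      - fderiv ℂ a m v * ((k + 1) * (f m).coeff (k + 1)) := by
  rw [varL_eq, HahnSeries.coeff_sub, varCoeff_coeff hU hf hm, cst_mul_coeff, dz_coeff]

lemma varCoeff_mul (hU : IsOpen U) {f g : S.Total → Laur} (hf : HolFam U f) (hg : HolFam U g)
    {m : S.Total} (hm : m ∈ U) (v : S.Total) :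
    varCoeff (fun m' => f m' * g m') m v = varCoeff f m v * g m + f m * varCoeff g m v := by
  obtain ⟨N, hN⟩ := hf.bdd
  obtain ⟨M, hM⟩ := hg.bdd
  have hN' := varCoeff_ordGE hU hf hm v hN
  have hM' := varCoeff_ordGE hU hg hm v hM
  ext k
  rw [varCoeff_coeff hU (hf.mul hU hg) hm, HahnSeries.coeff_add,
    coeff_mul_Icc hN' (hM m hm), coeff_mul_Icc (hN m hm) hM']
  have e : (fun m' => (f m' * g m').coeff k) =ᶠ[nhds m] fun m' =>
      ∑ i ∈ Finset.Icc N (k - M), (f m').coeff i * (g m').coeff (k - i) :=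
    Filter.eventuallyEq_of_mem (hU.mem_nhds hm) fun m' hm' =>
      coeff_mul_Icc (hN m' hm') (hM m' hm') k
  rw [e.fderiv_eq, fderiv_fun_sum, _root_.sum_apply, ← Finset.sum_add_distrib]
  · refine Finset.sum_congr rfl fun i _ => ?_
    rw [fderiv_fun_mul (hf.an i m hm).differentiableAt (hg.an (k - i) m hm).differentiableAt,
      varCoeff_coeff hU hf hm, varCoeff_coeff hU hg hm]
    simp only [_root_.add_apply, _root_.smul_apply, smul_eq_mul]
    ring
  · intro i _
    exact ((hf.an i m hm).mul (hg.an (k - i) m hm)).differentiableAt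

lemma varL_mul (hU : IsOpen U) (a : S.Total → ℂ) {f g : S.Total → Laur} (hf : HolFam U f)
    (hg : HolFam U g) {m : S.Total} (hm : m ∈ U) (v : S.Total) :
    varL a (fun m' => f m' * g m') m v = varL a f m v * g m + f m * varL a g m v := by
  rw [varL_eq, varL_eq, varL_eq, varCoeff_mul hU hf hg hm, dz_mul]
  ring

lemma varL_add (hU : IsOpen U) (a : S.Total → ℂ) {f g : S.Total → Laur} (hf : HolFam U f)
    (hg : HolFam U g) {m : S.Total} (hm : m ∈ U) (v : S.Total) :
    varL a (fun m' => f m' + g m') m v = varL a f m v + varL a g m v := by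
  ext k
  rw [HahnSeries.coeff_add, varL_coeff hU a (hf.add hg) hm, varL_coeff hU a hf hm,
    varL_coeff hU a hg hm]
  simp only [HahnSeries.coeff_add]
  rw [fderiv_fun_add (hf.an k m hm).differentiableAt (hg.an k m hm).differentiableAt]
  simp only [_root_.add_apply]
  ring

lemma varL_dz (hU : IsOpen U) (a : S.Total → ℂ) {f : S.Total → Laur} (hf : HolFam U f)
    {m : S.Total} (hm : m ∈ U) (v : S.Total) :
    varL a (fun m' => dz (f m')) m v = dz (varL a f m v) := by
  ext k
  rw [dz_coeff, varL_coeff hU a hf.dz hm, varL_coeff hU a hf hm]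
  simp only [dz_coeff]
  rw [fderiv_const_mul (hf.an _ m hm).differentiableAt]
  simp only [_root_.smul_apply, smul_eq_mul]
  push_cast
  ring

lemma varL_const (a : S.Total → ℂ) (f : Laur) (m v : S.Total) :
    varL a (fun _ => f) m v = -(cst (fderiv ℂ a m v) * dz f) := by
  have h : HolFam Set.univ (fun _ : S.Total => f) := holFam_const f
  ext k
  rw [varL_coeff isOpen_univ a h (Set.mem_univ m), HahnSeries.coeff_neg, cst_mul_coeff, dz_coeff]
  simp

lemma varL_congr (hU : IsOpen U) (a : S.Total → ℂ) {f g : S.Total → Laur}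
    {m : S.Total} (hm : m ∈ U) (v : S.Total) (h : ∀ m' ∈ U, f m' = g m') :
    varL a f m v = varL a g m v := by
  have e : ∀ k, fderiv ℂ (fun m' => (f m').coeff k) m = fderiv ℂ (fun m' => (g m').coeff k) m := by
    intro k
    refine Filter.EventuallyEq.fderiv_eq
      (Filter.eventuallyEq_of_mem (hU.mem_nhds hm) fun m' hm' => ?_)
    rw [h m' hm']
  simp only [varL, e, h m hm]

lemma varL_ordGE (hU : IsOpen U) (a : S.Total → ℂ) {f : S.Total → Laur} (hf : HolFam U f)
    {m : S.Total} (hm : m ∈ U) (v : S.Total) {N : ℤ} (hN : ∀ m' ∈ U, OrdGE N (f m')) :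
    OrdGE (N - 1) (varL a f m v) :=
  ((varCoeff_ordGE hU hf hm v hN).mono (by omega)).sub ((hN m hm).dz.cst_mul _)

lemma varL_ordGE_zero (hU : IsOpen U) (a : S.Total → ℂ) {f : S.Total → Laur} (hf : HolFam U f)
    {m : S.Total} (hm : m ∈ U) (v : S.Total) (hN : ∀ m' ∈ U, OrdGE 0 (f m')) :
    OrdGE 0 (varL a f m v) :=
  (varCoeff_ordGE hU hf hm v hN).sub ((hN m hm).dz_zero.cst_mul _)

lemma varL_add_dir (hU : IsOpen U) (a : S.Total → ℂ) {f : S.Total → Laur} (hf : HolFam U f)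
    {m : S.Total} (hm : m ∈ U) (v w : S.Total) :
    varL a f m (v + w) = varL a f m v + varL a f m w := by
  ext k
  rw [HahnSeries.coeff_add, varL_coeff hU a hf hm, varL_coeff hU a hf hm, varL_coeff hU a hf hm,
    map_add, map_add]
  ring

lemma varL_smul_dir (hU : IsOpen U) (a : S.Total → ℂ) {f : S.Total → Laur} (hf : HolFam U f)
    {m : S.Total} (hm : m ∈ U) (c : ℂ) (v : S.Total) :
    varL a f m (c • v) = cst c * varL a f m v := by
  ext k
  rw [cst_mul_coeff, varL_coeff hU a hf hm, varL_coeff hU a hf hm, map_smul, map_smul]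
  simp only [smul_eq_mul]
  ring

lemma analyticOnNhd_fderiv_apply {f : S.Total → ℂ} (hf : AnalyticOnNhd ℂ f U) (v : S.Total) :
    AnalyticOnNhd ℂ (fun m => fderiv ℂ f m v) U := fun m hm =>
  ((ContinuousLinearMap.apply ℂ ℂ v).analyticAt _).comp (hf.fderiv m hm)

lemma HolFam.varL (hU : IsOpen U) {a : S.Total → ℂ} (ha : AnalyticOnNhd ℂ a U)
    {f : S.Total → Laur} (hf : HolFam U f) (v : S.Total) :
    HolFam U (fun m => varL a f m v) := by
  refine ⟨fun k => ?_, ?_⟩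
  · have h1 : AnalyticOnNhd ℂ (fun m => fderiv ℂ (fun m' => (f m').coeff k) m v
      - fderiv ℂ a m v * ((k + 1) * (f m).coeff (k + 1))) U :=
      (analyticOnNhd_fderiv_apply (hf.an k) v).sub
        ((analyticOnNhd_fderiv_apply ha v).mul (analyticOnNhd_const.mul (hf.an _)))
    exact h1.congr hU fun m hm => (varL_coeff hU a hf hm v k).symm
  · obtain ⟨N, hN⟩ := hf.bdd
    exact ⟨N - 1, fun m hm => varL_ordGE hU a hf hm v hN⟩

lemma fderiv_zero_fun (m v : S.Total) : fderiv ℂ (0 : S.Total → ℂ) m v = 0 := by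
  rw [fderiv_zero]
  rfl

/-- Variation with a fixed centre commutes with the substitution `z = ζ²`. -/
lemma varL_sqSubst (hU : IsOpen U) {f : S.Total → Laur} (hf : HolFam U f)
    {m : S.Total} (hm : m ∈ U) (v : S.Total) :
    varL 0 (fun m' => sqSubst (f m')) m v = sqSubst (varL 0 f m v) := by
  ext k
  rw [varL_coeff hU 0 hf.sqSubst hm, fderiv_zero_fun, zero_mul, sub_zero]
  rcases Int.even_or_odd' k with ⟨j, rfl | rfl⟩
  · simp only [sqSubst_coeff_even]
    rw [varL_coeff hU 0 hf hm, fderiv_zero_fun, zero_mul, sub_zero]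
  · rw [sqSubst_coeff_odd _ _ fun i => by omega]
    have : (fun m' => (sqSubst (f m')).coeff (2 * j + 1)) = fun _ => 0 := by
      funext m
      exact sqSubst_coeff_odd _ _ fun i => by omega
    rw [this]
    simp

/-! #### Formal primitives -/

/-- The power part of the formal primitive. -/
def primPart (f : Laur) : Laur := ofCoeff fun k => if k = 0 then 0 else f.coeff (k - 1) / k

lemma primPart_coeff (f : Laur) (k : ℤ) :
    (primPart f).coeff k = if k = 0 then 0 else f.coeff (k - 1) / k := by
  obtain ⟨N, hN⟩ := exists_ordGE f
  exact ofCoeff_coeff (N := N) (fun k hk => by rw [hN (k - 1) (by omega)]; simp) k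

lemma HolFam.primPart {f : S.Total → Laur} (hf : HolFam U f) :
    HolFam U (fun m => primPart (f m)) where
  an k := by
    simp only [primPart_coeff]
    split_ifs
    · exact analyticOnNhd_const
    · simpa only [div_eq_mul_inv] using (hf.an _).mul analyticOnNhd_const
  bdd := by
    obtain ⟨N, hN⟩ := hf.bdd
    exact ⟨N, fun m hm k hk => by rw [primPart_coeff, hN m hm (k - 1) (by omega)]; simp⟩

lemma varPrim_eq (a : S.Total → ℂ) (f : S.Total → Laur) (m v : S.Total) :
    varPrim a f m v = varL a (fun m' => primPart (f m')) m v
      - cst (fderiv ℂ a m v * (f m).coeff (-1)) * zvar⁻¹ := rfl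

lemma varPrim_coeff (hU : IsOpen U) (a : S.Total → ℂ) {f : S.Total → Laur} (hf : HolFam U f)
    {m : S.Total} (hm : m ∈ U) (v : S.Total) (k : ℤ) :
    (varPrim a f m v).coeff k
      = (if k = 0 then 0 else fderiv ℂ (fun m' => (f m').coeff (k - 1)) m v / k)
        - fderiv ℂ a m v * (f m).coeff k := by
  rw [varPrim_eq, HahnSeries.coeff_sub, varL_coeff hU a hf.primPart hm, cst_mul_coeff, zvar_inv,
    zpow_coeff]
  simp only [primPart_coeff]
  have h1 : fderiv ℂ (fun m' => if k = 0 then 0 else (f m').coeff (k - 1) / (k : ℂ)) m v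
      = if k = 0 then 0 else fderiv ℂ (fun m' => (f m').coeff (k - 1)) m v / k := by
    split_ifs
    · simp
    · simp only [div_eq_mul_inv]
      rw [fderiv_mul_const (hf.an _ m hm).differentiableAt]
      simp only [_root_.smul_apply, smul_eq_mul]
      ring
  rw [h1, add_sub_cancel_right]
  by_cases hk : k = -1
  · subst hk
    simp
  · have : (k : ℂ) + 1 ≠ 0 := by exact_mod_cast fun h => hk (by omega)
    have hk' : k + 1 ≠ 0 := by omega
    rw [if_neg hk, if_neg hk']
    push_cast
    field_simp
    ring

lemma dz_varPrim (hU : IsOpen U) (a : S.Total → ℂ) {f : S.Total → Laur} (hf : HolFam U f)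
    {m : S.Total} (hm : m ∈ U) (v : S.Total)
    (hres : fderiv ℂ (fun m' => (f m').coeff (-1)) m v = 0) :
    dz (varPrim a f m v) = varL a f m v := by
  ext k
  rw [dz_coeff, varPrim_coeff hU a hf hm, varL_coeff hU a hf hm, add_sub_cancel_right]
  by_cases hk : k = -1
  · subst hk
    rw [hres]
    simp
  · have : (k : ℂ) + 1 ≠ 0 := by exact_mod_cast fun h => hk (by omega)
    have hk' : k + 1 ≠ 0 := by omega
    rw [if_neg hk']
    push_cast
    field_simp

lemma HolFam.varPrim (hU : IsOpen U) {a : S.Total → ℂ} (ha : AnalyticOnNhd ℂ a U)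
    {f : S.Total → Laur} (hf : HolFam U f) (v : S.Total) :
    HolFam U (fun m => varPrim a f m v) := by
  simp only [varPrim_eq]
  exact (hf.primPart.varL hU ha v).sub
    ((holFam_cst ((analyticOnNhd_fderiv_apply ha v).mul (hf.an _))).mul hU (holFam_const _))

lemma varPrim_add_dir (hU : IsOpen U) (a : S.Total → ℂ) {f : S.Total → Laur} (hf : HolFam U f)
    {m : S.Total} (hm : m ∈ U) (v w : S.Total) :
    varPrim a f m (v + w) = varPrim a f m v + varPrim a f m w := by
  rw [varPrim_eq, varPrim_eq, varPrim_eq, varL_add_dir hU a hf.primPart hm, map_add, add_mul,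
    cst_add]
  ring

lemma varPrim_smul_dir (hU : IsOpen U) (a : S.Total → ℂ) {f : S.Total → Laur} (hf : HolFam U f)
    {m : S.Total} (hm : m ∈ U) (c : ℂ) (v : S.Total) :
    varPrim a f m (c • v) = cst c * varPrim a f m v := by
  rw [varPrim_eq, varPrim_eq, varL_smul_dir hU a hf.primPart hm, map_smul, smul_eq_mul, mul_assoc,
    cst_mul]
  ring

/-! #### Variations of matrices -/

lemma varMat_mul (hU : IsOpen U) (a : S.Total → ℂ) {A B : S.Total → LMat} (hA : HolFamMat U A)
    (hB : HolFamMat U B) {m : S.Total} (hm : m ∈ U) (v : S.Total) :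
    varMat a (fun m' => A m' * B m') m v = varMat a A m v * B m + A m * varMat a B m v := by
  ext r s : 1
  simp only [varMat, Matrix.add_apply, Matrix.mul_apply, Fin.sum_univ_two]
  rw [varL_add hU a ((hA r 0).mul hU (hB 0 s)) ((hA r 1).mul hU (hB 1 s)) hm,
    varL_mul hU a (hA r 0) (hB 0 s) hm, varL_mul hU a (hA r 1) (hB 1 s) hm]
  ring

lemma varMat_add (hU : IsOpen U) (a : S.Total → ℂ) {A B : S.Total → LMat} (hA : HolFamMat U A)
    (hB : HolFamMat U B) {m : S.Total} (hm : m ∈ U) (v : S.Total) :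
    varMat a (fun m' => A m' + B m') m v = varMat a A m v + varMat a B m v := by
  ext r s : 1
  exact varL_add hU a (hA r s) (hB r s) hm v

lemma varMat_ddz (hU : IsOpen U) (a : S.Total → ℂ) {A : S.Total → LMat} (hA : HolFamMat U A)
    {m : S.Total} (hm : m ∈ U) (v : S.Total) :
    varMat a (fun m' => ddz (A m')) m v = ddz (varMat a A m v) := by
  ext r s : 1
  exact varL_dz hU a (hA r s) hm v

lemma varMat_congr (hU : IsOpen U) (a : S.Total → ℂ) {A B : S.Total → LMat}
    {m : S.Total} (hm : m ∈ U) (v : S.Total) (h : ∀ m' ∈ U, A m' = B m') :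
    varMat a A m v = varMat a B m v := by
  ext r s : 1
  exact varL_congr hU a (f := fun m' => A m' r s) (g := fun m' => B m' r s) hm v
    fun m' hm' => by rw [h m' hm']

lemma HolFamMat.varMat (hU : IsOpen U) {a : S.Total → ℂ} (ha : AnalyticOnNhd ℂ a U)
    {A : S.Total → LMat} (hA : HolFamMat U A) (v : S.Total) :
    HolFamMat U (fun m => varMat a A m v) := fun r s => (hA r s).varL hU ha v

lemma varMat_add_dir (hU : IsOpen U) (a : S.Total → ℂ) {A : S.Total → LMat} (hA : HolFamMat U A)
    {m : S.Total} (hm : m ∈ U) (v w : S.Total) :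
    varMat a A m (v + w) = varMat a A m v + varMat a A m w := by
  ext r s : 1
  exact varL_add_dir hU a (hA r s) hm v w

end Variations

lemma ddz_apply (A : LMat) (r s : Fin 2) : ddz A r s = dz (A r s) := rfl

lemma ddz_mul (A B : LMat) : ddz (A * B) = ddz A * B + A * ddz B := by
  ext r s : 1
  simp only [ddz_apply, Matrix.add_apply, Matrix.mul_apply, Fin.sum_univ_two]
  rw [dz_add, dz_mul, dz_mul]
  ring

lemma ddz_sub (A B : LMat) : ddz (A - B) = ddz A - ddz B := by
  ext r s : 1
  exact dz_sub _ _

/-- The gauge equation without inverses. -/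
lemma gaugeTransform_eq_iff {g A B : LMat} (hg : g.det ≠ 0) :
    gaugeTransform g A = B ↔ g * B = ddz g + A * g := by
  have hu : IsUnit g.det := isUnit_iff_ne_zero.mpr hg
  constructor
  · rintro rfl
    rw [gaugeTransform, mul_add, ← mul_assoc, Matrix.mul_nonsing_inv _ hu, one_mul, ← mul_assoc,
      ← mul_assoc, Matrix.mul_nonsing_inv _ hu, one_mul]
  · intro h
    rw [gaugeTransform, mul_assoc, ← mul_add, ← h, ← mul_assoc, Matrix.nonsing_inv_mul _ hu,
      one_mul]

/-! ### Residue identities for formal connections -/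

/-- All entries of the matrix are `O(z^N)`. -/
def MatGE (N : ℤ) (A : LMat) : Prop := ∀ a b, OrdGE N (A a b)

lemma MatGE.mul {N M K : ℤ} {A B : LMat} (hA : MatGE N A) (hB : MatGE M B) (h : K ≤ N + M) :
    MatGE K (A * B) := fun a b => by
  rw [Matrix.mul_apply]
  exact ordGE_sum _ _ fun c _ => (hA a c).mul (hB c b) h

lemma MatGE.trace {N : ℤ} {A : LMat} (hA : MatGE N A) : OrdGE N A.trace := by
  rw [Matrix.trace_fin_two]
  exact (hA 0 0).add (hA 1 1)

lemma MatGE.ddz_zero {A : LMat} (hA : MatGE 0 A) : MatGE 0 (ddz A) :=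
  fun a b => (hA a b).dz_zero

lemma MatGE.inv {A : LMat} (hA : MatGE 0 A) (h : A.det.coeff 0 ≠ 0) : MatGE 0 A⁻¹ := by
  have hd : OrdGE 0 A.det := by
    rw [Matrix.det_fin_two]
    exact ((hA 0 0).mul (hA 1 1) (by omega)).sub ((hA 0 1).mul (hA 1 0) (by omega))
  have hi : OrdGE 0 A.det⁻¹ := by simpa using hd.inv h
  intro a b
  rw [inv_fin_two, Matrix.smul_apply, smul_eq_mul]
  refine hi.mul (N := 0) (M := 0) ?_ (by omega)
  fin_cases a <;> fin_cases b
  · exact hA 1 1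
  · exact (hA 0 1).neg
  · exact (hA 1 0).neg
  · exact hA 0 0

lemma mul_right_cancel_of_det {g A B : LMat} (hg : g.det ≠ 0) (h : A * g = B * g) : A = B := by
  have hu : IsUnit g.det := isUnit_iff_ne_zero.mpr hg
  have := congrArg (· * g⁻¹) h
  simpa [mul_assoc, Matrix.mul_nonsing_inv _ hu] using this

lemma mul_left_cancel_of_det {g A B : LMat} (hg : g.det ≠ 0) (h : g * A = g * B) : A = B := by
  have hu : IsUnit g.det := isUnit_iff_ne_zero.mpr hg
  have := congrArg (g⁻¹ * ·) h
  simpa [← mul_assoc, Matrix.nonsing_inv_mul _ hu] using this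

/-- If both variations come from variations `Y = δψ ψ⁻¹` of solutions, the antisymmetrised residue
is twice `res Tr(δ₁A δ₂ψ ψ⁻¹)`, because the difference is the residue of `d Tr(Y₁ Y₂)`. -/
lemma residue_wedge {A Y₁ Y₂ dA₁ dA₂ : LMat} (h₁ : dA₁ = -ddz Y₁ - (A * Y₁ - Y₁ * A))
    (h₂ : dA₂ = -ddz Y₂ - (A * Y₂ - Y₂ * A)) :
    (Matrix.trace (dA₁ * Y₂ - Y₁ * dA₂)).coeff (-1)
      = 2 * (Matrix.trace (dA₁ * Y₂)).coeff (-1) := by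
  have e : Matrix.trace (dA₁ * Y₂ - Y₁ * dA₂)
      = cst 2 * Matrix.trace (dA₁ * Y₂) + dz (Matrix.trace (Y₁ * Y₂)) := by
    have c2 : cst 2 = 2 := by rw [cst, map_ofNat]
    subst h₁ h₂
    rw [c2]
    simp only [Matrix.trace_fin_two, Matrix.mul_apply, Matrix.sub_apply, Matrix.neg_apply,
      Fin.sum_univ_two, dz_add, dz_mul, ddz_apply]
    ring
  rw [e, HahnSeries.coeff_add, dz_coeff_neg_one, cst_mul_coeff, add_zero]

/-- The variation of the connection matrix in terms of the variation of the formal solution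
`ψ = g exp(-L)`, where `B = g⁻¹ g' + g⁻¹ A g` commutes with `L` and `L' = δB`. -/
lemma variation_eq_of_formal_solution {A g B dA dg dB L : LMat} (hg : g.det ≠ 0)
    (h0 : g * B = ddz g + A * g) (h1 : dg * B + g * dB = ddz dg + dA * g + A * dg)
    (hc : L * B = B * L) (hL : ddz L = dB) :
    dA = -ddz (dg * g⁻¹ - g * L * g⁻¹)
      - (A * (dg * g⁻¹ - g * L * g⁻¹) - (dg * g⁻¹ - g * L * g⁻¹) * A) := by
  have hu : IsUnit g.det := isUnit_iff_ne_zero.mpr hg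
  obtain ⟨Y, hY⟩ : ∃ Y, Y = dg * g⁻¹ - g * L * g⁻¹ := ⟨_, rfl⟩
  rw [← hY]
  have hYg : Y * g = dg - g * L := by
    rw [hY, sub_mul, mul_assoc, mul_assoc, Matrix.nonsing_inv_mul _ hu, mul_one, mul_one]
  have hd : ddz Y * g = ddz dg - ddz g * L - g * dB - Y * ddz g := by
    have := congrArg ddz hYg
    rw [ddz_mul, ddz_sub, ddz_mul, hL] at this
    rw [eq_sub_of_add_eq this]
    abel
  apply mul_right_cancel_of_det hg
  have e1 : ddz g = g * B - A * g := by rw [h0]; abel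
  have e2 : ddz dg = dg * B + g * dB - dA * g - A * dg := by rw [h1]; abel
  have e3 : Y * (g * B) = (dg - g * L) * B := by rw [← mul_assoc, hYg]
  have e4 : A * Y * g = A * (dg - g * L) := by rw [mul_assoc, hYg]
  rw [sub_mul, Matrix.neg_mul, sub_mul, hd, e4, e2, e1, mul_sub Y, e3]
  rw [sub_mul dg, mul_assoc g L B, hc]
  simp only [mul_sub, sub_mul, mul_assoc]
  abel

lemma conj_variation {A g B dA dg dB : LMat} (hg : g.det ≠ 0)
    (h0 : g * B = ddz g + A * g) (h1 : dg * B + g * dB = ddz dg + dA * g + A * dg) :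
    g⁻¹ * dA * g = dB - ddz (g⁻¹ * dg) - (B * (g⁻¹ * dg) - g⁻¹ * dg * B) := by
  have hu : IsUnit g.det := isUnit_iff_ne_zero.mpr hg
  set X := g⁻¹ * dg with hX
  have hgX : g * X = dg := by rw [hX, ← mul_assoc, Matrix.mul_nonsing_inv _ hu, one_mul]
  apply mul_left_cancel_of_det hg
  have e0 : g * (g⁻¹ * dA * g) = dA * g := by
    rw [← mul_assoc, ← mul_assoc, Matrix.mul_nonsing_inv _ hu, one_mul]
  have hd : g * ddz X = ddz dg - ddz g * X := by
    have := congrArg ddz hgX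
    rw [ddz_mul] at this
    rw [← this]
    abel
  have e2 : ddz dg = dg * B + g * dB - dA * g - A * dg := by rw [h1]; abel
  have e3 : ddz g * X = g * B * X - A * dg := by
    rw [← hgX, h0]; noncomm_ring
  rw [e0, mul_sub, mul_sub, hd, e3, e2, mul_sub, ← mul_assoc g B, ← mul_assoc g X, hgX]
  noncomm_ring

/-- The residue of `Tr(δ₁A ∧ δψ ψ⁻¹)` in terms of diagonal data. -/
lemma residue_wedge_of_diagonal {A g B dA₁ dg₁ dB₁ dA₂ dg₂ dB₂ : LMat} {ℓ₁ ℓ₂ : Fin 2 → Laur}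
    (hg : g.det ≠ 0) (h0 : g * B = ddz g + A * g)
    (h1 : dg₁ * B + g * dB₁ = ddz dg₁ + dA₁ * g + A * dg₁)
    (h2 : dg₂ * B + g * dB₂ = ddz dg₂ + dA₂ * g + A * dg₂)
    (hB : B.IsDiag) (hL1 : ddz (Matrix.diagonal ℓ₁) = dB₁) (hL2 : ddz (Matrix.diagonal ℓ₂) = dB₂)
    (hres : (Matrix.trace (dA₁ * (dg₂ * g⁻¹))).coeff (-1) = 0) :
    (Matrix.trace (dA₁ * (dg₂ * g⁻¹ - g * Matrix.diagonal ℓ₂ * g⁻¹)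
      - (dg₁ * g⁻¹ - g * Matrix.diagonal ℓ₁ * g⁻¹) * dA₂)).coeff (-1)
    = -2 * ∑ s, ((dB₁ s s - dz ((g⁻¹ * dg₁) s s)) * ℓ₂ s).coeff (-1) := by
  have hcomm : ∀ ℓ : Fin 2 → Laur, Matrix.diagonal ℓ * B = B * Matrix.diagonal ℓ := by
    intro ℓ
    ext a b : 1
    rw [Matrix.diagonal_mul, Matrix.mul_diagonal]
    by_cases h : a = b
    · subst h; ring
    · rw [hB h]; ring
  rw [residue_wedge (variation_eq_of_formal_solution hg h0 h1 (hcomm ℓ₁) hL1)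
    (variation_eq_of_formal_solution hg h0 h2 (hcomm ℓ₂) hL2)]
  have e1 : Matrix.trace (dA₁ * (dg₂ * g⁻¹ - g * Matrix.diagonal ℓ₂ * g⁻¹))
      = Matrix.trace (dA₁ * (dg₂ * g⁻¹))
        - Matrix.trace (g⁻¹ * dA₁ * g * Matrix.diagonal ℓ₂) := by
    rw [mul_sub, Matrix.trace_sub]
    congr 1
    rw [← mul_assoc, Matrix.trace_mul_comm, ← mul_assoc, ← mul_assoc]
  have e2 : Matrix.trace (g⁻¹ * dA₁ * g * Matrix.diagonal ℓ₂)
      = ∑ s, (dB₁ s s - dz ((g⁻¹ * dg₁) s s)) * ℓ₂ s := by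
    rw [conj_variation hg h0 h1]
    set X := g⁻¹ * dg₁
    have h01 : B 0 1 = 0 := hB (by simp)
    have h10 : B 1 0 = 0 := hB (by simp)
    simp only [Matrix.trace_fin_two, Matrix.mul_diagonal, Matrix.sub_apply]
    simp only [Matrix.mul_apply, Fin.sum_univ_two, h01, h10, ddz_apply]
    ring
  rw [e1, HahnSeries.coeff_sub, hres, e2, coeff_finsetSum]
  ring

/-! ### The diagonal part of the infinitesimal gauge transformation at an unramified pole -/

/-- A solution of a first order equation with an irreducible pole and no polar part vanishes to
the order of the pole. -/
lemma ordGE_of_dz_add_mul {n : ℕ} (hn : 1 ≤ n) {h x : Laur} (hh : OrdGE (-n) h)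
    (hlead : h.coeff (-n) ≠ 0) (hx : OrdGE 0 x) (hreg : OrdGE 0 (dz x + h * x)) :
    OrdGE n x := by
  have key : ∀ k : ℕ, k ≤ n → OrdGE k x := by
    intro k
    induction k with
    | zero => intro _; simpa using hx
    | succ k ih =>
      intro hk
      have hxk := ih (by omega)
      have h1 := hreg ((k : ℤ) - n) (by omega)
      rw [HahnSeries.coeff_add, dz_coeff, coeff_mul_lead hh hxk (by ring)] at h1
      have h2 : (((k : ℤ) - n : ℤ) + 1 : ℂ) * x.coeff ((k : ℤ) - n + 1) = 0 := by
        rcases eq_or_ne n 1 with rfl | hn1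
        · have : k = 0 := by omega
          subst this
          simp
        · rw [hxk _ (by omega), mul_zero]
      rw [h2, zero_add] at h1
      have h3 := (mul_eq_zero.mp h1).resolve_left hlead
      intro j hj
      rcases eq_or_ne j k with rfl | hjk
      · exact h3
      · exact hxk j (by push_cast at hj; omega)
  exact key n le_rfl

/-- If the gauge transformation is `ΦΞ` with `Ξ` of unit diagonal, the diagonal of its logarithmic
derivative along a variation that preserves the polar part is constant up to order `n + 1`. -/
lemma diag_logVar_ordGE {n : ℕ} (hn : 1 ≤ n) {B dB C X Ξ dΞ D : LMat} (hB : B.IsDiag)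
    (hBn : MatGE (-n) B) (hlead : (B 0 0).coeff (-n) ≠ (B 1 1).coeff (-n))
    (hdB : dB.IsDiag) (hC : MatGE 0 C) (hCeq : C = dB - ddz X - (B * X - X * B))
    (hX : MatGE 0 X) (hΞ : ∀ s, Ξ s s = 1) (hΞo : ∀ a b, a ≠ b → OrdGE 1 (Ξ a b))
    (hdΞ : ∀ s, dΞ s s = 0) (hdΞo : MatGE 1 dΞ) (hD : ∀ a b, D a b = cst ((D a b).coeff 0))
    (hrel : Ξ * X = D * Ξ + dΞ) (s : Fin 2) : OrdGE n (dz (X s s)) := by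
  have hoff : ∀ a b, a ≠ b → OrdGE n (X a b) := by
    intro a b hab
    have hBab := hB hab
    have e : dz (X a b) + (B a a - B b b) * X a b = -C a b := by
      rw [hCeq]
      have hd : dB a b = 0 := hdB hab
      have hl : (B * X) a b = B a a * X a b := by
        rw [Matrix.mul_apply, Finset.sum_eq_single a (fun c _ hc => by rw [hB hc.symm, zero_mul])
          (by simp)]
      have hr : (X * B) a b = X a b * B b b := by
        rw [Matrix.mul_apply, Finset.sum_eq_single b (fun c _ hc => by rw [hB hc, mul_zero])
          (by simp)]
      rw [Matrix.sub_apply, Matrix.sub_apply, Matrix.sub_apply, hd, hl, hr, ddz_apply]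
      ring
    refine ordGE_of_dz_add_mul hn (h := B a a - B b b) ((hBn a a).sub (hBn b b)) ?_ (hX a b) ?_
    · rw [HahnSeries.coeff_sub, sub_ne_zero]
      fin_cases a <;> fin_cases b
      · exact absurd rfl hab
      · exact hlead
      · exact hlead.symm
      · exact absurd rfl hab
    · rw [e]
      exact (hC a b).neg
  have hD0 : ∀ a b, a ≠ b → D a b = 0 := by
    intro a b hab
    have h1 := congrFun (congrFun hrel a) b
    have h2 : (X a b).coeff 0 = 0 := hoff a b hab 0 (by omega)
    have h3 : (dΞ a b).coeff 0 = 0 := hdΞo a b 0 (by omega)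
    have h4 : ∀ c d e : Fin 2, c ≠ d → (Ξ c d * X d e).coeff 0 = 0 := fun c d e hcd =>
      ((hΞo c d hcd).mul (hX d e) (K := 1) (by omega)) 0 (by omega)
    have h5 : ∀ c d e : Fin 2, d ≠ e → (D c d * Ξ d e).coeff 0 = 0 := fun c d e hde => by
      rw [hD c d, cst_mul_coeff, hΞo d e hde 0 (by omega), mul_zero]
    have h6 : (D a b).coeff 0 = 0 := by
      have h7 := congrArg (fun f : Laur => f.coeff 0) h1
      have hl : (Ξ * X) a b = X a b + Ξ a b * X b b := by
        rw [Matrix.mul_apply, Fintype.sum_eq_add a b hab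
          (fun c hc => absurd hc (by clear * - hab; decide +revert)), hΞ, one_mul]
      have hr : (D * Ξ) a b = D a b + D a a * Ξ a b := by
        rw [Matrix.mul_apply, Fintype.sum_eq_add b a hab.symm
          (fun c hc => absurd hc (by clear * - hab; decide +revert)), hΞ, mul_one]
      rw [Matrix.add_apply, hl, hr] at h7
      simp only [HahnSeries.coeff_add] at h7
      rw [h2, h3, h4 a b b hab, h5 a a b hab] at h7
      simpa using h7.symm
    rw [hD a b, h6, cst_zero]
  have hs : ∃ t : Fin 2, s ≠ t := ⟨s + 1, by fin_cases s <;> simp⟩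
  obtain ⟨t, hst⟩ := hs
  have e : X s s = D s s - Ξ s t * X t s := by
    have h1 := congrFun (congrFun hrel s) s
    have h2 := hD0 s t hst
    rw [Matrix.add_apply, hdΞ, add_zero, Matrix.mul_apply, Matrix.mul_apply,
      Fintype.sum_eq_add s t hst (fun c hc => absurd hc (by clear * - hst; decide +revert)),
      Fintype.sum_eq_add s t hst (fun c hc => absurd hc (by clear * - hst; decide +revert)),
      h2, hΞ] at h1
    rw [← sub_eq_zero] at h1 ⊢
    rw [← h1]
    ring
  rw [e, dz_sub, hD s s, dz_cst, zero_sub]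
  have h1 := ((hΞo s t hst).mul' (hoff t s hst.symm)).dz.neg
  exact h1.mono (by omega)

variable {ν : ℕ} {S : SingularData ν}

/-! ### Coordinates on the phase space -/

lemma analytic_pos (i : Fin ν) (U : Set S.Total) :
    AnalyticOnNhd ℂ (fun m : S.Total => pos m.2 i) U := by
  unfold pos
  split_ifs with h1 h2 h
  · exact analyticOnNhd_const
  · exact analyticOnNhd_const
  · exact fun m _ => (((ContinuousLinearMap.proj (R := ℂ) (φ := fun _ : S.Mov => ℂ) ⟨i, h⟩).comp
      ((ContinuousLinearMap.fst ℂ _ _).comp (ContinuousLinearMap.snd ℂ _ _))).analyticAt m)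
  · exact analyticOnNhd_const

lemma analytic_thetaUn (i : Option (Fin ν)) (l : ℕ) (s : Fin 2) (U : Set S.Total) :
    AnalyticOnNhd ℂ (fun m : S.Total => thetaUn m.2 i l s) U := by
  unfold thetaUn
  split_ifs with h
  · exact fun m _ => (((ContinuousLinearMap.proj (R := ℂ) (φ := fun _ : S.ThUn => ℂ)
      ⟨i, ⟨l, h⟩, s⟩).comp ((ContinuousLinearMap.fst ℂ _ _).comp
      ((ContinuousLinearMap.snd ℂ _ _).comp (ContinuousLinearMap.snd ℂ _ _)))).analyticAt m)
  · exact analyticOnNhd_const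

lemma analytic_thetaRa (i : Option (Fin ν)) (l : ℕ) (U : Set S.Total) :
    AnalyticOnNhd ℂ (fun m : S.Total => thetaRa m.2 i l) U := by
  unfold thetaRa
  split_ifs with h
  · exact fun m _ => (((ContinuousLinearMap.proj (R := ℂ) (φ := fun _ : S.ThRa => ℂ)
      ⟨i, ⟨l, h⟩⟩).comp ((ContinuousLinearMap.snd ℂ _ _).comp
      ((ContinuousLinearMap.snd ℂ _ _).comp (ContinuousLinearMap.snd ℂ _ _)))).analyticAt m)
  · exact analyticOnNhd_const

lemma analytic_qc (j : Fin S.numApp) (U : Set S.Total) :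
    AnalyticOnNhd ℂ (fun m : S.Total => qc m j) U :=
  fun m _ => (((ContinuousLinearMap.proj (R := ℂ) (φ := fun _ : Fin S.numApp => ℂ) j).comp
    ((ContinuousLinearMap.fst ℂ _ _).comp (ContinuousLinearMap.fst ℂ _ _))).analyticAt m)

lemma analytic_pc (j : Fin S.numApp) (U : Set S.Total) :
    AnalyticOnNhd ℂ (fun m : S.Total => pc m j) U :=
  fun m _ => (((ContinuousLinearMap.proj (R := ℂ) (φ := fun _ : Fin S.numApp => ℂ) j).comp
    ((ContinuousLinearMap.snd ℂ _ _).comp (ContinuousLinearMap.fst ℂ _ _))).analyticAt m)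

lemma analytic_center (i : Option (Fin ν)) (U : Set S.Total) :
    AnalyticOnNhd ℂ (center i : S.Total → ℂ) U := by
  cases i with
  | none => exact analyticOnNhd_const
  | some i => exact analytic_pos i U

lemma isOpen_phaseSpace : IsOpen (phaseSpace S) := by
  have hc : ∀ {f : S.Total → ℂ}, AnalyticOnNhd ℂ f Set.univ → Continuous f := fun h =>
    continuousOn_univ.mp h.continuousOn
  have hne : ∀ {f g : S.Total → ℂ}, AnalyticOnNhd ℂ f Set.univ → AnalyticOnNhd ℂ g Set.univ →
      IsOpen {m | f m ≠ g m} := fun hf hg => isOpen_ne_fun (hc hf) (hc hg)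
  have e : phaseSpace S = {m | ∀ i k : Fin ν, i ≠ k → pos m.2 i ≠ pos m.2 k} ∩
      ({m | ∀ j k : Fin S.numApp, j ≠ k → qc m j ≠ qc m k} ∩
      ({m | ∀ (j : Fin S.numApp) (i : Fin ν), qc m j ≠ pos m.2 i} ∩
      ({m | ∀ i, S.kind i = Kind.un → thetaUn m.2 i 0 0 ≠ thetaUn m.2 i 0 1} ∩
      {m | ∀ i, S.kind i = Kind.ra → thetaRa m.2 i 1 ≠ 0}))) := by
    ext m
    simp only [phaseSpace, Set.mem_ofPred_eq, Set.mem_inter_iff]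
    refine and_congr ?_ (and_congr ?_ Iff.rfl)
    · exact ⟨fun h i k hik => h.ne hik, fun h i k hik => by
        by_contra hne
        exact h i k hne hik⟩
    · exact ⟨fun h i k hik => h.ne hik, fun h i k hik => by
        by_contra hne
        exact h i k hne hik⟩
  rw [e]
  simp only [Set.ofPred_forall]
  refine IsOpen.inter ?_ (IsOpen.inter ?_ (IsOpen.inter ?_ (IsOpen.inter ?_ ?_)))
  · exact isOpen_iInter_of_finite fun i => isOpen_iInter_of_finite fun k =>
      isOpen_iInter_of_finite fun _ => hne (analytic_pos i _) (analytic_pos k _)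
  · exact isOpen_iInter_of_finite fun i => isOpen_iInter_of_finite fun k =>
      isOpen_iInter_of_finite fun _ => hne (analytic_qc i _) (analytic_qc k _)
  · exact isOpen_iInter_of_finite fun i => isOpen_iInter_of_finite fun k =>
      hne (analytic_qc i _) (analytic_pos k _)
  · exact isOpen_iInter_of_finite fun i => isOpen_iInter_of_finite fun _ =>
      hne (analytic_thetaUn i 0 0 _) (analytic_thetaUn i 0 1 _)
  · exact isOpen_iInter_of_finite fun i => isOpen_iInter_of_finite fun _ =>
      hne (analytic_thetaRa i 1 _) analyticOnNhd_const

/-- A function that depends on the deformation parameters only has vanishing derivative in the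
directions of the fibre. -/
lemma fderiv_vertical {U : Set S.Total} (hU : IsOpen U) {f : S.Total → ℂ}
    (hf : AnalyticOnNhd ℂ f U) (hb : ∀ m ∈ U, ∀ m' ∈ U, m.2 = m'.2 → f m = f m')
    {m v : S.Total} (hm : m ∈ U) (hv : v.2 = 0) : fderiv ℂ f m v = 0 := by
  let p : S.Total → S.Total := fun m' => (m.1, m'.2)
  have hp : HasFDerivAt p ((0 : S.Total →L[ℂ] _).prod (ContinuousLinearMap.snd ℂ _ _)) m :=
    (hasFDerivAt_const m.1 m).prodMk hasFDerivAt_snd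
  have hpm : p m = m := rfl
  have e : f =ᶠ[nhds m] f ∘ p := by
    have h1 : p ⁻¹' U ∈ nhds m := hp.continuousAt.preimage_mem_nhds (by
      rw [hpm]; exact hU.mem_nhds hm)
    filter_upwards [h1, hU.mem_nhds hm] with m' h2 h3
    exact hb m' h3 (p m') h2 rfl
  have hfd : HasFDerivAt f (fderiv ℂ f m) (p m) := (hf m hm).differentiableAt.hasFDerivAt
  rw [e.fderiv_eq, (hfd.comp m hp).fderiv]
  simp only [ContinuousLinearMap.comp_apply, ContinuousLinearMap.prod_apply, zero_apply,
    ContinuousLinearMap.coe_snd', hv]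
  exact map_zero _

lemma SingularData.one_le_ord (i : Option (Fin ν)) : 1 ≤ S.ord i := by
  by_cases h : S.kind i = Kind.reg
  · rw [S.ord_reg i h]
  · have := S.ord_irr i h
    omega

lemma fderiv_center_vertical (i : Option (Fin ν)) {m v : S.Total} (hv : v.2 = 0) :
    fderiv ℂ (center i) m v = 0 := by
  refine fderiv_vertical isOpen_univ (analytic_center i _) ?_ (Set.mem_univ m) hv
  intro m _ m' _ h
  cases i with
  | none => rfl
  | some i => simp [center, h]

lemma fderiv_thetaUn_vertical (i : Option (Fin ν)) (l : ℕ) (s : Fin 2) {m v : S.Total}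
    (hv : v.2 = 0) : fderiv ℂ (fun m : S.Total => thetaUn m.2 i l s) m v = 0 :=
  fderiv_vertical isOpen_univ (analytic_thetaUn i l s _) (fun m _ m' _ h => by rw [h])
    (Set.mem_univ m) hv

lemma fderiv_thetaRa_vertical (i : Option (Fin ν)) (l : ℕ) {m v : S.Total}
    (hv : v.2 = 0) : fderiv ℂ (fun m : S.Total => thetaRa m.2 i l) m v = 0 :=
  fderiv_vertical isOpen_univ (analytic_thetaRa i l _) (fun m _ m' _ h => by rw [h])
    (Set.mem_univ m) hv

/-! ### Framings and their variations -/

lemma seriesMat_apply (X : ℕ → CMat) (a b : Fin 2) :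
    seriesMat X a b = ser fun s => X s a b := rfl

lemma seriesMat_ge (X : ℕ → CMat) : MatGE 0 (seriesMat X) :=
  fun _ _ => ser_ordGE _

lemma det_val {A : LMat} {X : CMat} (h : ∀ a b, Val (A a b) (X a b)) : Val A.det X.det := by
  rw [Matrix.det_fin_two, Matrix.det_fin_two]
  exact ((h 0 0).mul (h 1 1)).sub ((h 0 1).mul (h 1 0))

lemma cstMat_apply (X : CMat) (a b : Fin 2) : cstMat X a b = cst (X a b) := rfl

lemma cstMat_mul (X Y : CMat) : cstMat (X * Y) = cstMat X * cstMat Y :=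
  Matrix.map_mul (f := (HahnSeries.C : ℂ →+* Laur))

lemma cstMat_one : cstMat 1 = 1 :=
  Matrix.map_one (HahnSeries.C : ℂ →+* Laur) (map_zero _) (map_one _)

lemma cstMat_det (X : CMat) : (cstMat X).det = cst X.det := by
  rw [Matrix.det_fin_two, Matrix.det_fin_two, cst_sub, cst_mul, cst_mul]
  rfl

lemma cstMat_inv {X : CMat} (h : X.det ≠ 0) : (cstMat X)⁻¹ = cstMat X⁻¹ := by
  have hu : IsUnit X.det := isUnit_iff_ne_zero.mpr h
  refine Matrix.inv_eq_left_inv ?_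
  rw [← cstMat_mul, Matrix.nonsing_inv_mul _ hu, cstMat_one]

lemma frameZ_ge (F : Frames S) (i : Option (Fin ν)) (m : S.Total) : MatGE 0 (frameZ F i m) :=
  MatGE.mul (N := 0) (M := 0) (fun _ _ => ordGE_cst _) (seriesMat_ge _) (by omega)

lemma frameZ_det {F : Frames S} (hF : F.IsCompatible) (i : Option (Fin ν)) {m : S.Total}
    (hm : m ∈ phaseSpace S) : Val (frameZ F i m).det (F.Phi i m).det := by
  have h1 : Val (seriesMat fun s => F.Xi i s m).det (1 : CMat).det := by
    refine det_val fun a b => ⟨ser_ordGE _, ?_⟩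
    rw [seriesMat_apply, ser_coeff_zero, hF.xi_zero i m hm]
  rw [frameZ, Matrix.det_mul, cstMat_det]
  simpa using (val_cst (F.Phi i m).det).mul h1

lemma holFam_frameZ {F : Frames S} (hF : F.IsCompatible) (i : Option (Fin ν)) :
    HolFamMat (phaseSpace S) (frameZ F i) :=
  (holFamMat_cstMat (hF.hol_Phi i)).mul isOpen_phaseSpace
    (holFamMat_seriesMat (X := fun s m => F.Xi i s m) (hF.hol_Xi i))

lemma frameZ_det_unit {F : Frames S} (hF : F.IsCompatible) (i : Option (Fin ν)) :
    UnitFam (phaseSpace S) fun m => (frameZ F i m).det :=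
  unitFam_of_val ((holFam_frameZ hF i).det isOpen_phaseSpace)
    fun m hm => ⟨frameZ_det hF i hm, hF.det_ne i m hm⟩

lemma frameZ_inv_ge {F : Frames S} (hF : F.IsCompatible) (i : Option (Fin ν)) {m : S.Total}
    (hm : m ∈ phaseSpace S) : MatGE 0 (frameZ F i m)⁻¹ :=
  (frameZ_ge F i m).inv (by rw [(frameZ_det hF i hm).2]; exact hF.det_ne i m hm)

lemma varL_cst {U : Set S.Total} (hU : IsOpen U) (a : S.Total → ℂ) {f : S.Total → ℂ}
    (hf : AnalyticOnNhd ℂ f U) {m : S.Total} (hm : m ∈ U) (v : S.Total) :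
    varL a (fun m' => cst (f m')) m v = cst (fderiv ℂ f m v) := by
  ext k
  rw [varL_eq, dz_cst, mul_zero, sub_zero, varCoeff_coeff hU (holFam_cst hf) hm]
  rcases eq_or_ne k 0 with rfl | hk
  · simp only [cst_coeff_zero]
  · simp [cst, hk]

/-- The variation of the gauge equation `g B = g' + A g`. -/
lemma variation_gauge {U : Set S.Total} (hU : IsOpen U) (a : S.Total → ℂ) {g A B : S.Total → LMat}
    (hg : HolFamMat U g) (hA : HolFamMat U A) (hB : HolFamMat U B)
    (h : ∀ m ∈ U, g m * B m = ddz (g m) + A m * g m) {m : S.Total} (hm : m ∈ U) (v : S.Total) :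
    varMat a g m v * B m + g m * varMat a B m v
      = ddz (varMat a g m v) + varMat a A m v * g m + A m * varMat a g m v := by
  have h1 := varMat_congr hU a hm v h
  rw [varMat_mul hU a hg hB hm, varMat_add hU a hg.ddz (hA.mul hU hg) hm,
    varMat_mul hU a hA hg hm, varMat_ddz hU a hg hm] at h1
  rw [h1, add_assoc]

/-- A family whose polar part depends on the deformation parameters only has regular variations
along the fibres. -/
lemma varMat_vertical_ge {U : Set S.Total} (hU : IsOpen U) (a : S.Total → ℂ) {A : S.Total → LMat}
    (hA : HolFamMat U A) {N : ℤ}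
    (hb : ∀ m ∈ U, ∀ m' ∈ U, m.2 = m'.2 → MatGE N (A m - A m'))
    {m v : S.Total} (hm : m ∈ U) (hv : v.2 = 0) (ha : fderiv ℂ a m v = 0) :
    MatGE N (varMat a A m v) := fun r s k hk => by
  rw [varMat, varL_coeff hU a (hA r s) hm, ha, zero_mul, sub_zero]
  refine fderiv_vertical hU ((hA r s).an k) (fun m hm m' hm' h => ?_) hm hv
  exact coeff_eq_of_sub (hb m hm m' hm' h r s) hk

/-! ### The contribution of a regular or unramified pole -/

section Unramified

variable {F : Frames S} {i : Option (Fin ν)}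

lemma thetaUn_last (b : S.Base) (i : Option (Fin ν)) (s : Fin 2) :
    thetaUn b i (S.ord i - 1) s = S.res i s := by
  unfold thetaUn
  rw [dif_neg]
  unfold SingularData.unLen
  split_ifs <;> omega

lemma thetaUn_lead_ne (hi : S.kind i ≠ Kind.ra) {m : S.Total} (hm : m ∈ phaseSpace S) :
    thetaUn m.2 i 0 0 ≠ thetaUn m.2 i 0 1 := by
  cases hk : S.kind i with
  | un => exact hm.2.2.2.1 i hk
  | ra => exact absurd hk hi
  | reg =>
    have h1 := S.ord_reg i hk
    have h2 := fun s => thetaUn_last m.2 i s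
    rw [h1] at h2
    rw [h2, h2]
    intro h
    exact S.nonres i hk 0 (by simp [h])

lemma holFam_omDiag (hF : F.IsCompatible) (hA : HolFamMat (phaseSpace S) (omPole i)) :
    HolFamMat (phaseSpace S) (omDiag F i) :=
  (holFam_frameZ hF i).gauge isOpen_phaseSpace (frameZ_det_unit hF i) hA

lemma omDiag_ge (hF : F.IsCompatible) (hi : S.kind i ≠ Kind.ra) {m : S.Total}
    (hm : m ∈ phaseSpace S) : MatGE (-(S.ord i : ℤ)) (omDiag F i m) := fun a b k hk => by
  by_cases hab : a = b
  · subst hab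
    exact (hF.un i hi m hm).below k hk a
  · rw [(hF.un i hi m hm).isDiag hab]
    rfl

lemma analytic_thetaHat (hF : F.IsCompatible) (hA : HolFamMat (phaseSpace S) (omPole i)) (l : ℕ)
    (s : Fin 2) : AnalyticOnNhd ℂ (thetaHat F i l s) (phaseSpace S) :=
  (holFam_omDiag hF hA s s).an _

lemma varL_eq_zero_of_const {U : Set S.Total} (hU : IsOpen U) {a : S.Total → ℂ}
    {f : S.Total → Laur} {c : Laur} {m v : S.Total} (hm : m ∈ U) (hc : dz c = 0)
    (h : ∀ m' ∈ U, f m' = c) : varL a f m v = 0 := by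
  rw [varL_congr hU a hm v h, varL_const, hc, mul_zero, neg_zero]

lemma xi_diag (hF : F.IsCompatible) (hi : S.kind i ≠ Kind.ra) {m : S.Total}
    (hm : m ∈ phaseSpace S) (s : Fin 2) : seriesMat (fun k => F.Xi i k m) s s = 1 := by
  refine ext_nat (ser_ordGE _) ordGE_one fun k => ?_
  rw [seriesMat_apply, ser_coeff, HahnSeries.coeff_one]
  rcases Nat.eq_zero_or_pos k with rfl | hk
  · rw [hF.xi_zero i m hm]
    simp
  · rw [(hF.un i hi m hm).diag_zero k hk s, if_neg (by omega)]

lemma xi_off (hF : F.IsCompatible) {m : S.Total}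
    (hm : m ∈ phaseSpace S) {a b : Fin 2} (hab : a ≠ b) :
    OrdGE 1 (seriesMat (fun k => F.Xi i k m) a b) := by
  refine Val.ordGE_one ⟨ser_ordGE _, ?_⟩
  rw [seriesMat_apply, ser_coeff_zero, hF.xi_zero i m hm, Matrix.one_apply_ne hab]

/-- The diagonal of `g⁻¹ δg` along the fibre is constant to sufficiently high order. -/
lemma unram_logVar_diag (hF : F.IsCompatible) (hi : S.kind i ≠ Kind.ra)
    (hA : HolFamMat (phaseSpace S) (omPole i))
    (hb : ∀ m ∈ phaseSpace S, ∀ m' ∈ phaseSpace S, m.2 = m'.2 →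
      MatGE 0 (omPole i m - omPole i m'))
    {m v : S.Total} (hm : m ∈ phaseSpace S) (hv : v.2 = 0) (s : Fin 2) :
    OrdGE (S.ord i) (dz (((frameZ F i m)⁻¹ * varMat (center i) (frameZ F i) m v) s s)) := by
  have hU := isOpen_phaseSpace (S := S)
  have hg := holFam_frameZ hF i
  have hB := holFam_omDiag hF hA
  have hdet : ∀ m ∈ phaseSpace S, (frameZ F i m).det ≠ 0 := fun m hm =>
    (frameZ_det_unit hF i).ne_zero hm
  have ha := fderiv_center_vertical i (m := m) hv
  have h0 : ∀ m ∈ phaseSpace S,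
      frameZ F i m * omDiag F i m = ddz (frameZ F i m) + omPole i m * frameZ F i m :=
    fun m hm => (gaugeTransform_eq_iff (hdet m hm)).mp rfl
  have h1 := variation_gauge hU (center i) hg hA hB h0 hm v
  have hΦ := holFamMat_cstMat (hF.hol_Phi i)
  have hΞ := holFamMat_seriesMat (X := fun s m => F.Xi i s m) (hF.hol_Xi i)
  have hge : ∀ m ∈ phaseSpace S, MatGE 0 (varMat (center i) (frameZ F i) m v) := fun m hm a b =>
    varL_ordGE_zero hU _ (hg a b) hm v fun m' _ => frameZ_ge F i m' a b
  have hPdet : (cstMat (F.Phi i m)).det ≠ 0 := by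
    rw [cstMat_det]
    exact cst_ne_zero (hF.det_ne i m hm)
  have hPu : IsUnit (cstMat (F.Phi i m)).det := isUnit_iff_ne_zero.mpr hPdet
  have hdP : varMat (center i) (fun m' => cstMat (F.Phi i m')) m v
      = cstMat (Matrix.of fun a b => fderiv ℂ (fun m' => F.Phi i m' a b) m v) := by
    ext a b : 1
    exact varL_cst hU (center i) (hF.hol_Phi i a b) hm v
  refine diag_logVar_ordGE (S.one_le_ord i) (hF.un i hi m hm).isDiag (omDiag_ge hF hi hm)
    (dB := varMat (center i) (omDiag F i) m v)
    (C := (frameZ F i m)⁻¹ * varMat (center i) (omPole i) m v * frameZ F i m)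
    (Ξ := seriesMat fun s => F.Xi i s m)
    (dΞ := varMat (center i) (fun m' => seriesMat fun s => F.Xi i s m') m v)
    (D := (cstMat (F.Phi i m))⁻¹ * varMat (center i) (fun m' => cstMat (F.Phi i m')) m v)
    ?_ ?_ ?_ (conj_variation (hdet m hm) (h0 m hm) h1) ?_ (xi_diag hF hi hm)
    (fun a b hab => xi_off hF hm hab) ?_ ?_ ?_ ?_ s
  · have e0 := (hF.un i hi m hm).theta 0 (S.one_le_ord i) 0
    have e1 := (hF.un i hi m hm).theta 0 (S.one_le_ord i) 1
    simp only [thetaHat, Nat.cast_zero, zero_sub] at e0 e1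
    rw [e0, e1]
    exact thetaUn_lead_ne hi hm
  · intro a b hab
    exact varL_eq_zero_of_const hU hm dz_zero fun m' hm' => (hF.un i hi m' hm').isDiag hab
  · exact ((frameZ_inv_ge hF i hm).mul (varMat_vertical_ge hU _ hA hb hm hv ha) (K := 0)
      (by omega)).mul (frameZ_ge F i m) (by omega)
  · exact (frameZ_inv_ge hF i hm).mul (hge m hm) (by omega)
  · intro s
    exact varL_eq_zero_of_const hU hm dz_one fun m' hm' => xi_diag hF hi hm' s
  · intro a b
    by_cases hab : a = b
    · subst hab
      rw [varMat, varL_eq_zero_of_const hU hm dz_one fun m' hm' => xi_diag hF hi hm' a]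
      exact ordGE_zero 1
    · rw [varMat, varL_eq, ha, cst_zero, zero_mul, sub_zero]
      exact varCoeff_ordGE hU (hΞ a b) hm v fun m' hm' => xi_off hF hm' hab
  · intro a b
    rw [hdP, cstMat_inv (hF.det_ne i m hm), ← cstMat_mul, cstMat_apply, cst_coeff_zero]
  · apply mul_left_cancel_of_det hPdet
    have e1 : cstMat (F.Phi i m) * (seriesMat (fun s => F.Xi i s m) *
        ((frameZ F i m)⁻¹ * varMat (center i) (frameZ F i) m v))
        = varMat (center i) (frameZ F i) m v := by
      rw [← mul_assoc, ← mul_assoc]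
      change frameZ F i m * (frameZ F i m)⁻¹ * _ = _
      rw [Matrix.mul_nonsing_inv _ (isUnit_iff_ne_zero.mpr (hdet m hm)), one_mul]
    rw [e1, mul_add, ← mul_assoc, ← mul_assoc, Matrix.mul_nonsing_inv _ hPu, one_mul]
    exact varMat_mul hU (center i) hΦ hΞ hm v

lemma thetaHat_eventuallyEq (hF : F.IsCompatible) (hi : S.kind i ≠ Kind.ra) {l : ℕ}
    (hl : l < S.ord i) (s : Fin 2) {m : S.Total} (hm : m ∈ phaseSpace S) :
    fderiv ℂ (thetaHat F i l s) m = fderiv ℂ (fun m : S.Total => thetaUn m.2 i l s) m :=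
  Filter.EventuallyEq.fderiv_eq (Filter.eventuallyEq_of_mem (isOpen_phaseSpace.mem_nhds hm)
    fun m' hm' => (hF.un i hi m' hm').theta l hl s)

/-- The local contribution of a regular or unramified pole to the isomonodromy form, for a first
argument along the fibre. -/
lemma unram_contribution (hF : F.IsCompatible) (hi : S.kind i ≠ Kind.ra)
    (hA : HolFamMat (phaseSpace S) (omPole i))
    (hb : ∀ m ∈ phaseSpace S, ∀ m' ∈ phaseSpace S, m.2 = m'.2 →
      MatGE 0 (omPole i m - omPole i m'))
    {m v₁ : S.Total} (hm : m ∈ phaseSpace S) (hv : v₁.2 = 0) (v₂ : S.Total) :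
    resWedge (varMat (center i) (omPole i) m)
        (logVar (center i) (frameZ F i) (omDiag F i) m) v₁ v₂
      = 2 * (∑ l ∈ Finset.range (S.ord i - 1), ∑ s : Fin 2,
            fderiv ℂ (thetaHat F i (2 * S.ord i - l - 2) s) m v₁ / ((S.ord i : ℂ) - l - 1)
              * fderiv ℂ (fun m : S.Total => thetaUn m.2 i l s) m v₂
          + fderiv ℂ (center i) m v₂ * ∑ l ∈ Finset.range (S.ord i), ∑ s : Fin 2,
            thetaHat F i l s m * fderiv ℂ (thetaHat F i (2 * S.ord i - l - 1) s) m v₁) := by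
  have hU := isOpen_phaseSpace (S := S)
  have hg := holFam_frameZ hF i
  have hB := holFam_omDiag hF hA
  have hdet : ∀ m ∈ phaseSpace S, (frameZ F i m).det ≠ 0 := fun m hm =>
    (frameZ_det_unit hF i).ne_zero hm
  have ha := fderiv_center_vertical i (m := m) hv
  have h0 : ∀ m ∈ phaseSpace S,
      frameZ F i m * omDiag F i m = ddz (frameZ F i m) + omPole i m * frameZ F i m :=
    fun m hm => (gaugeTransform_eq_iff (hdet m hm)).mp rfl
  have hn := S.one_le_ord i
  obtain ⟨n, hn'⟩ : ∃ n, S.ord i = n + 1 := ⟨S.ord i - 1, by omega⟩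
  have hL : ∀ v, ddz (Matrix.diagonal fun s =>
      varPrim (center i) (fun m' => omDiag F i m' s s) m v)
      = varMat (center i) (omDiag F i) m v := by
    intro v
    ext a b : 1
    rw [ddz_apply]
    by_cases hab : a = b
    · subst hab
      rw [Matrix.diagonal_apply_eq]
      refine dz_varPrim hU (center i) (hB a a) hm v ?_
      rw [fderiv_eq_zero_of_eqOn hU hm (c := S.res i a)]
      · rfl
      · intro m' hm'
        have h2 := (hF.un i hi m' hm').theta (S.ord i - 1) (by omega) a
        rw [thetaUn_last, thetaHat] at h2
        rw [← h2]
        congr 1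
        omega
    · rw [Matrix.diagonal_apply_ne _ hab, dz_zero]
      exact (varL_eq_zero_of_const hU hm dz_zero
        fun m' hm' => (hF.un i hi m' hm').isDiag hab).symm
  have hge2 : MatGE 0 (varMat (center i) (frameZ F i) m v₂) := fun a b =>
    varL_ordGE_zero hU _ (hg a b) hm v₂ fun m' _ => frameZ_ge F i m' a b
  have hdA := varMat_vertical_ge hU (center i) hA hb hm hv ha
  have hres : (Matrix.trace (varMat (center i) (omPole i) m v₁ *
      (varMat (center i) (frameZ F i) m v₂ * (frameZ F i m)⁻¹))).coeff (-1) = 0 :=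
    (hdA.mul (hge2.mul (frameZ_inv_ge hF i hm) (K := 0) (by omega)) (K := 0)
      (by omega)).trace (-1) (by omega)
  rw [resWedge, logVar, logVar, residue_wedge_of_diagonal (hdet m hm) (h0 m hm)
    (variation_gauge hU (center i) hg hA hB h0 hm v₁)
    (variation_gauge hU (center i) hg hA hB h0 hm v₂) (hF.un i hi m hm).isDiag (hL v₁) (hL v₂)
    hres]
  have key : ∀ s : Fin 2, ((varMat (center i) (omDiag F i) m v₁ s s
      - dz (((frameZ F i m)⁻¹ * varMat (center i) (frameZ F i) m v₁) s s)) *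
        varPrim (center i) (fun m' => omDiag F i m' s s) m v₂).coeff (-1)
      = -(∑ l ∈ Finset.range (S.ord i - 1),
            fderiv ℂ (thetaHat F i (2 * S.ord i - l - 2) s) m v₁ / ((S.ord i : ℂ) - l - 1)
              * fderiv ℂ (fun m : S.Total => thetaUn m.2 i l s) m v₂)
          - fderiv ℂ (center i) m v₂ * ∑ l ∈ Finset.range (S.ord i),
            thetaHat F i l s m * fderiv ℂ (thetaHat F i (2 * S.ord i - l - 1) s) m v₁ := by
    intro s
    have hlo : ∀ m' ∈ phaseSpace S, ∀ k : ℤ, k < -(S.ord i : ℤ) →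
        (omDiag F i m' s s).coeff k = 0 := fun m' hm' k hk => omDiag_ge hF hi hm' s s k hk
    have hℓ : OrdGE (-(S.ord i : ℤ))
        (varPrim (center i) (fun m' => omDiag F i m' s s) m v₂) := by
      intro k hk
      rw [varPrim_coeff hU (center i) (hB s s) hm, if_neg (by omega), hlo m hm k hk,
        fderiv_eq_zero_of_eqOn hU hm (c := 0) fun m' hm' => hlo m' hm' (k - 1) (by omega)]
      simp
    have hdB : OrdGE 0 (varMat (center i) (omDiag F i) m v₁ s s) := by
      intro k hk
      rw [varMat, varL_coeff hU (center i) (hB s s) hm, ha, zero_mul, sub_zero]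
      rcases lt_or_ge k (-(S.ord i : ℤ)) with hk' | hk'
      · rw [fderiv_eq_zero_of_eqOn hU hm (c := 0) fun m' hm' => hlo m' hm' k hk']
        rfl
      · obtain ⟨l, hl⟩ : ∃ l : ℕ, k = (l : ℤ) - S.ord i := ⟨(k + S.ord i).toNat, by omega⟩
        subst hl
        have := thetaHat_eventuallyEq hF hi (l := l) (by omega) s hm
        unfold thetaHat at this
        rw [this]
        exact fderiv_thetaUn_vertical i l s hv
    have hX := (unram_logVar_diag hF hi hA hb hm hv s).mul hℓ (K := 0) (by omega)
    have e := coeff_mul_nat hdB hℓ n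
    rw [show (0 : ℤ) + -(S.ord i : ℤ) + n = -1 by omega] at e
    rw [sub_mul, HahnSeries.coeff_sub, hX (-1) (by omega), sub_zero, e]
    have e1 : ∀ j : ℕ, (varMat (center i) (omDiag F i) m v₁ s s).coeff (0 + j)
        = fderiv ℂ (thetaHat F i (S.ord i + j) s) m v₁ := by
      intro j
      rw [varMat, varL_coeff hU (center i) (hB s s) hm, ha, zero_mul, sub_zero]
      unfold thetaHat
      rw [show (0 : ℤ) + j = ((S.ord i + j : ℕ) : ℤ) - S.ord i by push_cast; ring]
    have e2 : ∀ j ∈ Finset.range (n + 1),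
        (varPrim (center i) (fun m' => omDiag F i m' s s) m v₂).coeff
          (-(S.ord i : ℤ) + (n - j : ℕ))
        = fderiv ℂ (fun m' => (omDiag F i m' s s).coeff (-2 - j)) m v₂ / (-1 - j)
          - fderiv ℂ (center i) m v₂ * thetaHat F i (n - j) s m := by
      intro j hj
      have hj' := Finset.mem_range.mp hj
      rw [varPrim_coeff hU (center i) (hB s s) hm, if_neg (by omega)]
      unfold thetaHat
      have c1 : -(S.ord i : ℤ) + (n - j : ℕ) = -1 - j := by omega
      have c2 : ((n - j : ℕ) : ℤ) - S.ord i = -1 - j := by omega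
      rw [c1, c2, show (-1 - (j : ℤ) - 1) = -2 - j by ring]
      push_cast
      rfl
    rw [Finset.sum_congr rfl fun j hj => by rw [e1 j, e2 j hj]]
    simp only [mul_sub, Finset.sum_sub_distrib]
    congr 1
    · rw [Finset.sum_range_succ, fderiv_eq_zero_of_eqOn hU hm (c := 0)
        fun m' hm' => hlo m' hm' (-2 - n) (by omega), show S.ord i - 1 = n by omega,
        ← Finset.sum_range_reflect (fun l => fderiv ℂ (thetaHat F i (2 * S.ord i - l - 2) s) m v₁
          / ((S.ord i : ℂ) - l - 1) * fderiv ℂ (fun m : S.Total => thetaUn m.2 i l s) m v₂),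
        ← Finset.sum_neg_distrib]
      simp only [zero_apply, zero_div, mul_zero, add_zero]
      refine Finset.sum_congr rfl fun j hj => ?_
      have hj' := Finset.mem_range.mp hj
      rw [← thetaHat_eventuallyEq hF hi (l := n - 1 - j) (by omega) s hm]
      unfold thetaHat
      have c1 : ((n - 1 - j : ℕ) : ℤ) - S.ord i = -2 - j := by omega
      have c2 : 2 * S.ord i - (n - 1 - j) - 2 = S.ord i + j := by omega
      have c3 : ((S.ord i : ℂ) - (n - 1 - j : ℕ) - 1) = 1 + j := by
        have : (S.ord i : ℂ) = ((n - 1 - j : ℕ) : ℂ) + j + 2 := by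
          rw [hn']
          exact_mod_cast (by omega : n + 1 = (n - 1 - j) + j + 2)
        rw [this]; ring
      rw [c1, c2, c3]
      have c4 : (1 + j : ℂ) ≠ 0 := by exact_mod_cast (by omega : 1 + j ≠ 0)
      have c5 : (-1 - j : ℂ) ≠ 0 := by
        rw [show (-1 - j : ℂ) = -(1 + j) by ring]
        exact neg_ne_zero.mpr c4
      rw [show (-1 - j : ℂ) = -(1 + j) by ring, div_neg]
      ring
    · rw [hn', ← Finset.sum_range_reflect, Finset.mul_sum]
      refine Finset.sum_congr rfl fun j hj => ?_
      have hj' := Finset.mem_range.mp hj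
      have c1 : n + 1 - 1 - j = n - j := by omega
      have c2 : n - (n - j) = j := by omega
      have c3 : n + 1 + (n - j) = 2 * (n + 1) - j - 1 := by omega
      rw [c1, c2, c3]
      ring
  rw [Finset.sum_congr rfl fun s _ => key s, Finset.sum_sub_distrib, Finset.sum_neg_distrib,
    ← Finset.mul_sum, Finset.sum_comm (t := Finset.range (S.ord i - 1)),
    Finset.sum_comm (t := Finset.range (S.ord i))]
  ring

end Unramified

/-! ### The contribution of an apparent singularity -/

/-- The residue at an apparent singularity after the elementary transform; here
`z⁻¹ [[0, 0], [δp, -δq]]` is the logarithmic variation of the elementary transform. -/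
lemma residue_elementary {B dB V : LMat} {P₁ Q₁ P₂ Q₂ : ℂ} (hB : MatGE 0 B) (hdB : MatGE 0 dB)
    (hV : MatGE 0 V) (hB01 : (B 0 1).coeff 0 = 0)
    (hV0 : ∀ a b, (V a b).coeff 0 = Q₂ * (B a b).coeff 0) :
    (Matrix.trace ((dB - ddz !![0, 0; zvar⁻¹ * cst P₁, -(zvar⁻¹ * cst Q₁)]
        - (B * !![0, 0; zvar⁻¹ * cst P₁, -(zvar⁻¹ * cst Q₁)]
          - !![0, 0; zvar⁻¹ * cst P₁, -(zvar⁻¹ * cst Q₁)] * B))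
      * (!![0, 0; zvar⁻¹ * cst P₂, -(zvar⁻¹ * cst Q₂)] + V))).coeff (-1)
    = P₂ * (dB 0 1).coeff 0 - Q₂ * (dB 1 1).coeff 0 + P₁ * (V 0 1).coeff 1 - Q₁ * (V 1 1).coeff 1
      - (P₁ * Q₂ - Q₁ * P₂) * (B 0 1).coeff 1 := by
  have hz : dz zvar⁻¹ = -zvar⁻¹ ^ 2 := by
    rw [dz_inv zvar_ne_zero, dz_zvar]; ring
  have e : Matrix.trace ((dB - ddz !![0, 0; zvar⁻¹ * cst P₁, -(zvar⁻¹ * cst Q₁)]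
        - (B * !![0, 0; zvar⁻¹ * cst P₁, -(zvar⁻¹ * cst Q₁)]
          - !![0, 0; zvar⁻¹ * cst P₁, -(zvar⁻¹ * cst Q₁)] * B))
      * (!![0, 0; zvar⁻¹ * cst P₂, -(zvar⁻¹ * cst Q₂)] + V))
      = Matrix.trace (dB * V) + zvar ^ (-1 : ℤ) * ((cst P₂ * dB 0 1 - cst Q₂ * dB 1 1)
          - (cst P₁ * (V 0 0 * B 0 1 + V 0 1 * B 1 1 - B 0 0 * V 0 1 - B 0 1 * V 1 1)
            - cst Q₁ * (V 1 0 * B 0 1 - B 1 0 * V 0 1)))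
        + zvar ^ (-2 : ℤ) * ((cst P₁ * V 0 1 - cst Q₁ * V 1 1)
          - (cst P₁ * cst Q₂ - cst Q₁ * cst P₂) * B 0 1)
        + zvar ^ (-3 : ℤ) * (cst Q₁ * cst Q₂) := by
    rw [show zvar ^ (-1 : ℤ) = zvar⁻¹ by simp, show zvar ^ (-2 : ℤ) = zvar⁻¹ ^ 2 by
      rw [zpow_neg, inv_pow]; rfl, show zvar ^ (-3 : ℤ) = zvar⁻¹ ^ 3 by
      rw [zpow_neg, inv_pow]; rfl]
    simp only [Matrix.trace_fin_two, Matrix.mul_apply, Matrix.sub_apply, Matrix.add_apply,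
      Fin.sum_univ_two, ddz_apply, Matrix.of_apply, Matrix.cons_val_zero, Matrix.cons_val_one,
      Matrix.cons_val', Matrix.cons_val_fin_one, dz_zero, dz_neg, dz_mul, dz_cst, hz]
    ring
  have h1 : ∀ x y : Laur, OrdGE 0 x → OrdGE 0 y → (x * y).coeff 0 = x.coeff 0 * y.coeff 0 :=
    fun x y hx hy => coeff_mul_lead hx hy (by ring)
  rw [e, HahnSeries.coeff_add, HahnSeries.coeff_add, HahnSeries.coeff_add,
    (hdB.mul hV (K := 0) (by omega)).trace (-1) (by omega), zpow_mul_coeff, zpow_mul_coeff,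
    zpow_mul_coeff]
  simp only [← cst_mul, ← cst_sub]
  norm_num only
  simp only [HahnSeries.coeff_add, HahnSeries.coeff_sub, cst_mul_coeff,
    h1 _ _ (hV _ _) (hB _ _), h1 _ _ (hB _ _) (hV _ _), hV0, hB01]
  have h2 : (cst (Q₁ * Q₂)).coeff 2 = 0 := by simp [cst]
  rw [h2]
  ring

/-- The elementary transform at `q_j`. -/
def elemQ (j : Fin S.numApp) (m : S.Total) : LMat := !![1, 0; cst (pc m j), zvar]

/-- The regular connection after the elementary transform at `q_j`. -/
def omElem (j : Fin S.numApp) (m : S.Total) : LMat := gaugeTransform (elemQ j m) (omApp j m)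

/-- The solution of the connection after the elementary transform. -/
def solElem (F : Frames S) (j : Fin S.numApp) (m : S.Total) : LMat :=
  (elemQ j m)⁻¹ * psiQ F j m

section Apparent

variable {F : Frames S} {j : Fin S.numApp}

lemma elemQ_det (j : Fin S.numApp) (m : S.Total) : (elemQ j m).det = zvar := by
  simp [elemQ, Matrix.det_fin_two]

lemma elemQ_det_ne (j : Fin S.numApp) (m : S.Total) : (elemQ j m).det ≠ 0 := by
  rw [elemQ_det]; exact zvar_ne_zero

lemma elemQ_inv (j : Fin S.numApp) (m : S.Total) :
    (elemQ j m)⁻¹ = !![1, 0; -(cst (pc m j) * zvar⁻¹), zvar⁻¹] := by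
  refine Matrix.inv_eq_left_inv ?_
  have := zvar_ne_zero
  ext a b : 1
  fin_cases a <;> fin_cases b <;> simp [elemQ, Matrix.mul_apply, this, mul_comm]

lemma holFam_elemQ (U : Set S.Total) : HolFamMat U (elemQ j) := by
  intro a b
  fin_cases a <;> fin_cases b
  · exact holFam_const 1
  · exact holFam_const 0
  · exact holFam_cst (analytic_pc j U)
  · exact holFam_const zvar

lemma varMat_elemQ (m v : S.Total) : varMat (fun m' => qc m' j) (elemQ j) m v
    = !![0, 0; cst (fderiv ℂ (fun m' => pc m' j) m v),
        -cst (fderiv ℂ (fun m' => qc m' j) m v)] := by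
  ext a b : 1
  fin_cases a <;> fin_cases b
  · exact varL_eq_zero_of_const isOpen_univ (Set.mem_univ m) dz_one fun _ _ => rfl
  · exact varL_eq_zero_of_const isOpen_univ (Set.mem_univ m) dz_zero fun _ _ => rfl
  · exact varL_cst isOpen_univ _ (analytic_pc j _) (Set.mem_univ m) v
  · refine (varL_const (fun m' => qc m' j) zvar m v).trans ?_
    rw [dz_zvar, mul_one]
    rfl

lemma elemQ_logVar (m v : S.Total) :
    (elemQ j m)⁻¹ * varMat (fun m' => qc m' j) (elemQ j) m v
    = !![0, 0; zvar⁻¹ * cst (fderiv ℂ (fun m' => pc m' j) m v),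
        -(zvar⁻¹ * cst (fderiv ℂ (fun m' => qc m' j) m v))] := by
  rw [elemQ_inv, varMat_elemQ]
  ext a b : 1
  fin_cases a <;> fin_cases b <;> simp [Matrix.mul_apply, -mul_neg, mul_neg (zvar⁻¹ : Laur)]

lemma solElem_eq (F : Frames S) (j : Fin S.numApp) (m : S.Total) :
    solElem F j m = !![ser fun s => F.XiQ j s m 0 0, zvar * ser fun s => F.XiQ j s m 0 1;
      zvar⁻¹ * ser fun s => F.XiQ j s m 1 0, ser fun s => F.XiQ j s m 1 1] := by
  have := zvar_ne_zero
  rw [solElem, elemQ_inv, psiQ]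
  ext a b : 1
  fin_cases a <;> fin_cases b <;>
    simp [Matrix.mul_apply, cstMat_apply, seriesMat_apply] <;> field_simp <;> ring

lemma holFam_solElem (hF : F.IsCompatible) : HolFamMat (phaseSpace S) (solElem F j) := by
  have hU := isOpen_phaseSpace (S := S)
  have h : ∀ a b, HolFam (phaseSpace S) (fun m => ser fun s => F.XiQ j s m a b) := fun a b =>
    holFam_ser (β := fun s m => F.XiQ j s m a b) fun s => hF.hol_XiQ j s a b
  intro a b
  simp only [solElem_eq]
  fin_cases a <;> fin_cases b
  · exact h 0 0
  · exact (holFam_const zvar).mul hU (h 0 1)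
  · exact (holFam_const zvar⁻¹).mul hU (h 1 0)
  · exact h 1 1

lemma solElem_val (hF : F.IsCompatible) {m : S.Total} (hm : m ∈ phaseSpace S) (a b : Fin 2) :
    Val (solElem F j m a b) ((1 : CMat) a b) := by
  have h0 := (hF.app j m hm).zero
  have h1 := (hF.app j m hm).one
  rw [solElem_eq]
  fin_cases a <;> fin_cases b
  · exact ⟨ser_ordGE _, by simp [ser_coeff_zero, h0]⟩
  · have := val_zvar.mul (ser_ordGE fun s => F.XiQ j s m 0 1).val
    simpa using this
  · have h2 : (zvar⁻¹ * ser fun s => F.XiQ j s m 1 0)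
        = zvar ^ (-1 : ℤ) * ser fun s => F.XiQ j s m 1 0 := by simp
    have h3 := ser_coeff (fun s => F.XiQ j s m 1 0) 1
    refine ⟨?_, ?_⟩
    · change OrdGE 0 (zvar⁻¹ * ser fun s => F.XiQ j s m 1 0)
      rw [h2, ordGE_zpow_mul]
      exact (Val.ordGE_one ⟨ser_ordGE _, by simp [ser_coeff_zero, h0]⟩).mono (by omega)
    · change (zvar⁻¹ * ser fun s => F.XiQ j s m 1 0).coeff 0 = 0
      rw [h2, zpow_mul_coeff]
      simpa [h1] using h3
  · exact ⟨ser_ordGE _, by simp [ser_coeff_zero, h0]⟩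

lemma psiQ_eq (F : Frames S) (j : Fin S.numApp) (m : S.Total) :
    psiQ F j m = elemQ j m * solElem F j m := by
  rw [solElem, ← mul_assoc,
    Matrix.mul_nonsing_inv _ (isUnit_iff_ne_zero.mpr (elemQ_det_ne j m)), one_mul]

lemma solElem_det (hF : F.IsCompatible) {m : S.Total} (hm : m ∈ phaseSpace S) :
    Val (solElem F j m).det 1 := by
  simpa using det_val (solElem_val hF hm (j := j))

lemma solElem_det_ne (hF : F.IsCompatible) {m : S.Total} (hm : m ∈ phaseSpace S) :
    (solElem F j m).det ≠ 0 :=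
  ne_zero_of_coeff (N := 0) (by rw [(solElem_det hF hm).2]; exact one_ne_zero)

lemma solElem_ode (hF : F.IsCompatible) {m : S.Total} (hm : m ∈ phaseSpace S) :
    ddz (solElem F j m) = -(omElem j m * solElem F j m) := by
  have h0 := (gaugeTransform_eq_iff (elemQ_det_ne j m) (A := omApp j m)
    (B := omElem j m)).mp rfl
  have h1 := (hF.app j m hm).sol
  rw [psiQ_eq, ddz_mul] at h1
  apply mul_left_cancel_of_det (elemQ_det_ne j m)
  rw [Matrix.mul_neg, ← mul_assoc, h0, eq_neg_iff_add_eq_zero, ← h1, add_mul, ← mul_assoc]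
  abel

lemma psiQ_det_ne (hF : F.IsCompatible) {m : S.Total} (hm : m ∈ phaseSpace S) :
    (psiQ F j m).det ≠ 0 := by
  rw [psiQ_eq, Matrix.det_mul]
  exact mul_ne_zero (elemQ_det_ne j m) (solElem_det_ne hF hm)

lemma holFam_psiQ (hF : F.IsCompatible) : HolFamMat (phaseSpace S) (psiQ F j) := by
  have := (holFam_elemQ (j := j) (phaseSpace S)).mul isOpen_phaseSpace (holFam_solElem hF (j := j))
  exact this.congr isOpen_phaseSpace fun m _ => (psiQ_eq F j m).symm

lemma psiQ_det_unit (hF : F.IsCompatible) :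
    UnitFam (phaseSpace S) fun m => (psiQ F j m).det := by
  have h1 : UnitFam (phaseSpace S) fun m => (solElem F j m).det :=
    unitFam_of_val ((holFam_solElem hF).det isOpen_phaseSpace) (r := fun _ => 1)
      fun m hm => ⟨solElem_det hF hm, one_ne_zero⟩
  refine ((unitFam_const zvar_ne_zero).mul isOpen_phaseSpace h1).congr isOpen_phaseSpace
    fun m _ => ?_
  rw [psiQ_eq, Matrix.det_mul, elemQ_det]

lemma holFam_omElem (hA : HolFamMat (phaseSpace S) (omApp j)) :
    HolFamMat (phaseSpace S) (omElem j) := by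
  refine (holFam_elemQ _).gauge isOpen_phaseSpace ?_ hA
  simp only [elemQ_det]
  exact unitFam_const zvar_ne_zero

lemma omElem_apply_zero_one (m : S.Total) : omElem j m 0 1 = omApp j m 0 1 * zvar := by
  have h0 := (gaugeTransform_eq_iff (elemQ_det_ne j m) (A := omApp j m)
    (B := omElem j m)).mp rfl
  have h1 := congrFun (congrFun h0 0) 1
  simpa [elemQ, Matrix.mul_apply, ddz_apply] using h1

/-- The local contribution of the apparent singularity `q_j` to the isomonodromy form. -/
lemma apparent_contribution (hF : F.IsCompatible) (hA : HolFamMat (phaseSpace S) (omApp j))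
    (hreg : ∀ m ∈ phaseSpace S, MatGE 0 (omElem j m))
    (hf : ∀ m ∈ phaseSpace S, OrdGE 0 (omApp j m 0 1))
    {m : S.Total} (hm : m ∈ phaseSpace S) (v₁ v₂ : S.Total) :
    resWedge (varMat (fun m' => qc m' j) (omApp j) m)
        (fun v => varMat (fun m' => qc m' j) (psiQ F j) m v * (psiQ F j m)⁻¹) v₁ v₂
      = 2 * (fderiv ℂ (fun m' => qc m' j) m v₁
              * fderiv ℂ (fun m' => (omElem j m' 1 1).coeff 0) m v₂
            - fderiv ℂ (fun m' => qc m' j) m v₂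
              * fderiv ℂ (fun m' => (omElem j m' 1 1).coeff 0) m v₁) := by
  have hU := isOpen_phaseSpace (S := S)
  set a : S.Total → ℂ := fun m' => qc m' j with ha
  have hg := holFam_elemQ (j := j) (phaseSpace S)
  have hB := holFam_omElem hA
  have hψ := holFam_psiQ hF (j := j)
  have hs := holFam_solElem hF (j := j)
  have hgd := elemQ_det_ne j m
  have h0 : ∀ m ∈ phaseSpace S,
      elemQ j m * omElem j m = ddz (elemQ j m) + omApp j m * elemQ j m :=
    fun m _ => (gaugeTransform_eq_iff (elemQ_det_ne j m)).mp rfl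
  -- the variation of the connection matrix through that of the solution
  have hvar : ∀ v, varMat a (omApp j) m v
      = -ddz (varMat a (psiQ F j) m v * (psiQ F j m)⁻¹)
        - (omApp j m * (varMat a (psiQ F j) m v * (psiQ F j m)⁻¹)
          - varMat a (psiQ F j) m v * (psiQ F j m)⁻¹ * omApp j m) := by
    intro v
    have h1 := variation_gauge hU a hψ hA (holFamMat_const 0) (fun m' hm' => by
      rw [mul_zero, (hF.app j m' hm').sol]) hm v
    have h2 : varMat a (fun _ => (0 : LMat)) m v = 0 := by
      ext r s : 1
      exact varL_eq_zero_of_const hU hm dz_zero fun _ _ => rfl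
    have h3 := variation_eq_of_formal_solution (g := psiQ F j m) (A := omApp j m) (B := 0)
      (L := 0) (psiQ_det_ne hF hm) (by rw [mul_zero, (hF.app j m hm).sol]) h1 (by simp)
      (by rw [h2]; ext r s : 1; exact dz_zero)
    simpa using h3
  rw [resWedge, residue_wedge (hvar v₁) (hvar v₂)]
  congr 1
  set V := varMat a (solElem F j) m v₂ * (solElem F j m)⁻¹ with hV
  have hY : varMat a (psiQ F j) m v₂ * (psiQ F j m)⁻¹
      = elemQ j m * ((elemQ j m)⁻¹ * varMat a (elemQ j) m v₂ + V) * (elemQ j m)⁻¹ := by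
    have hsu := isUnit_iff_ne_zero.mpr (solElem_det_ne hF hm (j := j))
    rw [varMat_congr hU a hm v₂ (fun m' _ => psiQ_eq F j m'), varMat_mul hU a hg hs hm, psiQ_eq,
      Matrix.mul_inv_rev, mul_add, ← mul_assoc (elemQ j m),
      Matrix.mul_nonsing_inv _ (isUnit_iff_ne_zero.mpr hgd), one_mul, ← mul_assoc, add_mul,
      mul_assoc (varMat a (elemQ j) m v₂), Matrix.mul_nonsing_inv _ hsu, mul_one, hV, mul_assoc]
  have htr : Matrix.trace (varMat a (omApp j) m v₁ * (varMat a (psiQ F j) m v₂ * (psiQ F j m)⁻¹))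
      = Matrix.trace ((elemQ j m)⁻¹ * varMat a (omApp j) m v₁ * elemQ j m
          * ((elemQ j m)⁻¹ * varMat a (elemQ j) m v₂ + V)) := by
    rw [hY, ← mul_assoc, Matrix.trace_mul_comm, ← mul_assoc, ← mul_assoc]
  rw [htr, conj_variation hgd (h0 m hm) (variation_gauge hU a hg hA hB h0 hm v₁), elemQ_logVar,
    elemQ_logVar]
  -- expansions of the regular matrices
  have hsinv : ∀ r s, Val ((solElem F j m)⁻¹ r s) ((1 : CMat) r s) := by
    intro r s
    have hd := (solElem_det hF hm (j := j)).inv one_ne_zero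
    rw [inv_fin_two, Matrix.smul_apply, smul_eq_mul]
    have hv := solElem_val hF hm (j := j)
    fin_cases r <;> fin_cases s
    · simpa using hd.mul (hv 1 1)
    · simpa using hd.mul (hv 0 1).neg
    · simpa using hd.mul (hv 1 0).neg
    · simpa using hd.mul (hv 0 0)
  let D : LMat := fun r s => varCoeff (fun m' => solElem F j m' r s) m v₂
  have hVD : V = D * (solElem F j m)⁻¹ + cst (fderiv ℂ a m v₂) • omElem j m := by
    have h1 : varMat a (solElem F j) m v₂
        = D + cst (fderiv ℂ a m v₂) • (omElem j m * solElem F j m) := by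
      ext r s : 1
      have h2 := congrFun (congrFun (solElem_ode hF hm (j := j)) r) s
      rw [ddz_apply, Matrix.neg_apply] at h2
      rw [varMat, varL_eq, h2, Matrix.add_apply, Matrix.smul_apply, smul_eq_mul]
      ring
    have hsm : ∀ (c : Laur) (X Y : LMat), (c • X) * Y = c • (X * Y) := fun c X Y => by
      ext r s : 1
      simp only [Matrix.mul_apply, Matrix.smul_apply, smul_eq_mul, Fin.sum_univ_two]
      ring
    rw [hV, h1, add_mul, hsm, mul_assoc,
      Matrix.mul_nonsing_inv _ (isUnit_iff_ne_zero.mpr (solElem_det_ne hF hm)), mul_one]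
  have hD1 : MatGE 1 D := by
    intro r s k hk
    rw [varCoeff_coeff hU (hs r s) hm]
    rcases eq_or_ne k 0 with rfl | hk0
    · rw [fderiv_eq_zero_of_eqOn hU hm fun m' hm' => (solElem_val hF hm' r s).2]
      rfl
    · rw [fderiv_eq_zero_of_eqOn hU hm fun m' hm' => (solElem_val hF hm' r s).1 k (by omega)]
      rfl
  have hS1 : ∀ m' ∈ phaseSpace S, ∀ r s, (solElem F j m' r s).coeff 1
      = -(omElem j m' r s).coeff 0 := by
    intro m' hm' r s
    have h1 := congrArg (fun f : Laur => f.coeff 0)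
      (congrFun (congrFun (solElem_ode hF hm' (j := j)) r) s)
    have h2 : ∀ r s t, (omElem j m' r s * solElem F j m' s t).coeff 0
        = (omElem j m' r s).coeff 0 * (1 : CMat) s t := fun r s t => by
      rw [coeff_mul_lead (hreg m' hm' r s) (solElem_val hF hm' s t).1 (by ring),
        (solElem_val hF hm' s t).2]
    rw [Matrix.neg_apply, Matrix.mul_apply, ddz_apply] at h1
    simp only [dz_coeff, HahnSeries.coeff_neg, coeff_finsetSum, h2] at h1
    simpa [Matrix.one_apply] using h1
  have hDS : ∀ r s, OrdGE 1 ((D * (solElem F j m)⁻¹) r s) ∧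
      ((D * (solElem F j m)⁻¹) r s).coeff 1
        = -fderiv ℂ (fun m' => (omElem j m' r s).coeff 0) m v₂ := by
    intro r s
    refine ⟨hD1.mul (M := 0) (fun r s => (hsinv r s).1) (by omega) r s, ?_⟩
    have h2 : ∀ t, (D r t * (solElem F j m)⁻¹ t s).coeff 1
        = (D r t).coeff 1 * (1 : CMat) t s := fun t => by
      rw [coeff_mul_lead (hD1 r t) (hsinv t s).1 (by ring), (hsinv t s).2]
    have h3 : (D r s).coeff 1 = -fderiv ℂ (fun m' => (omElem j m' r s).coeff 0) m v₂ := by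
      have e : (fun m' => (solElem F j m' r s).coeff 1)
          =ᶠ[nhds m] fun m' => -(omElem j m' r s).coeff 0 :=
        Filter.eventuallyEq_of_mem (hU.mem_nhds hm) fun m' hm' => hS1 m' hm' r s
      rw [varCoeff_coeff hU (hs r s) hm, e.fderiv_eq, fderiv_fun_neg]
      rfl
    rw [← h3, Matrix.mul_apply, coeff_finsetSum, Finset.sum_congr rfl fun t _ => h2 t]
    simp [Matrix.one_apply]
  have hVc : ∀ r s k, (V r s).coeff k = ((D * (solElem F j m)⁻¹) r s).coeff k
      + fderiv ℂ a m v₂ * (omElem j m r s).coeff k := by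
    intro r s k
    rw [hVD, Matrix.add_apply, HahnSeries.coeff_add, Matrix.smul_apply, smul_eq_mul, cst_mul_coeff]
  have hB01 : ∀ m' ∈ phaseSpace S, (omElem j m' 0 1).coeff 0 = 0 := fun m' hm' => by
    rw [omElem_apply_zero_one, mul_comm, zvar_mul_coeff]
    exact hf m' hm' _ (by omega)
  have hdB : ∀ r s, (varMat a (omElem j) m v₁ r s).coeff 0
      = fderiv ℂ (fun m' => (omElem j m' r s).coeff 0) m v₁
        - fderiv ℂ a m v₁ * (omElem j m r s).coeff 1 := fun r s => by
    rw [varMat, varL_coeff hU a (hB r s) hm]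
    simp
  have hdBge : MatGE 0 (varMat a (omElem j) m v₁) := fun r s =>
    varL_ordGE_zero hU a (hB r s) hm v₁ fun m' hm' => hreg m' hm' r s
  rw [residue_elementary (hreg m hm) hdBge ?_ (hB01 m hm) ?_]
  · have h01 : ∀ v, fderiv ℂ (fun m' => (omElem j m' 0 1).coeff 0) m v = 0 := fun v => by
      rw [fderiv_eq_zero_of_eqOn hU hm hB01]
      rfl
    rw [hdB, hdB, hVc, hVc, (hDS 0 1).2, (hDS 1 1).2, h01, h01]
    ring
  · intro r s
    rw [hVD, Matrix.add_apply, Matrix.smul_apply]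
    exact ((hDS r s).1.mono (by omega)).add ((hreg m hm r s).cst_mul _)
  · intro r s
    rw [hVc, (hDS r s).1 0 (by omega), zero_add]

end Apparent

/-! ### The contribution of a ramified pole -/

section Ramified

variable {F : Frames S} {i : Option (Fin ν)}

/-- The connection at a pole in the frame `Φ_i Ξ_i`. -/
def omShape (F : Frames S) (i : Option (Fin ν)) (m : S.Total) : LMat :=
  gaugeTransform (frameZ F i m) (omPole i m)

lemma holFam_omShape (hF : F.IsCompatible) (hA : HolFamMat (phaseSpace S) (omPole i)) :
    HolFamMat (phaseSpace S) (omShape F i) :=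
  (holFam_frameZ hF i).gauge isOpen_phaseSpace (frameZ_det_unit hF i) hA

lemma omShape_eq (hF : F.IsCompatible) (hi : S.kind i = Kind.ra) {m : S.Total}
    (hm : m ∈ phaseSpace S) : omShape F i m = ramShape (omShape F i m 0 0) (omShape F i m 0 1) := by
  obtain ⟨α, β, h, -⟩ := hF.ra i hi m hm
  have h' : omShape F i m = ramShape α β := h
  rw [h']
  rfl

lemma omShape_ge (hF : F.IsCompatible) (hi : S.kind i = Kind.ra) {m : S.Total}
    (hm : m ∈ phaseSpace S) (s : Fin 2) : OrdGE (-(S.ord i : ℤ)) (omShape F i m 0 s) := by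
  obtain ⟨α, β, h, h2, -⟩ := hF.ra i hi m hm
  have h' : omShape F i m = ramShape α β := h
  rw [h']
  fin_cases s
  · exact fun k hk => (h2 k hk).1
  · exact fun k hk => (h2 k hk).2

lemma cst_two : cst 2 = 2 := by rw [cst, map_ofNat]

lemma two_ne_zero_laur : (2 : Laur) ≠ 0 := by
  rw [← cst_two]
  exact cst_ne_zero two_ne_zero

lemma matM_det : matM.det = -2 * zvar := by
  rw [matM, Matrix.det_fin_two_of]; ring

lemma matM_det_ne : matM.det ≠ 0 := by
  rw [matM_det]
  exact mul_ne_zero (neg_ne_zero.mpr two_ne_zero_laur) zvar_ne_zero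

lemma map_sq_mul (A B : LMat) : (A * B).map sqSubst = A.map sqSubst * B.map sqSubst :=
  Matrix.map_mul

lemma map_sq_det (A : LMat) : (A.map sqSubst).det = sqSubst A.det :=
  (RingHom.map_det sqSubst A).symm

lemma map_sq_det_ne {A : LMat} (h : A.det ≠ 0) : (A.map sqSubst).det ≠ 0 := by
  rw [map_sq_det]
  exact (map_ne_zero sqSubst).mpr h

lemma map_sq_inv {A : LMat} (h : A.det ≠ 0) : (A.map sqSubst)⁻¹ = A⁻¹.map sqSubst := by
  refine Matrix.inv_eq_left_inv ?_
  rw [← map_sq_mul, Matrix.nonsing_inv_mul _ (isUnit_iff_ne_zero.mpr h)]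
  exact Matrix.map_one _ (map_zero _) (map_one _)

lemma frameZeta_det_ne (hF : F.IsCompatible) {m : S.Total}
    (hm : m ∈ phaseSpace S) : (frameZeta F i m).det ≠ 0 := by
  rw [frameZeta, Matrix.det_mul]
  exact mul_ne_zero (map_sq_det_ne ((frameZ_det_unit hF i).ne_zero hm)) matM_det_ne

lemma frameZeta_det_unit (hF : F.IsCompatible) (i : Option (Fin ν)) :
    UnitFam (phaseSpace S) fun m => (frameZeta F i m).det := by
  have h1 : UnitFam (phaseSpace S) fun m => sqSubst (frameZ F i m).det :=
    unitFam_of_val ((holFam_frameZ hF i).det isOpen_phaseSpace).sqSubst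
      (r := fun m => (F.Phi i m).det) fun m hm => ⟨⟨by
        simpa using sqSubst_ordGE (frameZ_det hF i hm).1, by
        simpa using (sqSubst_coeff_even (frameZ F i m).det 0).trans (frameZ_det hF i hm).2⟩,
        hF.det_ne i m hm⟩
  refine (h1.mul isOpen_phaseSpace (unitFam_const matM_det_ne)).congr isOpen_phaseSpace
    fun m _ => ?_
  rw [frameZeta, Matrix.det_mul, map_sq_det]

lemma holFam_frameZeta (hF : F.IsCompatible) (i : Option (Fin ν)) :
    HolFamMat (phaseSpace S) (frameZeta F i) :=
  (holFam_frameZ hF i).mapSq.mul isOpen_phaseSpace (holFamMat_const _)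

lemma holFam_omDiagZeta (hF : F.IsCompatible) (hA : HolFamMat (phaseSpace S) (omPole i)) :
    HolFamMat (phaseSpace S) (omDiagZeta F i) :=
  (holFam_frameZeta hF i).gauge isOpen_phaseSpace (frameZeta_det_unit hF i)
    (hA.ramify isOpen_phaseSpace)

lemma analytic_thetaHatRa (hF : F.IsCompatible) (hA : HolFamMat (phaseSpace S) (omPole i))
    (l : ℕ) : AnalyticOnNhd ℂ (thetaHatRa F i l) (phaseSpace S) :=
  (holFam_omDiagZeta hF hA 0 0).an _

/-- On the ramified cover, the matrix `M_ζ` diagonalises the connection. -/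
lemma omDiagZeta_eq (hF : F.IsCompatible) (hi : S.kind i = Kind.ra) {m : S.Total}
    (hm : m ∈ phaseSpace S) : omDiagZeta F i m = Matrix.diagonal
      ![2 * (zvar * sqSubst (omShape F i m 0 0)) + 2 * (zvar ^ 2 * sqSubst (omShape F i m 0 1)),
        2 * (zvar * sqSubst (omShape F i m 0 0)) - 2 * (zvar ^ 2 * sqSubst (omShape F i m 0 1))] := by
  have hz := zvar_ne_zero
  have h0 : frameZ F i m * omShape F i m = ddz (frameZ F i m) + omPole i m * frameZ F i m :=
    (gaugeTransform_eq_iff ((frameZ_det_unit hF i).ne_zero hm)).mp rfl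
  rw [omDiagZeta, gaugeTransform_eq_iff (frameZeta_det_ne hF hm)]
  have h1 : ddz ((frameZ F i m).map sqSubst) + ramify (omPole i m) * (frameZ F i m).map sqSubst
      = (frameZ F i m).map sqSubst * ramify (omShape F i m) := by
    ext a b : 1
    have h2 := congrArg sqSubst (congrFun (congrFun h0 a) b)
    simp only [Matrix.add_apply, Matrix.mul_apply, Fin.sum_univ_two, ddz_apply, map_add,
      map_mul] at h2
    simp only [Matrix.add_apply, Matrix.mul_apply, Fin.sum_univ_two, ddz_apply, Matrix.map_apply,
      dz_sqSubst, ramify]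
    linear_combination -(2 * zvar) * h2
  obtain ⟨a, ha⟩ : ∃ a, a = sqSubst (omShape F i m 0 0) := ⟨_, rfl⟩
  obtain ⟨b, hb⟩ : ∃ b, b = sqSubst (omShape F i m 0 1) := ⟨_, rfl⟩
  have e : (omShape F i m).map sqSubst
      = !![a, b; zvar ^ 2 * b, a - cst (1 / 2) * (zvar ^ 2)⁻¹] := by
    rw [omShape_eq hF hi hm, ha, hb]
    ext r s : 1
    fin_cases r <;> fin_cases s <;> simp [ramShape, sqSubst_zvar, sqSubst_cst]
  have e' : ramify (omShape F i m) = !![a * (2 * zvar), b * (2 * zvar);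
      zvar ^ 2 * b * (2 * zvar), (a - cst (1 / 2) * (zvar ^ 2)⁻¹) * (2 * zvar)] := by
    ext r s : 1
    have := congrFun (congrFun e r) s
    rw [Matrix.map_apply] at this
    rw [ramify, this]
    fin_cases r <;> fin_cases s <;> rfl
  have hc : cst (1 / 2) * 2 = 1 := by rw [← cst_two, ← cst_mul]; norm_num
  have hc' : (a - cst (1 / 2) * (zvar ^ 2)⁻¹) * (2 * zvar) = 2 * a * zvar - zvar⁻¹ := by
    field_simp
    linear_combination -hc
  have hdM : ddz matM = !![0, 0; 1, -1] := by
    ext r s : 1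
    fin_cases r <;> fin_cases s
    · exact dz_one
    · exact dz_one
    · exact dz_zvar
    · exact (dz_neg zvar).trans (by rw [dz_zvar]; rfl)
  have hM : matM * Matrix.diagonal ![2 * (zvar * a) + 2 * (zvar ^ 2 * b),
      2 * (zvar * a) - 2 * (zvar ^ 2 * b)] = ramify (omShape F i m) * matM + ddz matM := by
    rw [e', hc', hdM]
    ext r s : 1
    rw [Matrix.mul_diagonal]
    fin_cases r <;> fin_cases s <;> simp [matM] <;> field_simp <;> ring
  rw [← ha, ← hb, frameZeta, ddz_mul, Matrix.mul_assoc, hM, Matrix.mul_add, ← Matrix.mul_assoc,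
    ← h1, Matrix.add_mul, ← Matrix.mul_assoc]
  abel

lemma thetaHatRa_even (hF : F.IsCompatible) (hi : S.kind i = Kind.ra) {m : S.Total}
    (hm : m ∈ phaseSpace S) (s : Fin 2) (k : ℤ) :
    (omDiagZeta F i m s s).coeff (2 * k + 1) = 2 * (omShape F i m 0 0).coeff k := by
  have h1 : (zvar * sqSubst (omShape F i m 0 0)).coeff (2 * k + 1)
      = (omShape F i m 0 0).coeff k := by
    rw [zvar_mul_coeff, add_sub_cancel_right, sqSubst_coeff_even]
  have h2 : (zvar ^ 2 * sqSubst (omShape F i m 0 1)).coeff (2 * k + 1) = 0 := by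
    rw [show zvar ^ 2 = zvar ^ (2 : ℤ) by norm_cast, zpow_mul_coeff,
      sqSubst_coeff_odd _ _ fun j => by omega]
  rw [omDiagZeta_eq hF hi hm, Matrix.diagonal_apply_eq, ← cst_two]
  fin_cases s <;> simp [cst_mul_coeff, h1, h2]

lemma thetaHatRa_odd (hF : F.IsCompatible) (hi : S.kind i = Kind.ra) {m : S.Total}
    (hm : m ∈ phaseSpace S) (s : Fin 2) (k : ℤ) :
    (omDiagZeta F i m s s).coeff (2 * k) = (-1) ^ (s : ℕ) * (2 * (omShape F i m 0 1).coeff (k - 1)) := by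
  have h1 : (zvar * sqSubst (omShape F i m 0 0)).coeff (2 * k) = 0 := by
    rw [zvar_mul_coeff, sqSubst_coeff_odd _ _ fun j => by omega]
  have h2 : (zvar ^ 2 * sqSubst (omShape F i m 0 1)).coeff (2 * k)
      = (omShape F i m 0 1).coeff (k - 1) := by
    rw [show zvar ^ 2 = zvar ^ (2 : ℤ) by norm_cast, zpow_mul_coeff,
      show 2 * k - 2 = 2 * (k - 1) by ring, sqSubst_coeff_even]
  rw [omDiagZeta_eq hF hi hm, Matrix.diagonal_apply_eq, ← cst_two]
  fin_cases s <;> simp [cst_mul_coeff, h1, h2]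

/-- The two diagonal entries are exchanged by `ζ ↦ -ζ`. -/
lemma omDiagZeta_coeff (hF : F.IsCompatible) (hi : S.kind i = Kind.ra) {m : S.Total}
    (hm : m ∈ phaseSpace S) (s : Fin 2) (k : ℤ) : (omDiagZeta F i m s s).coeff k
      = ((-1) ^ (s : ℕ)) ^ (k + 1).natAbs * (omDiagZeta F i m 0 0).coeff k := by
  rcases Int.even_or_odd' k with ⟨j, rfl | rfl⟩
  · rw [thetaHatRa_odd hF hi hm, thetaHatRa_odd hF hi hm]
    have : Odd (2 * j + 1).natAbs := Int.natAbs_odd.mpr ⟨j, rfl⟩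
    fin_cases s <;> simp [this.neg_one_pow]
  · rw [thetaHatRa_even hF hi hm, thetaHatRa_even hF hi hm]
    have : Even (2 * j + 1 + 1).natAbs := Int.natAbs_even.mpr ⟨j + 1, by ring⟩
    fin_cases s <;> simp [this.neg_one_pow]

lemma omDiagZeta_ge (hF : F.IsCompatible) (hi : S.kind i = Kind.ra) {m : S.Total}
    (hm : m ∈ phaseSpace S) (s : Fin 2) :
    OrdGE (-2 * (S.ord i : ℤ) + 1) (omDiagZeta F i m s s) := by
  intro k hk
  rcases Int.even_or_odd' k with ⟨j, rfl | rfl⟩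
  · rw [thetaHatRa_odd hF hi hm, omShape_ge hF hi hm 1 _ (by omega)]
    simp
  · rw [thetaHatRa_even hF hi hm, omShape_ge hF hi hm 0 _ (by omega)]
    simp

lemma thetaRa_last (b : S.Base) (hi : S.kind i = Kind.ra) :
    thetaRa b i (2 * S.ord i - 2) = S.resRa i := by
  unfold thetaRa
  rw [dif_neg]
  unfold SingularData.raLen
  rw [if_pos hi]
  omega

lemma thetaHatRa_eq (hF : F.IsCompatible) (hi : S.kind i = Kind.ra) {l : ℕ}
    (hl : l ≤ 2 * S.ord i - 2) {m : S.Total} (hm : m ∈ phaseSpace S) :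
    thetaHatRa F i l m = thetaRa m.2 i l := by
  have hn := S.ord_irr i (by rw [hi]; decide)
  obtain ⟨α, β, h, -, hα, hβ⟩ := hF.ra i hi m hm
  have h' : omShape F i m = ramShape α β := h
  have h0 : omShape F i m 0 0 = α := by rw [h']; rfl
  have h1 : omShape F i m 0 1 = β := by rw [h']; rfl
  rw [thetaHatRa]
  rcases Nat.even_or_odd' l with ⟨e, rfl | rfl⟩
  · rw [show ((2 * e : ℕ) : ℤ) - 2 * S.ord i + 1 = 2 * ((e : ℤ) - S.ord i) + 1 by push_cast; ring,
      thetaHatRa_even hF hi hm, h0, hα e (by omega)]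
    ring
  · rw [show ((2 * e + 1 : ℕ) : ℤ) - 2 * S.ord i + 1 = 2 * ((e : ℤ) - S.ord i + 1) by
      push_cast; ring, thetaHatRa_odd hF hi hm, h1, add_sub_cancel_right, hβ e (by omega)]
    simp
    ring

lemma thetaHatRa_one_ne (hF : F.IsCompatible) (hi : S.kind i = Kind.ra) {m : S.Total}
    (hm : m ∈ phaseSpace S) : thetaHatRa F i 1 m ≠ 0 := by
  have hn := S.ord_irr i (by rw [hi]; decide)
  rw [thetaHatRa_eq hF hi (by omega) hm]
  exact hm.2.2.2.2 i hi

lemma fderiv_thetaHatRa (hF : F.IsCompatible) (hi : S.kind i = Kind.ra) {l : ℕ}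
    (hl : l ≤ 2 * S.ord i - 2) {m : S.Total} (hm : m ∈ phaseSpace S) :
    fderiv ℂ (thetaHatRa F i l) m = fderiv ℂ (fun m : S.Total => thetaRa m.2 i l) m :=
  Filter.EventuallyEq.fderiv_eq (Filter.eventuallyEq_of_mem (isOpen_phaseSpace.mem_nhds hm)
    fun _ hm' => thetaHatRa_eq hF hi hl hm')

lemma varL_zero_coeff {f : S.Total → Laur} (hf : HolFam (phaseSpace S) f)
    {m : S.Total} (hm : m ∈ phaseSpace S) (v : S.Total) (k : ℤ) :
    (varL 0 f m v).coeff k = fderiv ℂ (fun m' => (f m').coeff k) m v := by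
  rw [varL_coeff isOpen_phaseSpace 0 hf hm, fderiv_zero_fun, zero_mul, sub_zero]

lemma frameZ_coeff (F : Frames S) (i : Option (Fin ν)) (m : S.Total) (a b : Fin 2) (k : ℕ) :
    (frameZ F i m a b).coeff k = ∑ c, F.Phi i m a c * F.Xi i k m c b := by
  rw [frameZ, Matrix.mul_apply, coeff_finsetSum]
  refine Finset.sum_congr rfl fun c _ => ?_
  rw [cstMat_apply, cst_mul_coeff, seriesMat_apply, ser_coeff]

/-- By the normalisation of the frames, their variations along the fibres start at order `n_i` in
the first column, and at order `n_i - 1` in the second. -/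
lemma varMat_frameZ_ge (hF : F.IsCompatible) (hi : S.kind i = Kind.ra) {m v : S.Total}
    (hm : m ∈ phaseSpace S) (hv : v.2 = 0) (a b : Fin 2) :
    OrdGE ((S.ord i : ℤ) - (b : ℕ)) (varMat 0 (frameZ F i) m v a b) := by
  have hn := S.ord_irr i (by rw [hi]; decide)
  intro k hk
  rw [varMat, varL_zero_coeff (holFam_frameZ hF i a b) hm]
  refine fderiv_vertical isOpen_phaseSpace ((holFam_frameZ hF i a b).an k) ?_ hm hv
  intro m' hm' m'' hm'' h
  rcases lt_or_ge k 0 with h0 | h0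
  · rw [frameZ_ge F i m' a b k h0, frameZ_ge F i m'' a b k h0]
  · lift k to ℕ using h0
    have hN := hF.ra_norm i hi m' hm' m'' hm'' h
    rw [frameZ_coeff, frameZ_coeff, hN.phi]
    refine Finset.sum_congr rfl fun c _ => ?_
    rcases lt_or_ge (k + 1) (S.ord i) with h1 | h1
    · rw [hN.xi k (by omega)]
    · have hb : b = 0 := by
        by_contra hb
        have : (b : ℕ) = 1 := by omega
        rw [this] at hk
        push_cast at hk
        omega
      subst hb
      have : k = S.ord i - 1 := by simp at hk; omega
      rw [this, hN.col c]

lemma varMat_frameZeta (hF : F.IsCompatible) {m : S.Total} (hm : m ∈ phaseSpace S)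
    (v : S.Total) :
    varMat 0 (frameZeta F i) m v = (varMat 0 (frameZ F i) m v).map sqSubst * matM := by
  have hU := isOpen_phaseSpace (S := S)
  have h1 := varMat_mul hU 0 (holFam_frameZ hF i).mapSq (holFamMat_const matM) hm v
  have h2 : varMat 0 (fun _ => matM) m v = 0 := by
    ext a b : 1
    rw [varMat, varL_const, fderiv_zero_fun]
    simp
  rw [h2, mul_zero, add_zero] at h1
  refine h1.trans ?_
  congr 1
  ext a b : 1
  exact varL_sqSubst hU (holFam_frameZ hF i a b) hm v

lemma matM_inv : matM⁻¹ = !![cst (1 / 2), cst (1 / 2) * zvar⁻¹;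
    cst (1 / 2), -(cst (1 / 2) * zvar⁻¹)] := by
  have hz := zvar_ne_zero
  have hc : cst (1 / 2) + cst (1 / 2) = 1 := by rw [← cst_add]; norm_num
  have hz' : cst (1 / 2) * zvar⁻¹ * zvar = cst (1 / 2) := by rw [mul_assoc, inv_mul_cancel₀ hz, mul_one]
  have e1 : cst (1 / 2) * 1 + cst (1 / 2) * zvar⁻¹ * zvar = 1 := by linear_combination hc + hz'
  have e2 : cst (1 / 2) * 1 + cst (1 / 2) * zvar⁻¹ * -zvar = 0 := by linear_combination -hz'
  have e3 : cst (1 / 2) * 1 + -(cst (1 / 2) * zvar⁻¹) * zvar = 0 := by linear_combination -hz'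
  have e4 : cst (1 / 2) * 1 + -(cst (1 / 2) * zvar⁻¹) * -zvar = 1 := by
    linear_combination hc + hz'
  refine Matrix.inv_eq_left_inv ?_
  rw [matM, Matrix.mul_fin_two, Matrix.one_fin_two, e1, e2, e3, e4]

/-- The diagonal of the logarithmic variation of the frame on the ramified cover. -/
lemma frameZeta_logVar (hF : F.IsCompatible) (hi : S.kind i = Kind.ra) {m v : S.Total}
    (hm : m ∈ phaseSpace S) (hv : v.2 = 0) (s : Fin 2) :
    OrdGE (2 * (S.ord i : ℤ) - 2) (((frameZeta F i m)⁻¹ * varMat 0 (frameZeta F i) m v) s s) ∧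
    (((frameZeta F i m)⁻¹ * varMat 0 (frameZeta F i) m v) s s).coeff (2 * (S.ord i : ℤ) - 2)
      = 1 / 2 * (((frameZ F i m)⁻¹ * varMat 0 (frameZ F i) m v) 1 1).coeff (S.ord i - 1) := by
  have hd := (frameZ_det_unit hF i).ne_zero hm
  obtain ⟨K, hK⟩ : ∃ K, K = (frameZ F i m)⁻¹ * varMat 0 (frameZ F i) m v := ⟨_, rfl⟩
  have hKge : ∀ a b : Fin 2, OrdGE ((S.ord i : ℤ) - (b : ℕ)) (K a b) := by
    intro a b
    rw [hK, Matrix.mul_apply]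
    exact ordGE_sum _ _ fun c _ => (frameZ_inv_ge hF i hm a c).mul
      (varMat_frameZ_ge hF hi hm hv c b) (by omega)
  have e : (frameZeta F i m)⁻¹ * varMat 0 (frameZeta F i) m v
      = matM⁻¹ * K.map sqSubst * matM := by
    rw [varMat_frameZeta hF hm, frameZeta, Matrix.mul_inv_rev, hK, map_sq_mul, map_sq_inv hd]
    simp only [Matrix.mul_assoc]
  have e2 : (matM⁻¹ * K.map sqSubst * matM) s s
      = cst (1 / 2) * (sqSubst (K 0 0) + sqSubst (K 1 1))
        + cst ((-1) ^ (s : ℕ) / 2) * (zvar * sqSubst (K 0 1) + zvar ^ (-1 : ℤ) * sqSubst (K 1 0)) := by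
    have hz := zvar_ne_zero
    rw [matM_inv]
    fin_cases s <;>
      simp [matM, Matrix.mul_apply, Matrix.vecMul, dotProduct, -one_div, neg_div, cst_neg] <;>
      field_simp <;> ring
  rw [← hK, e, e2]
  have k00 := hKge 0 0
  have k01 := hKge 0 1
  have k10 := hKge 1 0
  have k11 := hKge 1 1
  simp only [Fin.val_zero, Fin.val_one, Nat.cast_zero, Nat.cast_one, sub_zero] at k00 k01 k10 k11
  have c1 : OrdGE (2 * (S.ord i : ℤ) - 2) (zvar * sqSubst (K 0 1)) := fun k hk => by
    rw [zvar_mul_coeff]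
    exact sqSubst_ordGE k01 _ (by omega)
  have c2 : OrdGE (2 * (S.ord i : ℤ) - 2) (zvar ^ (-1 : ℤ) * sqSubst (K 1 0)) := fun k hk => by
    rw [zpow_mul_coeff]
    exact sqSubst_ordGE k10 _ (by omega)
  refine ⟨((((sqSubst_ordGE k00).mono (by omega)).add
    ((sqSubst_ordGE k11).mono (by omega))).cst_mul _).add ((c1.add c2).cst_mul _), ?_⟩
  rw [HahnSeries.coeff_add, cst_mul_coeff, cst_mul_coeff, HahnSeries.coeff_add,
    HahnSeries.coeff_add, zvar_mul_coeff, zpow_mul_coeff,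
    sqSubst_coeff_odd _ (2 * (S.ord i : ℤ) - 2 - 1) (fun j => by omega),
    sqSubst_ordGE k10 _ (by omega), sqSubst_ordGE k00 _ (by omega),
    show 2 * (S.ord i : ℤ) - 2 = 2 * (S.ord i - 1) by ring, sqSubst_coeff_even]
  ring

/-- The leading coefficient of the logarithmic variation of the frame is determined by the
condition that the polar part of the connection is constant along the fibre. -/
lemma frameZ_logVar_coeff (hF : F.IsCompatible) (hi : S.kind i = Kind.ra)
    (hA : HolFamMat (phaseSpace S) (omPole i))
    (hb : ∀ m ∈ phaseSpace S, ∀ m' ∈ phaseSpace S, m.2 = m'.2 →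
      MatGE 0 (omPole i m - omPole i m'))
    {m v : S.Total} (hm : m ∈ phaseSpace S) (hv : v.2 = 0) :
    (((frameZ F i m)⁻¹ * varMat 0 (frameZ F i) m v) 1 1).coeff (S.ord i - 1)
      = fderiv ℂ (thetaHatRa F i (2 * S.ord i - 1)) m v / thetaHatRa F i 1 m := by
  have hU := isOpen_phaseSpace (S := S)
  have hn := S.ord_irr i (by rw [hi]; decide)
  have hd : ∀ m ∈ phaseSpace S, (frameZ F i m).det ≠ 0 := fun m hm =>
    (frameZ_det_unit hF i).ne_zero hm
  have h0 : ∀ m ∈ phaseSpace S,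
      frameZ F i m * omShape F i m = ddz (frameZ F i m) + omPole i m * frameZ F i m :=
    fun m hm => (gaugeTransform_eq_iff (hd m hm)).mp rfl
  have hc := conj_variation (hd m hm) (h0 m hm)
    (variation_gauge hU 0 (holFam_frameZ hF i) hA (holFam_omShape hF hA) h0 hm v)
  obtain ⟨K, hK⟩ : ∃ K, K = (frameZ F i m)⁻¹ * varMat 0 (frameZ F i) m v := ⟨_, rfl⟩
  have hKge : ∀ a b : Fin 2, OrdGE ((S.ord i : ℤ) - (b : ℕ)) (K a b) := by
    intro a b
    rw [hK, Matrix.mul_apply]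
    exact ordGE_sum _ _ fun c _ => (frameZ_inv_ge hF i hm a c).mul
      (varMat_frameZ_ge hF hi hm hv c b) (by omega)
  have k00 := hKge 0 0
  have k01 := hKge 0 1
  have k11 := hKge 1 1
  simp only [Fin.val_zero, Fin.val_one, Nat.cast_zero, Nat.cast_one, sub_zero] at k00 k01 k11
  have hreg : MatGE 0 ((frameZ F i m)⁻¹ * varMat 0 (omPole i) m v * frameZ F i m) :=
    (((frameZ_inv_ge hF i hm).mul (varMat_vertical_ge hU 0 hA hb hm hv (fderiv_zero_fun m v))
      (K := 0) (by omega)).mul (frameZ_ge F i m) (by omega))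
  have h01 := hreg 0 1 (-1) (by omega)
  have hR11 : omShape F i m 1 1 = omShape F i m 0 0 - cst (1 / 2) * zvar ^ (-1 : ℤ) := by
    rw [omShape_eq hF hi hm]
    simp [ramShape]
  have e : ((frameZ F i m)⁻¹ * varMat 0 (omPole i) m v * frameZ F i m) 0 1
      = varL 0 (fun m => omShape F i m 0 1) m v - dz (K 0 1)
        - (cst (1 / 2) * (zvar ^ (-1 : ℤ) * K 0 1) + omShape F i m 0 1 * K 1 1
          - K 0 0 * omShape F i m 0 1) := by
    rw [hc, ← hK]
    simp only [Matrix.sub_apply, Matrix.mul_apply, Fin.sum_univ_two, hR11, ddz_apply, varMat]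
    ring
  have hβ := omShape_ge hF hi hm 1
  rw [e, HahnSeries.coeff_sub, HahnSeries.coeff_sub, HahnSeries.coeff_sub, HahnSeries.coeff_add,
    dz_coeff_neg_one, cst_mul_coeff, zpow_mul_coeff, k01 _ (by omega),
    k00.mul hβ (K := 0) (by omega) (-1) (by omega),
    coeff_mul_lead hβ k11 (by ring), varL_zero_coeff (holFam_omShape hF hA 0 1) hm] at h01
  have t1 : thetaHatRa F i 1 m = 2 * (omShape F i m 0 1).coeff (-(S.ord i : ℤ)) := by
    rw [thetaHatRa, show ((1 : ℕ) : ℤ) - 2 * S.ord i + 1 = 2 * (1 - S.ord i) by push_cast; ring,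
      thetaHatRa_odd hF hi hm]
    simp
  have t2 : fderiv ℂ (thetaHatRa F i (2 * S.ord i - 1)) m v
      = 2 * fderiv ℂ (fun m => (omShape F i m 0 1).coeff (-1)) m v := by
    have : thetaHatRa F i (2 * S.ord i - 1) =ᶠ[nhds m]
        fun m => 2 * (omShape F i m 0 1).coeff (-1) :=
      Filter.eventuallyEq_of_mem (hU.mem_nhds hm) fun m' hm' => by
        rw [thetaHatRa, show ((2 * S.ord i - 1 : ℕ) : ℤ) - 2 * S.ord i + 1 = 2 * 0 by omega,
          thetaHatRa_odd hF hi hm']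
        simp
    rw [this.fderiv_eq,
      fderiv_const_mul ((holFam_omShape hF hA 0 1).an (-1) m hm).differentiableAt]
    rfl
  rw [← hK, eq_div_iff (thetaHatRa_one_ne hF hi hm), t1, t2]
  linear_combination -2 * h01

/-- The local contribution of a ramified pole to the isomonodromy form, for a first argument along
the fibre. -/
lemma ram_contribution (hF : F.IsCompatible) (hi : S.kind i = Kind.ra)
    (hA : HolFamMat (phaseSpace S) (omPole i))
    (hb : ∀ m ∈ phaseSpace S, ∀ m' ∈ phaseSpace S, m.2 = m'.2 →
      MatGE 0 (omPole i m - omPole i m'))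
    {m v₁ : S.Total} (hm : m ∈ phaseSpace S) (hv : v₁.2 = 0) (v₂ : S.Total) :
    resWedge (varMat 0 (fun m' => ramify (omPole i m')) m)
        (logVar 0 (frameZeta F i) (omDiagZeta F i) m) v₁ v₂
      = 4 * ∑ l ∈ Finset.range (2 * S.ord i - 2),
            fderiv ℂ (thetaHatRa F i (4 * (S.ord i - 1) - l)) m v₁
                / (2 * ((S.ord i : ℂ) - 1) - l)
              * fderiv ℂ (fun m : S.Total => thetaRa m.2 i l) m v₂
        - 2 * (fderiv ℂ (thetaHatRa F i (2 * S.ord i - 1)) m v₁ / thetaHatRa F i 1 m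
            * fderiv ℂ (fun m : S.Total => thetaRa m.2 i 0) m v₂) := by
  have hU := isOpen_phaseSpace (S := S)
  have hg := holFam_frameZeta hF i
  have hB := holFam_omDiagZeta hF hA
  have hAr := hA.ramify hU
  have hdet : ∀ m ∈ phaseSpace S, (frameZeta F i m).det ≠ 0 := fun m hm =>
    frameZeta_det_ne hF hm
  have hdiag : ∀ m ∈ phaseSpace S, (omDiagZeta F i m).IsDiag := fun m hm => by
    rw [omDiagZeta_eq hF hi hm]
    exact Matrix.isDiag_diagonal _
  have h0 : ∀ m ∈ phaseSpace S, frameZeta F i m * omDiagZeta F i m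
      = ddz (frameZeta F i m) + ramify (omPole i m) * frameZeta F i m :=
    fun m hm => (gaugeTransform_eq_iff (hdet m hm)).mp rfl
  have hn := S.ord_irr i (by rw [hi]; decide)
  obtain ⟨n, hn'⟩ : ∃ n, S.ord i = n + 2 := ⟨S.ord i - 2, by omega⟩
  have hL : ∀ v, ddz (Matrix.diagonal fun s => varPrim 0 (fun m' => omDiagZeta F i m' s s) m v)
      = varMat 0 (omDiagZeta F i) m v := by
    intro v
    ext a b : 1
    rw [ddz_apply]
    by_cases hab : a = b
    · subst hab
      rw [Matrix.diagonal_apply_eq]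
      refine dz_varPrim hU 0 (hB a a) hm v ?_
      rw [fderiv_eq_zero_of_eqOn hU hm (c := S.resRa i)]
      · rfl
      · intro m' hm'
        rw [omDiagZeta_coeff hF hi hm', ← thetaRa_last m'.2 hi, ← thetaHatRa_eq hF hi le_rfl hm',
          thetaHatRa, show ((2 * S.ord i - 2 : ℕ) : ℤ) - 2 * S.ord i + 1 = -1 by omega]
        simp
    · rw [Matrix.diagonal_apply_ne _ hab, dz_zero]
      exact (varL_eq_zero_of_const hU hm dz_zero fun m' hm' => hdiag m' hm' hab).symm
  have hres : (Matrix.trace (varMat 0 (fun m' => ramify (omPole i m')) m v₁ *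
      (varMat 0 (frameZeta F i) m v₂ * (frameZeta F i m)⁻¹))).coeff (-1) = 0 := by
    have e1 : varMat 0 (frameZeta F i) m v₂ * (frameZeta F i m)⁻¹
        = (varMat 0 (frameZ F i) m v₂).map sqSubst * ((frameZ F i m)⁻¹).map sqSubst := by
      rw [varMat_frameZeta hF hm, frameZeta, Matrix.mul_inv_rev,
        map_sq_inv ((frameZ_det_unit hF i).ne_zero hm), Matrix.mul_assoc, ← Matrix.mul_assoc matM,
        Matrix.mul_nonsing_inv _ (isUnit_iff_ne_zero.mpr matM_det_ne), Matrix.one_mul]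
    have e2 : MatGE 0 (varMat 0 (fun m' => ramify (omPole i m')) m v₁) := by
      refine varMat_vertical_ge hU 0 hAr ?_ hm hv (fderiv_zero_fun m v₁)
      intro m₁ h₁ m₂ h₂ h a b
      have e3 : (ramify (omPole i m₁) - ramify (omPole i m₂)) a b
          = sqSubst ((omPole i m₁ - omPole i m₂) a b) * (2 * zvar) := by
        simp only [Matrix.sub_apply, ramify, map_sub, sub_mul]
      rw [e3]
      refine (sqSubst_ordGE (hb m₁ h₁ m₂ h₂ h a b)).mul (M := 0) ?_ (by omega)
      rw [← cst_two]
      exact (ordGE_zvar.mono (by omega)).cst_mul 2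
    have e4 : MatGE 0 ((varMat 0 (frameZ F i) m v₂).map sqSubst) := fun a b => by
      have := sqSubst_ordGE (varL_ordGE_zero hU 0 (holFam_frameZ hF i a b) hm v₂
        fun m' _ => frameZ_ge F i m' a b)
      rwa [mul_zero] at this
    have e5 : MatGE 0 (((frameZ F i m)⁻¹).map sqSubst) := fun a b => by
      simpa using sqSubst_ordGE (frameZ_inv_ge hF i hm a b)
    rw [e1]
    exact (e2.mul (e4.mul e5 (K := 0) (by omega)) (K := 0) (by omega)).trace (-1) (by omega)
  rw [resWedge, logVar, logVar, residue_wedge_of_diagonal (hdet m hm) (h0 m hm)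
    (variation_gauge hU 0 hg hAr hB h0 hm v₁) (variation_gauge hU 0 hg hAr hB h0 hm v₂)
    (hdiag m hm) (hL v₁) (hL v₂) hres]
  have key : ∀ s : Fin 2, ((varMat 0 (omDiagZeta F i) m v₁ s s
      - dz (((frameZeta F i m)⁻¹ * varMat 0 (frameZeta F i) m v₁) s s)) *
        varPrim 0 (fun m' => omDiagZeta F i m' s s) m v₂).coeff (-1)
      = -(∑ l ∈ Finset.range (2 * S.ord i - 2),
            fderiv ℂ (thetaHatRa F i (4 * (S.ord i - 1) - l)) m v₁
                / (2 * ((S.ord i : ℂ) - 1) - l)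
              * fderiv ℂ (fun m : S.Total => thetaRa m.2 i l) m v₂)
        + 1 / 2 * (fderiv ℂ (thetaHatRa F i (2 * S.ord i - 1)) m v₁ / thetaHatRa F i 1 m
            * fderiv ℂ (fun m : S.Total => thetaRa m.2 i 0) m v₂) := by
    intro s
    have hcoef : ∀ (k : ℤ) (v : S.Total), fderiv ℂ (fun m' => (omDiagZeta F i m' s s).coeff k) m v
        = ((-1) ^ (s : ℕ)) ^ (k + 1).natAbs
          * fderiv ℂ (fun m' => (omDiagZeta F i m' 0 0).coeff k) m v := by
      intro k v
      have : (fun m' => (omDiagZeta F i m' s s).coeff k) =ᶠ[nhds m]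
          fun m' => ((-1) ^ (s : ℕ)) ^ (k + 1).natAbs * (omDiagZeta F i m' 0 0).coeff k :=
        Filter.eventuallyEq_of_mem (hU.mem_nhds hm) fun m' hm' => omDiagZeta_coeff hF hi hm' s k
      rw [this.fderiv_eq, fderiv_const_mul ((hB 0 0).an k m hm).differentiableAt]
      rfl
    have hlo : ∀ m' ∈ phaseSpace S, ∀ k : ℤ, k < -2 * (S.ord i : ℤ) + 1 →
        (omDiagZeta F i m' s s).coeff k = 0 := fun m' hm' k hk => omDiagZeta_ge hF hi hm' s k hk
    have hℓc : ∀ k : ℤ, (varPrim 0 (fun m' => omDiagZeta F i m' s s) m v₂).coeff k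
        = if k = 0 then 0
          else fderiv ℂ (fun m' => (omDiagZeta F i m' s s).coeff (k - 1)) m v₂ / k := by
      intro k
      rw [varPrim_coeff hU 0 (hB s s) hm, fderiv_zero_fun, zero_mul, sub_zero]
    have hℓ : OrdGE (-2 * (S.ord i : ℤ) + 2)
        (varPrim 0 (fun m' => omDiagZeta F i m' s s) m v₂) := by
      intro k hk
      rw [hℓc, if_neg (by omega),
        fderiv_eq_zero_of_eqOn hU hm (c := 0) fun m' hm' => hlo m' hm' (k - 1) (by omega)]
      simp
    have hdB : OrdGE 0 (varMat 0 (omDiagZeta F i) m v₁ s s) := by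
      intro k hk
      rw [varMat, varL_zero_coeff (hB s s) hm]
      rcases lt_or_ge k (-2 * (S.ord i : ℤ) + 1) with hk' | hk'
      · rw [fderiv_eq_zero_of_eqOn hU hm (c := 0) fun m' hm' => hlo m' hm' k hk']
        rfl
      · obtain ⟨l, hl⟩ : ∃ l : ℕ, k = (l : ℤ) - 2 * S.ord i + 1 :=
          ⟨(k + 2 * S.ord i - 1).toNat, by omega⟩
        subst hl
        have h3 := fderiv_thetaHatRa hF hi (l := l) (by omega) hm
        unfold thetaHatRa at h3
        rw [hcoef, h3, fderiv_thetaRa_vertical i l hv, mul_zero]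
    have e1 : ∀ j : ℕ, (varMat 0 (omDiagZeta F i) m v₁ s s).coeff (0 + j)
        = ((-1) ^ (s : ℕ)) ^ (j + 1)
          * fderiv ℂ (thetaHatRa F i (2 * S.ord i - 1 + j)) m v₁ := by
      intro j
      rw [varMat, varL_zero_coeff (hB s s) hm, hcoef]
      have c1 : (0 + (j : ℤ) + 1).natAbs = j + 1 := by omega
      have c2 : ((2 * S.ord i - 1 + j : ℕ) : ℤ) - 2 * S.ord i + 1 = 0 + j := by omega
      unfold thetaHatRa
      rw [c1, c2]
    have e2 : ∀ j ∈ Finset.range (2 * n + 2),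
        (varPrim 0 (fun m' => omDiagZeta F i m' s s) m v₂).coeff
          (-2 * (S.ord i : ℤ) + 2 + (2 * n + 1 - j : ℕ))
        = -(((-1) ^ (s : ℕ)) ^ (j + 1)
          * fderiv ℂ (fun m : S.Total => thetaRa m.2 i (2 * n + 1 - j)) m v₂ / (1 + j)) := by
      intro j hj
      have hj' := Finset.mem_range.mp hj
      have c1 : -2 * (S.ord i : ℤ) + 2 + (2 * n + 1 - j : ℕ) = -1 - j := by omega
      have c2 : ((2 * n + 1 - j : ℕ) : ℤ) - 2 * S.ord i + 1 = -1 - j - 1 := by omega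
      have c3 : (-1 - (j : ℤ) - 1 + 1).natAbs = j + 1 := by omega
      rw [c1, hℓc, if_neg (by omega), hcoef, c3,
        ← fderiv_thetaHatRa hF hi (l := 2 * n + 1 - j) (by omega) hm]
      unfold thetaHatRa
      rw [c2]
      push_cast
      rw [show (-1 - j : ℂ) = -(1 + j) by ring, div_neg]
    have e3 := coeff_mul_nat hdB hℓ (2 * n + 1)
    rw [show (0 : ℤ) + (-2 * (S.ord i : ℤ) + 2) + (2 * n + 1 : ℕ) = -1 by omega] at e3
    have hX := frameZeta_logVar hF hi hm hv s
    have hℓ0 : (varPrim 0 (fun m' => omDiagZeta F i m' s s) m v₂).coeff (-2 * (S.ord i : ℤ) + 2)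
        = -(fderiv ℂ (fun m : S.Total => thetaRa m.2 i 0) m v₂ / (2 * (n + 1))) := by
      have h4 := e2 (2 * n + 1) (by simp)
      have hp : ((-1 : ℂ) ^ (s : ℕ)) ^ (2 * n + 1 + 1) = 1 := by
        rw [← pow_mul]
        exact Even.neg_one_pow ⟨s * (n + 1), by ring⟩
      rw [Nat.sub_self, Nat.cast_zero, add_zero, hp] at h4
      rw [h4]
      push_cast
      ring
    have e4 : (dz (((frameZeta F i m)⁻¹ * varMat 0 (frameZeta F i) m v₁) s s)
        * varPrim 0 (fun m' => omDiagZeta F i m' s s) m v₂).coeff (-1)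
        = -(1 / 2 * (fderiv ℂ (thetaHatRa F i (2 * S.ord i - 1)) m v₁ / thetaHatRa F i 1 m
            * fderiv ℂ (fun m : S.Total => thetaRa m.2 i 0) m v₂)) := by
      rw [coeff_mul_lead hX.1.dz hℓ (by ring), dz_coeff, sub_add_cancel, hX.2, hℓ0,
        frameZ_logVar_coeff hF hi hA hb hm hv]
      have c1 : (n : ℂ) + 1 ≠ 0 := by exact_mod_cast n.succ_ne_zero
      have c2 : ((2 * (S.ord i : ℤ) - 2 - 1 : ℤ) : ℂ) + 1 = 2 * (n + 1) := by
        rw [hn']; push_cast; ring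
      rw [c2]
      field_simp
    rw [sub_mul, HahnSeries.coeff_sub, e4, sub_neg_eq_add, e3]
    congr 1
    rw [Finset.sum_congr rfl fun j hj => by rw [e1 j, e2 j hj],
      show 2 * S.ord i - 2 = 2 * n + 1 + 1 by omega,
      ← Finset.sum_range_reflect (fun l => fderiv ℂ (thetaHatRa F i (4 * (S.ord i - 1) - l)) m v₁
          / (2 * ((S.ord i : ℂ) - 1) - l) * fderiv ℂ (fun m : S.Total => thetaRa m.2 i l) m v₂),
      ← Finset.sum_neg_distrib]
    refine Finset.sum_congr rfl fun j hj => ?_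
    have hj' := Finset.mem_range.mp hj
    have c1 : 2 * n + 1 + 1 - 1 - j = 2 * n + 1 - j := by omega
    have c2 : 4 * (S.ord i - 1) - (2 * n + 1 - j) = 2 * S.ord i - 1 + j := by omega
    have c3 : (2 * ((S.ord i : ℂ) - 1) - (2 * n + 1 - j : ℕ)) = 1 + j := by
      have : (2 * (n : ℂ) + 1) = ((2 * n + 1 - j : ℕ) : ℂ) + j := by
        exact_mod_cast (by omega : 2 * n + 1 = (2 * n + 1 - j) + j)
      rw [hn']
      push_cast
      linear_combination this
    have c4 : (((-1 : ℂ) ^ (s : ℕ)) ^ (j + 1)) * (((-1 : ℂ) ^ (s : ℕ)) ^ (j + 1)) = 1 := by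
      rw [← mul_pow, ← mul_pow]
      simp
    rw [c1, c2, c3]
    linear_combination (-(fderiv ℂ (thetaHatRa F i (2 * S.ord i - 1 + j)) m v₁
      * fderiv ℂ (fun m : S.Total => thetaRa m.2 i (2 * n + 1 - j)) m v₂ / (1 + j))) * c4
  rw [Fin.sum_univ_two, key, key]
  ring

end Ramified

/-! ### Local expansions of the connection -/

/-- The `(0, 1)`-entry of the connection at the pole `i`, which depends on the positions of the
poles only. -/
def leadF (b : S.Base) : Option (Fin ν) → Laur
  | some i => 1 / aeval (cst (pos b i) + zvar) (polyP b)
  | none => -(zvar⁻¹) ^ 2 * (1 / aeval zvar⁻¹ (polyP b)) * (zvar⁻¹) ^ (S.deg - 2)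

/-- The leading unit `z^{n_i} f` of the `(0, 1)`-entry `f`. -/
def leadU (b : S.Base) (i : Option (Fin ν)) : Laur := zvar ^ S.ord i * leadF b i

/-- The `(1, 0)`-entry that the local exponents prescribe, up to its regular part. -/
def lowS (b : S.Base) (i : Option (Fin ν)) : Laur := -(formalType b i).det / leadF b i

/-- The shape of the connection at a pole: a vanishing first entry, and the trace and determinant
of the formal type up to terms that do not affect it. -/
structure LocalForm (b : S.Base) (i : Option (Fin ν)) (A : LMat) : Prop where
  apply_zero_zero : A 0 0 = 0
  apply_zero_one : A 0 1 = leadF b i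
  apply_one_zero : OrdGE 0 (A 1 0 - lowS b i)
  apply_one_one : OrdGE 0 (A 1 1 - (formalType b i).trace)

lemma SingularData.deg_eq : S.deg = S.ord none + ∑ i : Fin ν, S.ord (some i) := by
  rw [SingularData.deg, Fintype.sum_option]

lemma SingularData.three_le_deg : 3 ≤ S.deg := by
  have h1 : Fintype.card (Option (Fin ν)) • 1 ≤ ∑ i, S.ord i :=
    Finset.card_nsmul_le_sum _ _ _ fun i _ => S.one_le_ord i
  have := S.two_le
  rw [Fintype.card_option, Fintype.card_fin, smul_eq_mul, mul_one] at h1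
  rw [SingularData.deg]
  omega

lemma val_shift (a : ℂ) : Val (cst a + zvar) a := by simpa using (val_cst a).add val_zvar

lemma val_frac {x : Laur} {a t : ℂ} (hx : Val x a) (h : a ≠ t) (p : ℂ[X]) (n : ℕ) :
    Val (aeval x p / (x - cst t) ^ n) (p.eval a / (a - t) ^ n) :=
  (val_aeval hx p).div ((hx.sub (val_cst t)).pow n) (pow_ne_zero _ (sub_ne_zero.mpr h))

lemma val_simple_frac {x : Laur} {a t : ℂ} (hx : Val x a) (h : a ≠ t) (p : ℂ) :
    Val (cst p / (x - cst t)) (p / (a - t)) :=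
  (val_cst p).div (hx.sub (val_cst t)) (sub_ne_zero.mpr h)

lemma val_simple_frac_one {x : Laur} {a t : ℂ} (hx : Val x a) (h : a ≠ t) :
    Val (1 / (x - cst t)) (1 / (a - t)) :=
  val_one.div (hx.sub (val_cst t)) (sub_ne_zero.mpr h)

lemma aeval_polyP (b : S.Base) (x : Laur) :
    aeval x (polyP b) = ∏ i : Fin ν, (x - cst (pos b i)) ^ S.ord (some i) := by
  simp [polyP, map_prod, algebraMap_eq_cst]

lemma eval_polyP (b : S.Base) (x : ℂ) :
    (polyP b).eval x = ∏ i : Fin ν, (x - pos b i) ^ S.ord (some i) := by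
  simp [polyP, eval_prod]

lemma eval_polyP_ne {b : S.Base} {x : ℂ} (h : ∀ i, x ≠ pos b i) : (polyP b).eval x ≠ 0 := by
  rw [eval_polyP]
  exact Finset.prod_ne_zero_iff.mpr fun i _ => pow_ne_zero _ (sub_ne_zero.mpr (h i))

/-- The leading coefficient of `f`. -/
def leadR (b : S.Base) : Option (Fin ν) → ℂ
  | some i => (∏ k ∈ Finset.univ.erase i, (pos b i - pos b k) ^ S.ord (some k))⁻¹
  | none => -1

lemma leadR_ne {b : S.Base} (hb : Function.Injective (pos b)) (i : Option (Fin ν)) :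
    leadR b i ≠ 0 := by
  cases i with
  | none => simp [leadR]
  | some i =>
    refine inv_ne_zero (Finset.prod_ne_zero_iff.mpr fun k hk => pow_ne_zero _ ?_)
    exact sub_ne_zero.mpr fun h => (Finset.ne_of_mem_erase hk) (hb h).symm

lemma val_inv_shift (t : ℂ) : Val (zvar * (zvar⁻¹ - cst t)) 1 := by
  have e : zvar * (zvar⁻¹ - cst t) = 1 - zvar * cst t := by
    rw [mul_sub, mul_inv_cancel₀ zvar_ne_zero]
  rw [e]
  simpa using val_one.sub (val_zvar.mul (val_cst t))

lemma val_leadU {b : S.Base} (hb : Function.Injective (pos b)) (i : Option (Fin ν)) :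
    Val (leadU b i) (leadR b i) := by
  have hz := zvar_ne_zero
  cases i with
  | none =>
    have h1 : Val (∏ i : Fin ν, (zvar * (zvar⁻¹ - cst (pos b i))) ^ S.ord (some i)) 1 := by
      have := val_prod Finset.univ (fun i : Fin ν =>
        (zvar * (zvar⁻¹ - cst (pos b i))) ^ S.ord (some i)) (fun i => 1 ^ S.ord (some i))
        fun i _ => (val_inv_shift (pos b i)).pow _
      simpa using this
    have e : leadU b none
        = -(∏ i : Fin ν, (zvar * (zvar⁻¹ - cst (pos b i))) ^ S.ord (some i))⁻¹ := by
      have h3 := S.three_le_deg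
      have h2 : zvar ^ 2 * zvar ^ (S.deg - 2)
          = zvar ^ S.ord none * ∏ i : Fin ν, zvar ^ S.ord (some i) := by
        rw [← pow_add, Finset.prod_pow_eq_pow_sum, ← pow_add, ← S.deg_eq]
        congr 1
        omega
      simp only [mul_pow, Finset.prod_mul_distrib]
      rw [leadU, leadF, aeval_polyP]
      have h4 : ∏ i : Fin ν, (zvar⁻¹ - cst (pos b i)) ^ S.ord (some i) ≠ 0 := by
        refine Finset.prod_ne_zero_iff.mpr fun i _ => pow_ne_zero _ ?_
        have := (val_inv_shift (pos b i)).2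
        have h5 := ne_zero_of_coeff (N := 0) (by rw [this]; exact one_ne_zero)
        exact right_ne_zero_of_mul h5
      have h6 : (∏ i : Fin ν, zvar ^ S.ord (some i)) ≠ 0 :=
        Finset.prod_ne_zero_iff.mpr fun i _ => pow_ne_zero _ hz
      rw [inv_pow, inv_pow, mul_inv]
      have h7 : (zvar ^ 2)⁻¹ * (zvar ^ (S.deg - 2))⁻¹
        = (zvar ^ S.ord none)⁻¹ * (∏ i : Fin ν, zvar ^ S.ord (some i))⁻¹ := by
        rw [← mul_inv, h2, mul_inv]
      have h8 : zvar ^ S.ord none * (zvar ^ S.ord none)⁻¹ = 1 :=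
        mul_inv_cancel₀ (pow_ne_zero _ hz)
      rw [one_div]
      linear_combination (-(zvar ^ S.ord none
        * (∏ i : Fin ν, (zvar⁻¹ - cst (pos b i)) ^ S.ord (some i))⁻¹)) * h7
        - ((∏ i : Fin ν, zvar ^ S.ord (some i))⁻¹
        * (∏ i : Fin ν, (zvar⁻¹ - cst (pos b i)) ^ S.ord (some i))⁻¹) * h8
    rw [e]
    have := (h1.inv one_ne_zero).neg
    rwa [inv_one] at this
  | some i =>
    have h1 : Val (∏ k ∈ Finset.univ.erase i,
        (cst (pos b i) + zvar - cst (pos b k)) ^ S.ord (some k))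
        (∏ k ∈ Finset.univ.erase i, (pos b i - pos b k) ^ S.ord (some k)) :=
      val_prod _ _ _ fun k _ => ((val_shift _).sub (val_cst _)).pow _
    have h2 := h1.inv (by simpa [leadR] using leadR_ne hb (some i))
    have e : leadU b (some i) = (∏ k ∈ Finset.univ.erase i,
        (cst (pos b i) + zvar - cst (pos b k)) ^ S.ord (some k))⁻¹ := by
      rw [leadU, leadF, aeval_polyP, ← Finset.mul_prod_erase _ _ (Finset.mem_univ i),
        add_sub_cancel_left, one_div, mul_inv, ← mul_assoc,
        mul_inv_cancel₀ (pow_ne_zero _ hz), one_mul]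
    rw [e]
    exact h2

lemma leadF_eq (b : S.Base) (i : Option (Fin ν)) :
    leadF b i = zvar ^ (-(S.ord i : ℤ)) * leadU b i := by
  rw [leadU, ← mul_assoc, zpow_neg, zpow_natCast, inv_mul_cancel₀ (pow_ne_zero _ zvar_ne_zero),
    one_mul]

lemma leadU_ne {b : S.Base} (hb : Function.Injective (pos b)) (i : Option (Fin ν)) :
    leadU b i ≠ 0 :=
  ne_zero_of_coeff (N := 0) (by rw [(val_leadU hb i).2]; exact leadR_ne hb i)

lemma leadF_ne {b : S.Base} (hb : Function.Injective (pos b)) (i : Option (Fin ν)) :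
    leadF b i ≠ 0 := by
  rw [leadF_eq]
  exact mul_ne_zero (zpow_ne_zero _ zvar_ne_zero) (leadU_ne hb i)

lemma leadF_ge {b : S.Base} (hb : Function.Injective (pos b)) (i : Option (Fin ν)) :
    OrdGE (-(S.ord i : ℤ)) (leadF b i) := by
  rw [leadF_eq, ordGE_zpow_mul]
  exact (val_leadU hb i).1.mono (by omega)

lemma leadF_inv_ge {b : S.Base} (hb : Function.Injective (pos b)) (i : Option (Fin ν)) :
    OrdGE (S.ord i : ℤ) (leadF b i)⁻¹ := by
  rw [leadF_eq, mul_inv, ← zpow_neg, neg_neg, ordGE_zpow_mul]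
  exact ((val_leadU hb i).inv (leadR_ne hb i)).1.mono (by omega)

/-! #### The formal types -/

lemma formalUn_apply (b : S.Base) (i : Option (Fin ν)) (s : Fin 2) :
    formalUn b i s s = ∑ l ∈ Finset.range (S.ord i),
      HahnSeries.single ((l : ℤ) - S.ord i) (thetaUn b i l s) :=
  Matrix.diagonal_apply_eq _ _

lemma formalType_ge (b : S.Base) (i : Option (Fin ν)) :
    MatGE (-(S.ord i : ℤ)) (formalType b i) := by
  rw [formalType]
  split_ifs with h
  · have hn := S.ord_irr i (by rw [h]; decide)
    have h1 : ∀ (k : ℕ) (f : ℕ → ℂ), OrdGE (-(S.ord i : ℤ)) (∑ l ∈ Finset.range k,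
        HahnSeries.single ((l : ℤ) - S.ord i) (f l)) := fun k f =>
      ordGE_sum _ _ fun l _ => (ordGE_single _ _).mono (by omega)
    intro r s
    fin_cases r <;> fin_cases s
    · exact h1 _ _
    · exact h1 _ _
    · exact ordGE_zvar.mul (h1 _ _) (by omega)
    · exact (h1 _ _).sub ((ordGE_zvar_inv.mono (by omega)).cst_mul _)
  · intro r s
    by_cases hrs : r = s
    · subst hrs
      rw [formalUn_apply]
      exact ordGE_sum _ _ fun l _ => (ordGE_single _ _).mono (by omega)
    · rw [formalUn, Matrix.diagonal_apply_ne _ hrs]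
      exact ordGE_zero _

lemma single_sum_coeff (n N : ℕ) (f : ℕ → ℂ) {l : ℕ} (hl : l < n) :
    (∑ l ∈ Finset.range n, HahnSeries.single ((l : ℤ) - N) (f l) : Laur).coeff ((l : ℤ) - N)
      = f l := by
  rw [coeff_finsetSum, Finset.sum_eq_single l]
  · simp
  · intro k _ hk
    rw [HahnSeries.coeff_single_of_ne]
    omega
  · intro h
    exact absurd (Finset.mem_range.mpr hl) h

/-- The sum of the residue exponents at a pole. -/
lemma formalType_trace_residue (b : S.Base) (i : Option (Fin ν)) :
    (formalType b i).trace.coeff (-1)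
      = if S.kind i = Kind.ra then S.resRa i - 1 / 2 else S.res i 0 + S.res i 1 := by
  have hn := S.one_le_ord i
  have e : (-1 : ℤ) = ((S.ord i - 1 : ℕ) : ℤ) - S.ord i := by omega
  rw [formalType, Matrix.trace_fin_two]
  split_ifs with h
  · have hn := S.ord_irr i (by rw [h]; decide)
    have h1 : (∑ l ∈ Finset.range (S.ord i), HahnSeries.single ((l : ℤ) - S.ord i)
        (thetaRa b i (2 * l) / 2) : Laur).coeff (-1) = S.resRa i / 2 := by
      rw [e, single_sum_coeff _ _ (fun l => thetaRa b i (2 * l) / 2) (by omega),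
        show 2 * (S.ord i - 1) = 2 * S.ord i - 2 by omega, thetaRa_last b h]
    have h2 : (cst (1 / 2) * zvar⁻¹).coeff (-1) = 1 / 2 := by
      rw [cst_mul_coeff, zvar_inv, zpow_coeff]
      simp
    simp only [formalRa, ramShape, Matrix.of_apply, Matrix.cons_val_zero, Matrix.cons_val_one,
      Matrix.cons_val', Matrix.cons_val_fin_one, HahnSeries.coeff_add, HahnSeries.coeff_sub, h1, h2]
    ring
  · rw [HahnSeries.coeff_add, formalUn_apply, formalUn_apply, e,
      single_sum_coeff _ _ (fun l => thetaUn b i l 0) (by omega),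
      single_sum_coeff _ _ (fun l => thetaUn b i l 1) (by omega), thetaUn_last, thetaUn_last]

lemma lowS_ge {b : S.Base} (hb : Function.Injective (pos b)) (i : Option (Fin ν)) :
    OrdGE (-(S.ord i : ℤ)) (lowS b i) := by
  rw [lowS, div_eq_mul_inv, Matrix.det_fin_two]
  have h := formalType_ge b i
  exact ((((h 0 0).mul (h 1 1) (K := -2 * (S.ord i : ℤ)) (by omega)).sub
    ((h 0 1).mul (h 1 0) (by omega))).neg).mul (leadF_inv_ge hb i) (by omega)

/-! #### Polar parts -/

/-- The polar part of a Laurent series with a pole of order at most `n`. -/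
def polarPart (n : ℕ) (f : Laur) : Laur :=
  ∑ l ∈ Finset.range n, HahnSeries.single ((l : ℤ) - n) (f.coeff (l - n))

lemma sub_polarPart_ge {n : ℕ} {f : Laur} (hf : OrdGE (-n) f) : OrdGE 0 (f - polarPart n f) := by
  intro k hk
  rw [HahnSeries.coeff_sub, sub_eq_zero]
  rcases lt_or_ge k (-n) with h | h
  · rw [hf k h]
    exact ((ordGE_sum _ _ fun l _ => (ordGE_single _ _).mono (by omega)) k h).symm
  · obtain ⟨l, rfl⟩ : ∃ l : ℕ, k = (l : ℤ) - n := ⟨(k + n).toNat, by omega⟩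
    exact (single_sum_coeff n n (fun l => f.coeff (l - n)) (by omega)).symm

/-- The polynomial whose quotient by `(x - t)^n` has the given polar part at `t`. -/
def polarPoly (t : ℂ) (n : ℕ) (f : Laur) : ℂ[X] :=
  ∑ l ∈ Finset.range n, C (f.coeff ((l : ℤ) - n)) * (X - C t) ^ l

lemma polarPoly_degree (t : ℂ) (n : ℕ) (f : Laur) : (polarPoly t n f).degree < (n : ℕ) := by
  rw [← mem_degreeLT]
  refine Submodule.sum_mem _ fun l hl => ?_
  rw [mem_degreeLT]
  calc _ ≤ (C (f.coeff ((l : ℤ) - n))).degree + ((X - C t) ^ l).degree := degree_mul_le _ _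
    _ ≤ 0 + (l : ℕ) := by
        gcongr
        · exact degree_C_le
        · rw [degree_pow, degree_X_sub_C]; simp
    _ < n := by rw [zero_add]; exact_mod_cast Finset.mem_range.mp hl

lemma aeval_polarPoly (t : ℂ) (n : ℕ) (f : Laur) :
    aeval (cst t + zvar) (polarPoly t n f) / zvar ^ n = polarPart n f := by
  rw [polarPoly, polarPart, map_sum, Finset.sum_div]
  refine Finset.sum_congr rfl fun l _ => ?_
  rw [single_eq, zpow_sub₀ zvar_ne_zero]
  simp [algebraMap_eq_cst]
  ring

/-- The polynomial with a given polar part at `∞`; the factor is the one of a one-form (`k < n`)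
or that of the off-diagonal entry (`k = n`). -/
def polarPolyInf (n k : ℕ) (f : Laur) : ℂ[X] :=
  -∑ l ∈ Finset.range k, C (f.coeff ((l : ℤ) - n)) * X ^ (k - 1 - l)

lemma polarPolyInf_degree (n k : ℕ) (f : Laur) : (polarPolyInf n k f).degree < (k : ℕ) := by
  rw [polarPolyInf, degree_neg, ← mem_degreeLT]
  refine Submodule.sum_mem _ fun l hl => ?_
  rw [mem_degreeLT]
  have := Finset.mem_range.mp hl
  exact (degree_C_mul_X_pow_le _ _).trans_lt (by exact_mod_cast (by omega : k - 1 - l < k))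

lemma aeval_polarPolyInf {n k : ℕ} (f : Laur) (hk : k ≤ n) :
    -(zvar ^ (-((n - k : ℕ) : ℤ) - 1) * aeval zvar⁻¹ (polarPolyInf n k f))
      = ∑ l ∈ Finset.range k, HahnSeries.single ((l : ℤ) - n) (f.coeff (l - n)) := by
  have hz := zvar_ne_zero
  have e : ∀ a b : Laur, -(a * -b) = a * b := fun a b => by ring
  rw [polarPolyInf, map_neg]
  refine (e _ _).trans ?_
  rw [map_sum, Finset.mul_sum]
  refine Finset.sum_congr rfl fun l hl => ?_
  have := Finset.mem_range.mp hl
  rw [single_eq, map_mul, map_pow, aeval_C, aeval_X, algebraMap_eq_cst, inv_pow,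
    ← zpow_natCast, ← zpow_neg, mul_left_comm, ← zpow_add₀ hz]
  congr 2
  omega

lemma aeval_inv_coeff (p : ℂ[X]) (k : ℕ) : (aeval zvar⁻¹ p).coeff (-(k : ℤ)) = p.coeff k := by
  rw [aeval_eq_sum_range' (n := max (p.natDegree + 1) (k + 1)) (by omega), coeff_finsetSum,
    Finset.sum_eq_single k]
  · rw [Algebra.smul_def, algebraMap_eq_cst, cst_mul_coeff, inv_pow, ← zpow_natCast, ← zpow_neg,
      zpow_coeff]
    simp
  · intro l _ hl
    rw [Algebra.smul_def, algebraMap_eq_cst, cst_mul_coeff, inv_pow, ← zpow_natCast, ← zpow_neg,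
      zpow_coeff, if_neg (by omega), mul_zero]
  · intro h
    simp at h

lemma aeval_inv_ge {p : ℂ[X]} {n : ℕ} (hp : p.degree < (n : ℕ)) :
    OrdGE (1 - (n : ℤ)) (aeval zvar⁻¹ p) := by
  rcases eq_or_ne p 0 with rfl | h0
  · rw [map_zero]
    exact ordGE_zero _
  have hd := (natDegree_lt_iff_degree_lt h0).mpr hp
  rw [aeval_eq_sum_range]
  refine ordGE_sum _ _ fun l hl => ?_
  have := Finset.mem_range.mp hl
  rw [Algebra.smul_def, algebraMap_eq_cst, inv_pow, ← zpow_natCast, ← zpow_neg]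
  exact ((ordGE_zpow _).mono (by omega)).cst_mul _

lemma val_frac_infty {p : ℂ[X]} {n : ℕ} (hn : 1 ≤ n) (hp : p.degree < (n : ℕ)) (t : ℂ) :
    Val (zvar⁻¹ * (aeval zvar⁻¹ p / (zvar⁻¹ - cst t) ^ n)) (p.coeff (n - 1)) := by
  have hz := zvar_ne_zero
  have h1 : Val (zvar ^ ((n - 1 : ℕ) : ℤ) * aeval zvar⁻¹ p) (p.coeff (n - 1)) := by
    refine ⟨?_, ?_⟩
    · rw [ordGE_zpow_mul]
      exact (aeval_inv_ge hp).mono (by omega)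
    · rw [zpow_mul_coeff, zero_sub, aeval_inv_coeff]
  have h2 := h1.div ((val_inv_shift t).pow n) (by simp)
  rw [one_pow, div_one] at h2
  convert h2 using 1
  obtain ⟨k, rfl⟩ : ∃ k, n = k + 1 := ⟨n - 1, by omega⟩
  rw [mul_pow, Nat.add_sub_cancel, zpow_natCast, pow_succ]
  field_simp
  ring

lemma val_simple_frac_infty (p t : ℂ) : Val (zvar⁻¹ * (cst p / (zvar⁻¹ - cst t))) p := by
  have h := val_frac_infty (p := C p) le_rfl
    (lt_of_le_of_lt degree_C_le (by exact_mod_cast one_pos)) t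
  simpa [algebraMap_eq_cst] using h

/-! ### The explicit normal form -/

section Expansions

variable {m : S.Total} {c : CoeffTuple ν}

lemma connInfty_eq (m : S.Total) (c : CoeffTuple ν) : connInfty m c
    = !![0, leadF m.2 none; -(zvar ^ ((S.deg : ℤ) - 4) * entryC m c zvar⁻¹),
        -(zvar ^ (-2 : ℤ) * entryD m c zvar⁻¹) - cst (S.deg - 2 : ℕ) * zvar⁻¹] := by
  have hz := zvar_ne_zero
  have h3 := S.three_le_deg
  obtain ⟨N, hN⟩ : ∃ N, S.deg = N + 2 := ⟨S.deg - 2, by omega⟩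
  have hN' : S.deg - 2 = N := by omega
  have hd : (!![1, 0; 0, (zvar⁻¹) ^ N] : LMat).det ≠ 0 := by
    rw [Matrix.det_fin_two_of]
    simp [hz]
  have hdz : ddz !![1, 0; 0, (zvar⁻¹) ^ N]
      = !![0, 0; 0, -(cst N * (zvar⁻¹) ^ (N + 1))] := by
    ext a b : 1
    fin_cases a <;> fin_cases b
    · exact dz_one
    · exact dz_zero
    · exact dz_zero
    · change dz ((zvar⁻¹) ^ N) = -(cst N * (zvar⁻¹) ^ (N + 1))
      have h1 : ((zvar⁻¹) ^ N) = zvar ^ (-(N : ℤ)) := by simp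
      have h2 : ((zvar⁻¹) ^ (N + 1)) = zvar ^ (-(N : ℤ) - 1) := by
        rw [inv_pow, ← zpow_natCast, ← zpow_neg]
        congr 1
        push_cast
        ring
      rw [h1, h2, dz_zpow]
      push_cast
      rw [cst_neg]
      ring
  have e4 : zvar ^ ((S.deg : ℤ) - 4) = zvar ^ N * (zvar⁻¹) ^ 2 := by
    rw [inv_pow, ← zpow_natCast, ← zpow_natCast, ← zpow_neg, ← zpow_add₀ hz]
    congr 1
    push_cast
    omega
  have e2 : zvar ^ (-2 : ℤ) = (zvar⁻¹) ^ 2 := by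
    rw [inv_pow, ← zpow_natCast, ← zpow_neg]
    rfl
  rw [connInfty, hN', gaugeTransform_eq_iff hd, hdz, connMatrix, e4, e2, leadF, hN']
  generalize entryC m c zvar⁻¹ = C₀
  generalize entryD m c zvar⁻¹ = D₀
  generalize aeval zvar⁻¹ (polyP m.2) = P₀
  ext a b : 1
  fin_cases a <;> fin_cases b <;> simp [Matrix.mul_apply] <;> field_simp <;> ring

lemma entryD_finite (i : Fin ν) (hm : m ∈ phaseSpace S) :
    OrdGE 0 (entryD m c (cst (pos m.2 i) + zvar)
      - aeval (cst (pos m.2 i) + zvar) (c.D (some i)) / zvar ^ S.ord (some i)) := by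
  have hx := val_shift (pos m.2 i)
  have e : entryD m c (cst (pos m.2 i) + zvar)
      - aeval (cst (pos m.2 i) + zvar) (c.D (some i)) / zvar ^ S.ord (some i)
      = ∑ k ∈ Finset.univ.erase i, aeval (cst (pos m.2 i) + zvar) (c.D (some k))
          / (cst (pos m.2 i) + zvar - cst (pos m.2 k)) ^ S.ord (some k)
        - ∑ j, 1 / (cst (pos m.2 i) + zvar - cst (qc m j))
        + aeval (cst (pos m.2 i) + zvar) (c.D none) := by
    rw [entryD, ← Finset.add_sum_erase _ _ (Finset.mem_univ i), add_sub_cancel_left]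
    ring
  rw [e]
  refine ((ordGE_sum _ _ fun k hk => ?_).sub (ordGE_sum _ _ fun j _ => ?_)).add (val_aeval hx _).1
  · exact (val_frac hx (fun h => Finset.ne_of_mem_erase hk (hm.1 h).symm) _ _).1
  · exact (val_simple_frac_one hx (hm.2.2.1 j i).symm).1

lemma entryC_finite (i : Fin ν) (hm : m ∈ phaseSpace S) :
    OrdGE 0 (entryC m c (cst (pos m.2 i) + zvar)
      - aeval (cst (pos m.2 i) + zvar) (c.C (some i)) / zvar ^ S.ord (some i)) := by
  have hx := val_shift (pos m.2 i)
  have e : entryC m c (cst (pos m.2 i) + zvar)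
      - aeval (cst (pos m.2 i) + zvar) (c.C (some i)) / zvar ^ S.ord (some i)
      = ∑ k ∈ Finset.univ.erase i, aeval (cst (pos m.2 i) + zvar) (c.C (some k))
          / (cst (pos m.2 i) + zvar - cst (pos m.2 k)) ^ S.ord (some k)
        + ∑ j, cst (pc m j) / (cst (pos m.2 i) + zvar - cst (qc m j))
        + aeval (cst (pos m.2 i) + zvar) c.Ct
        + (cst (pos m.2 i) + zvar) ^ S.numApp * aeval (cst (pos m.2 i) + zvar) (c.C none) := by
    rw [entryC, ← Finset.add_sum_erase _ _ (Finset.mem_univ i), add_sub_cancel_left]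
    ring
  rw [e]
  refine (((ordGE_sum _ _ fun k hk => ?_).add (ordGE_sum _ _ fun j _ => ?_)).add
    (val_aeval hx _).1).add ((hx.pow _).mul (val_aeval hx _)).1
  · exact (val_frac hx (fun h => Finset.ne_of_mem_erase hk (hm.1 h).symm) _ _).1
  · exact (val_simple_frac hx (hm.2.2.1 j i).symm _).1

/-- The behaviour of `d₀` at infinity. -/
lemma entryD_infty (hD : ∀ i : Fin ν, (c.D (some i)).degree < (S.ord (some i) : ℕ)) :
    Val (zvar⁻¹ * (entryD m c zvar⁻¹ - aeval zvar⁻¹ (c.D none)))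
      (∑ i : Fin ν, (c.D (some i)).coeff (S.ord (some i) - 1) - S.numApp) := by
  have e : zvar⁻¹ * (entryD m c zvar⁻¹ - aeval zvar⁻¹ (c.D none))
      = ∑ i : Fin ν, zvar⁻¹ * (aeval zvar⁻¹ (c.D (some i))
          / (zvar⁻¹ - cst (pos m.2 i)) ^ S.ord (some i))
        - ∑ j, zvar⁻¹ * (cst 1 / (zvar⁻¹ - cst (qc m j))) := by
    rw [entryD, add_sub_cancel_right, mul_sub, Finset.mul_sum, Finset.mul_sum, cst_one]
  rw [e]
  have h2 := val_sum Finset.univ (fun j => zvar⁻¹ * (cst 1 / (zvar⁻¹ - cst (qc m j))))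
    (fun _ => 1) fun j _ => val_simple_frac_infty 1 _
  simp only [Finset.sum_const, Finset.card_univ, Fintype.card_fin, nsmul_eq_mul, mul_one] at h2
  exact (val_sum _ _ _ fun i _ => val_frac_infty (S.one_le_ord _) (hD i) _).sub h2

lemma entryC_infty (hC : ∀ i, (c.C i).degree < (S.ord i : ℕ)) (hCt : c.Ct.degree < (S.numApp : ℕ)) :
    OrdGE 0 (zvar ^ ((S.deg : ℤ) - 4) * (entryC m c zvar⁻¹
      - (zvar⁻¹) ^ S.numApp * aeval zvar⁻¹ (c.C none))) := by
  have h3 := S.three_le_deg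
  have h3' : S.numApp = S.deg - 3 := rfl
  have hz := zvar_ne_zero
  have e : zvar ^ ((S.deg : ℤ) - 4) * (entryC m c zvar⁻¹
      - (zvar⁻¹) ^ S.numApp * aeval zvar⁻¹ (c.C none))
      = zvar ^ ((S.deg : ℤ) - 3) * (∑ i : Fin ν, zvar⁻¹ * (aeval zvar⁻¹ (c.C (some i))
          / (zvar⁻¹ - cst (pos m.2 i)) ^ S.ord (some i))
        + ∑ j, zvar⁻¹ * (cst (pc m j) / (zvar⁻¹ - cst (qc m j))))
        + zvar ^ ((S.deg : ℤ) - 4) * aeval zvar⁻¹ c.Ct := by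
    rw [entryC, add_sub_cancel_right, ← Finset.mul_sum, ← Finset.mul_sum, ← mul_add, ← mul_assoc,
      ← zpow_sub_one₀ hz, show (S.deg : ℤ) - 3 - 1 = S.deg - 4 by ring]
    ring
  rw [e]
  refine OrdGE.add ?_ ?_
  · rw [ordGE_zpow_mul]
    refine OrdGE.mono (N := 0) (OrdGE.add (ordGE_sum _ _ fun i _ => ?_)
      (ordGE_sum _ _ fun j _ => ?_)) (by omega)
    · exact (val_frac_infty (S.one_le_ord _) (hC _) _).1
    · exact (val_simple_frac_infty _ _).1
  · rw [ordGE_zpow_mul]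
    exact (aeval_inv_ge hCt).mono (by omega)

/-- The regular part of `c₀` at `q_j`. -/
def cReg (m : S.Total) (c : CoeffTuple ν) (j : Fin S.numApp) : ℂ :=
  ∑ i : Fin ν, (c.C (some i)).eval (qc m j) / (qc m j - pos m.2 i) ^ S.ord (some i)
    + ∑ k ∈ Finset.univ.erase j, pc m k / (qc m j - qc m k) + c.Ct.eval (qc m j)
    + qc m j ^ S.numApp * (c.C none).eval (qc m j)

/-- The regular part of `d₀` at `q_j`. -/
def dReg (m : S.Total) (c : CoeffTuple ν) (j : Fin S.numApp) : ℂ :=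
  ∑ i : Fin ν, (c.D (some i)).eval (qc m j) / (qc m j - pos m.2 i) ^ S.ord (some i)
    - ∑ k ∈ Finset.univ.erase j, 1 / (qc m j - qc m k) + (c.D none).eval (qc m j)

lemma val_entryC_app (j : Fin S.numApp) (hm : m ∈ phaseSpace S) :
    Val (entryC m c (cst (qc m j) + zvar) - cst (pc m j) * zvar⁻¹) (cReg m c j) := by
  have hx := val_shift (qc m j)
  have e : entryC m c (cst (qc m j) + zvar) - cst (pc m j) * zvar⁻¹
      = ∑ i : Fin ν, aeval (cst (qc m j) + zvar) (c.C (some i))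
          / (cst (qc m j) + zvar - cst (pos m.2 i)) ^ S.ord (some i)
        + ∑ k ∈ Finset.univ.erase j, cst (pc m k) / (cst (qc m j) + zvar - cst (qc m k))
        + aeval (cst (qc m j) + zvar) c.Ct
        + (cst (qc m j) + zvar) ^ S.numApp * aeval (cst (qc m j) + zvar) (c.C none) := by
    rw [entryC, ← Finset.add_sum_erase (Finset.univ : Finset (Fin S.numApp)) _
      (Finset.mem_univ j), add_sub_cancel_left, div_eq_mul_inv (cst (pc m j))]
    ring
  rw [e]
  exact (((val_sum _ _ _ fun i _ => val_frac hx (hm.2.2.1 j i) _ _).add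
    (val_sum _ _ _ fun k hk => val_simple_frac hx
      (fun h => Finset.ne_of_mem_erase hk (hm.2.1 h).symm) _)).add (val_aeval hx _)).add
    ((hx.pow _).mul (val_aeval hx _))

lemma val_entryD_app (j : Fin S.numApp) (hm : m ∈ phaseSpace S) :
    Val (entryD m c (cst (qc m j) + zvar) + zvar⁻¹) (dReg m c j) := by
  have hx := val_shift (qc m j)
  have e : entryD m c (cst (qc m j) + zvar) + zvar⁻¹
      = ∑ i : Fin ν, aeval (cst (qc m j) + zvar) (c.D (some i))
          / (cst (qc m j) + zvar - cst (pos m.2 i)) ^ S.ord (some i)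
        - ∑ k ∈ Finset.univ.erase j, 1 / (cst (qc m j) + zvar - cst (qc m k))
        + aeval (cst (qc m j) + zvar) (c.D none) := by
    rw [entryD, ← Finset.add_sum_erase (Finset.univ : Finset (Fin S.numApp)) _
      (Finset.mem_univ j), add_sub_cancel_left, one_div]
    ring
  rw [e]
  exact ((val_sum _ _ _ fun i _ => val_frac hx (hm.2.2.1 j i) _ _).sub
    (val_sum _ _ _ fun k hk => val_simple_frac_one hx
      (fun h => Finset.ne_of_mem_erase hk (hm.2.1 h).symm))).add (val_aeval hx _)

lemma val_leadF_app (j : Fin S.numApp) (hm : m ∈ phaseSpace S) :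
    Val (1 / aeval (cst (qc m j) + zvar) (polyP m.2)) (1 / (polyP m.2).eval (qc m j)) :=
  val_one.div (val_aeval (val_shift _) _) (eval_polyP_ne fun i => hm.2.2.1 j i)

/-- The elementary transform of a connection with vanishing first entry. -/
lemma gaugeTransform_elem (p f c d : Laur) (hp : dz p = 0) :
    gaugeTransform !![1, 0; p, zvar] !![0, f; c, d]
      = !![f * p, f * zvar; zvar⁻¹ * (c + d * p - f * p ^ 2), d - f * p + zvar⁻¹] := by
  have hz := zvar_ne_zero
  have hd : (!![1, 0; p, zvar] : LMat).det ≠ 0 := by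
    rw [Matrix.det_fin_two_of]
    simp [hz]
  have hdz : ddz !![1, 0; p, zvar] = !![0, 0; 0, 1] := by
    ext a b : 1
    fin_cases a <;> fin_cases b
    · exact dz_one
    · exact dz_zero
    · exact hp
    · exact dz_zvar
  rw [gaugeTransform_eq_iff hd, hdz]
  ext a b : 1
  fin_cases a <;> fin_cases b <;>
    simp [Matrix.mul_apply] <;> field_simp <;> ring

lemma elem_val (j : Fin S.numApp) (hm : m ∈ phaseSpace S) :
    Val (entryC m c (cst (qc m j) + zvar) + entryD m c (cst (qc m j) + zvar) * cst (pc m j)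
        - 1 / aeval (cst (qc m j) + zvar) (polyP m.2) * cst (pc m j) ^ 2)
      (cReg m c j + dReg m c j * pc m j - 1 / (polyP m.2).eval (qc m j) * pc m j ^ 2) := by
  have h := ((val_entryC_app j hm (c := c)).add ((val_entryD_app j hm (c := c)).mul
    (val_cst (pc m j)))).sub ((val_leadF_app j hm).mul ((val_cst (pc m j)).pow 2))
  convert h using 1
  ring

/-- The condition that `q_j` is an apparent singularity with parameter `p_j`. -/
lemma apparent_iff (j : Fin S.numApp) (hm : m ∈ phaseSpace S) :
    IsRegularMat (gaugeTransform !![1, 0; cst (pc m j), zvar] (connAt m c (qc m j)))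
      ↔ cReg m c j + dReg m c j * pc m j - 1 / (polyP m.2).eval (qc m j) * pc m j ^ 2 = 0 := by
  have hv := elem_val j hm (c := c)
  have hf := val_leadF_app j hm
  rw [connAt, connMatrix, gaugeTransform_elem _ _ _ _ (dz_cst _)]
  constructor
  · intro h
    have h1 := h 1 0 (-1) (by omega)
    simp only [Matrix.of_apply, Matrix.cons_val_zero, Matrix.cons_val_one,
      Matrix.cons_val', Matrix.cons_val_fin_one] at h1
    rw [zvar_inv, zpow_mul_coeff, sub_self, hv.2] at h1
    exact h1
  · intro h a b
    rw [h] at hv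
    fin_cases a <;> fin_cases b
    · exact (hf.mul (val_cst _)).1
    · exact (hf.mul val_zvar).1
    · change OrdGE 0 (zvar⁻¹ * _)
      rw [zvar_inv, ordGE_zpow_mul]
      exact hv.ordGE_one.mono (by omega)
    · have h2 := ((val_entryD_app j hm (c := c)).sub (hf.mul (val_cst (pc m j)))).1
      change OrdGE 0 (entryD m c (cst (qc m j) + zvar)
        - 1 / aeval (cst (qc m j) + zvar) (polyP m.2) * cst (pc m j) + zvar⁻¹)
      convert h2 using 1
      ring

end Expansions

section NormalForm

variable {m : S.Total} {c : CoeffTuple ν}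

lemma connInfty_one_one (hD : ∀ i : Fin ν, (c.D (some i)).degree < (S.ord (some i) : ℕ)) :
    OrdGE 0 (connInfty m c 1 1 + zvar ^ (-2 : ℤ) * aeval zvar⁻¹ (c.D none)
      - cst (-∑ i : Fin ν, (c.D (some i)).coeff (S.ord (some i) - 1) - 1) * zvar ^ (-1 : ℤ)) := by
  have h3 := S.three_le_deg
  have h3' : S.numApp = S.deg - 3 := rfl
  have hz := zvar_ne_zero
  have hv := entryD_infty hD (m := m)
  set r := ∑ i : Fin ν, (c.D (some i)).coeff (S.ord (some i) - 1) with hr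
  have e : connInfty m c 1 1 + zvar ^ (-2 : ℤ) * aeval zvar⁻¹ (c.D none)
      - cst (-r - 1) * zvar ^ (-1 : ℤ)
      = zvar ^ (-1 : ℤ) * -(zvar⁻¹ * (entryD m c zvar⁻¹ - aeval zvar⁻¹ (c.D none))
        - cst (r - S.numApp)) := by
    have h1 : (S.numApp : ℂ) = ((S.deg - 2 : ℕ) : ℂ) - 1 := by
      rw [eq_sub_iff_add_eq]
      exact_mod_cast (by omega : S.numApp + 1 = S.deg - 2)
    have h2 : zvar ^ (-2 : ℤ) = (zvar⁻¹) ^ 2 := by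
      rw [inv_pow, ← zpow_natCast, ← zpow_neg]
      rfl
    rw [connInfty_eq, h1, h2, ← zvar_inv]
    simp only [Matrix.of_apply, Matrix.cons_val_one, Matrix.cons_val', Matrix.cons_val_fin_one]
    rw [cst_sub, cst_sub, cst_sub, cst_neg, cst_one]
    ring
  rw [e, ordGE_zpow_mul]
  exact hv.ordGE_one_sub.neg.mono (by omega)

lemma connInfty_one_zero (hC : ∀ i, (c.C i).degree < (S.ord i : ℕ))
    (hCt : c.Ct.degree < (S.numApp : ℕ)) :
    OrdGE 0 (connInfty m c 1 0 + zvar ^ (-1 : ℤ) * aeval zvar⁻¹ (c.C none)) := by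
  have h3 := S.three_le_deg
  have h3' : S.numApp = S.deg - 3 := rfl
  have hz := zvar_ne_zero
  have e : connInfty m c 1 0 + zvar ^ (-1 : ℤ) * aeval zvar⁻¹ (c.C none)
      = -(zvar ^ ((S.deg : ℤ) - 4) * (entryC m c zvar⁻¹
      - (zvar⁻¹) ^ S.numApp * aeval zvar⁻¹ (c.C none))) := by
    have h1 : zvar ^ (-1 : ℤ) = zvar ^ ((S.deg : ℤ) - 4) * (zvar⁻¹) ^ S.numApp := by
      rw [inv_pow, ← zpow_natCast, ← zpow_neg, ← zpow_add₀ hz]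
      congr 1
      omega
    rw [connInfty_eq, h1]
    simp only [Matrix.of_apply, Matrix.cons_val_zero, Matrix.cons_val_one, Matrix.cons_val',
      Matrix.cons_val_fin_one]
    ring
  rw [e]
  exact (entryC_infty hC hCt).neg

lemma connPole_zero_zero (i : Option (Fin ν)) : connPole m c i 0 0 = 0 := by
  cases i with
  | some i => rfl
  | none =>
    rw [connPole, connInfty_eq]
    rfl

lemma connPole_zero_one (i : Option (Fin ν)) : connPole m c i 0 1 = leadF m.2 i := by
  cases i with
  | some i => rfl
  | none =>
    rw [connPole, connInfty_eq]
    rfl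

lemma aeval_frac_ge (x : Laur) (hx : OrdGE 0 x) (p : ℂ[X]) (n : ℕ) :
    OrdGE (-(n : ℤ)) (aeval x p / zvar ^ n) := by
  rw [div_eq_mul_inv, mul_comm, ← zpow_natCast, ← zpow_neg, ordGE_zpow_mul]
  exact (val_aeval hx.val p).1.mono (by omega)

lemma OrdGE.of_sub {N : ℤ} {f g : Laur} (h : OrdGE 0 (f - g)) (hg : OrdGE N g) (hN : N ≤ 0) :
    OrdGE N f := by
  have := (h.mono hN).add hg
  rwa [sub_add_cancel] at this

/-- The pole at `t_i` has order at most `n_i`. -/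
lemma connPole_ge (hm : m ∈ phaseSpace S) (hC : ∀ i, (c.C i).degree < (S.ord i : ℕ))
    (hD : ∀ i : Fin ν, (c.D (some i)).degree < (S.ord (some i) : ℕ))
    (hDi : (c.D none).degree < ((S.ord none - 1 : ℕ) : WithBot ℕ))
    (hCt : c.Ct.degree < (S.numApp : ℕ)) (i : Option (Fin ν)) :
    MatGE (-(S.ord i : ℤ)) (connPole m c i) := by
  have hn := S.one_le_ord i
  intro a b
  fin_cases a <;> fin_cases b
  · change OrdGE _ (connPole m c i 0 0)
    rw [connPole_zero_zero]
    exact ordGE_zero _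
  · change OrdGE _ (connPole m c i 0 1)
    rw [connPole_zero_one]
    exact leadF_ge hm.1 i
  · cases i with
    | some i =>
      exact (entryC_finite i hm).of_sub (aeval_frac_ge _ (val_shift _).1 _ _) (by omega)
    | none =>
      have h := connInfty_one_zero hC hCt (m := m)
      rw [← sub_neg_eq_add] at h
      refine h.of_sub (OrdGE.neg ?_) (by omega)
      rw [ordGE_zpow_mul]
      exact (aeval_inv_ge (hC none)).mono (by omega)
  · cases i with
    | some i =>
      exact (entryD_finite i hm).of_sub (aeval_frac_ge _ (val_shift _).1 _ _) (by omega)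
    | none =>
      have h := connInfty_one_one hD (m := m)
      have e : ∀ a b r : Laur, a + b - r = a - (r - b) := fun a b r => by ring
      rw [e] at h
      refine OrdGE.of_sub (N := -(S.ord none : ℤ)) h (OrdGE.sub
        (((ordGE_zpow _).mono (by omega)).cst_mul _) ?_) (by omega)
      rw [ordGE_zpow_mul]
      exact (aeval_inv_ge hDi).mono (by omega)

/-- The trace modulo regular terms and the determinant modulo terms with the pole order of the
connection are invariant under regular gauge transformations. -/
lemma gauge_invariants {n : ℕ} {G A B : LMat} (hG : MatGE 0 G) (hdet : G.det.coeff 0 ≠ 0)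
    (hA : MatGE (-(n : ℤ)) A) (h : gaugeTransform G A = B) :
    OrdGE 0 (A.trace - B.trace) ∧ OrdGE (-(n : ℤ)) (A.det - B.det) := by
  have hGi := hG.inv hdet
  have hd : G.det ≠ 0 := ne_zero_of_coeff hdet
  have hu := isUnit_iff_ne_zero.mpr hd
  obtain ⟨R, hR⟩ : ∃ R, R = G⁻¹ * ddz G := ⟨_, rfl⟩
  obtain ⟨N, hN⟩ : ∃ N, N = G⁻¹ * A * G := ⟨_, rfl⟩
  have hRge : MatGE 0 R := hR ▸ hGi.mul hG.ddz_zero (by omega)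
  have hNge : MatGE (-(n : ℤ)) N :=
    hN ▸ (hGi.mul hA (K := -(n : ℤ)) (by omega)).mul hG (by omega)
  have ht : A.trace = N.trace := by
    rw [hN, Matrix.trace_mul_comm, ← mul_assoc, Matrix.mul_nonsing_inv _ hu, one_mul]
  have hdt : A.det = N.det := by
    rw [hN, Matrix.det_mul, Matrix.det_mul, mul_right_comm, ← Matrix.det_mul,
      Matrix.nonsing_inv_mul _ hu, Matrix.det_one, one_mul]
  have hB : B = R + N := by rw [← h, hR, hN, gaugeTransform]
  constructor
  · rw [ht, hB, Matrix.trace_add, sub_add_cancel_right]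
    exact hRge.trace.neg
  · have e : A.det - B.det = -((R 0 0 * R 1 1 - R 0 1 * R 1 0)
        + (R 0 0 * N 1 1 + N 0 0 * R 1 1 - R 0 1 * N 1 0 - N 0 1 * R 1 0)) := by
      rw [hdt, hB, Matrix.det_fin_two, Matrix.det_fin_two]
      simp only [Matrix.add_apply]
      ring
    rw [e]
    refine OrdGE.neg (OrdGE.add (OrdGE.sub ?_ ?_) (OrdGE.sub (OrdGE.sub (OrdGE.add ?_ ?_) ?_) ?_))
    · exact (hRge 0 0).mul (hRge 1 1) (by omega)
    · exact (hRge 0 1).mul (hRge 1 0) (by omega)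
    · exact (hRge 0 0).mul (hNge 1 1) (by omega)
    · exact (hNge 0 0).mul (hRge 1 1) (by omega)
    · exact (hRge 0 1).mul (hNge 1 0) (by omega)
    · exact (hNge 0 1).mul (hRge 1 0) (by omega)

lemma seriesMat_det (G : ℕ → CMat) : Val (seriesMat G).det (G 0).det :=
  det_val fun _ _ => ⟨ser_ordGE _, ser_coeff_zero _⟩

lemma IsNormalForm.localForm (hm : m ∈ phaseSpace S) (hc : IsNormalForm m c)
    (i : Option (Fin ν)) : LocalForm m.2 i (connPole m c i) := by
  obtain ⟨G, hG, h⟩ := hc.formal i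
  have hge := connPole_ge hm hc.deg_C hc.deg_D hc.deg_D_infty hc.deg_Ct i
  have hinv := gauge_invariants (seriesMat_ge G) (by rwa [(seriesMat_det G).2]) hge h
  have hf := leadF_ne hm.1 i
  refine ⟨connPole_zero_zero i, connPole_zero_one i, ?_, ?_⟩
  · have h2 := (hinv.2.mul (leadF_inv_ge hm.1 i) (K := 0) (by omega)).neg
    rw [Matrix.det_fin_two, connPole_zero_zero, connPole_zero_one] at h2
    convert h2 using 1
    rw [lowS]
    field_simp
    ring
  · have h1 := hinv.1
    rwa [Matrix.trace_fin_two, connPole_zero_zero, zero_add] at h1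

lemma aeval_zvar_coeff (p : ℂ[X]) (k : ℕ) : (aeval zvar p).coeff k = p.coeff k := by
  rw [aeval_eq_sum_range' (n := max (p.natDegree + 1) (k + 1)) (by omega), coeff_finsetSum,
    Finset.sum_eq_single k]
  · rw [Algebra.smul_def, algebraMap_eq_cst, cst_mul_coeff, ← zpow_natCast, zpow_coeff]
    simp
  · intro l _ hl
    rw [Algebra.smul_def, algebraMap_eq_cst, cst_mul_coeff, ← zpow_natCast, zpow_coeff,
      if_neg (by omega), mul_zero]
  · intro h
    simp at h

lemma eq_zero_of_aeval_shift_ge {p : ℂ[X]} {n : ℕ} {t : ℂ} (hp : p.degree < (n : ℕ))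
    (h : OrdGE n (aeval (cst t + zvar) p)) : p = 0 := by
  have e : aeval (cst t + zvar) p = aeval zvar (taylor t p) := by
    rw [taylor_apply, aeval_comp]
    simp [algebraMap_eq_cst, add_comm]
  rw [e] at h
  apply taylor_injective t
  rw [map_zero]
  ext k
  rw [coeff_zero]
  rcases lt_or_ge k n with hk | hk
  · rw [← aeval_zvar_coeff]
    exact h k (by exact_mod_cast hk)
  · refine coeff_eq_zero_of_degree_lt ?_
    rw [degree_taylor]
    exact hp.trans_le (by exact_mod_cast hk)

lemma eq_zero_of_aeval_inv_ge {p : ℂ[X]} (h : OrdGE 1 (aeval zvar⁻¹ p)) : p = 0 := by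
  ext k
  rw [coeff_zero, ← aeval_inv_coeff]
  exact h _ (by omega)

/-- A tuple of the prescribed degrees is determined by the local forms and the apparent
singularities. -/
lemma coeffTuple_unique (hm : m ∈ phaseSpace S) {c c' : CoeffTuple ν}
    (hC : ∀ i, (c.C i).degree < (S.ord i : ℕ)) (hC' : ∀ i, (c'.C i).degree < (S.ord i : ℕ))
    (hD : ∀ i : Fin ν, (c.D (some i)).degree < (S.ord (some i) : ℕ))
    (hD' : ∀ i : Fin ν, (c'.D (some i)).degree < (S.ord (some i) : ℕ))
    (hCt : c.Ct.degree < (S.numApp : ℕ)) (hCt' : c'.Ct.degree < (S.numApp : ℕ))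
    (ha : ∀ j, cReg m c j + dReg m c j * pc m j - 1 / (polyP m.2).eval (qc m j) * pc m j ^ 2 = 0)
    (ha' : ∀ j, cReg m c' j + dReg m c' j * pc m j
      - 1 / (polyP m.2).eval (qc m j) * pc m j ^ 2 = 0)
    (hl : ∀ i, LocalForm m.2 i (connPole m c i)) (hl' : ∀ i, LocalForm m.2 i (connPole m c' i)) :
    c = c' := by
  have h10 : ∀ i, OrdGE 0 (connPole m c i 1 0 - connPole m c' i 1 0) := fun i => by
    have := (hl i).apply_one_zero.sub (hl' i).apply_one_zero
    rwa [sub_sub_sub_cancel_right] at this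
  have h11 : ∀ i, OrdGE 0 (connPole m c i 1 1 - connPole m c' i 1 1) := fun i => by
    have := (hl i).apply_one_one.sub (hl' i).apply_one_one
    rwa [sub_sub_sub_cancel_right] at this
  have hfin : ∀ (i : Fin ν) (p p' : ℂ[X]) (f f' : Laur), p.degree < (S.ord (some i) : ℕ) →
      p'.degree < (S.ord (some i) : ℕ) →
      OrdGE 0 (f - aeval (cst (pos m.2 i) + zvar) p / zvar ^ S.ord (some i)) →
      OrdGE 0 (f' - aeval (cst (pos m.2 i) + zvar) p' / zvar ^ S.ord (some i)) →
      OrdGE 0 (f - f') → p = p' := by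
    intro i p p' f f' hp hp' h1 h2 h3
    rw [← sub_eq_zero]
    refine eq_zero_of_aeval_shift_ge (n := S.ord (some i)) (t := pos m.2 i)
      ((degree_sub_le _ _).trans_lt (max_lt hp hp')) ?_
    have h4 := (h3.sub h1).add h2
    have e : f - f' - (f - aeval (cst (pos m.2 i) + zvar) p / zvar ^ S.ord (some i))
        + (f' - aeval (cst (pos m.2 i) + zvar) p' / zvar ^ S.ord (some i))
        = zvar ^ (-(S.ord (some i) : ℤ)) * aeval (cst (pos m.2 i) + zvar) (p - p') := by
      rw [zpow_neg, zpow_natCast, map_sub]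
      ring
    rw [e, ordGE_zpow_mul] at h4
    exact h4.mono (by omega)
  have hDf : ∀ i : Fin ν, c.D (some i) = c'.D (some i) := fun i =>
    hfin i _ _ _ _ (hD i) (hD' i) (entryD_finite i hm) (entryD_finite i hm) (h11 (some i))
  have hCf : ∀ i : Fin ν, c.C (some i) = c'.C (some i) := fun i =>
    hfin i _ _ _ _ (hC _) (hC' _) (entryC_finite i hm) (entryC_finite i hm) (h10 (some i))
  have hDi : c.D none = c'.D none := by
    rw [← sub_eq_zero]
    have h1 := connInfty_one_one hD (m := m)
    have h2 := connInfty_one_one hD' (m := m)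
    simp only [← hDf] at h2
    have h3 := ((h1.sub h2).sub (h11 none))
    have e : ∀ a a' b b' r z : Laur, a + z * b - r - (a' + z * b' - r) - (a - a')
        = z * (b - b') := fun a a' b b' r z => by ring
    rw [show connPole m c none = connInfty m c from rfl,
      show connPole m c' none = connInfty m c' from rfl, e, ordGE_zpow_mul, ← map_sub] at h3
    exact eq_zero_of_aeval_inv_ge (h3.mono (by omega))
  have hCi : c.C none = c'.C none := by
    rw [← sub_eq_zero]
    have h1 := connInfty_one_zero hC hCt (m := m)
    have h2 := connInfty_one_zero hC' hCt' (m := m)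
    have h3 := ((h1.sub h2).sub (h10 none))
    have e : ∀ a a' b b' z : Laur, a + z * b - (a' + z * b') - (a - a')
        = z * (b - b') := fun a a' b b' z => by ring
    rw [show connPole m c none = connInfty m c from rfl,
      show connPole m c' none = connInfty m c' from rfl, e, ordGE_zpow_mul, ← map_sub] at h3
    exact eq_zero_of_aeval_inv_ge (h3.mono (by omega))
  have hCt2 : c.Ct = c'.Ct := by
    refine eq_of_degrees_lt_of_eval_index_eq (Finset.univ : Finset (Fin S.numApp)) (v := qc m)
      hm.2.1.injOn (by simpa using hCt) (by simpa using hCt') fun j _ => ?_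
    have h1 := ha j
    rw [← ha' j] at h1
    simp only [cReg, dReg, hDf, hDi, hCf, hCi] at h1
    linear_combination h1
  cases c
  cases c'
  simp only [CoeffTuple.mk.injEq]
  refine ⟨?_, ?_, hCt2⟩
  · funext i
    cases i
    · exact hCi
    · exact hCf _
  · funext i
    cases i
    · exact hDi
    · exact hDf _

end NormalForm

/-! ### Existence and holomorphy of the normal form -/

/-- The normal form without the polynomial `C̃`, read off from the polar parts of the trace and
of the lower left entry that the formal types prescribe. -/
def polarTuple (b : S.Base) : CoeffTuple ν where
  C
    | some i => polarPoly (pos b i) (S.ord (some i)) (lowS b (some i))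
    | none => polarPolyInf (S.ord none) (S.ord none) (lowS b none)
  D
    | some i => polarPoly (pos b i) (S.ord (some i)) (formalType b (some i)).trace
    | none => polarPolyInf (S.ord none) (S.ord none - 1) (formalType b none).trace
  Ct := 0

/-- The value of `C̃` at `q_j` for which `q_j` becomes an apparent singularity. -/
def apparentValue (m : S.Total) (j : Fin S.numApp) : ℂ :=
  1 / (polyP m.2).eval (qc m j) * pc m j ^ 2 - dReg m (polarTuple m.2) j * pc m j
    - cReg m (polarTuple m.2) j

/-- The explicit normal form; `C̃` is found by Lagrange interpolation. -/
def explicitTuple (m : S.Total) : CoeffTuple ν :=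
  { polarTuple m.2 with Ct := Lagrange.interpolate Finset.univ (qc m) (apparentValue m) }

lemma polarPoly_coeff_last (t : ℂ) {n : ℕ} (hn : 1 ≤ n) (f : Laur) :
    (polarPoly t n f).coeff (n - 1) = f.coeff (-1) := by
  obtain ⟨k, rfl⟩ : ∃ k, n = k + 1 := ⟨n - 1, by omega⟩
  rw [polarPoly, finsetSum_coeff, Nat.add_sub_cancel, Finset.sum_range_succ,
    Finset.sum_eq_zero, zero_add, coeff_C_mul]
  · have h1 := ((monic_X_sub_C t).pow k).coeff_natDegree
    rw [natDegree_pow, natDegree_X_sub_C, mul_one] at h1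
    rw [h1, mul_one]
    congr 1
    push_cast
    ring
  · intro l hl
    rw [coeff_C_mul, coeff_eq_zero_of_natDegree_lt, mul_zero]
    rw [natDegree_pow, natDegree_X_sub_C, mul_one]
    exact Finset.mem_range.mp hl

section Explicit

variable {m : S.Total}

lemma explicit_deg_C (m : S.Total) (i : Option (Fin ν)) :
    ((explicitTuple m).C i).degree < (S.ord i : ℕ) := by
  cases i
  · exact polarPolyInf_degree _ _ _
  · exact polarPoly_degree _ _ _

lemma explicit_deg_D (m : S.Total) (i : Fin ν) :
    ((explicitTuple m).D (some i)).degree < (S.ord (some i) : ℕ) :=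
  polarPoly_degree _ _ _

lemma explicit_deg_D_infty (m : S.Total) :
    ((explicitTuple m).D none).degree < ((S.ord none - 1 : ℕ) : WithBot ℕ) :=
  polarPolyInf_degree _ _ _

lemma explicit_deg_Ct (hm : m ∈ phaseSpace S) :
    (explicitTuple m).Ct.degree < (S.numApp : ℕ) := by
  have := Lagrange.degree_interpolate_lt (s := (Finset.univ : Finset (Fin S.numApp)))
    (r := apparentValue m) hm.2.1.injOn
  rwa [Finset.card_univ, Fintype.card_fin] at this

lemma explicit_apparent (hm : m ∈ phaseSpace S) (j : Fin S.numApp) :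
    cReg m (explicitTuple m) j + dReg m (explicitTuple m) j * pc m j
      - 1 / (polyP m.2).eval (qc m j) * pc m j ^ 2 = 0 := by
  have h1 : (explicitTuple m).Ct.eval (qc m j) = apparentValue m j :=
    Lagrange.eval_interpolate_at_node _ hm.2.1.injOn (Finset.mem_univ j)
  have h2 : cReg m (explicitTuple m) j = cReg m (polarTuple m.2) j + apparentValue m j := by
    have h3 : (polarTuple m.2).Ct.eval (qc m j) = 0 := eval_zero
    rw [cReg, cReg, h1, h3]
    simp only [explicitTuple]
    ring
  have h4 : dReg m (explicitTuple m) j = dReg m (polarTuple m.2) j := rfl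
  rw [h2, h4, apparentValue]
  ring

/-- The Fuchs relation makes the residue at infinity the prescribed one. -/
lemma explicit_localForm (hm : m ∈ phaseSpace S) (i : Option (Fin ν)) :
    LocalForm m.2 i (connPole m (explicitTuple m) i) := by
  have htr : ∀ i, OrdGE (-(S.ord i : ℤ)) (formalType m.2 i).trace := fun i =>
    (formalType_ge m.2 i).trace
  refine ⟨connPole_zero_zero i, connPole_zero_one i, ?_, ?_⟩
  · cases i with
    | some i =>
      have h := entryC_finite (c := explicitTuple m) i hm
      have e := aeval_polarPoly (pos m.2 i) (S.ord (some i)) (lowS m.2 (some i))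
      change OrdGE 0 (_ - aeval _ (polarPoly _ _ _) / _) at h
      rw [e] at h
      have h2 := h.sub (sub_polarPart_ge (lowS_ge hm.1 (some i)))
      rwa [sub_sub_sub_cancel_right] at h2
    | none =>
      have h := connInfty_one_zero (m := m) (explicit_deg_C m) (explicit_deg_Ct hm)
      have e := aeval_polarPolyInf (n := S.ord none) (k := S.ord none) (lowS m.2 none) le_rfl
      rw [Nat.sub_self, Nat.cast_zero, neg_zero, zero_sub] at e
      change OrdGE 0 (_ + _ * aeval _ (polarPolyInf _ _ _)) at h
      rw [← sub_neg_eq_add, e] at h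
      have h2 := h.sub (sub_polarPart_ge (lowS_ge hm.1 none))
      rw [polarPart, sub_sub_sub_cancel_right] at h2
      exact h2
  · cases i with
    | some i =>
      have h := entryD_finite (c := explicitTuple m) i hm
      have e := aeval_polarPoly (pos m.2 i) (S.ord (some i)) (formalType m.2 (some i)).trace
      change OrdGE 0 (_ - aeval _ (polarPoly _ _ _) / _) at h
      rw [e] at h
      have h2 := h.sub (sub_polarPart_ge (htr (some i)))
      rwa [sub_sub_sub_cancel_right] at h2
    | none =>
      have hn := S.one_le_ord none
      have h := connInfty_one_one (m := m) (explicit_deg_D m)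
      have e := aeval_polarPolyInf (n := S.ord none) (k := S.ord none - 1)
        (formalType m.2 none).trace (by omega)
      rw [show -((S.ord none - (S.ord none - 1) : ℕ) : ℤ) - 1 = -2 by omega] at e
      have e2 : polarPart (S.ord none) (formalType m.2 none).trace
          = (∑ l ∈ Finset.range (S.ord none - 1), HahnSeries.single ((l : ℤ) - S.ord none)
              ((formalType m.2 none).trace.coeff (l - S.ord none)))
            + cst ((formalType m.2 none).trace.coeff (-1)) * zvar ^ (-1 : ℤ) := by
        have h3 : ((S.ord none - 1 : ℕ) : ℤ) - S.ord none = -1 := by omega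
        conv_lhs => rw [polarPart, show S.ord none = S.ord none - 1 + 1 by omega,
          Finset.sum_range_succ]
        rw [show S.ord none - 1 + 1 = S.ord none by omega, h3, single_eq]
      have e3 : -∑ i : Fin ν, ((explicitTuple m).D (some i)).coeff (S.ord (some i) - 1) - 1
          = (formalType m.2 none).trace.coeff (-1) := by
        have h3 := S.fuchs
        simp only [← formalType_trace_residue m.2] at h3
        rw [Fintype.sum_option] at h3
        have h4 : ∀ i : Fin ν, ((explicitTuple m).D (some i)).coeff (S.ord (some i) - 1)
            = (formalType m.2 (some i)).trace.coeff (-1) := fun i =>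
          polarPoly_coeff_last _ (S.one_le_ord _) _
        simp only [h4]
        linear_combination -h3
      rw [e3] at h
      have h2 := h.sub (sub_polarPart_ge (htr none))
      rw [e2, ← e] at h2
      have e4 : ∀ a b r t : Laur, a + b - r - (t - (-b + r)) = a - t := fun a b r t => by ring
      change OrdGE 0 (_ + zvar ^ (-2 : ℤ) * aeval zvar⁻¹ (polarPolyInf (S.ord none)
        (S.ord none - 1) (formalType m.2 none).trace) - _ - _) at h2
      rw [e4] at h2
      exact h2

end Explicit

/-! #### Holomorphic families of polynomials -/

section HolPoly

variable {E : Type*} [NormedAddCommGroup E] [NormedSpace ℂ E] {U : Set E}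

/-- A holomorphic family of polynomials: its values at holomorphic families of Laurent series are
holomorphic families. -/
def HolPoly (U : Set E) (p : E → ℂ[X]) : Prop :=
  ∀ x : E → Laur, HolFam U x → HolFam U fun m => aeval (x m) (p m)

lemma holPoly_C {a : E → ℂ} (ha : AnalyticOnNhd ℂ a U) : HolPoly U fun m => C (a m) :=
  fun x _ => by
    simp only [aeval_C, algebraMap_eq_cst]
    exact holFam_cst ha

lemma holPoly_X : HolPoly U fun _ => X := fun x hx => by simpa using hx

lemma HolPoly.sub {p q : E → ℂ[X]} (hp : HolPoly U p) (hq : HolPoly U q) :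
    HolPoly U fun m => p m - q m := fun x hx => by
  simpa using (hp x hx).sub (hq x hx)

lemma HolPoly.neg {p : E → ℂ[X]} (hp : HolPoly U p) : HolPoly U fun m => -p m := fun x hx => by
  simpa using (hp x hx).neg

lemma HolPoly.mul (hU : IsOpen U) {p q : E → ℂ[X]} (hp : HolPoly U p) (hq : HolPoly U q) :
    HolPoly U fun m => p m * q m := fun x hx => by
  simpa using (hp x hx).mul hU (hq x hx)

lemma HolPoly.pow (hU : IsOpen U) {p : E → ℂ[X]} (hp : HolPoly U p) (n : ℕ) :
    HolPoly U fun m => p m ^ n := fun x hx => by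
  simpa using (hp x hx).pow hU n

lemma HolPoly.sum {ι : Type*} (s : Finset ι) {p : ι → E → ℂ[X]} (hp : ∀ i ∈ s, HolPoly U (p i)) :
    HolPoly U fun m => ∑ i ∈ s, p i m := fun x hx => by
  simpa using HolFam.sum s fun i hi => hp i hi x hx

lemma HolPoly.prod (hU : IsOpen U) {ι : Type*} (s : Finset ι) {p : ι → E → ℂ[X]}
    (hp : ∀ i ∈ s, HolPoly U (p i)) : HolPoly U fun m => ∏ i ∈ s, p i m := fun x hx => by
  simpa [map_prod] using HolFam.prod hU s fun i hi => hp i hi x hx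

lemma holPoly_polarPoly (hU : IsOpen U) {t : E → ℂ} (ht : AnalyticOnNhd ℂ t U) (n : ℕ) {f : E → Laur}
    (hf : HolFam U f) : HolPoly U fun m => polarPoly (t m) n (f m) :=
  HolPoly.sum _ fun _ _ => (holPoly_C (hf.an _)).mul hU ((holPoly_X.sub (holPoly_C ht)).pow hU _)

lemma holPoly_polarPolyInf (hU : IsOpen U) (n k : ℕ) {f : E → Laur}
    (hf : HolFam U f) : HolPoly U fun m => polarPolyInf n k (f m) :=
  (HolPoly.sum _ fun _ _ => (holPoly_C (hf.an _)).mul hU (holPoly_X.pow hU _)).neg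

lemma holPoly_interpolate (hU : IsOpen U) {N : ℕ} {q r : Fin N → E → ℂ}
    (hq : ∀ j, AnalyticOnNhd ℂ (q j) U) (hr : ∀ j, AnalyticOnNhd ℂ (r j) U)
    (hne : ∀ m ∈ U, ∀ j k, j ≠ k → q j m ≠ q k m) :
    HolPoly U fun m => Lagrange.interpolate Finset.univ (fun j => q j m) fun j => r j m := by
  simp only [Lagrange.interpolate_apply, Lagrange.basis, Lagrange.basisDivisor]
  refine HolPoly.sum _ fun j _ => (holPoly_C (hr j)).mul hU (HolPoly.prod hU _ fun k hk => ?_)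
  exact (holPoly_C (((hq j).sub (hq k)).inv fun m hm => sub_ne_zero.mpr
    (hne m hm j k (Finset.ne_of_mem_erase hk).symm))).mul hU (holPoly_X.sub (holPoly_C (hq k)))

/-- A coordinate centred at a point that is either different from `0` or equal to `0`. -/
lemma unitFam_shift {a : E → ℂ} (ha : AnalyticOnNhd ℂ a U)
    (h : (∀ m ∈ U, a m ≠ 0) ∨ ∀ m ∈ U, a m = 0) : UnitFam U fun m => cst (a m) + zvar := by
  have hf : HolFam U fun m => cst (a m) + zvar := (holFam_cst ha).add (holFam_const zvar)
  rcases h with h | h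
  · exact unitFam_of_val hf (r := a) fun m hm => ⟨val_shift _, h m hm⟩
  · refine ⟨hf, 1, fun m hm => ?_⟩
    have e : cst (a m) + zvar = zvar := by rw [h m hm, cst_zero, zero_add]
    simp only [e]
    refine ⟨ordGE_zvar, ?_⟩
    rw [zvar, HahnSeries.coeff_single_same]
    exact one_ne_zero

end HolPoly

/-! #### Holomorphy of the explicit normal form -/

/-- A holomorphic family of points of the line that stays away from the singularities, or is
centred at one of them. -/
structure AdmissibleFam (x : S.Total → Laur) : Prop where
  hol : HolFam (phaseSpace S) x
  pole : ∀ i, UnitFam (phaseSpace S) fun m => x m - cst (pos m.2 i)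
  app : ∀ j, UnitFam (phaseSpace S) fun m => x m - cst (qc m j)

lemma admissibleFam_shift {a : S.Total → ℂ} (ha : AnalyticOnNhd ℂ a (phaseSpace S))
    (hp : ∀ i, (∀ m ∈ phaseSpace S, a m - pos m.2 i ≠ 0) ∨ ∀ m ∈ phaseSpace S, a m - pos m.2 i = 0)
    (hq : ∀ j, (∀ m ∈ phaseSpace S, a m - qc m j ≠ 0) ∨ ∀ m ∈ phaseSpace S, a m - qc m j = 0) :
    AdmissibleFam fun m => cst (a m) + zvar where
  hol := (holFam_cst ha).add (holFam_const _)
  pole i := (unitFam_shift (ha.sub (analytic_pos i _)) (hp i)).congr isOpen_phaseSpace fun m _ => by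
    simp only [Pi.sub_apply, cst_sub]; ring
  app j := (unitFam_shift (ha.sub (analytic_qc j _)) (hq j)).congr isOpen_phaseSpace fun m _ => by
    simp only [Pi.sub_apply, cst_sub]; ring

lemma admissibleFam_pole (i : Fin ν) :
    AdmissibleFam fun m : S.Total => cst (pos m.2 i) + zvar := by
  refine admissibleFam_shift (analytic_pos i _) (fun k => ?_) fun j => ?_
  · by_cases h : i = k
    · exact Or.inr fun m _ => by rw [h, sub_self]
    · exact Or.inl fun m hm => sub_ne_zero.mpr fun h' => h (hm.1 h')
  · exact Or.inl fun m hm => sub_ne_zero.mpr (hm.2.2.1 j i).symm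

lemma admissibleFam_app (j : Fin S.numApp) :
    AdmissibleFam fun m : S.Total => cst (qc m j) + zvar := by
  refine admissibleFam_shift (analytic_qc j _) (fun i => ?_) fun k => ?_
  · exact Or.inl fun m hm => sub_ne_zero.mpr (hm.2.2.1 j i)
  · by_cases h : j = k
    · exact Or.inr fun m _ => by rw [h, sub_self]
    · exact Or.inl fun m hm => sub_ne_zero.mpr fun h' => h (hm.2.1 h')

lemma admissibleFam_infty : AdmissibleFam fun _ : S.Total => zvar⁻¹ := by
  have h : ∀ {a : S.Total → ℂ}, AnalyticOnNhd ℂ a (phaseSpace S) →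
      UnitFam (phaseSpace S) fun m => zvar⁻¹ - cst (a m) := by
    intro a ha
    have h1 : UnitFam (phaseSpace S) fun m => zvar * (zvar⁻¹ - cst (a m)) :=
      unitFam_of_val ((holFam_const _).mul isOpen_phaseSpace ((holFam_const _).sub
        (holFam_cst ha))) (r := fun _ => 1) fun m _ => ⟨val_inv_shift _, one_ne_zero⟩
    refine ((unitFam_const (inv_ne_zero zvar_ne_zero)).mul isOpen_phaseSpace h1).congr
      isOpen_phaseSpace fun m _ => ?_
    rw [← mul_assoc, inv_mul_cancel₀ zvar_ne_zero, one_mul]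
  exact ⟨holFam_const _, fun i => h (analytic_pos i _), fun j => h (analytic_qc j _)⟩

section Holomorphy

variable {x : S.Total → Laur}

lemma AdmissibleFam.unit_polyP (hx : AdmissibleFam x) :
    UnitFam (phaseSpace S) fun m => aeval (x m) (polyP m.2) := by
  simp only [aeval_polyP]
  exact UnitFam.prod isOpen_phaseSpace _ fun i _ => (hx.pole i).pow isOpen_phaseSpace _

lemma AdmissibleFam.inv_polyP (hx : AdmissibleFam x) :
    UnitFam (phaseSpace S) fun m => 1 / aeval (x m) (polyP m.2) := by
  simp only [one_div]
  exact hx.unit_polyP.inv isOpen_phaseSpace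

/-- The polynomials of a family of coefficient tuples vary holomorphically. -/
structure HolTuple (c : S.Total → CoeffTuple ν) : Prop where
  C : ∀ i, HolPoly (phaseSpace S) fun m => (c m).C i
  D : ∀ i, HolPoly (phaseSpace S) fun m => (c m).D i
  Ct : HolPoly (phaseSpace S) fun m => (c m).Ct

lemma AdmissibleFam.entryC (hx : AdmissibleFam x) {c : S.Total → CoeffTuple ν} (hc : HolTuple c) :
    HolFam (phaseSpace S) fun m => entryC m (c m) (x m) := by
  have hU := isOpen_phaseSpace (S := S)
  exact (((HolFam.sum _ fun i _ => (hc.C _ x hx.hol).div hU ((hx.pole i).pow hU _)).add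
    (HolFam.sum _ fun j _ => (holFam_cst (analytic_pc j _)).div hU (hx.app j))).add
    (hc.Ct x hx.hol)).add ((hx.hol.pow hU _).mul hU (hc.C none x hx.hol))

lemma AdmissibleFam.entryD (hx : AdmissibleFam x) {c : S.Total → CoeffTuple ν} (hc : HolTuple c) :
    HolFam (phaseSpace S) fun m => entryD m (c m) (x m) := by
  have hU := isOpen_phaseSpace (S := S)
  exact ((HolFam.sum _ fun i _ => (hc.D _ x hx.hol).div hU ((hx.pole i).pow hU _)).sub
    (HolFam.sum _ fun j _ => (holFam_const 1).div hU (hx.app j))).add (hc.D none x hx.hol)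

lemma AdmissibleFam.connMatrix (hx : AdmissibleFam x) {c : S.Total → CoeffTuple ν}
    (hc : HolTuple c) : HolFamMat (phaseSpace S) fun m => connMatrix m (c m) (x m) := by
  intro a b
  fin_cases a <;> fin_cases b
  · exact holFam_const 0
  · exact hx.inv_polyP.1
  · exact hx.entryC hc
  · exact hx.entryD hc

lemma unitFam_leadF (i : Option (Fin ν)) :
    UnitFam (phaseSpace S) fun m : S.Total => leadF m.2 i := by
  have hU := isOpen_phaseSpace (S := S)
  cases i with
  | some i => exact (admissibleFam_pole i).inv_polyP
  | none =>
    have hz := inv_ne_zero zvar_ne_zero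
    exact ((unitFam_const (neg_ne_zero.mpr (pow_ne_zero 2 hz))).mul hU
      admissibleFam_infty.inv_polyP).mul hU (unitFam_const (pow_ne_zero _ hz))

lemma holFam_formalType (i : Option (Fin ν)) :
    HolFamMat (phaseSpace S) fun m : S.Total => formalType m.2 i := by
  have hU := isOpen_phaseSpace (S := S)
  by_cases h : S.kind i = Kind.ra
  · simp only [formalType, if_pos h]
    have h1 : ∀ (k : ℕ) (g : ℕ → ℕ), HolFam (phaseSpace S) fun m : S.Total =>
        ∑ l ∈ Finset.range k, HahnSeries.single ((l : ℤ) - S.ord i) (thetaRa m.2 i (g l) / 2) :=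
      fun k g => HolFam.sum _ fun l _ => holFam_single (by
        simp only [div_eq_mul_inv]
        exact (analytic_thetaRa i _ _).mul analyticOnNhd_const) _
    intro a b
    fin_cases a <;> fin_cases b
    · exact h1 _ fun l => 2 * l
    · exact h1 _ fun l => 2 * l + 1
    · exact (holFam_const zvar).mul hU (h1 _ fun l => 2 * l + 1)
    · exact (h1 _ fun l => 2 * l).sub (holFam_const _)
  · simp only [formalType, if_neg h]
    intro a b
    by_cases hab : a = b
    · subst hab
      simp only [formalUn_apply]
      exact HolFam.sum _ fun l _ => holFam_single (analytic_thetaUn i l a _) _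
    · simp only [formalUn, Matrix.diagonal_apply_ne _ hab]
      exact holFam_const 0

lemma holFam_trace_formalType (i : Option (Fin ν)) :
    HolFam (phaseSpace S) fun m : S.Total => (formalType m.2 i).trace := by
  simp only [Matrix.trace_fin_two]
  exact (holFam_formalType i 0 0).add (holFam_formalType i 1 1)

lemma holFam_lowS (i : Option (Fin ν)) :
    HolFam (phaseSpace S) fun m : S.Total => lowS m.2 i :=
  ((holFam_formalType i).det isOpen_phaseSpace).neg.div isOpen_phaseSpace (unitFam_leadF i)

lemma holTuple_polarTuple : HolTuple fun m : S.Total => polarTuple m.2 where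
  C i := by
    cases i with
    | none => exact holPoly_polarPolyInf isOpen_phaseSpace _ _ (holFam_lowS none)
    | some i => exact holPoly_polarPoly isOpen_phaseSpace (analytic_pos i _) _ (holFam_lowS _)
  D i := by
    cases i with
    | none => exact holPoly_polarPolyInf isOpen_phaseSpace _ _ (holFam_trace_formalType none)
    | some i =>
      exact holPoly_polarPoly isOpen_phaseSpace (analytic_pos i _) _ (holFam_trace_formalType _)
  Ct := fun x _ => by
    have : ∀ m : S.Total, aeval (x m) (polarTuple m.2).Ct = 0 := fun m => map_zero _
    simp only [this]
    exact holFam_const 0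

lemma analytic_cReg {c : S.Total → CoeffTuple ν} (hc : HolTuple c) (j : Fin S.numApp) :
    AnalyticOnNhd ℂ (fun m => cReg m (c m) j) (phaseSpace S) := by
  have h := (((admissibleFam_app j).entryC hc).sub ((holFam_cst (analytic_pc j _)).mul
    isOpen_phaseSpace (holFam_const zvar⁻¹))).an 0
  exact h.congr isOpen_phaseSpace fun m hm => (val_entryC_app j hm).2

lemma analytic_dReg {c : S.Total → CoeffTuple ν} (hc : HolTuple c) (j : Fin S.numApp) :
    AnalyticOnNhd ℂ (fun m => dReg m (c m) j) (phaseSpace S) := by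
  have h := (((admissibleFam_app j).entryD hc).add (holFam_const zvar⁻¹)).an 0
  exact h.congr isOpen_phaseSpace fun m hm => (val_entryD_app j hm).2

lemma analytic_inv_polyP (j : Fin S.numApp) :
    AnalyticOnNhd ℂ (fun m : S.Total => 1 / (polyP m.2).eval (qc m j)) (phaseSpace S) :=
  ((admissibleFam_app j).inv_polyP.1.an 0).congr isOpen_phaseSpace
    fun _ hm => (val_leadF_app j hm).2

lemma holTuple_explicitTuple : HolTuple (explicitTuple : S.Total → CoeffTuple ν) where
  C := holTuple_polarTuple.C
  D := holTuple_polarTuple.D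
  Ct := by
    have h1 : ∀ j, AnalyticOnNhd ℂ (fun m : S.Total => apparentValue m j) (phaseSpace S) :=
      fun j => (((analytic_inv_polyP j).mul ((analytic_pc j _).pow 2)).sub
        ((analytic_dReg holTuple_polarTuple j).mul (analytic_pc j _))).sub
        (analytic_cReg holTuple_polarTuple j)
    exact holPoly_interpolate isOpen_phaseSpace (fun j => analytic_qc j _) h1
      fun m hm j k h h' => h (hm.2.1 h')

lemma holFam_explicit_pole (i : Option (Fin ν)) :
    HolFamMat (phaseSpace S) fun m : S.Total => connPole m (explicitTuple m) i := by
  have hU := isOpen_phaseSpace (S := S)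
  have hc := holTuple_explicitTuple (S := S)
  cases i with
  | some i => exact (admissibleFam_pole i).connMatrix hc
  | none =>
    simp only [connPole, connInfty_eq]
    intro a b
    fin_cases a <;> fin_cases b
    · exact holFam_const 0
    · exact (unitFam_leadF none).1
    · exact ((holFam_const _).mul hU (admissibleFam_infty.entryC hc)).neg
    · exact (((holFam_const _).mul hU (admissibleFam_infty.entryD hc)).neg).sub (holFam_const _)

lemma holFam_explicit_app (j : Fin S.numApp) :
    HolFamMat (phaseSpace S) fun m : S.Total => connAt m (explicitTuple m) (qc m j) :=
  (admissibleFam_app j).connMatrix holTuple_explicitTuple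

end Holomorphy

/-! ### Coefficientwise solution of formal equations with holomorphic parameters -/

section Newton

variable {M : Type*} [NormedAddCommGroup M] [NormedSpace ℂ M] {U : Set M} {ι : Type*}

/-- The coefficients of the solution of a system `E(b) = 0` of formal equations: the first `n`
are prescribed, the others are found by solving for the coefficient of order `k` of `E`. -/
def newton (n : ℕ) (θ : ℕ → M → ι → ℂ) (R : ℕ → M → (ι → ℂ) → ι → ℂ)
    (Eq : M → (ι → Laur) → ι → Laur) (k : ℕ) (m : M) : ι → ℂ :=
  if k < n then θ k m
  else R k m fun s => -(Eq m (fun s => ∑ j : Fin k,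
    cst (newton n θ R Eq j m s) * zvar ^ (j : ℕ)) s).coeff k
termination_by k
decreasing_by exact j.2

lemma trunc_coeff (β : ℕ → ℂ) (k j : ℕ) :
    (∑ j : Fin k, cst (β j) * zvar ^ (j : ℕ)).coeff j = if j < k then β j else 0 := by
  rw [Fin.sum_univ_eq_sum_range (fun j => cst (β j) * zvar ^ j), coeff_finsetSum]
  have h : ∀ i : ℕ, (cst (β i) * zvar ^ i).coeff (j : ℤ) = if i = j then β j else 0 := fun i => by
    rw [cst_mul_coeff, ← zpow_natCast, zpow_coeff]
    split_ifs with h1 h2 h2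
    · rw [h2, mul_one]
    · omega
    · omega
    · rw [mul_zero]
  simp only [h, Finset.sum_ite_eq', Finset.mem_range]

lemma trunc_ge (β : ℕ → ℂ) (k : ℕ) : OrdGE 0 (∑ j : Fin k, cst (β j) * zvar ^ (j : ℕ)) :=
  ordGE_sum _ _ fun j _ => ((ordGE_zvar.mono (by omega)).pow _).cst_mul _

/-- A formal equation whose linearisation in the coefficient of order `k` is solved by `R k` has a
solution with given first coefficients, holomorphic in the parameters. -/
lemma exists_formal_solution {n : ℕ} {θ : ℕ → M → ι → ℂ}
    {R : ℕ → M → (ι → ℂ) → ι → ℂ} {Eq : M → (ι → Laur) → ι → Laur}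
    (hθ : ∀ k < n, ∀ s, AnalyticOnNhd ℂ (fun m => θ k m s) U)
    (hE : ∀ b : M → ι → Laur, (∀ s, HolFam U fun m => b m s) →
      (∀ m ∈ U, ∀ s, OrdGE 0 (b m s)) → (∀ m ∈ U, ∀ s, ∀ j < n, (b m s).coeff (j : ℕ) = θ j m s) →
      ∀ s, HolFam U fun m => Eq m (b m) s)
    (hRan : ∀ k, n ≤ k → ∀ w : M → ι → ℂ, (∀ s, AnalyticOnNhd ℂ (fun m => w m s) U) →
      ∀ s, AnalyticOnNhd ℂ (fun m => R k m (w m) s) U)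
    (hR : ∀ m ∈ U, ∀ k, n ≤ k → ∀ b b' : ι → Laur, (∀ s, OrdGE 0 (b s)) → (∀ s, OrdGE 0 (b' s)) →
      (∀ s, ∀ j < n, (b s).coeff (j : ℕ) = θ j m s) →
      (∀ s, ∀ j < n, (b' s).coeff (j : ℕ) = θ j m s) →
      (∀ s, OrdGE k (b s - b' s)) → ∀ w, (∀ s, (b s - b' s).coeff k = R k m w s) →
      ∀ s, (Eq m b s).coeff k = (Eq m b' s).coeff k + w s) :
    ∃ b : M → ι → Laur, (∀ s, HolFam U fun m => b m s) ∧ (∀ m s, OrdGE 0 (b m s)) ∧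
      (∀ m s, ∀ j < n, (b m s).coeff (j : ℕ) = θ j m s) ∧
      ∀ m ∈ U, ∀ k, n ≤ k → ∀ s, (Eq m (b m) s).coeff (k : ℕ) = 0 := by
  set β := newton n θ R Eq with hβ
  have hlt : ∀ k < n, ∀ m, β k m = θ k m := fun k hk m => by
    rw [hβ, newton, if_pos hk]
  have htr : ∀ k, n ≤ k → ∀ m s, ∀ j < n,
      (∑ j : Fin k, cst (β j m s) * zvar ^ (j : ℕ)).coeff (j : ℕ) = θ j m s := by
    intro k hk m s j hj
    rw [trunc_coeff (fun j => β j m s), if_pos (by omega), hlt j hj]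
  have han : ∀ k s, AnalyticOnNhd ℂ (fun m => β k m s) U := by
    intro k
    induction k using Nat.strong_induction_on with
    | _ k ih =>
      intro s
      by_cases hk : k < n
      · simp only [hlt k hk]
        exact hθ k hk s
      · have e : ∀ m, β k m = R k m fun s => -(Eq m (fun s => ∑ j : Fin k,
            cst (β j m s) * zvar ^ (j : ℕ)) s).coeff k := fun m => by
          rw [hβ, newton, if_neg hk]
        simp only [e]
        refine hRan k (by omega) _ (fun s => ?_) s
        have h1 := hE (fun m s => ∑ j : Fin k, cst (β j m s) * zvar ^ (j : ℕ)) (fun s =>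
          HolFam.sum _ fun j _ => by
            have : (fun m => cst (β j m s) * zvar ^ (j : ℕ))
                = fun m => HahnSeries.single ((j : ℕ) : ℤ) (β j m s) := by
              funext m
              rw [single_eq, zpow_natCast]
            rw [this]
            exact holFam_single (ih j j.2 s) _) (fun m _ s => trunc_ge (fun j => β j m s) k)
          (fun m _ s j hj => htr k (by omega) m s j hj) s
        exact (h1.an k).neg
  refine ⟨fun m s => ser fun k => β k m s, fun s => holFam_ser fun k => han k s,
    fun m s => ser_ordGE _, fun m s j hj => by rw [ser_coeff, hlt j hj], ?_⟩
  intro m hm k hk s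
  have h1 := hR m hm k hk (fun s => ser fun k => β k m s)
    (fun s => ∑ j : Fin k, cst (β j m s) * zvar ^ (j : ℕ)) (fun s => ser_ordGE _)
    (fun s => trunc_ge (fun j => β j m s) k) (fun s j hj => by rw [ser_coeff, hlt j hj])
    (htr k hk m) (fun s j hj => ?_)
    (fun s => -(Eq m (fun s => ∑ j : Fin k, cst (β j m s) * zvar ^ (j : ℕ)) s).coeff k)
    (fun s => ?_) s
  · rw [h1, add_neg_cancel]
  · rcases lt_or_ge j 0 with h0 | h0
    · exact ((ser_ordGE _).sub (trunc_ge (fun j => β j m s) k)) j h0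
    · lift j to ℕ using h0
      rw [HahnSeries.coeff_sub, ser_coeff, trunc_coeff (fun j => β j m s),
        if_pos (by exact_mod_cast hj), sub_self]
  · rw [HahnSeries.coeff_sub, ser_coeff, trunc_coeff (fun j => β j m s), if_neg (by omega), sub_zero]
    conv_lhs => rw [hβ, newton, if_neg (by omega)]

end Newton

section Linear

variable {M : Type*} [NormedAddCommGroup M] [NormedSpace ℂ M] {U : Set M}

lemma zvar_mul_dz_coeff (f : Laur) (k : ℤ) : (zvar * dz f).coeff k = k * f.coeff k := by
  rw [zvar_mul_coeff, dz_coeff, sub_add_cancel]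
  push_cast
  ring

/-- Holomorphic power series solutions of a linear system `z y' + N y = 0` whose exponents
`-N(0)` are not positive integers, with an initial value in the kernel of `N(0)`. -/
lemma exists_linear_solution (hU : IsOpen U) {N : M → LMat} (hN : HolFamMat U N)
    (hN0 : ∀ m ∈ U, MatGE 0 (N m)) {y₀ : M → Fin 2 → ℂ}
    (hy₀ : ∀ s, AnalyticOnNhd ℂ (fun m => y₀ m s) U)
    (hk : ∀ m ∈ U, ∀ s, ∑ t, (N m s t).coeff 0 * y₀ m t = 0)
    (hdet : ∀ m ∈ U, ∀ k : ℕ, 1 ≤ k → ((N m 0 0).coeff 0 + k) * ((N m 1 1).coeff 0 + k)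
      - (N m 0 1).coeff 0 * (N m 1 0).coeff 0 ≠ 0) :
    ∃ y : M → Fin 2 → Laur, (∀ s, HolFam U fun m => y m s) ∧ (∀ m s, Val (y m s) (y₀ m s)) ∧
      ∀ m ∈ U, ∀ s, zvar * dz (y m s) + ∑ t, N m s t * y m t = 0 := by
  let D : ℕ → M → ℂ := fun k m => ((N m 0 0).coeff 0 + k) * ((N m 1 1).coeff 0 + k)
      - (N m 0 1).coeff 0 * (N m 1 0).coeff 0
  let R : ℕ → M → (Fin 2 → ℂ) → Fin 2 → ℂ := fun k m w =>
    ![(((N m 1 1).coeff 0 + k) * w 0 - (N m 0 1).coeff 0 * w 1) * (D k m)⁻¹,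
      (((N m 0 0).coeff 0 + k) * w 1 - (N m 1 0).coeff 0 * w 0) * (D k m)⁻¹]
  have hc : ∀ s t, AnalyticOnNhd ℂ (fun m => (N m s t).coeff 0) U := fun s t => (hN s t).an 0
  obtain ⟨y, hy, hyge, hyθ, hyE⟩ := exists_formal_solution (U := U) (n := 1) (θ := fun _ => y₀)
    (R := R) (Eq := fun m b s => zvar * dz (b s) + ∑ t, N m s t * b t)
    (fun _ _ s => hy₀ s)
    (fun b hb _ _ s => ((holFam_const zvar).mul hU (hb s).dz).add
      (HolFam.sum _ fun t _ => (hN s t).mul hU (hb t)))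
    (fun k hk1 w hw s => by
      have hD : AnalyticOnNhd ℂ (fun m => (D k m)⁻¹) U :=
        ((((hc 0 0).add analyticOnNhd_const).mul ((hc 1 1).add analyticOnNhd_const)).sub
          ((hc 0 1).mul (hc 1 0))).inv fun m hm => hdet m hm k hk1
      fin_cases s
      · exact ((((hc 1 1).add analyticOnNhd_const).mul (hw 0)).sub ((hc 0 1).mul (hw 1))).mul hD
      · exact ((((hc 0 0).add analyticOnNhd_const).mul (hw 1)).sub ((hc 1 0).mul (hw 0))).mul hD)
    (by
      intro m hm k hk1 b b' _ _ _ _ hbb w hw s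
      have h1 : zvar * dz (b s) + ∑ t, N m s t * b t - (zvar * dz (b' s) + ∑ t, N m s t * b' t)
          = zvar * dz (b s - b' s) + ∑ t, N m s t * (b t - b' t) := by
        simp only [Fin.sum_univ_two, dz_sub]
        ring
      have h2 : ∀ t, (N m s t * (b t - b' t)).coeff k = (N m s t).coeff 0 * R k m w t := fun t => by
        rw [coeff_mul_lead (hN0 m hm s t) (hbb t) (by ring), hw]
      have hD := hdet m hm k hk1
      rw [← sub_eq_iff_eq_add', ← HahnSeries.coeff_sub, h1, HahnSeries.coeff_add,
        zvar_mul_dz_coeff, hw, coeff_finsetSum, Finset.sum_congr rfl fun t _ => h2 t,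
        Fin.sum_univ_two]
      have hD' : (D k m)⁻¹ * D k m = 1 := inv_mul_cancel₀ hD
      fin_cases s
      · simp only [R, Matrix.cons_val_zero, Matrix.cons_val_one, Fin.zero_eta]
        simp only [D] at hD' ⊢
        push_cast
        linear_combination w 0 * hD'
      · simp only [R, Matrix.cons_val_zero, Matrix.cons_val_one, Fin.mk_one]
        simp only [D] at hD' ⊢
        push_cast
        linear_combination w 1 * hD')
  refine ⟨y, hy, fun m s => ⟨hyge m s, by simpa using hyθ m s 0 one_pos⟩, fun m hm s => ?_⟩
  have hge : OrdGE 0 (zvar * dz (y m s) + ∑ t, N m s t * y m t) :=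
    ((ordGE_zvar.mono (M := 0) (by omega)).mul (hyge m s).dz_zero (K := 0) (by omega)).add
      (ordGE_sum _ _ fun t _ => (hN0 m hm s t).mul (hyge m t) (by omega))
  refine ext_nat hge (ordGE_zero 0) fun k => ?_
  rcases Nat.eq_zero_or_pos k with rfl | h
  · have h2 : ∀ t, (N m s t * y m t).coeff 0 = (N m s t).coeff 0 * y₀ m t := fun t => by
      rw [coeff_mul_lead (hN0 m hm s t) (hyge m t) (by ring)]
      congr 1
      simpa using hyθ m t 0 one_pos
    rw [HahnSeries.coeff_add, zvar_mul_dz_coeff, coeff_finsetSum, Nat.cast_zero,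
      Finset.sum_congr rfl fun t _ => h2 t, hk m hm s]
    simp
  · exact hyE m hm k h s

end Linear

/-! #### Compositions of gauge transformations -/

lemma gaugeTransform_mul {g h A : LMat} (hg : g.det ≠ 0) (hh : h.det ≠ 0) :
    gaugeTransform (g * h) A = gaugeTransform h (gaugeTransform g A) := by
  have hgh : (g * h).det ≠ 0 := by
    rw [Matrix.det_mul]
    exact mul_ne_zero hg hh
  rw [gaugeTransform_eq_iff hgh]
  have h1 := (gaugeTransform_eq_iff hg (A := A)).mp rfl
  have h2 := (gaugeTransform_eq_iff hh (A := gaugeTransform g A)).mp rfl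
  rw [mul_assoc, h2, mul_add, ← mul_assoc, h1, ddz_mul]
  noncomm_ring

lemma seriesMat_of_ge {A : LMat} (hA : MatGE 0 A) :
    seriesMat (fun s => Matrix.of fun a b => (A a b).coeff s) = A := by
  ext a b : 1
  exact ser_self (hA a b)

lemma formallyEquivalent_of_ge {G A B : LMat} (hG : MatGE 0 G) (hdet : G.det.coeff 0 ≠ 0)
    (h : gaugeTransform G A = B) : FormallyEquivalent A B := by
  refine ⟨fun s => Matrix.of fun a b => (G a b).coeff s, ?_, by rwa [seriesMat_of_ge hG]⟩
  have h1 := (seriesMat_det fun s => Matrix.of fun a b => (G a b).coeff (s : ℕ)).2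
  rw [seriesMat_of_ge hG] at h1
  rwa [← h1]

/-! ### Formal diagonalisation at a regular or unramified pole -/

section UnramFrame

variable {i : Option (Fin ν)} {A : S.Total → LMat}

/-- The prescribed exponents as a power series `∑_l θ_l z^l`. -/
def expUn (b : S.Base) (i : Option (Fin ν)) (s : Fin 2) : Laur :=
  ∑ l ∈ Finset.range (S.ord i), HahnSeries.single (l : ℤ) (thetaUn b i l s)

lemma expUn_ge (b : S.Base) (i : Option (Fin ν)) (s : Fin 2) : OrdGE 0 (expUn b i s) :=
  ordGE_sum _ _ fun _ _ => (ordGE_single _ _).mono (by omega)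

lemma formalUn_eq (b : S.Base) (i : Option (Fin ν)) (s : Fin 2) :
    formalUn b i s s = zvar ^ (-(S.ord i : ℤ)) * expUn b i s := by
  rw [formalUn_apply, expUn, Finset.mul_sum]
  refine Finset.sum_congr rfl fun l _ => ?_
  rw [single_eq, single_eq, mul_left_comm, ← zpow_add₀ zvar_ne_zero]
  congr 2
  ring

lemma expUn_coeff (b : S.Base) (i : Option (Fin ν)) (s : Fin 2) {l : ℕ} (hl : l < S.ord i) :
    (expUn b i s).coeff l = thetaUn b i l s := by
  have := single_sum_coeff (S.ord i) 0 (fun l => thetaUn b i l s) hl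
  simpa [expUn] using this

/-- The quadratic differential equation for `b = z^n B`, where `(1, b/u)` spans an invariant line
with eigenvalue `B`. -/
def riccatiUn (n : ℕ) (u c d b : Laur) : Laur :=
  u * (zvar ^ n * c) + (zvar ^ n * d) * b + zvar ^ n * (dz b - b * (dz u * u⁻¹)) - b ^ 2

/-- A solution of the Riccati equation gives a column of the diagonalising gauge. -/
lemma riccatiUn_column {n : ℕ} {u c d b : Laur} (hu : u ≠ 0) (h : riccatiUn n u c d b = 0) :
    c + d * (b * u⁻¹) + dz (b * u⁻¹) = zvar ^ (-(n : ℤ)) * b * (b * u⁻¹) := by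
  have hz : zvar ^ n ≠ 0 := pow_ne_zero _ zvar_ne_zero
  rw [dz_mul, dz_inv hu, zpow_neg, zpow_natCast]
  rw [riccatiUn] at h
  field_simp at h ⊢
  linear_combination h

/-- The Riccati equation modulo `z^n` is the characteristic equation of the formal type. -/
lemma riccatiUn_approx (hi : S.kind i ≠ Kind.ra) {m : S.Total} (hm : m ∈ phaseSpace S)
    {A : LMat} (hA : LocalForm m.2 i A) {b : Laur} (hb : OrdGE 0 b) (s : Fin 2)
    (hbs : OrdGE (S.ord i) (b - expUn m.2 i s)) :
    OrdGE (S.ord i) (riccatiUn (S.ord i) (leadU m.2 i) (A 1 0) (A 1 1) b) := by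
  have hz := zvar_ne_zero
  have hf := leadF_ne hm.1 i
  have hu := (val_leadU hm.1 i)
  have hzn : ∀ f, OrdGE 0 f → OrdGE (S.ord i) (zvar ^ S.ord i * f) := fun f hf => by
    rw [← zpow_natCast, ordGE_zpow_mul, sub_self]
    exact hf
  have e : riccatiUn (S.ord i) (leadU m.2 i) (A 1 0) (A 1 1) b
      = leadU m.2 i * (zvar ^ S.ord i * (A 1 0 - lowS m.2 i))
        + (zvar ^ S.ord i * (A 1 1 - (formalType m.2 i).trace)) * b
        + zvar ^ S.ord i * (dz b - b * (dz (leadU m.2 i) * (leadU m.2 i)⁻¹))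
        - (b - expUn m.2 i 0) * (b - expUn m.2 i 1) := by
    have ht : formalType m.2 i = formalUn m.2 i := by rw [formalType, if_neg hi]
    have h01 : formalUn m.2 i 0 1 = 0 := Matrix.diagonal_apply_ne _ (by decide)
    have e1 : leadU m.2 i * (zvar ^ S.ord i * lowS m.2 i)
        = -(expUn m.2 i 0 * expUn m.2 i 1) := by
      rw [lowS, ht, Matrix.det_fin_two, h01, formalUn_eq, formalUn_eq, leadU, zpow_neg,
        zpow_natCast]
      field_simp
      ring
    have e2 : zvar ^ S.ord i * (formalType m.2 i).trace = expUn m.2 i 0 + expUn m.2 i 1 := by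
      rw [ht, Matrix.trace_fin_two, formalUn_eq, formalUn_eq, zpow_neg, zpow_natCast]
      field_simp
    rw [riccatiUn]
    linear_combination e1 + b * e2
  rw [e]
  refine OrdGE.sub (OrdGE.add (OrdGE.add ?_ ?_) ?_) ?_
  · exact hu.1.mul (hzn _ hA.apply_one_zero) (by omega)
  · exact (hzn _ hA.apply_one_one).mul hb (by omega)
  · exact hzn _ (hb.dz_zero.sub (hb.mul (hu.1.dz_zero.mul (hu.inv (leadR_ne hm.1 i)).1
      (K := 0) (by omega)) (by omega)))
  · have h1 : ∀ t, OrdGE 0 (b - expUn m.2 i t) := fun t => hb.sub (expUn_ge _ _ _)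
    fin_cases s
    · exact hbs.mul (h1 1) (by omega)
    · exact (h1 0).mul hbs (by omega)

/-- The linearisation of the Riccati equation at the coefficient of order `k`. -/
lemma riccatiUn_sub {n k : ℕ} (hn : 1 ≤ n) {u c d b b' : Laur} {r : ℂ} (hu : Val u r)
    (hr : r ≠ 0) (hd : OrdGE (-n) d) (hb : OrdGE 0 b) (hb' : OrdGE 0 b')
    (hbb : b'.coeff 0 = b.coeff 0) (h : OrdGE k (b - b')) :
    (riccatiUn n u c d b).coeff k - (riccatiUn n u c d b').coeff k
      = ((if n = 1 then (k : ℂ) else 0) + d.coeff (-n) - 2 * b.coeff 0) * (b - b').coeff k := by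
  obtain ⟨δ, hδ⟩ : ∃ δ, δ = b - b' := ⟨_, rfl⟩
  have e : riccatiUn n u c d b - riccatiUn n u c d b'
      = zvar ^ (n : ℤ) * d * δ + zvar ^ (n : ℤ) * dz δ - zvar ^ (n : ℤ) * (δ * (dz u * u⁻¹))
        - δ * (b + b') := by
    rw [riccatiUn, riccatiUn, hδ, dz_sub, zpow_natCast]
    ring
  rw [← hδ] at h ⊢
  have h1 : (zvar ^ (n : ℤ) * d * δ).coeff k = d.coeff (-n) * δ.coeff k := by
    rw [coeff_mul_lead (N := 0) (M := k) _ h (by ring), zpow_mul_coeff, zero_sub]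
    rw [ordGE_zpow_mul]
    exact hd.mono (by omega)
  have h2 : (zvar ^ (n : ℤ) * dz δ).coeff k = (if n = 1 then (k : ℂ) else 0) * δ.coeff k := by
    rw [zpow_mul_coeff, dz_coeff]
    split_ifs with h0
    · rw [h0]
      push_cast
      rw [sub_add_cancel, sub_add_cancel]
    · rw [h _ (by omega), mul_zero, zero_mul]
  have h3 : (zvar ^ (n : ℤ) * (δ * (dz u * u⁻¹))).coeff k = 0 := by
    rw [zpow_mul_coeff]
    exact (h.mul (hu.1.dz_zero.mul (hu.inv hr).1 (K := 0) (by omega)) (K := k) (by omega)) _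
      (by omega)
  have h4 : (δ * (b + b')).coeff k = δ.coeff k * (2 * b.coeff 0) := by
    rw [coeff_mul_lead h (hb.add hb') (by ring), HahnSeries.coeff_add, hbb]
    ring
  rw [← HahnSeries.coeff_sub, e, HahnSeries.coeff_sub, HahnSeries.coeff_sub, HahnSeries.coeff_add,
    h1, h2, h3, h4]
  ring

lemma formalUn_trace_lead (b : S.Base) (hi : S.kind i ≠ Kind.ra) :
    (formalType b i).trace.coeff (-(S.ord i : ℤ)) = thetaUn b i 0 0 + thetaUn b i 0 1 := by
  have hn := S.one_le_ord i
  have h : ∀ s, (formalUn b i s s).coeff (-(S.ord i : ℤ)) = thetaUn b i 0 s := fun s => by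
    rw [formalUn_eq, zpow_mul_coeff, sub_self]
    exact_mod_cast expUn_coeff b i s (l := 0) (by omega)
  rw [formalType, if_neg hi, Matrix.trace_fin_two, HahnSeries.coeff_add, h, h]

/-- Holomorphic solutions of the Riccati equations at a regular or unramified pole. -/
lemma exists_riccatiUn (hi : S.kind i ≠ Kind.ra) (hA : HolFamMat (phaseSpace S) A)
    (hl : ∀ m ∈ phaseSpace S, LocalForm m.2 i (A m)) :
    ∃ b : S.Total → Fin 2 → Laur, (∀ s, HolFam (phaseSpace S) fun m => b m s) ∧
      (∀ m s, OrdGE 0 (b m s)) ∧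
      (∀ m s, ∀ l < S.ord i, (b m s).coeff (l : ℕ) = thetaUn m.2 i l s) ∧
      ∀ m ∈ phaseSpace S, ∀ s,
        riccatiUn (S.ord i) (leadU m.2 i) (A m 1 0) (A m 1 1) (b m s) = 0 := by
  have hU := isOpen_phaseSpace (S := S)
  have hn := S.one_le_ord i
  have hun : UnitFam (phaseSpace S) fun m : S.Total => leadU m.2 i :=
    (unitFam_const (pow_ne_zero _ zvar_ne_zero)).mul hU (unitFam_leadF i)
  have hd : ∀ m ∈ phaseSpace S, OrdGE (-(S.ord i : ℤ)) (A m 1 1) := fun m hm =>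
    (hl m hm).apply_one_one.of_sub (formalType_ge m.2 i).trace (by omega)
  have hd0 : ∀ m ∈ phaseSpace S, (A m 1 1).coeff (-(S.ord i : ℤ))
      = thetaUn m.2 i 0 0 + thetaUn m.2 i 0 1 := fun m hm => by
    rw [← formalUn_trace_lead m.2 hi]
    exact coeff_eq_of_sub (hl m hm).apply_one_one (by omega)
  let L : ℕ → S.Total → Fin 2 → ℂ := fun k m s => (if S.ord i = 1 then (k : ℂ) else 0)
    + (thetaUn m.2 i 0 0 + thetaUn m.2 i 0 1) - 2 * thetaUn m.2 i 0 s
  have hL : ∀ m ∈ phaseSpace S, ∀ k, S.ord i ≤ k → ∀ s, L k m s ≠ 0 := by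
    intro m hm k hk s
    have hne := thetaUn_lead_ne hi hm
    by_cases h1 : S.ord i = 1
    · have hreg : S.kind i = Kind.reg := by
        by_contra h
        have := S.ord_irr i h
        omega
      have h2 : ∀ s, thetaUn m.2 i 0 s = S.res i s := fun s => by
        have := thetaUn_last m.2 i s
        rwa [h1] at this
      simp only [L, if_pos h1, h2]
      intro h
      fin_cases s
      · refine S.nonres i hreg k ?_
        simp only [Fin.zero_eta] at h
        push_cast
        linear_combination -h
      · refine S.nonres i hreg (-k) ?_
        simp only [Fin.mk_one] at h
        push_cast
        linear_combination h
    · simp only [L, if_neg h1]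
      intro h
      apply hne
      fin_cases s
      · simp only [Fin.zero_eta] at h
        linear_combination -h
      · simp only [Fin.mk_one] at h
        linear_combination h
  obtain ⟨b, hb, hbge, hbθ, hbE⟩ := exists_formal_solution (U := phaseSpace S) (n := S.ord i)
    (θ := fun l m s => thetaUn m.2 i l s) (R := fun k m w s => w s * (L k m s)⁻¹)
    (Eq := fun m b s => riccatiUn (S.ord i) (leadU m.2 i) (A m 1 0) (A m 1 1) (b s))
    (fun l _ s => analytic_thetaUn i l s _)
    (fun b hb _ _ s => by
      have hz : HolFam (phaseSpace S) fun _ : S.Total => zvar ^ S.ord i := holFam_const _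
      exact (((hun.1.mul hU (hz.mul hU (hA 1 0))).add ((hz.mul hU (hA 1 1)).mul hU (hb s))).add
        (hz.mul hU ((hb s).dz.sub ((hb s).mul hU (hun.1.dz.mul hU (hun.inv hU).1))))).sub
        ((hb s).pow hU 2))
    (fun k hk w hw s => (hw s).mul (AnalyticOnNhd.inv
      ((analyticOnNhd_const.add ((analytic_thetaUn i 0 0 _).add (analytic_thetaUn i 0 1 _))).sub
        (analyticOnNhd_const.mul (analytic_thetaUn i 0 s _))) fun m hm => hL m hm k hk s))
    (fun m hm k hk b b' hb hb' hbθ hbθ' hbb w hw s => by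
      have h0 := hbθ s 0 (by omega)
      have h0' := hbθ' s 0 (by omega)
      have h := riccatiUn_sub hn (c := A m 1 0) (val_leadU hm.1 i) (leadR_ne hm.1 i) (hd m hm)
        (hb s) (hb' s) (by exact_mod_cast h0'.trans h0.symm) (hbb s)
      rw [← sub_eq_iff_eq_add', h, hw s, hd0 m hm]
      have h0c : (b s).coeff 0 = thetaUn m.2 i 0 s := by exact_mod_cast h0
      rw [h0c]
      have hLk := hL m hm k hk s
      rw [mul_left_comm]
      exact (congrArg (w s * ·) (mul_inv_cancel₀ hLk)).trans (mul_one _))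
  refine ⟨b, hb, hbge, hbθ, fun m hm s => ?_⟩
  have hsub : OrdGE (S.ord i) (b m s - expUn m.2 i s) := by
    intro k hk
    rcases lt_or_ge k 0 with h0 | h0
    · exact (hbge m s).sub (expUn_ge _ _ _) k h0
    · lift k to ℕ using h0
      have hk' : k < S.ord i := by exact_mod_cast hk
      rw [HahnSeries.coeff_sub, hbθ m s k hk', expUn_coeff _ _ _ hk', sub_self]
  have happ := riccatiUn_approx hi hm (hl m hm) (hbge m s) s hsub
  refine ext_nat (happ.mono (by omega)) (ordGE_zero 0) fun k => ?_
  rcases lt_or_ge k (S.ord i) with h | h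
  · rw [happ k (by exact_mod_cast h)]
    rfl
  · rw [hbE m hm k h s]
    rfl

/-! #### Frames from gauge transformations -/

/-- The constant term of a matrix of power series. -/
def leadMat (G : LMat) : CMat := Matrix.of fun a b => (G a b).coeff 0

/-- The coefficients of `Ξ`, where `G = Φ Ξ` with the constant term `Φ` of `G`. -/
def xiCoeff (G : LMat) (s : ℕ) : CMat :=
  Matrix.of fun a b => (((cstMat (leadMat G))⁻¹ * G) a b).coeff s

lemma leadMat_val {G : LMat} (hG : MatGE 0 G) (a b : Fin 2) : Val (G a b) (leadMat G a b) :=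
  ⟨hG a b, rfl⟩

lemma leadMat_det {G : LMat} (hG : MatGE 0 G) : (leadMat G).det = G.det.coeff 0 :=
  (det_val (leadMat_val hG)).2.symm

lemma leadMat_inv_mul_val {G : LMat} (hG : MatGE 0 G) (hd : (leadMat G).det ≠ 0) (a b : Fin 2) :
    Val (((cstMat (leadMat G))⁻¹ * G) a b) ((1 : CMat) a b) := by
  have h := val_sum Finset.univ (fun c => cst ((leadMat G)⁻¹ a c) * G c b)
    (fun c => (leadMat G)⁻¹ a c * leadMat G c b) fun c _ => (val_cst _).mul (leadMat_val hG c b)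
  rw [← Matrix.nonsing_inv_mul _ (isUnit_iff_ne_zero.mpr hd), cstMat_inv hd]
  exact h

lemma frame_mul_eq {G : LMat} (hG : MatGE 0 G) (hd : (leadMat G).det ≠ 0) :
    cstMat (leadMat G) * seriesMat (xiCoeff G) = G := by
  have h1 : seriesMat (xiCoeff G) = (cstMat (leadMat G))⁻¹ * G :=
    seriesMat_of_ge fun a b => (leadMat_inv_mul_val hG hd a b).1
  have h2 : IsUnit (cstMat (leadMat G)).det := by
    rw [cstMat_det]
    exact isUnit_iff_ne_zero.mpr (cst_ne_zero hd)
  rw [h1, ← mul_assoc, Matrix.mul_nonsing_inv _ h2, one_mul]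

lemma xiCoeff_zero {G : LMat} (hG : MatGE 0 G) (hd : (leadMat G).det ≠ 0) : xiCoeff G 0 = 1 := by
  ext a b
  simpa [xiCoeff] using (leadMat_inv_mul_val hG hd a b).2

lemma holMat_leadMat {G : S.Total → LMat} (hG : HolFamMat (phaseSpace S) G) :
    HolMat fun m => leadMat (G m) := fun a b => (hG a b).an 0

lemma holFam_leadMat_inv_mul {G : S.Total → LMat} (hG : HolFamMat (phaseSpace S) G)
    (hd : ∀ m ∈ phaseSpace S, (leadMat (G m)).det ≠ 0) :
    HolFamMat (phaseSpace S) fun m => (cstMat (leadMat (G m)))⁻¹ * G m := by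
  have hU := isOpen_phaseSpace (S := S)
  have h1 : HolFamMat (phaseSpace S) fun m => cstMat (leadMat (G m)) :=
    holFamMat_cstMat fun a b => (hG a b).an 0
  refine (h1.inv hU (unitFam_of_val (h1.det hU) (r := fun m => (leadMat (G m)).det)
    fun m hm => ⟨?_, hd m hm⟩)).mul hU hG
  rw [cstMat_det]
  exact val_cst _

lemma holMat_xiCoeff {G : S.Total → LMat} (hG : HolFamMat (phaseSpace S) G)
    (hd : ∀ m ∈ phaseSpace S, (leadMat (G m)).det ≠ 0) (s : ℕ) :
    HolMat fun m => xiCoeff (G m) s := fun a b => (holFam_leadMat_inv_mul hG hd a b).an s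

lemma gaugeTransform_diagonal {h B : Fin 2 → Laur} (hh : ∀ s, h s ≠ 0) :
    gaugeTransform (Matrix.diagonal h) (Matrix.diagonal B)
      = Matrix.diagonal fun s => B s + dz (h s) * (h s)⁻¹ := by
  have hd : (Matrix.diagonal h).det ≠ 0 := by
    rw [Matrix.det_diagonal, Fin.prod_univ_two]
    exact mul_ne_zero (hh 0) (hh 1)
  rw [gaugeTransform_eq_iff hd, Matrix.diagonal_mul_diagonal, Matrix.diagonal_mul_diagonal]
  ext a b : 1
  rw [Matrix.add_apply, ddz_apply]
  by_cases hab : a = b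
  · subst hab
    have := hh a
    simp only [Matrix.diagonal_apply_eq]
    field_simp
    ring
  · simp only [Matrix.diagonal_apply_ne _ hab, dz_zero, add_zero]

/-- A gauge transformation whose columns are `(1, b_s/u)` diagonalises the connection. -/
lemma gaugeTransform_columns {n : ℕ} {u : Laur} {b : Fin 2 → Laur} {A : LMat} (hu : u ≠ 0)
    (h00 : A 0 0 = 0) (h01 : A 0 1 = zvar ^ (-(n : ℤ)) * u)
    (hb : ∀ s, riccatiUn n u (A 1 0) (A 1 1) (b s) = 0)
    (hd : (!![1, 1; b 0 * u⁻¹, b 1 * u⁻¹] : LMat).det ≠ 0) :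
    gaugeTransform !![1, 1; b 0 * u⁻¹, b 1 * u⁻¹] A
      = Matrix.diagonal fun s => zvar ^ (-(n : ℤ)) * b s := by
  have huu : u * u⁻¹ = 1 := mul_inv_cancel₀ hu
  have e0 := riccatiUn_column hu (hb 0)
  have e1 := riccatiUn_column hu (hb 1)
  rw [gaugeTransform_eq_iff hd]
  ext r s : 1
  rw [Matrix.mul_diagonal, Matrix.add_apply, ddz_apply, Matrix.mul_apply, Fin.sum_univ_two]
  fin_cases r <;> fin_cases s <;>
    simp only [Matrix.of_apply, Matrix.cons_val_zero, Matrix.cons_val_one, Matrix.cons_val',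
      Matrix.cons_val_fin_one, Fin.zero_eta, Fin.mk_one, dz_one, h00, h01]
  · linear_combination -(zvar ^ (-(n : ℤ)) * b 0) * huu
  · linear_combination -(zvar ^ (-(n : ℤ)) * b 1) * huu
  · linear_combination -e0
  · linear_combination -e1

/-- Existence of holomorphic compatible frames at a regular or unramified pole. -/
lemma exists_unram_frame (hi : S.kind i ≠ Kind.ra) (hA : HolFamMat (phaseSpace S) A)
    (hl : ∀ m ∈ phaseSpace S, LocalForm m.2 i (A m)) :
    ∃ G : S.Total → LMat, HolFamMat (phaseSpace S) G ∧ ∀ m ∈ phaseSpace S,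
      MatGE 0 (G m) ∧ (leadMat (G m)).det ≠ 0 ∧ (∀ s, 0 < s → ∀ a, xiCoeff (G m) s a a = 0) ∧
      (gaugeTransform (G m) (A m)).IsDiag ∧
      ∀ s, OrdGE 0 (gaugeTransform (G m) (A m) s s - formalUn m.2 i s s) := by
  have hU := isOpen_phaseSpace (S := S)
  have hn := S.one_le_ord i
  obtain ⟨b, hb, hbge, hbθ, hbE⟩ := exists_riccatiUn hi hA hl
  have hun : UnitFam (phaseSpace S) fun m : S.Total => leadU m.2 i :=
    (unitFam_const (pow_ne_zero _ zvar_ne_zero)).mul hU (unitFam_leadF i)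
  let G₀ : S.Total → LMat := fun m =>
    !![1, 1; b m 0 * (leadU m.2 i)⁻¹, b m 1 * (leadU m.2 i)⁻¹]
  have hG₀ : HolFamMat (phaseSpace S) G₀ := by
    intro r s
    fin_cases r <;> fin_cases s
    · exact holFam_const 1
    · exact holFam_const 1
    · exact (hb 0).mul hU (hun.inv hU).1
    · exact (hb 1).mul hU (hun.inv hU).1
  have hui : ∀ m ∈ phaseSpace S, Val (leadU m.2 i)⁻¹ (leadR m.2 i)⁻¹ := fun m hm =>
    (val_leadU hm.1 i).inv (leadR_ne hm.1 i)
  have hbv : ∀ m s, Val (b m s) (thetaUn m.2 i 0 s) := fun m s =>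
    ⟨hbge m s, by exact_mod_cast hbθ m s 0 (by omega)⟩
  have hG₀ge : ∀ m ∈ phaseSpace S, MatGE 0 (G₀ m) := by
    intro m hm r s
    fin_cases r <;> fin_cases s
    · exact ordGE_one
    · exact ordGE_one
    · exact ((hbv m 0).mul (hui m hm)).1
    · exact ((hbv m 1).mul (hui m hm)).1
  have hG₀d : ∀ m ∈ phaseSpace S, (leadMat (G₀ m)).det ≠ 0 := by
    intro m hm
    have e : leadMat (G₀ m) = !![1, 1; thetaUn m.2 i 0 0 * (leadR m.2 i)⁻¹,
        thetaUn m.2 i 0 1 * (leadR m.2 i)⁻¹] := by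
      ext r s
      fin_cases r <;> fin_cases s
      · exact val_one.2
      · exact val_one.2
      · exact ((hbv m 0).mul (hui m hm)).2
      · exact ((hbv m 1).mul (hui m hm)).2
    rw [e, Matrix.det_fin_two_of, one_mul, one_mul, ← sub_mul]
    exact mul_ne_zero (sub_ne_zero.mpr (thetaUn_lead_ne hi hm).symm)
      (inv_ne_zero (leadR_ne hm.1 i))
  have hG₀d' : ∀ m ∈ phaseSpace S, (G₀ m).det ≠ 0 := fun m hm =>
    ne_zero_of_coeff (N := 0) (by rw [← leadMat_det (hG₀ge m hm)]; exact hG₀d m hm)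
  -- the columns are rescaled so that the diagonal of `Ξ` becomes `1`
  let W : S.Total → LMat := fun m => (cstMat (leadMat (G₀ m)))⁻¹ * G₀ m
  have hWf : HolFamMat (phaseSpace S) W := holFam_leadMat_inv_mul hG₀ hG₀d
  have hWv : ∀ m ∈ phaseSpace S, ∀ s, Val (W m s s) 1 := fun m hm s => by
    have := leadMat_inv_mul_val (hG₀ge m hm) (hG₀d m hm) s s
    rwa [Matrix.one_apply_eq] at this
  have hWne : ∀ m ∈ phaseSpace S, ∀ s, W m s s ≠ 0 := fun m hm s =>
    ne_zero_of_coeff (N := 0) (by rw [(hWv m hm s).2]; exact one_ne_zero)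
  have hWi : ∀ m ∈ phaseSpace S, ∀ s, Val (W m s s)⁻¹ 1 := fun m hm s => by
    simpa using (hWv m hm s).inv one_ne_zero
  let D : S.Total → LMat := fun m => Matrix.diagonal fun s => (W m s s)⁻¹
  have hD : HolFamMat (phaseSpace S) D := by
    intro r s
    by_cases hrs : r = s
    · subst hrs
      simp only [D, Matrix.diagonal_apply_eq]
      exact ((unitFam_of_val (hWf r r) (r := fun _ => 1)
        fun m hm => ⟨hWv m hm r, one_ne_zero⟩).inv hU).1
    · simp only [D, Matrix.diagonal_apply_ne _ hrs]
      exact holFam_const 0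
  have hDv : ∀ m ∈ phaseSpace S, ∀ r s, Val (D m r s) ((1 : CMat) r s) := by
    intro m hm r s
    by_cases hrs : r = s
    · subst hrs
      simp only [D, Matrix.diagonal_apply_eq, Matrix.one_apply_eq]
      exact hWi m hm r
    · simp only [D, Matrix.diagonal_apply_ne _ hrs, Matrix.one_apply_ne hrs]
      exact val_zero
  have hDd : ∀ m ∈ phaseSpace S, (D m).det ≠ 0 := fun m hm => by
    simp only [D, Matrix.det_diagonal, Fin.prod_univ_two]
    exact mul_ne_zero (inv_ne_zero (hWne m hm 0)) (inv_ne_zero (hWne m hm 1))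
  have hGge : ∀ m ∈ phaseSpace S, MatGE 0 (G₀ m * D m) := fun m hm =>
    (hG₀ge m hm).mul (fun r s => (hDv m hm r s).1) (by omega)
  have hlead : ∀ m ∈ phaseSpace S, leadMat (G₀ m * D m) = leadMat (G₀ m) := by
    intro m hm
    ext r s
    have h := (val_sum Finset.univ (fun c => G₀ m r c * D m c s)
      (fun c => leadMat (G₀ m) r c * (1 : CMat) c s)
      fun c _ => (leadMat_val (hG₀ge m hm) r c).mul (hDv m hm c s)).2
    refine h.trans ?_
    rw [← Matrix.mul_apply, mul_one]
  refine ⟨fun m => G₀ m * D m, hG₀.mul hU hD, fun m hm => ⟨hGge m hm, ?_, ?_, ?_⟩⟩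
  · rw [hlead m hm]
    exact hG₀d m hm
  · intro s hs a
    have e : ((cstMat (leadMat (G₀ m * D m)))⁻¹ * (G₀ m * D m)) a a = 1 := by
      rw [hlead m hm, ← mul_assoc, Matrix.mul_diagonal]
      exact mul_inv_cancel₀ (hWne m hm a)
    rw [xiCoeff, Matrix.of_apply, e]
    have : (1 : Laur).coeff (s : ℤ) = if (s : ℤ) = 0 then 1 else 0 := by
      simpa using zpow_coeff 0 s
    rw [this, if_neg (by omega)]
  · have e : gaugeTransform (G₀ m * D m) (A m) = Matrix.diagonal fun s =>
        zvar ^ (-(S.ord i : ℤ)) * b m s + dz (W m s s)⁻¹ * ((W m s s)⁻¹)⁻¹ := by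
      rw [gaugeTransform_mul (hG₀d' m hm) (hDd m hm), gaugeTransform_columns (leadU_ne hm.1 i)
        (hl m hm).apply_zero_zero (by rw [(hl m hm).apply_zero_one, leadF_eq]) (hbE m hm)
        (hG₀d' m hm), gaugeTransform_diagonal fun s => inv_ne_zero (hWne m hm s)]
    rw [e]
    refine ⟨Matrix.isDiag_diagonal _, fun s => ?_⟩
    rw [Matrix.diagonal_apply_eq, formalUn_eq, add_sub_right_comm, ← mul_sub]
    refine OrdGE.add ?_ ?_
    · rw [ordGE_zpow_mul, zero_sub, neg_neg]
      intro k hk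
      rcases lt_or_ge k 0 with h0 | h0
      · exact (hbge m s).sub (expUn_ge _ _ _) k h0
      · lift k to ℕ using h0
        have hk' : k < S.ord i := by exact_mod_cast hk
        rw [HahnSeries.coeff_sub, hbθ m s k hk', expUn_coeff _ _ _ hk', sub_self]
    · rw [inv_inv]
      exact (hWi m hm s).1.dz_zero.mul (hWv m hm s).1 (by omega)

/-- A diagonal connection is equivalent to its polar part. -/
lemma formallyEquivalent_of_diag {G A B : LMat} (hG : MatGE 0 G) (hd : (leadMat G).det ≠ 0)
    (hdiag : (gaugeTransform G A).IsDiag) (hB : B.IsDiag)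
    (h : ∀ s, OrdGE 0 (gaugeTransform G A s s - B s s)) : FormallyEquivalent A B := by
  have hdet : G.det.coeff 0 ≠ 0 := by rwa [← leadMat_det hG]
  obtain ⟨R, hR⟩ : ∃ R, R = gaugeTransform G A := ⟨_, rfl⟩
  rw [← hR] at h hdiag
  have hex : ∀ s, ∃ e : Laur, Val e 1 ∧ dz e + (R s s - B s s) * e = 0 := by
    intro s
    obtain ⟨y, -, hy, hE⟩ := exists_linear_solution (M := ℂ) (U := Set.univ) isOpen_univ
      (N := fun _ => Matrix.diagonal fun _ => zvar * (R s s - B s s)) (holFamMat_const _)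
      (fun _ _ => by
        intro a b
        by_cases hab : a = b
        · subst hab
          rw [Matrix.diagonal_apply_eq]
          exact ordGE_zvar.mul (h s) (by omega)
        · rw [Matrix.diagonal_apply_ne _ hab]
          exact ordGE_zero _)
      (y₀ := fun _ _ => 1) (fun _ => analyticOnNhd_const)
      (fun _ _ a => by
        refine Finset.sum_eq_zero fun t _ => ?_
        by_cases hab : a = t
        · subst hab
          rw [Matrix.diagonal_apply_eq, zvar_mul_coeff, h s _ (by omega), zero_mul]
        · rw [Matrix.diagonal_apply_ne _ hab]
          exact zero_mul _)
      (fun _ _ k hk => by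
        rw [Matrix.diagonal_apply_eq, Matrix.diagonal_apply_eq,
          Matrix.diagonal_apply_ne _ (by decide : (0 : Fin 2) ≠ 1), zvar_mul_coeff,
          h s _ (by omega)]
        have : (k : ℂ) ≠ 0 := by exact_mod_cast (by omega : k ≠ 0)
        simp [this])
    refine ⟨y 0 0, hy 0 0, ?_⟩
    have h1 := hE 0 (Set.mem_univ _) 0
    rw [Fin.sum_univ_two, Matrix.diagonal_apply_eq,
      Matrix.diagonal_apply_ne _ (by decide : (0 : Fin 2) ≠ 1), zero_mul, add_zero, mul_assoc,
      ← mul_add] at h1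
    exact (mul_eq_zero.mp h1).resolve_left zvar_ne_zero
  choose e he1 he2 using hex
  have hene : ∀ s, e s ≠ 0 := fun s =>
    ne_zero_of_coeff (N := 0) (by rw [(he1 s).2]; exact one_ne_zero)
  have hev : ∀ r s, Val (Matrix.diagonal e r s) ((1 : CMat) r s) := by
    intro r s
    by_cases hrs : r = s
    · subst hrs
      rw [Matrix.diagonal_apply_eq, Matrix.one_apply_eq]
      exact he1 r
    · rw [Matrix.diagonal_apply_ne _ hrs, Matrix.one_apply_ne hrs]
      exact val_zero
  have hed := det_val hev
  rw [Matrix.det_one] at hed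
  refine formallyEquivalent_of_ge (G := G * Matrix.diagonal e)
    (hG.mul (fun r s => (hev r s).1) (by omega)) ?_ ?_
  · rw [Matrix.det_mul, coeff_mul_lead (N := 0) (M := 0) (det_val (leadMat_val hG)).1 hed.1 (by ring),
      hed.2, mul_one]
    exact hdet
  · have hRd : R = Matrix.diagonal fun s => R s s := by
      ext a b : 1
      by_cases hab : a = b
      · subst hab
        rw [Matrix.diagonal_apply_eq]
      · rw [Matrix.diagonal_apply_ne _ hab, hdiag hab]
    rw [gaugeTransform_mul (ne_zero_of_coeff hdet)
      (ne_zero_of_coeff (N := 0) (by rw [hed.2]; exact one_ne_zero)), ← hR, hRd,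
      gaugeTransform_diagonal hene]
    ext a b : 1
    by_cases hab : a = b
    · subst hab
      rw [Matrix.diagonal_apply_eq]
      have h1 := he2 a
      have h2 := hene a
      field_simp
      linear_combination h1
    · rw [Matrix.diagonal_apply_ne _ hab, hB hab]

end UnramFrame

/-! ### Formal normal form at a ramified pole -/

section RamFrame

variable {i : Option (Fin ν)} {A : S.Total → LMat}

/-- `z^n α` for the `α` of the formal type. -/
def expRaA (b : S.Base) (i : Option (Fin ν)) : Laur :=
  ∑ l ∈ Finset.range (S.ord i), HahnSeries.single (l : ℤ) (thetaRa b i (2 * l) / 2)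

/-- `z^n β` for the `β` of the formal type. -/
def expRaB (b : S.Base) (i : Option (Fin ν)) : Laur :=
  ∑ l ∈ Finset.range (S.ord i - 1), HahnSeries.single (l : ℤ) (thetaRa b i (2 * l + 1) / 2)

lemma expRaA_ge (b : S.Base) (i : Option (Fin ν)) : OrdGE 0 (expRaA b i) :=
  ordGE_sum _ _ fun _ _ => (ordGE_single _ _).mono (by omega)

lemma expRaB_ge (b : S.Base) (i : Option (Fin ν)) : OrdGE 0 (expRaB b i) :=
  ordGE_sum _ _ fun _ _ => (ordGE_single _ _).mono (by omega)

lemma formalRa_eq (b : S.Base) (i : Option (Fin ν)) :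
    formalRa b i = ramShape (zvar ^ (-(S.ord i : ℤ)) * expRaA b i)
      (zvar ^ (-(S.ord i : ℤ)) * expRaB b i) := by
  have h : ∀ (k : ℕ) (θ : ℕ → ℂ), ∑ l ∈ Finset.range k, HahnSeries.single ((l : ℤ) - S.ord i) (θ l)
      = zvar ^ (-(S.ord i : ℤ)) * ∑ l ∈ Finset.range k, (HahnSeries.single (l : ℤ) (θ l) : Laur) := by
    intro k θ
    rw [Finset.mul_sum]
    refine Finset.sum_congr rfl fun l _ => ?_
    rw [single_eq, single_eq, mul_left_comm, ← zpow_add₀ zvar_ne_zero]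
    congr 2
    ring
  rw [formalRa, h, h, expRaA, expRaB]

lemma expRaA_coeff (b : S.Base) (i : Option (Fin ν)) {l : ℕ} (hl : l < S.ord i) :
    (expRaA b i).coeff l = thetaRa b i (2 * l) / 2 := by
  have := single_sum_coeff (S.ord i) 0 (fun l => thetaRa b i (2 * l) / 2) hl
  simpa [expRaA] using this

lemma expRaB_coeff (b : S.Base) (i : Option (Fin ν)) {l : ℕ} (hl : l < S.ord i - 1) :
    (expRaB b i).coeff l = thetaRa b i (2 * l + 1) / 2 := by
  have := single_sum_coeff (S.ord i - 1) 0 (fun l => thetaRa b i (2 * l + 1) / 2) hl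
  simpa [expRaB] using this

/-- The series `a = z^n α` that the second column of the gauge equation determines from
`b = z^n β`. -/
def ramA (n : ℕ) (u d b : Laur) : Laur :=
  cst (1 / 2) * (zvar ^ n * d + cst (1 / 2) * (zvar ^ n * zvar⁻¹)
    + zvar ^ n * (dz b * b⁻¹ - dz u * u⁻¹))

/-- The equation for `b = z^n β` that the first column of the gauge equation gives. -/
def ramEq (n : ℕ) (u c d b : Laur) : Laur :=
  zvar⁻¹ * (zvar ^ n * (dz (ramA n u d b) - ramA n u d b * (dz u * u⁻¹)) + u * (zvar ^ n * c)
    + zvar ^ n * d * ramA n u d b - ramA n u d b ^ 2) - b ^ 2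

lemma cst_half_mul_two : cst (1 / 2) * 2 = 1 := by
  rw [← cst_two, ← cst_mul, one_div, inv_mul_cancel₀ two_ne_zero]
  exact map_one _

/-- A solution of the equation for `b` gives a gauge transformation to the ramified shape. -/
lemma gaugeTransform_ram {n : ℕ} {u b : Laur} {A : LMat} (hu : u ≠ 0) (hb : b ≠ 0)
    (h00 : A 0 0 = 0) (h01 : A 0 1 = zvar ^ (-(n : ℤ)) * u)
    (h : ramEq n u (A 1 0) (A 1 1) b = 0) :
    gaugeTransform !![1, 0; ramA n u (A 1 1) b * u⁻¹, b * u⁻¹] A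
      = ramShape (zvar ^ (-(n : ℤ)) * ramA n u (A 1 1) b) (zvar ^ (-(n : ℤ)) * b) := by
  have hz := zvar_ne_zero
  have hzn : zvar ^ n ≠ 0 := pow_ne_zero _ hz
  have hd : (!![1, 0; ramA n u (A 1 1) b * u⁻¹, b * u⁻¹] : LMat).det ≠ 0 := by
    rw [Matrix.det_fin_two_of, one_mul, zero_mul, sub_zero]
    exact mul_ne_zero hb (inv_ne_zero hu)
  have ha : 2 * ramA n u (A 1 1) b = zvar ^ n * A 1 1 + cst (1 / 2) * (zvar ^ n * zvar⁻¹)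
      + zvar ^ n * (dz b * b⁻¹ - dz u * u⁻¹) := by
    rw [ramA]
    linear_combination (zvar ^ n * A 1 1 + cst (1 / 2) * (zvar ^ n * zvar⁻¹)
      + zvar ^ n * (dz b * b⁻¹ - dz u * u⁻¹)) * cst_half_mul_two
  have hE := h
  rw [ramEq] at hE
  rw [gaugeTransform_eq_iff hd, ramShape]
  generalize ramA n u (A 1 1) b = a at ha hE
  ext r s : 1
  rw [Matrix.mul_apply, Matrix.add_apply, ddz_apply, Matrix.mul_apply, Fin.sum_univ_two,
    Fin.sum_univ_two]
  fin_cases r <;> fin_cases s <;>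
    simp only [Matrix.of_apply, Matrix.cons_val_zero, Matrix.cons_val_one, Matrix.cons_val',
      Matrix.cons_val_fin_one, Fin.zero_eta, Fin.mk_one, dz_one, dz_zero, h00, h01, dz_mul,
      dz_inv hu, zpow_neg, zpow_natCast]
  · field_simp
    ring
  · field_simp
    ring
  · field_simp at hE ⊢
    linear_combination -hE
  · field_simp at ha ⊢
    linear_combination ha

/-- The series `a` has the prescribed first coefficients. -/
lemma ramA_approx (hi : S.kind i = Kind.ra) {m : S.Total} (hm : m ∈ phaseSpace S)
    {A : LMat} (hA : LocalForm m.2 i A) {b : Laur} {r : ℂ} (hb : Val b r) (hr : r ≠ 0) :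
    OrdGE (S.ord i) (ramA (S.ord i) (leadU m.2 i) (A 1 1) b - expRaA m.2 i) := by
  have hz := zvar_ne_zero
  have hu := val_leadU hm.1 i
  have e : ramA (S.ord i) (leadU m.2 i) (A 1 1) b - expRaA m.2 i
      = cst (1 / 2) * (zvar ^ (S.ord i : ℤ) * (A 1 1 - (formalType m.2 i).trace
        + (dz b * b⁻¹ - dz (leadU m.2 i) * (leadU m.2 i)⁻¹))) := by
    rw [formalType, if_pos hi, formalRa_eq, Matrix.trace_fin_two, ramA]
    simp only [ramShape, Matrix.of_apply, Matrix.cons_val_zero, Matrix.cons_val_one,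
      Matrix.cons_val', Matrix.cons_val_fin_one]
    rw [zpow_neg, zpow_natCast]
    have h1 : zvar ^ S.ord i * (zvar ^ S.ord i)⁻¹ = 1 :=
      mul_inv_cancel₀ (pow_ne_zero _ hz)
    linear_combination expRaA m.2 i * cst_half_mul_two
      + cst (1 / 2) * 2 * expRaA m.2 i * h1
  rw [e]
  refine OrdGE.cst_mul ?_ _
  rw [ordGE_zpow_mul, sub_self]
  exact hA.apply_one_one.add ((hb.1.dz_zero.mul (hb.inv hr).1 (by omega)).sub
    (hu.1.dz_zero.mul (hu.inv (leadR_ne hm.1 i)).1 (by omega)))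

lemma ramA_ge (hi : S.kind i = Kind.ra) {m : S.Total} (hm : m ∈ phaseSpace S)
    {A : LMat} (hA : LocalForm m.2 i A) {b : Laur} {r : ℂ} (hb : Val b r) (hr : r ≠ 0) :
    OrdGE 0 (ramA (S.ord i) (leadU m.2 i) (A 1 1) b) := by
  have := ((ramA_approx hi hm hA hb hr).mono (M := 0) (by omega)).add (expRaA_ge m.2 i)
  rwa [sub_add_cancel] at this

/-- Modulo `z^(n-1)`, the equation for `b` says that `b²` is the prescribed one. -/
lemma ramEq_approx (hi : S.kind i = Kind.ra) {m : S.Total} (hm : m ∈ phaseSpace S)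
    {A : LMat} (hA : LocalForm m.2 i A) {b : Laur} {r : ℂ} (hb : Val b r) (hr : r ≠ 0)
    (hbs : OrdGE (S.ord i - 1) (b - expRaB m.2 i)) :
    OrdGE (S.ord i - 1) (ramEq (S.ord i) (leadU m.2 i) (A 1 0) (A 1 1) b) := by
  have hz := zvar_ne_zero
  have hn := S.one_le_ord i
  have hf := leadF_ne hm.1 i
  have hu := val_leadU hm.1 i
  have ha := ramA_approx hi hm hA hb hr
  have hage := ramA_ge hi hm hA hb hr
  have hzn : ∀ f, OrdGE 0 f → OrdGE (S.ord i) (zvar ^ S.ord i * f) := fun f hf => by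
    rw [← zpow_natCast, ordGE_zpow_mul, sub_self]
    exact hf
  rw [ramEq]
  generalize ramA (S.ord i) (leadU m.2 i) (A 1 1) b = a at ha hage
  have e : zvar⁻¹ * (zvar ^ S.ord i * (dz a - a * (dz (leadU m.2 i) * (leadU m.2 i)⁻¹))
        + leadU m.2 i * (zvar ^ S.ord i * A 1 0) + zvar ^ S.ord i * A 1 1 * a - a ^ 2) - b ^ 2
      = zvar ^ (-1 : ℤ) * (zvar ^ S.ord i * (dz a - a * (dz (leadU m.2 i) * (leadU m.2 i)⁻¹))
        + leadU m.2 i * (zvar ^ S.ord i * (A 1 0 - lowS m.2 i))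
        + zvar ^ S.ord i * (A 1 1 - (formalType m.2 i).trace) * a
        - (a - expRaA m.2 i) * (a - expRaA m.2 i)
        - cst (1 / 2) * (zvar ^ ((S.ord i : ℤ) - 1) * (a - expRaA m.2 i)))
        - (b - expRaB m.2 i) * (b + expRaB m.2 i) := by
    have e1 : leadU m.2 i * (zvar ^ S.ord i * lowS m.2 i)
        = -(expRaA m.2 i * (expRaA m.2 i - cst (1 / 2) * (zvar ^ S.ord i * zvar⁻¹))
          - zvar * expRaB m.2 i ^ 2) := by
      rw [lowS, formalType, if_pos hi, formalRa_eq, Matrix.det_fin_two, leadU]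
      simp only [ramShape, Matrix.of_apply, Matrix.cons_val_zero, Matrix.cons_val_one,
        Matrix.cons_val', Matrix.cons_val_fin_one]
      rw [zpow_neg, zpow_natCast]
      field_simp
    have e2 : zvar ^ S.ord i * (formalType m.2 i).trace
        = 2 * expRaA m.2 i - cst (1 / 2) * (zvar ^ S.ord i * zvar⁻¹) := by
      rw [formalType, if_pos hi, formalRa_eq, Matrix.trace_fin_two]
      simp only [ramShape, Matrix.of_apply, Matrix.cons_val_zero, Matrix.cons_val_one,
        Matrix.cons_val', Matrix.cons_val_fin_one]
      rw [zpow_neg, zpow_natCast]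
      field_simp
      ring
    have e3 : zvar ^ ((S.ord i : ℤ) - 1) = zvar ^ S.ord i * zvar⁻¹ := by
      rw [zpow_sub_one₀ hz, zpow_natCast]
    have e4 : zvar⁻¹ * zvar = 1 := inv_mul_cancel₀ hz
    rw [e3, zpow_neg_one]
    linear_combination zvar⁻¹ * e1 + zvar⁻¹ * a * e2 + expRaB m.2 i ^ 2 * e4
  rw [e]
  have haA : OrdGE 0 (a - expRaA m.2 i) := ha.mono (by omega)
  refine OrdGE.sub ?_ (hbs.mul (hb.1.add (expRaB_ge _ _)) (by omega))
  rw [ordGE_zpow_mul]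
  refine OrdGE.mono (N := S.ord i) ?_ (by omega)
  refine OrdGE.sub (OrdGE.sub (OrdGE.add (OrdGE.add ?_ ?_) ?_) ?_) ?_
  · exact hzn _ (hage.dz_zero.sub (hage.mul (hu.1.dz_zero.mul (hu.inv (leadR_ne hm.1 i)).1
      (K := 0) (by omega)) (by omega)))
  · exact hu.1.mul (hzn _ hA.apply_one_zero) (by omega)
  · exact (hzn _ hA.apply_one_one).mul hage (by omega)
  · exact ha.mul haA (by omega)
  · refine OrdGE.cst_mul ?_ _
    rw [ordGE_zpow_mul]
    exact ha.mono (by omega)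

/-- The linearisation of the equation for `b` at the coefficient of order `k`: the dependence
of `a` on `b` is of higher order. -/
lemma ramEq_sub {n k : ℕ} (hn : 2 ≤ n) {u c d b b' : Laur} {r s : ℂ} (hu : Val u r)
    (hr : r ≠ 0) (hb : Val b s) (hb' : Val b' s) (hs : s ≠ 0) (h : OrdGE k (b - b')) :
    (ramEq n u c d b).coeff k - (ramEq n u c d b').coeff k = -(2 * s) * (b - b').coeff k := by
  have hz := zvar_ne_zero
  have hbne : b ≠ 0 := ne_zero_of_coeff (N := 0) (by rw [hb.2]; exact hs)
  have hbne' : b' ≠ 0 := ne_zero_of_coeff (N := 0) (by rw [hb'.2]; exact hs)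
  obtain ⟨δ, hδ⟩ : ∃ δ, δ = b - b' := ⟨_, rfl⟩
  obtain ⟨ε, hε⟩ : ∃ ε, ε = ramA n u d b - ramA n u d b' := ⟨_, rfl⟩
  have hi := (hb.inv hs).1
  have hi' := (hb'.inv hs).1
  have hui := (hu.inv hr).1
  have e1 : ε = cst (1 / 2) * (zvar ^ (n : ℤ) * ((dz δ * b' - δ * dz b') * (b⁻¹ * b'⁻¹))) := by
    rw [hε, hδ, ramA, ramA, dz_sub, zpow_natCast]
    have h1 : b * b⁻¹ = 1 := mul_inv_cancel₀ hbne
    have h2 : b' * b'⁻¹ = 1 := mul_inv_cancel₀ hbne'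
    linear_combination cst (1 / 2) * zvar ^ n * (-(dz b * b⁻¹) * h2 + dz b' * b'⁻¹ * h1)
  rw [← hδ] at h ⊢
  have hεge : OrdGE (n + k - 1) ε := by
    rw [e1]
    refine OrdGE.cst_mul ?_ _
    rw [ordGE_zpow_mul]
    exact ((h.dz.mul hb'.1 (K := k - 1) (by omega)).sub (h.mul hb'.1.dz_zero (by omega))).mul
      (hi.mul hi' (K := 0) (by omega)) (by omega)
  have e2 : zvar ^ n * d - ramA n u d b - ramA n u d b'
      = zvar ^ (n : ℤ) * (dz u * u⁻¹ - cst (1 / 2) * (dz b * b⁻¹ + dz b' * b'⁻¹))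
        - cst (1 / 2) * zvar ^ ((n : ℤ) - 1) := by
    rw [ramA, ramA, zpow_sub_one₀ hz, zpow_natCast]
    linear_combination -(zvar ^ n * d + cst (1 / 2) * (zvar ^ n * zvar⁻¹)
      - zvar ^ n * (dz u * u⁻¹)) * cst_half_mul_two
  have hge2 : OrdGE (n - 1) (zvar ^ n * d - ramA n u d b - ramA n u d b') := by
    rw [e2]
    refine OrdGE.sub (OrdGE.mono (N := n) ?_ (by omega)) (OrdGE.cst_mul (ordGE_zpow _) _)
    rw [ordGE_zpow_mul, sub_self]
    exact (hu.1.dz_zero.mul hui (by omega)).sub (((hb.1.dz_zero.mul hi (by omega)).add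
      (hb'.1.dz_zero.mul hi' (by omega))).cst_mul _)
  have e : ramEq n u c d b - ramEq n u c d b'
      = zvar ^ (-1 : ℤ) * (zvar ^ (n : ℤ) * (dz ε - ε * (dz u * u⁻¹))
          + ε * (zvar ^ n * d - ramA n u d b - ramA n u d b')) - δ * (b + b') := by
    rw [ramEq, ramEq, hδ, hε, dz_sub, zpow_neg_one, zpow_natCast]
    ring
  have h1 : OrdGE (k + 1) (zvar ^ (-1 : ℤ) * (zvar ^ (n : ℤ) * (dz ε - ε * (dz u * u⁻¹))
          + ε * (zvar ^ n * d - ramA n u d b - ramA n u d b'))) := by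
    rw [ordGE_zpow_mul]
    refine OrdGE.add ?_ (hεge.mul hge2 (by omega))
    rw [ordGE_zpow_mul]
    exact (hεge.dz.mono (by omega)).sub
      (hεge.mul (hu.1.dz_zero.mul hui (K := 0) (by omega)) (by omega))
  have h4 : (δ * (b + b')).coeff k = δ.coeff k * (2 * s) := by
    rw [coeff_mul_lead h (hb.1.add hb'.1) (by ring), HahnSeries.coeff_add, hb.2, hb'.2]
    ring
  rw [← HahnSeries.coeff_sub, e, HahnSeries.coeff_sub, h1 k (by omega), h4]
  ring

/-- Holomorphic solutions of the equation for `b`. -/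
lemma exists_ramB (hi : S.kind i = Kind.ra) (hA : HolFamMat (phaseSpace S) A)
    (hl : ∀ m ∈ phaseSpace S, LocalForm m.2 i (A m)) :
    ∃ b : S.Total → Laur, HolFam (phaseSpace S) b ∧
      (∀ m, Val (b m) (thetaRa m.2 i 1 / 2)) ∧
      (∀ m, OrdGE (S.ord i - 1) (b m - expRaB m.2 i)) ∧
      ∀ m ∈ phaseSpace S, ramEq (S.ord i) (leadU m.2 i) (A m 1 0) (A m 1 1) (b m) = 0 := by
  have hU := isOpen_phaseSpace (S := S)
  have hn : 2 ≤ S.ord i := S.ord_irr i (by rw [hi]; decide)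
  have hun : UnitFam (phaseSpace S) fun m : S.Total => leadU m.2 i :=
    (unitFam_const (pow_ne_zero _ zvar_ne_zero)).mul hU (unitFam_leadF i)
  have hθ : ∀ m ∈ phaseSpace S, thetaRa m.2 i 1 / 2 ≠ 0 := fun m hm =>
    div_ne_zero (hm.2.2.2.2 i hi) two_ne_zero
  obtain ⟨b, hb, hbge, hbθ, hbE⟩ := exists_formal_solution (U := phaseSpace S) (n := S.ord i - 1)
    (ι := Unit) (θ := fun l m _ => thetaRa m.2 i (2 * l + 1) / 2)
    (R := fun _ m w s => -w s * (thetaRa m.2 i 1)⁻¹)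
    (Eq := fun m b s => ramEq (S.ord i) (leadU m.2 i) (A m 1 0) (A m 1 1) (b s))
    (fun l _ s => (analytic_thetaRa i _ _).div_const)
    (fun b hb hbge hbθ s => by
      have hz : ∀ f : Laur, HolFam (phaseSpace S) fun _ : S.Total => f := fun f => holFam_const f
      have hbu : UnitFam (phaseSpace S) fun m => b m s := unitFam_of_val (hb s)
        (r := fun m => thetaRa m.2 i 1 / 2) fun m hm =>
          ⟨⟨hbge m hm s, by simpa using hbθ m hm s 0 (by omega)⟩, hθ m hm⟩
      have hlu := hun.1.dz.mul hU (hun.inv hU).1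
      have hzd := (hz (zvar ^ S.ord i)).mul hU (hA 1 1)
      have ha : HolFam (phaseSpace S) fun m =>
          ramA (S.ord i) (leadU m.2 i) (A m 1 1) (b m s) :=
        (hz _).mul hU ((hzd.add (hz _)).add
          ((hz _).mul hU (((hb s).dz.mul hU (hbu.inv hU).1).sub hlu)))
      exact ((hz _).mul hU (((((hz _).mul hU (ha.dz.sub (ha.mul hU hlu))).add
        (hun.1.mul hU ((hz _).mul hU (hA 1 0)))).add (hzd.mul hU ha)).sub (ha.pow hU 2))).sub
          ((hb s).pow hU 2))
    (fun k hk w hw s => (hw s).neg.mul ((analytic_thetaRa i 1 _).inv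
      fun m hm => hm.2.2.2.2 i hi))
    (fun m hm k hk b b' hb hb' hbθ hbθ' hbb w hw s => by
      have h := ramEq_sub hn (c := A m 1 0) (d := A m 1 1) (val_leadU hm.1 i) (leadR_ne hm.1 i)
        (b := b s) (b' := b' s) (s := thetaRa m.2 i 1 / 2)
        ⟨hb s, by simpa using hbθ s 0 (by omega)⟩ ⟨hb' s, by simpa using hbθ' s 0 (by omega)⟩
        (hθ m hm) (hbb s)
      have hθ1 := hm.2.2.2.2 i hi
      rw [← sub_eq_iff_eq_add', h, hw s]
      field_simp)
  have hval : ∀ m, Val (b m ()) (thetaRa m.2 i 1 / 2) := fun m =>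
    ⟨hbge m _, by simpa using hbθ m () 0 (by omega)⟩
  have hsub : ∀ m, OrdGE (S.ord i - 1) (b m () - expRaB m.2 i) := by
    intro m k hk
    rcases lt_or_ge k 0 with h0 | h0
    · exact (hbge m _).sub (expRaB_ge _ _) k h0
    · lift k to ℕ using h0
      have hk' : k < S.ord i - 1 := by omega
      rw [HahnSeries.coeff_sub, hbθ m _ k hk', expRaB_coeff _ _ hk', sub_self]
  refine ⟨fun m => b m (), hb (), hval, hsub, fun m hm => ?_⟩
  have happ := ramEq_approx hi hm (hl m hm) (hval m) (hθ m hm) (hsub m)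
  refine ext_nat (happ.mono (by omega)) (ordGE_zero 0) fun k => ?_
  rcases lt_or_ge k (S.ord i - 1) with h | h
  · rw [happ k (by omega)]
    rfl
  · rw [hbE m hm k h ()]
    rfl

/-- Existence of holomorphic compatible frames at a ramified pole.  Modulo `z^n` in the first
column and `z^(n-1)` in the second, they depend only on the deformation parameters. -/
lemma exists_ram_frame (hi : S.kind i = Kind.ra) (hA : HolFamMat (phaseSpace S) A)
    (hl : ∀ m ∈ phaseSpace S, LocalForm m.2 i (A m)) :
    ∃ G : S.Total → LMat, HolFamMat (phaseSpace S) G ∧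
      (∀ m ∈ phaseSpace S, MatGE 0 (G m) ∧ (leadMat (G m)).det ≠ 0 ∧
        ∃ α β, gaugeTransform (G m) (A m) = ramShape α β ∧
          OrdGE 0 (α - zvar ^ (-(S.ord i : ℤ)) * expRaA m.2 i) ∧
          OrdGE (-1) (β - zvar ^ (-(S.ord i : ℤ)) * expRaB m.2 i)) ∧
      ∀ m ∈ phaseSpace S, ∀ m' ∈ phaseSpace S, m.2 = m'.2 →
        (∀ a, OrdGE (S.ord i) (G m a 0 - G m' a 0)) ∧ MatGE (S.ord i - 1) (G m - G m') := by
  have hU := isOpen_phaseSpace (S := S)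
  have hn : 2 ≤ S.ord i := S.ord_irr i (by rw [hi]; decide)
  obtain ⟨b, hb, hbv, hbθ, hbE⟩ := exists_ramB hi hA hl
  have hθ : ∀ m ∈ phaseSpace S, thetaRa m.2 i 1 / 2 ≠ 0 := fun m hm =>
    div_ne_zero (hm.2.2.2.2 i hi) two_ne_zero
  have hun : UnitFam (phaseSpace S) fun m : S.Total => leadU m.2 i :=
    (unitFam_const (pow_ne_zero _ zvar_ne_zero)).mul hU (unitFam_leadF i)
  have hui : ∀ m ∈ phaseSpace S, Val (leadU m.2 i)⁻¹ (leadR m.2 i)⁻¹ := fun m hm =>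
    (val_leadU hm.1 i).inv (leadR_ne hm.1 i)
  have hbu : UnitFam (phaseSpace S) b := unitFam_of_val hb
    (r := fun m => thetaRa m.2 i 1 / 2) fun m hm => ⟨hbv m, hθ m hm⟩
  obtain ⟨a, ha⟩ : ∃ a : S.Total → Laur,
      a = fun m => ramA (S.ord i) (leadU m.2 i) (A m 1 1) (b m) := ⟨_, rfl⟩
  have hahol : HolFam (phaseSpace S) a := by
    have hz : ∀ f : Laur, HolFam (phaseSpace S) fun _ : S.Total => f := fun f => holFam_const f
    rw [ha]
    exact (hz _).mul hU ((((hz _).mul hU (hA 1 1)).add (hz _)).add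
      ((hz _).mul hU ((hb.dz.mul hU (hbu.inv hU).1).sub (hun.1.dz.mul hU (hun.inv hU).1))))
  have haθ : ∀ m ∈ phaseSpace S, OrdGE (S.ord i) (a m - expRaA m.2 i) := fun m hm => by
    rw [ha]
    exact ramA_approx hi hm (hl m hm) (hbv m) (hθ m hm)
  have hage : ∀ m ∈ phaseSpace S, OrdGE 0 (a m) := fun m hm => by
    rw [ha]
    exact ramA_ge hi hm (hl m hm) (hbv m) (hθ m hm)
  let G : S.Total → LMat := fun m => !![1, 0; a m * (leadU m.2 i)⁻¹, b m * (leadU m.2 i)⁻¹]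
  have hGge : ∀ m ∈ phaseSpace S, MatGE 0 (G m) := by
    intro m hm r s
    fin_cases r <;> fin_cases s
    · exact ordGE_one
    · exact ordGE_zero _
    · exact (hage m hm).mul (hui m hm).1 (by omega)
    · exact (hbv m).1.mul (hui m hm).1 (by omega)
  refine ⟨G, ?_, fun m hm => ⟨hGge m hm, ?_, zvar ^ (-(S.ord i : ℤ)) * a m,
    zvar ^ (-(S.ord i : ℤ)) * b m, ?_, ?_, ?_⟩, fun m hm m' hm' hmm => ?_⟩
  · intro r s
    fin_cases r <;> fin_cases s
    · exact holFam_const 1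
    · exact holFam_const 0
    · exact hahol.mul hU (hun.inv hU).1
    · exact hb.mul hU (hun.inv hU).1
  · have hd : (G m).det = b m * (leadU m.2 i)⁻¹ := by
      rw [Matrix.det_fin_two_of, one_mul, zero_mul, sub_zero]
    rw [leadMat_det (hGge m hm), hd, ((hbv m).mul (hui m hm)).2]
    exact mul_ne_zero (hθ m hm) (inv_ne_zero (leadR_ne hm.1 i))
  · have := gaugeTransform_ram (n := S.ord i) (leadU_ne hm.1 i) (hbu.ne_zero hm)
      (hl m hm).apply_zero_zero (by rw [(hl m hm).apply_zero_one, leadF_eq]) (hbE m hm)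
    simp only [G, ha]
    exact this
  · rw [← mul_sub, ordGE_zpow_mul, sub_neg_eq_add, zero_add]
    exact haθ m hm
  · rw [← mul_sub, ordGE_zpow_mul, sub_neg_eq_add]
    exact (hbθ m).mono (by omega)
  · have h1 : OrdGE (S.ord i) (a m * (leadU m.2 i)⁻¹ - a m' * (leadU m'.2 i)⁻¹) := by
      rw [hmm, ← sub_mul]
      have h := (haθ m hm).sub (haθ m' hm')
      rw [hmm, sub_sub_sub_cancel_right] at h
      exact h.mul (hui m' hm').1 (by omega)
    have h2 : OrdGE (S.ord i - 1) (b m * (leadU m.2 i)⁻¹ - b m' * (leadU m'.2 i)⁻¹) := by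
      rw [hmm, ← sub_mul]
      have h := (hbθ m).sub (hbθ m')
      rw [hmm, sub_sub_sub_cancel_right] at h
      exact h.mul (hui m' hm').1 (by omega)
    have h3 : ∀ (N : ℤ) (f : Laur), OrdGE N (f - f) := fun N f => by
      rw [sub_self]
      exact ordGE_zero _
    refine ⟨fun r => ?_, fun r s => ?_⟩
    · fin_cases r
      · exact h3 _ _
      · exact h1
    · rw [Matrix.sub_apply]
      fin_cases r <;> fin_cases s
      · exact h3 _ _
      · exact h3 _ _
      · exact h1.mono (by omega)
      · exact h2

/-- A connection of the ramified shape is equivalent to its polar part. -/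
lemma formallyEquivalent_of_ram {G A : LMat} {α β α₀ β₀ : Laur} (hG : MatGE 0 G)
    (hd : (leadMat G).det ≠ 0) (h : gaugeTransform G A = ramShape α β)
    (hα : OrdGE 0 (α - α₀)) (hβ : OrdGE (-1) (β - β₀)) :
    FormallyEquivalent A (ramShape α₀ β₀) := by
  have hz := zvar_ne_zero
  have hdet : G.det.coeff 0 ≠ 0 := by rwa [← leadMat_det hG]
  have hγ : OrdGE 0 (zvar * (β - β₀)) := ordGE_zvar.mul hβ (by omega)
  have hα' : OrdGE 1 (zvar * (α - α₀)) := ordGE_zvar.mul hα (by omega)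
  have hγ' : OrdGE 1 (zvar * (zvar * (β - β₀))) := ordGE_zvar.mul hγ (by omega)
  obtain ⟨y, -, hy, hE⟩ := exists_linear_solution (M := ℂ) (U := Set.univ) isOpen_univ
    (N := fun _ => !![zvar * (α - α₀), zvar * (zvar * (β - β₀)); zvar * (β - β₀),
      cst (1 / 2) + zvar * (α - α₀)]) (holFamMat_const _)
    (fun _ _ => by
      intro a b
      fin_cases a <;> fin_cases b
      · exact hα'.mono (by omega)
      · exact hγ'.mono (by omega)
      · exact hγ
      · exact (ordGE_cst _).add (hα'.mono (by omega)))
    (y₀ := fun _ => ![1, -(2 * (zvar * (β - β₀)).coeff 0)])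
    (fun s => by
      fin_cases s
      · exact analyticOnNhd_const
      · exact analyticOnNhd_const)
    (fun _ _ a => by
      rw [Fin.sum_univ_two]
      fin_cases a <;> simp only [Matrix.of_apply, Matrix.cons_val_zero, Matrix.cons_val_one,
        Matrix.cons_val', Matrix.cons_val_fin_one, Fin.zero_eta, Fin.mk_one, HahnSeries.coeff_add,
        cst_coeff_zero, hα' 0 (by omega), hγ' 0 (by omega)]
      · ring
      · ring)
    (fun _ _ k hk => by
      simp only [Matrix.of_apply, Matrix.cons_val_zero, Matrix.cons_val_one,
        Matrix.cons_val', Matrix.cons_val_fin_one, HahnSeries.coeff_add,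
        cst_coeff_zero, hα' 0 (by omega), hγ' 0 (by omega)]
      have h1 : (k : ℂ) ≠ 0 := by exact_mod_cast (by omega : k ≠ 0)
      have h2 : (1 / 2 + k : ℂ) ≠ 0 := by
        have : ((1 + 2 * k : ℕ) : ℂ) ≠ 0 := by exact_mod_cast (by omega)
        intro h
        apply this
        push_cast
        linear_combination 2 * h
      rw [zero_add, add_zero, zero_mul, sub_zero]
      exact mul_ne_zero h1 h2)
  have hE0 := hE 0 (Set.mem_univ _) 0
  have hE1 := hE 0 (Set.mem_univ _) 1
  have hy0 := hy 0 0
  have hy1 := hy 0 1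
  simp only [Fin.sum_univ_two, Matrix.of_apply, Matrix.cons_val_zero, Matrix.cons_val_one,
    Matrix.cons_val', Matrix.cons_val_fin_one] at hE0 hE1 hy0 hy1
  generalize y 0 0 = e₀ at hE0 hE1 hy0
  generalize y 0 1 = e₁ at hE0 hE1 hy1
  let T : LMat := !![e₀, e₁; zvar * e₁, e₀]
  have hTge : MatGE 0 T := by
    intro a b
    fin_cases a <;> fin_cases b
    · exact hy0.1
    · exact hy1.1
    · exact (ordGE_zvar.mono (M := 0) (by omega)).mul hy1.1 (by omega)
    · exact hy0.1
  have hTd : Val T.det 1 := by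
    have h1 := (hy0.mul hy0).sub (hy1.mul (val_zvar.mul hy1))
    rw [zero_mul, mul_zero, mul_one, sub_zero] at h1
    rw [Matrix.det_fin_two_of]
    exact h1
  have hTne : T.det ≠ 0 := ne_zero_of_coeff (N := 0) (by rw [hTd.2]; exact one_ne_zero)
  refine formallyEquivalent_of_ge (G := G * T) (hG.mul hTge (by omega)) ?_ ?_
  · rw [Matrix.det_mul, coeff_mul_lead (N := 0) (M := 0) (det_val (leadMat_val hG)).1 hTd.1
      (by ring), hTd.2, mul_one]
    exact hdet
  · rw [gaugeTransform_mul (ne_zero_of_coeff hdet) hTne, h, gaugeTransform_eq_iff hTne]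
    have hE0' : dz e₀ + (α - α₀) * e₀ + zvar * (β - β₀) * e₁ = 0 :=
      mul_left_cancel₀ hz (by linear_combination hE0)
    have hzi : zvar * zvar⁻¹ = 1 := mul_inv_cancel₀ hz
    have hE1' : dz e₁ + cst (1 / 2) * zvar⁻¹ * e₁ + (α - α₀) * e₁ + (β - β₀) * e₀ = 0 :=
      mul_left_cancel₀ hz (by linear_combination hE1 + cst (1 / 2) * e₁ * hzi)
    ext r s : 1
    rw [Matrix.mul_apply, Matrix.add_apply, ddz_apply, Matrix.mul_apply, Fin.sum_univ_two,
      Fin.sum_univ_two]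
    fin_cases r <;> fin_cases s <;>
      simp only [T, ramShape, Matrix.of_apply, Matrix.cons_val_zero, Matrix.cons_val_one,
        Matrix.cons_val', Matrix.cons_val_fin_one, Fin.zero_eta, Fin.mk_one, dz_mul, dz_zvar]
    · linear_combination -hE0'
    · linear_combination -hE1'
    · linear_combination -zvar * hE1' + e₁ * cst_half_mul_two + 2 * cst (1 / 2) * e₁ * hzi
    · linear_combination -hE0'

end RamFrame

/-! ### The normal form of the connection is the explicit one -/

section NormalFormEq

lemma explicit_isNormalForm {m : S.Total} (hm : m ∈ phaseSpace S) :
    IsNormalForm m (explicitTuple m) where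
  deg_C := explicit_deg_C m
  deg_D := explicit_deg_D m
  deg_D_infty := explicit_deg_D_infty m
  deg_Ct := explicit_deg_Ct hm
  apparent j := (apparent_iff j hm).mpr (explicit_apparent hm j)
  formal i := by
    have hA := holFam_explicit_pole (S := S) i
    have hl : ∀ m ∈ phaseSpace S, LocalForm m.2 i (connPole m (explicitTuple m) i) :=
      fun m hm => explicit_localForm hm i
    rw [formalType]
    split_ifs with hi
    · obtain ⟨G, -, hG, -⟩ := exists_ram_frame hi hA hl
      obtain ⟨hge, hd, α, β, h, hα, hβ⟩ := hG m hm
      rw [formalRa_eq]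
      exact formallyEquivalent_of_ram hge hd h hα hβ
    · obtain ⟨G, -, hG⟩ := exists_unram_frame hi hA hl
      obtain ⟨hge, hd, -, hdiag, h⟩ := hG m hm
      exact formallyEquivalent_of_diag hge hd hdiag (Matrix.isDiag_diagonal _) h

lemma IsNormalForm.eq_explicit {m : S.Total} (hm : m ∈ phaseSpace S) {c : CoeffTuple ν}
    (hc : IsNormalForm m c) : c = explicitTuple m :=
  coeffTuple_unique hm hc.deg_C (explicit_deg_C m) hc.deg_D (explicit_deg_D m) hc.deg_Ct
    (explicit_deg_Ct hm) (fun j => (apparent_iff j hm).mp (hc.apparent j)) (explicit_apparent hm)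
    (hc.localForm hm) (explicit_localForm hm)

lemma normalForm_eq {m : S.Total} (hm : m ∈ phaseSpace S) : normalForm m = explicitTuple m := by
  let : Nonempty (CoeffTuple ν) := ⟨⟨0, 0, 0⟩⟩
  exact (Classical.epsilon_spec (p := IsNormalForm m)
    ⟨explicitTuple m, explicit_isNormalForm hm⟩).eq_explicit hm

lemma holFam_omPole (i : Option (Fin ν)) : HolFamMat (phaseSpace S) (omPole i) :=
  (holFam_explicit_pole i).congr isOpen_phaseSpace fun m hm => by rw [omPole, normalForm_eq hm]

lemma holFam_omApp (j : Fin S.numApp) : HolFamMat (phaseSpace S) (omApp j) :=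
  (holFam_explicit_app j).congr isOpen_phaseSpace fun m hm => by rw [omApp, normalForm_eq hm]

lemma omPole_localForm (i : Option (Fin ν)) {m : S.Total} (hm : m ∈ phaseSpace S) :
    LocalForm m.2 i (omPole i m) := by
  rw [omPole, normalForm_eq hm]
  exact explicit_localForm hm i

/-- The polar part of the connection depends only on the deformation parameters. -/
lemma omPole_sub_ge (i : Option (Fin ν)) {m m' : S.Total} (hm : m ∈ phaseSpace S)
    (hm' : m' ∈ phaseSpace S) (h : m.2 = m'.2) : MatGE 0 (omPole i m - omPole i m') := by
  have h1 := omPole_localForm i hm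
  have h2 := omPole_localForm i hm'
  rw [h] at h1
  intro a b
  rw [Matrix.sub_apply]
  fin_cases a <;> fin_cases b
  · simp only [Fin.zero_eta, h1.apply_zero_zero, h2.apply_zero_zero, sub_self]
    exact ordGE_zero _
  · simp only [Fin.zero_eta, Fin.mk_one, h1.apply_zero_one, h2.apply_zero_one, sub_self]
    exact ordGE_zero _
  · have := h1.apply_one_zero.sub h2.apply_one_zero
    rwa [sub_sub_sub_cancel_right] at this
  · have := h1.apply_one_one.sub h2.apply_one_one
    rwa [sub_sub_sub_cancel_right] at this

lemma omElem_ge (j : Fin S.numApp) {m : S.Total} (hm : m ∈ phaseSpace S) :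
    MatGE 0 (omElem j m) := by
  have h := (explicit_isNormalForm hm).apparent j
  rw [← normalForm_eq hm] at h
  exact fun a b k hk => h a b k hk

lemma omApp_zero_one_val (j : Fin S.numApp) {m : S.Total} (hm : m ∈ phaseSpace S) :
    Val (omApp j m 0 1) (1 / (polyP m.2).eval (qc m j)) :=
  val_leadF_app j hm

lemma omElem_one_one_val (j : Fin S.numApp) {m : S.Total} (hm : m ∈ phaseSpace S) :
    Val (omElem j m 1 1) (dReg m (explicitTuple m) j
      - 1 / (polyP m.2).eval (qc m j) * pc m j) := by
  have e : omElem j m 1 1 = entryD m (explicitTuple m) (cst (qc m j) + zvar) + zvar⁻¹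
      - 1 / aeval (cst (qc m j) + zvar) (polyP m.2) * cst (pc m j) := by
    rw [omElem, elemQ, omApp, normalForm_eq hm, connAt, connMatrix,
      gaugeTransform_elem _ _ _ _ (dz_cst _)]
    simp only [Matrix.of_apply, Matrix.cons_val_one, Matrix.cons_val', Matrix.cons_val_fin_one]
    ring
  rw [e]
  exact (val_entryD_app j hm).sub ((val_leadF_app j hm).mul (val_cst _))

end NormalFormEq

/-! ### Existence of the formal solutions -/

section Existence

/-- The solution of the regular connection after the elementary transform, with initial value
`1`. -/
lemma exists_regular_solution (j : Fin S.numApp) :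
    ∃ Y : S.Total → LMat, HolFamMat (phaseSpace S) Y ∧
      (∀ m a b, Val (Y m a b) ((1 : CMat) a b)) ∧
      ∀ m ∈ phaseSpace S, ddz (Y m) + omElem j m * Y m = 0 := by
  have hU := isOpen_phaseSpace (S := S)
  have hB := holFam_omElem (holFam_omApp j)
  have hv : ∀ m ∈ phaseSpace S, ∀ a b, Val (zvar * omElem j m a b) 0 := fun m hm a b => by
    simpa using val_zvar.mul (omElem_ge j hm a b).val
  have h := fun t : Fin 2 => exists_linear_solution hU
    (N := fun m => Matrix.of fun a b => zvar * omElem j m a b)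
    (fun a b => (holFam_const zvar).mul hU (hB a b)) (fun m hm a b => (hv m hm a b).1)
    (y₀ := fun _ s => (1 : CMat) s t) (fun _ => analyticOnNhd_const)
    (fun m hm s => Finset.sum_eq_zero fun t _ => by
      rw [Matrix.of_apply, (hv m hm s t).2, zero_mul])
    (fun m hm k hk => by
      have : (k : ℂ) ≠ 0 := by exact_mod_cast (by omega : k ≠ 0)
      simp only [Matrix.of_apply, (hv m hm _ _).2]
      rw [zero_add, zero_mul, sub_zero]
      exact mul_ne_zero this this)
  choose y hy hy0 hyE using h
  refine ⟨fun m => Matrix.of fun a b => y b m a, fun a b => hy b a, fun m a b => hy0 b m a,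
    fun m hm => ?_⟩
  ext a b : 1
  refine mul_left_cancel₀ zvar_ne_zero ?_
  have h1 := hyE b m hm a
  rw [Matrix.add_apply, ddz_apply, Matrix.mul_apply, Matrix.zero_apply, mul_zero, mul_add,
    Finset.mul_sum]
  simpa only [Matrix.of_apply, mul_assoc] using h1

/-- The series `Ξ_{q_j} = Λ Y Λ⁻¹`, `Λ = diag(1, z)`, of the solution `Y`. -/
def xiApp (Y : LMat) : LMat := !![Y 0 0, zvar⁻¹ * Y 0 1; zvar * Y 1 0, Y 1 1]

lemma exists_xiApp (j : Fin S.numApp) :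
    ∃ X : S.Total → LMat, HolFamMat (phaseSpace S) X ∧ ∀ m ∈ phaseSpace S,
      (∀ a b, Val (X m a b) ((1 : CMat) a b)) ∧ (X m 1 0).coeff 1 = 0 ∧
      ddz (cstMat !![1, 0; pc m j, 1] * X m * !![1, 0; 0, zvar])
        + omApp j m * (cstMat !![1, 0; pc m j, 1] * X m * !![1, 0; 0, zvar]) = 0 := by
  have hU := isOpen_phaseSpace (S := S)
  have hz := zvar_ne_zero
  obtain ⟨Y, hY, hY0, hYE⟩ := exists_regular_solution j
  refine ⟨fun m => xiApp (Y m), ?_, fun m hm => ?_⟩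
  · intro a b
    fin_cases a <;> fin_cases b
    · exact hY 0 0
    · exact (holFam_const _).mul hU (hY 0 1)
    · exact (holFam_const _).mul hU (hY 1 0)
    · exact hY 1 1
  have hB := omElem_ge j hm
  -- the vanishing of `B₁₂` at `q_j` gives `Y₁₂ = O(z²)`
  have h01 : OrdGE 2 (Y m 0 1) := by
    have h1 := congrFun (congrFun (hYE m hm) 0) 1
    rw [Matrix.add_apply, ddz_apply, Matrix.mul_apply, Fin.sum_univ_two, Matrix.zero_apply] at h1
    have hB01 : OrdGE 1 (omElem j m 0 1) := by
      rw [omElem_apply_zero_one]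
      exact (omApp_zero_one_val j hm).1.mul ordGE_zvar (by omega)
    have hY1 : OrdGE 1 (Y m 0 1) := (hY0 m 0 1).ordGE_one
    have h2 : OrdGE 1 (dz (Y m 0 1)) := by
      rw [eq_neg_of_add_eq_zero_left h1]
      exact (((hB 0 0).mul hY1 (by omega)).add (hB01.mul (hY0 m 1 1).1 (by omega))).neg
    intro k hk
    rcases lt_or_ge k 1 with h | h
    · exact hY1 k h
    · obtain rfl : k = 1 := by omega
      have h3 := h2 0 (by omega)
      rw [dz_coeff] at h3
      simpa using h3
  have e : cstMat !![1, 0; pc m j, 1] * xiApp (Y m) * !![1, 0; 0, zvar] = elemQ j m * Y m := by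
    ext a b : 1
    fin_cases a <;> fin_cases b <;>
      simp [Matrix.mul_apply, cstMat_apply, xiApp, elemQ] <;> field_simp
  refine ⟨fun a b => ?_, ?_, ?_⟩
  · fin_cases a <;> fin_cases b
    · exact hY0 m 0 0
    · have : OrdGE 1 (zvar ^ (-1 : ℤ) * Y m 0 1) := by
        rw [ordGE_zpow_mul]
        exact h01.mono (by omega)
      rw [zpow_neg_one] at this
      exact ⟨this.mono (by omega), this 0 (by omega)⟩
    · have := val_zvar.mul (hY0 m 1 0)
      rw [zero_mul] at this
      exact this
    · exact hY0 m 1 1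
  · have h1 : (zvar * Y m 1 0).coeff 1 = 0 := by
      rw [zvar_mul_coeff, sub_self]
      exact (hY0 m 1 0).2
    exact h1
  · rw [e]
    have h0 := (gaugeTransform_eq_iff (elemQ_det_ne j m) (A := omApp j m)
      (B := omElem j m)).mp rfl
    calc ddz (elemQ j m * Y m) + omApp j m * (elemQ j m * Y m)
        = (ddz (elemQ j m) + omApp j m * elemQ j m) * Y m + elemQ j m * ddz (Y m) := by
          rw [ddz_mul]
          noncomm_ring
      _ = elemQ j m * (ddz (Y m) + omElem j m * Y m) := by
          rw [← h0]
          noncomm_ring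
      _ = 0 := by rw [hYE m hm, mul_zero]

/-- The conditions on the gauge `Φ Ξ` at a pole. -/
lemma exists_pole_frame (i : Option (Fin ν)) :
    ∃ G : S.Total → LMat, HolFamMat (phaseSpace S) G ∧
      (∀ m ∈ phaseSpace S, MatGE 0 (G m) ∧ (leadMat (G m)).det ≠ 0) ∧
      (S.kind i ≠ Kind.ra → ∀ m ∈ phaseSpace S,
        (∀ s, 0 < s → ∀ a, xiCoeff (G m) s a a = 0) ∧
        (gaugeTransform (G m) (omPole i m)).IsDiag ∧
        ∀ s, OrdGE 0 (gaugeTransform (G m) (omPole i m) s s - formalUn m.2 i s s)) ∧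
      (S.kind i = Kind.ra → (∀ m ∈ phaseSpace S,
        ∃ α β, gaugeTransform (G m) (omPole i m) = ramShape α β ∧
          OrdGE 0 (α - zvar ^ (-(S.ord i : ℤ)) * expRaA m.2 i) ∧
          OrdGE (-1) (β - zvar ^ (-(S.ord i : ℤ)) * expRaB m.2 i)) ∧
        ∀ m ∈ phaseSpace S, ∀ m' ∈ phaseSpace S, m.2 = m'.2 →
          (∀ a, OrdGE (S.ord i) (G m a 0 - G m' a 0)) ∧ MatGE (S.ord i - 1) (G m - G m')) := by
  have hl : ∀ m ∈ phaseSpace S, LocalForm m.2 i (omPole i m) := fun m hm => omPole_localForm i hm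
  by_cases hi : S.kind i = Kind.ra
  · obtain ⟨G, hG, h1, h2⟩ := exists_ram_frame hi (holFam_omPole i) hl
    exact ⟨G, hG, fun m hm => ⟨(h1 m hm).1, (h1 m hm).2.1⟩, fun h => absurd hi h,
      fun _ => ⟨fun m hm => (h1 m hm).2.2, h2⟩⟩
  · obtain ⟨G, hG, h1⟩ := exists_unram_frame hi (holFam_omPole i) hl
    exact ⟨G, hG, fun m hm => ⟨(h1 m hm).1, (h1 m hm).2.1⟩, fun _ m hm => (h1 m hm).2.2,
      fun h => absurd h hi⟩

lemma leadMat_eq_of_sub {G G' : LMat} {N : ℤ} (hN : 1 ≤ N) (h : MatGE N (G - G')) :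
    leadMat G = leadMat G' := by
  ext a b
  exact coeff_eq_of_sub (h a b) (by omega)

lemma xiCoeff_eq_of_sub {G G' : LMat} {N : ℤ} (hd : (leadMat G).det ≠ 0)
    (hl : leadMat G = leadMat G') {b : Fin 2} (h : ∀ a, OrdGE N (G a b - G' a b)) {s : ℕ}
    (hs : (s : ℤ) < N) (a : Fin 2) : xiCoeff G s a b = xiCoeff G' s a b := by
  rw [xiCoeff, xiCoeff, Matrix.of_apply, Matrix.of_apply, ← hl]
  refine coeff_eq_of_sub (N := N) ?_ hs
  rw [cstMat_inv hd, Matrix.mul_apply, Matrix.mul_apply, ← Finset.sum_sub_distrib]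
  refine ordGE_sum _ _ fun c _ => ?_
  rw [← mul_sub]
  exact (h c).cst_mul _

/-- Formal solutions exist holomorphically on the phase space. -/
theorem exists_isCompatible : ∃ F : Frames S, F.IsCompatible := by
  have hU := isOpen_phaseSpace (S := S)
  choose G hG hGu hGun hGra using exists_pole_frame (S := S)
  choose X hX hXs using exists_xiApp (S := S)
  let F : Frames S :=
    { Phi := fun i m => leadMat (G i m)
      Xi := fun i s m => xiCoeff (G i m) s
      XiQ := fun j s m => Matrix.of fun a b => (X j m a b).coeff s }
  have hframe : ∀ i, ∀ m ∈ phaseSpace S, frameZ F i m = G i m := fun i m hm =>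
    frame_mul_eq (hGu i m hm).1 (hGu i m hm).2
  refine ⟨F, ⟨fun i => holMat_leadMat (hG i), fun i s =>
    holMat_xiCoeff (hG i) (fun m hm => (hGu i m hm).2) s, fun j s a b => (hX j a b).an s,
    fun i m hm => (hGu i m hm).2, fun i m hm => xiCoeff_zero (hGu i m hm).1 (hGu i m hm).2,
    fun i hi m hm => ?_, fun i hi m hm => ?_, fun i hi m hm m' hm' h => ?_, fun j m hm => ?_⟩⟩
  · obtain ⟨h1, h2, h3⟩ := hGun i hi m hm
    have h4 := h3
    rw [← hframe i m hm] at h2 h4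
    refine ⟨h1, h2, fun k hk s => ?_, fun l hl s => ?_⟩
    · refine (coeff_eq_of_sub (h4 s) (by omega)).trans ?_
      rw [formalUn_eq, zpow_mul_coeff]
      exact expUn_ge _ _ _ _ (by omega)
    · refine (coeff_eq_of_sub (h4 s) (by omega)).trans ?_
      rw [formalUn_eq, zpow_mul_coeff, sub_neg_eq_add, sub_add_cancel]
      exact expUn_coeff _ _ _ hl
  · obtain ⟨α, β, h1, h2, h3⟩ := (hGra i hi).1 m hm
    rw [← hframe i m hm] at h1
    have hn : 2 ≤ S.ord i := S.ord_irr i (by rw [hi]; decide)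
    refine ⟨α, β, h1, fun k hk => ⟨(coeff_eq_of_sub h2 (by omega)).trans ?_,
      (coeff_eq_of_sub h3 (by omega)).trans ?_⟩, fun l hl =>
      (coeff_eq_of_sub h2 (by omega)).trans ?_, fun l hl =>
      (coeff_eq_of_sub h3 (by omega)).trans ?_⟩
    · rw [zpow_mul_coeff]
      exact expRaA_ge _ _ _ (by omega)
    · rw [zpow_mul_coeff]
      exact expRaB_ge _ _ _ (by omega)
    · rw [zpow_mul_coeff, sub_neg_eq_add, sub_add_cancel]
      exact expRaA_coeff _ _ hl
    · rw [zpow_mul_coeff, sub_neg_eq_add, sub_add_cancel]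
      exact expRaB_coeff _ _ hl
  · obtain ⟨h1, h2⟩ := (hGra i hi).2 m hm m' hm' h
    have hn : 2 ≤ S.ord i := S.ord_irr i (by rw [hi]; decide)
    have hl : leadMat (G i m) = leadMat (G i m') := leadMat_eq_of_sub (by omega) h2
    refine ⟨hl, fun s hs => ?_, fun a => ?_⟩
    · ext a b
      exact xiCoeff_eq_of_sub (hGu i m hm).2 hl (fun a => h2 a b) (by omega) a
    · exact xiCoeff_eq_of_sub (hGu i m hm).2 hl h1 (by omega) a
  · obtain ⟨h1, h2, h3⟩ := hXs j m hm
    have e : (seriesMat fun s => F.XiQ j s m) = X j m := seriesMat_of_ge fun a b => (h1 a b).1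
    refine ⟨?_, ?_, ?_⟩
    · ext a b
      exact (h1 a b).2
    · exact h2
    · have e' : psiQ F j m = cstMat !![1, 0; pc m j, 1] * X j m * !![1, 0; 0, zvar] := by
        rw [psiQ, e]
      rw [e']
      exact h3

end Existence

/-! ### Holomorphic 2-forms on the phase space -/

/-- A family of alternating bilinear forms in the tangent vectors, holomorphic on `U`. -/
structure IsForm (U : Set S.Total) (ω : S.Total → S.Total → S.Total → ℂ) : Prop where
  add : ∀ m ∈ U, ∀ v w x, ω m (v + w) x = ω m v x + ω m w x
  smul : ∀ m ∈ U, ∀ (c : ℂ) v x, ω m (c • v) x = c * ω m v x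
  swap : ∀ m ∈ U, ∀ v w, ω m w v = -ω m v w
  an : ∀ v w, AnalyticOnNhd ℂ (fun m => ω m v w) U

section Forms

variable {U : Set S.Total}

lemma IsForm.addForm {ω η : S.Total → S.Total → S.Total → ℂ} (hω : IsForm U ω)
    (hη : IsForm U η) : IsForm U fun m v w => ω m v w + η m v w where
  add m hm v w x := by rw [hω.add m hm, hη.add m hm]; ring
  smul m hm c v x := by rw [hω.smul m hm, hη.smul m hm]; ring
  swap m hm v w := by rw [hω.swap m hm, hη.swap m hm]; ring
  an v w := (hω.an v w).add (hη.an v w)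

lemma IsForm.constMul {ω : S.Total → S.Total → S.Total → ℂ} (hω : IsForm U ω) (c : ℂ) :
    IsForm U fun m v w => c * ω m v w where
  add m hm v w x := by rw [hω.add m hm]; ring
  smul m hm c v x := by rw [hω.smul m hm]; ring
  swap m hm v w := by rw [hω.swap m hm]; ring
  an v w := analyticOnNhd_const.mul (hω.an v w)

lemma IsForm.sum {ι : Type*} (s : Finset ι) {ω : ι → S.Total → S.Total → S.Total → ℂ}
    (hω : ∀ i ∈ s, IsForm U (ω i)) : IsForm U fun m v w => ∑ i ∈ s, ω i m v w where
  add m hm v w x := by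
    rw [← Finset.sum_add_distrib]
    exact Finset.sum_congr rfl fun i hi => (hω i hi).add m hm v w x
  smul m hm c v x := by
    rw [Finset.mul_sum]
    exact Finset.sum_congr rfl fun i hi => (hω i hi).smul m hm c v x
  swap m hm v w := by
    rw [← Finset.sum_neg_distrib]
    exact Finset.sum_congr rfl fun i hi => (hω i hi).swap m hm v w
  an v w := Finset.analyticOnNhd_fun_sum _ fun i hi => (hω i hi).an v w

lemma isForm_wedgeD {f g : S.Total → ℂ} (hf : AnalyticOnNhd ℂ f U) (hg : AnalyticOnNhd ℂ g U) :
    IsForm U (wedgeD f g) where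
  add m _ v w x := by simp only [wedgeD, map_add]; ring
  smul m _ c v x := by simp only [wedgeD, map_smul, smul_eq_mul]; ring
  swap m _ v w := by simp only [wedgeD]; ring
  an v w := ((analyticOnNhd_fderiv_apply hf v).mul (analyticOnNhd_fderiv_apply hg w)).sub
    ((analyticOnNhd_fderiv_apply hf w).mul (analyticOnNhd_fderiv_apply hg v))

/-- A matrix-valued family of linear forms in the tangent vector, holomorphic on `U`. -/
structure IsMatForm (U : Set S.Total) (D : S.Total → S.Total → LMat) : Prop where
  add : ∀ m ∈ U, ∀ v w, D m (v + w) = D m v + D m w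
  smul : ∀ m ∈ U, ∀ (c : ℂ) v a b, D m (c • v) a b = cst c * D m v a b
  hol : ∀ v, HolFamMat U fun m => D m v

lemma isForm_resWedge (hU : IsOpen U) {D E : S.Total → S.Total → LMat} (hD : IsMatForm U D)
    (hE : IsMatForm U E) : IsForm U fun m v w => resWedge (D m) (E m) v w where
  add m hm v w x := by
    rw [resWedge, resWedge, resWedge, ← HahnSeries.coeff_add, ← Matrix.trace_add, hD.add m hm,
      hE.add m hm]
    congr 2
    noncomm_ring
  smul m hm c v x := by
    rw [resWedge, resWedge, ← cst_mul_coeff]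
    congr 1
    simp only [Matrix.trace_fin_two, Matrix.sub_apply, Matrix.mul_apply, Fin.sum_univ_two,
      hD.smul m hm, hE.smul m hm]
    ring
  swap m hm v w := by
    rw [resWedge, resWedge, ← HahnSeries.coeff_neg, ← Matrix.trace_neg, neg_sub, Matrix.trace_sub,
      Matrix.trace_sub, Matrix.trace_mul_comm (D m w), Matrix.trace_mul_comm (E m w)]
  an v w := by
    have h := ((hD.hol v).mul hU (hE.hol w)).sub ((hE.hol v).mul hU (hD.hol w))
    have h2 := ((h 0 0).add (h 1 1)).an (-1)
    simp only [resWedge, Matrix.trace_fin_two]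
    exact h2

lemma isMatForm_varMat (hU : IsOpen U) {a : S.Total → ℂ} (ha : AnalyticOnNhd ℂ a U)
    {A : S.Total → LMat} (hA : HolFamMat U A) : IsMatForm U (varMat a A) where
  add _ hm v w := varMat_add_dir hU a hA hm v w
  smul _ hm c v r s := varL_smul_dir hU a (hA r s) hm c v
  hol v := hA.varMat hU ha v

lemma IsMatForm.mulRight (hU : IsOpen U) {D : S.Total → S.Total → LMat} (hD : IsMatForm U D)
    {B : S.Total → LMat} (hB : HolFamMat U B) : IsMatForm U fun m v => D m v * B m where
  add m hm v w := by rw [hD.add m hm, add_mul]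
  smul m hm c v a b := by
    simp only [Matrix.mul_apply, Fin.sum_univ_two, hD.smul m hm]
    ring
  hol v := (hD.hol v).mul hU hB

lemma IsMatForm.mulLeft (hU : IsOpen U) {D : S.Total → S.Total → LMat} (hD : IsMatForm U D)
    {B : S.Total → LMat} (hB : HolFamMat U B) : IsMatForm U fun m v => B m * D m v where
  add m hm v w := by rw [hD.add m hm, mul_add]
  smul m hm c v a b := by
    simp only [Matrix.mul_apply, Fin.sum_univ_two, hD.smul m hm]
    ring
  hol v := hB.mul hU (hD.hol v)

lemma IsMatForm.sub {D E : S.Total → S.Total → LMat} (hD : IsMatForm U D) (hE : IsMatForm U E) :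
    IsMatForm U fun m v => D m v - E m v where
  add m hm v w := by rw [hD.add m hm, hE.add m hm]; abel
  smul m hm c v a b := by
    rw [Matrix.sub_apply, Matrix.sub_apply, hD.smul m hm, hE.smul m hm, mul_sub]
  hol v := (hD.hol v).sub (hE.hol v)

lemma isMatForm_varPrim (hU : IsOpen U) {a : S.Total → ℂ} (ha : AnalyticOnNhd ℂ a U)
    {B : S.Total → LMat} (hB : HolFamMat U B) : IsMatForm U fun m v =>
      Matrix.diagonal fun s => varPrim a (fun m' => B m' s s) m v where
  add m hm v w := by
    rw [Matrix.diagonal_add]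
    congr 1
    funext s
    exact varPrim_add_dir hU a (hB s s) hm v w
  smul m hm c v r s := by
    by_cases hrs : r = s
    · subst hrs
      simp only [Matrix.diagonal_apply_eq]
      exact varPrim_smul_dir hU a (hB r r) hm c v
    · simp only [Matrix.diagonal_apply_ne _ hrs, mul_zero]
  hol v r s := by
    by_cases hrs : r = s
    · subst hrs
      simp only [Matrix.diagonal_apply_eq]
      exact (hB r r).varPrim hU ha v
    · simp only [Matrix.diagonal_apply_ne _ hrs]
      exact holFam_const 0

lemma isMatForm_logVar (hU : IsOpen U) {a : S.Total → ℂ} (ha : AnalyticOnNhd ℂ a U)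
    {g B : S.Total → LMat} (hg : HolFamMat U g) (hd : UnitFam U fun m => (g m).det)
    (hB : HolFamMat U B) : IsMatForm U (logVar a g B) :=
  ((isMatForm_varMat hU ha hg).mulRight hU (hg.inv hU hd)).sub
    (((isMatForm_varPrim hU ha hB).mulLeft hU hg).mulRight hU (hg.inv hU hd))

/-- The alternating form `(x, y) ↦ f(x) g(y) - f(y) g(x)`. -/
def wedgeForm (f g : S.Base →L[ℂ] ℂ) : S.Base [⋀^Fin 2]→L[ℂ] ℂ :=
  ContinuousMultilinearMap.alternatization
    ((ContinuousMultilinearMap.mkPiAlgebra ℂ (Fin 2) ℂ).compContinuousLinearMap ![f, g])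

lemma wedgeForm_apply (f g : S.Base →L[ℂ] ℂ) (x y : S.Base) :
    wedgeForm f g ![x, y] = f x * g y - f y * g x := by
  rw [wedgeForm, ContinuousMultilinearMap.alternatization_apply_apply,
    show (Finset.univ : Finset (Equiv.Perm (Fin 2))) = {1, Equiv.swap 0 1} by decide,
    Finset.sum_pair (by decide)]
  simp [Fin.prod_univ_two, sub_eq_add_neg]

/-- A holomorphic 2-form that vanishes on vectors of the fibre is a holomorphic section of the
pull-back of the 2-forms on the base. -/
lemma IsForm.exists_section {ω : S.Total → S.Total → S.Total → ℂ} (hω : IsForm U ω)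
    (hv : ∀ m ∈ U, ∀ v w : S.Total, v.2 = 0 → ω m v w = 0) :
    ∃ τ : S.Total → S.Base [⋀^Fin 2]→L[ℂ] ℂ, AnalyticOnNhd ℂ τ U ∧
      ∀ m ∈ U, ∀ v w : S.Total, ω m v w = τ m ![v.2, w.2] := by
  let b := Module.finBasis ℂ S.Base
  let x : Fin (Module.finrank ℂ S.Base) → S.Base →L[ℂ] ℂ := fun k =>
    (b.coord k).toContinuousLinearMap
  let e : Fin (Module.finrank ℂ S.Base) → S.Total := fun k => (0, b k)
  refine ⟨fun m => ∑ k, ∑ l, (1 / 2 * ω m (e k) (e l)) • wedgeForm (x k) (x l), ?_, ?_⟩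
  · exact Finset.analyticOnNhd_fun_sum _ fun k _ => Finset.analyticOnNhd_fun_sum _ fun l _ =>
      (analyticOnNhd_const.mul (hω.an _ _)).smul analyticOnNhd_const
  intro m hm v w
  have hleft : ∀ v w : S.Total, ω m v w = ∑ k, x k v.2 * ω m (e k) w := by
    intro v w
    let L : S.Total →ₗ[ℂ] ℂ :=
      { toFun := fun v => ω m v w
        map_add' := fun v v' => hω.add m hm v v' w
        map_smul' := fun c v => hω.smul m hm c v w }
    have h1 : v = (v.1, 0) + ∑ k, x k v.2 • e k := by
      refine Prod.ext ?_ ?_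
      · simp [e, Prod.fst_sum]
      · simp [e, Prod.snd_sum, x]
    have h2 : L v = L (v.1, 0) + ∑ k, x k v.2 * L (e k) := by
      conv_lhs => rw [h1]
      rw [map_add, map_sum]
      simp only [map_smul, smul_eq_mul]
    have h3 : L (v.1, 0) = 0 := hv m hm _ _ rfl
    rw [h3, zero_add] at h2
    exact h2
  have hright : ∀ v w : S.Total, ω m v w = ∑ l, x l w.2 * ω m v (e l) := by
    intro v w
    rw [hω.swap m hm w v, hleft w v, ← Finset.sum_neg_distrib]
    refine Finset.sum_congr rfl fun l _ => ?_
    rw [hω.swap m hm v (e l)]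
    ring
  have hexp : ∀ v w : S.Total, ω m v w = ∑ k, ∑ l, ω m (e k) (e l) * (x k v.2 * x l w.2) := by
    intro v w
    rw [hleft v w]
    refine Finset.sum_congr rfl fun k _ => ?_
    rw [hright (e k) w, Finset.mul_sum]
    exact Finset.sum_congr rfl fun l _ => by ring
  have e1 : ω m v w = 1 / 2 * ω m v w - 1 / 2 * ω m w v := by
    rw [hω.swap m hm v w]
    ring
  rw [e1, hexp v w, hexp w v]
  simp only [ContinuousAlternatingMap.sum_apply, ContinuousAlternatingMap.smul_apply,
    wedgeForm_apply, smul_eq_mul, Finset.mul_sum, ← Finset.sum_sub_distrib]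
  refine Finset.sum_congr rfl fun k _ => Finset.sum_congr rfl fun l _ => ?_
  ring

end Forms

/-! ### The functions `η_j` and the Hamiltonians -/

section Hamiltonians

variable {F : Frames S} {i : Option (Fin ν)}

/-- The sum over the other apparent singularities by which `η_j` differs from the regular part of
the connection. -/
def pairSum (j : Fin S.numApp) (m : S.Total) : ℂ :=
  ∑ k ∈ Finset.univ.erase j, 1 / (qc m j - qc m k)

lemma eta_eq (j : Fin S.numApp) {m : S.Total} (hm : m ∈ phaseSpace S) :
    eta j m = -(omElem j m 1 1).coeff 0 - pairSum j m := by
  rw [(omElem_one_one_val j hm).2, eta, normalForm_eq hm, dReg, pairSum]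
  ring

lemma analytic_pairSum (j : Fin S.numApp) : AnalyticOnNhd ℂ (pairSum j) (phaseSpace S) := by
  refine Finset.analyticOnNhd_fun_sum _ fun k hk => ?_
  simp only [one_div]
  exact ((analytic_qc j _).sub (analytic_qc k _)).inv fun m hm =>
    sub_ne_zero.mpr fun h => (Finset.ne_of_mem_erase hk) (hm.2.1 h).symm

lemma analytic_omElem (j : Fin S.numApp) :
    AnalyticOnNhd ℂ (fun m => (omElem j m 1 1).coeff 0) (phaseSpace S) :=
  (holFam_omElem (holFam_omApp j) 1 1).an 0

lemma analytic_eta (j : Fin S.numApp) : AnalyticOnNhd ℂ (eta j) (phaseSpace S) :=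
  ((analytic_omElem j).neg.sub (analytic_pairSum j)).congr isOpen_phaseSpace
    fun _ hm => (eta_eq j hm).symm

lemma analytic_hamUn (hF : F.IsCompatible) (i : Option (Fin ν)) (l : ℕ) (s : Fin 2) :
    AnalyticOnNhd ℂ (hamUn F i l s) (phaseSpace S) :=
  (analytic_thetaHat hF (holFam_omPole i) _ s).div_const

lemma analytic_hamT (hF : F.IsCompatible) (i : Fin ν) :
    AnalyticOnNhd ℂ (hamT F i) (phaseSpace S) :=
  Finset.analyticOnNhd_fun_sum _ fun _ _ => Finset.analyticOnNhd_fun_sum _ fun s _ =>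
    (analytic_thetaHat hF (holFam_omPole _) _ s).mul (analytic_thetaHat hF (holFam_omPole _) _ s)

lemma analytic_hamRa_correction (hF : F.IsCompatible) (hi : S.kind i = Kind.ra) :
    AnalyticOnNhd ℂ (fun m => (2 * thetaHatRa F i 1 m)⁻¹) (phaseSpace S) :=
  (analyticOnNhd_const.mul (analytic_thetaHatRa hF (holFam_omPole i) 1)).inv fun _ hm =>
    mul_ne_zero two_ne_zero (thetaHatRa_one_ne hF hi hm)

lemma hamRa_eq (F : Frames S) (i : Option (Fin ν)) (l : ℕ) : hamRa F i l = fun m =>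
    thetaHatRa F i (4 * (S.ord i - 1) - l) m * (2 * ((S.ord i : ℂ) - 1) - l)⁻¹
      - (if l = 0 then 1 else 0) * (thetaHatRa F i (2 * S.ord i - 1) m
          * (2 * thetaHatRa F i 1 m)⁻¹) := by
  funext m
  rw [hamRa, div_eq_mul_inv, div_eq_mul_inv]
  split_ifs
  · rw [one_mul]
  · rw [zero_mul]

lemma analytic_hamRa (hF : F.IsCompatible) (hi : S.kind i = Kind.ra) (l : ℕ) :
    AnalyticOnNhd ℂ (hamRa F i l) (phaseSpace S) := by
  have h := fun l => analytic_thetaHatRa hF (holFam_omPole i) l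
  rw [hamRa_eq]
  exact ((h _).mul analyticOnNhd_const).sub (analyticOnNhd_const.mul
    ((h _).mul (analytic_hamRa_correction hF hi)))

lemma fderiv_hamUn (hF : F.IsCompatible) (i : Option (Fin ν)) (l : ℕ) (s : Fin 2) {m : S.Total}
    (hm : m ∈ phaseSpace S) (v : S.Total) : fderiv ℂ (hamUn F i l s) m v
      = fderiv ℂ (thetaHat F i (2 * S.ord i - l - 2) s) m v / ((S.ord i : ℂ) - l - 1) := by
  have e : hamUn F i l s = fun m =>
      thetaHat F i (2 * S.ord i - l - 2) s m * ((S.ord i : ℂ) - l - 1)⁻¹ := by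
    funext m
    rw [hamUn, div_eq_mul_inv]
  rw [e, fderiv_mul_const (analytic_thetaHat hF (holFam_omPole i) _ s m hm).differentiableAt,
    div_eq_mul_inv]
  exact mul_comm _ _

/-- Along the fibre, only the second factors of the Hamiltonian of `t_i` vary. -/
lemma fderiv_hamT (hF : F.IsCompatible) {i : Fin ν} (hi : S.kind (some i) ≠ Kind.ra) {m v : S.Total}
    (hm : m ∈ phaseSpace S) (hv : v.2 = 0) : fderiv ℂ (hamT F i) m v
      = ∑ l ∈ Finset.range (S.ord (some i)), ∑ s : Fin 2, thetaHat F (some i) l s m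
          * fderiv ℂ (thetaHat F (some i) (2 * S.ord (some i) - l - 1) s) m v := by
  have hd : ∀ l s, HasFDerivAt (thetaHat F (some i) l s) (fderiv ℂ (thetaHat F (some i) l s) m) m :=
    fun l s => (analytic_thetaHat hF (holFam_omPole _) l s m hm).differentiableAt.hasFDerivAt
  have h : HasFDerivAt (hamT F i) _ m := HasFDerivAt.fun_sum fun l _ =>
    HasFDerivAt.fun_sum fun s _ => (hd l s).mul (hd (2 * S.ord (some i) - l - 1) s)
  rw [h.fderiv]
  simp only [_root_.sum_apply, _root_.add_apply, _root_.smul_apply, smul_eq_mul]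
  refine Finset.sum_congr rfl fun l hl => Finset.sum_congr rfl fun s _ => ?_
  rw [thetaHat_eventuallyEq hF hi (Finset.mem_range.mp hl) s hm, fderiv_thetaUn_vertical _ _ _ hv,
    mul_zero, add_zero]

/-- Along the fibre, `θ_1` in the correction term does not vary. -/
lemma fderiv_hamRa (hF : F.IsCompatible) (hi : S.kind i = Kind.ra) (l : ℕ) {m v : S.Total}
    (hm : m ∈ phaseSpace S) (hv : v.2 = 0) : fderiv ℂ (hamRa F i l) m v
      = fderiv ℂ (thetaHatRa F i (4 * (S.ord i - 1) - l)) m v / (2 * ((S.ord i : ℂ) - 1) - l)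
        - (if l = 0 then 1 else 0) * (1 / 2 * (fderiv ℂ (thetaHatRa F i (2 * S.ord i - 1)) m v
          / thetaHatRa F i 1 m)) := by
  have hn := S.ord_irr i (by rw [hi]; decide)
  have hd : ∀ l, HasFDerivAt (thetaHatRa F i l) (fderiv ℂ (thetaHatRa F i l) m) m :=
    fun l => (analytic_thetaHatRa hF (holFam_omPole _) l m hm).differentiableAt.hasFDerivAt
  have hc := (analytic_hamRa_correction hF hi m hm).differentiableAt.hasFDerivAt
  have hc0 : fderiv ℂ (fun m => (2 * thetaHatRa F i 1 m)⁻¹) m v = 0 :=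
    fderiv_vertical isOpen_phaseSpace (analytic_hamRa_correction hF hi)
      (fun m hm m' hm' h => by
        rw [thetaHatRa_eq hF hi (by omega) hm, thetaHatRa_eq hF hi (by omega) hm', h]) hm hv
  have h := ((hd (4 * (S.ord i - 1) - l)).mul_const (2 * ((S.ord i : ℂ) - 1) - l)⁻¹).sub
    (((hd (2 * S.ord i - 1)).mul hc).const_mul (if l = 0 then 1 else 0))
  rw [hamRa_eq]
  refine (congrArg (fun L : S.Total →L[ℂ] ℂ => L v) h.fderiv).trans ?_
  simp only [_root_.sub_apply, _root_.add_apply, _root_.smul_apply, smul_eq_mul, hc0]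
  rw [mul_inv]
  ring

/-- The interaction terms of the apparent singularities cancel by antisymmetry. -/
lemma sum_wedgeD_pairSum {m : S.Total} (hm : m ∈ phaseSpace S) (v w : S.Total) :
    ∑ j, wedgeD (pairSum j) (fun m' => qc m' j) m v w = 0 := by
  let D : Fin S.numApp → S.Total → ℂ := fun j v => fderiv ℂ (fun m' => qc m' j) m v
  let T : Fin S.numApp → Fin S.numApp → ℂ := fun j k =>
    (D k v * D j w - D k w * D j v) / (qc m j - qc m k) ^ 2
  have hd : ∀ (j : Fin S.numApp) (v : S.Total), fderiv ℂ (pairSum j) m v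
      = ∑ k ∈ Finset.univ.erase j, -(D j v - D k v) / (qc m j - qc m k) ^ 2 := by
    intro j v
    have hq : ∀ k, HasFDerivAt (fun m : S.Total => qc m k) (fderiv ℂ (fun m' => qc m' k) m) m :=
      fun k => (analytic_qc k Set.univ m (Set.mem_univ m)).differentiableAt.hasFDerivAt
    have h : HasFDerivAt (pairSum j) (∑ k ∈ Finset.univ.erase j,
        (-((qc m j - qc m k) ^ 2)⁻¹) • (fderiv ℂ (fun m' => qc m' j) m
          - fderiv ℂ (fun m' => qc m' k) m)) m := by
      refine HasFDerivAt.fun_sum fun k hk => ?_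
      simp only [one_div]
      have hne : qc m j - qc m k ≠ 0 :=
        sub_ne_zero.mpr fun h => (Finset.ne_of_mem_erase hk) (hm.2.1 h).symm
      exact (hasDerivAt_inv hne).comp_hasFDerivAt m ((hq j).sub (hq k))
    rw [h.fderiv, _root_.sum_apply]
    refine Finset.sum_congr rfl fun k _ => ?_
    simp only [_root_.sub_apply, _root_.smul_apply, smul_eq_mul, D]
    rw [div_eq_mul_inv]
    ring
  have h1 : ∀ j, wedgeD (pairSum j) (fun m' => qc m' j) m v w = ∑ k, T j k := by
    intro j
    have h0 : T j j = 0 := by simp [T]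
    rw [wedgeD, hd, hd, Finset.sum_mul, Finset.sum_mul, ← Finset.sum_sub_distrib,
      ← Finset.sum_erase _ h0]
    refine Finset.sum_congr rfl fun k _ => ?_
    simp only [T, D]
    ring
  have h2 : ∀ j k, T j k = -T k j := fun j k => by
    simp only [T]
    rw [← neg_sub (qc m k) (qc m j), neg_sq]
    ring
  have h3 : ∑ j, ∑ k, T j k = -∑ j, ∑ k, T j k := by
    conv_lhs => rw [Finset.sum_comm]
    rw [← Finset.sum_neg_distrib]
    refine Finset.sum_congr rfl fun j _ => ?_
    rw [← Finset.sum_neg_distrib]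
    exact Finset.sum_congr rfl fun k _ => h2 k j
  rw [Finset.sum_congr rfl fun j _ => h1 j]
  exact self_eq_neg.mp h3

end Hamiltonians

/-! ### The isomonodromy form and the explicit form -/

section Comparison

variable {F : Frames S}

lemma isForm_omegaHat (hF : F.IsCompatible) : IsForm (phaseSpace S) (omegaHat F) := by
  have hU := isOpen_phaseSpace (S := S)
  have h0 : AnalyticOnNhd ℂ (0 : S.Total → ℂ) (phaseSpace S) := analyticOnNhd_const
  refine (((IsForm.sum _ fun i _ => ?_).constMul (1 / 2)).addForm
    ((IsForm.sum _ fun i _ => ?_).constMul (1 / 4))).addForm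
    ((IsForm.sum _ fun j _ => ?_).constMul (1 / 2))
  · exact isForm_resWedge hU (isMatForm_varMat hU (analytic_center i _) (holFam_omPole i))
      (isMatForm_logVar hU (analytic_center i _) (holFam_frameZ hF i) (frameZ_det_unit hF i)
        (holFam_omDiag hF (holFam_omPole i)))
  · exact isForm_resWedge hU (isMatForm_varMat hU h0 ((holFam_omPole i).ramify hU))
      (isMatForm_logVar hU h0 (holFam_frameZeta hF i) (frameZeta_det_unit hF i)
        (holFam_omDiagZeta hF (holFam_omPole i)))
  · exact isForm_resWedge hU (isMatForm_varMat hU (analytic_qc j _) (holFam_omApp j))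
      ((isMatForm_varMat hU (analytic_qc j _) (holFam_psiQ hF)).mulRight hU
        ((holFam_psiQ hF).inv hU (psiQ_det_unit hF)))

lemma isForm_omegaExplicit (hF : F.IsCompatible) : IsForm (phaseSpace S) (omegaExplicit F) := by
  refine (((IsForm.sum _ fun j _ => ?_).addForm (IsForm.sum _ fun i _ => IsForm.sum _ fun l _ =>
    IsForm.sum _ fun s _ => ?_)).addForm (IsForm.sum _ fun i hi => IsForm.sum _ fun l _ =>
    ?_)).addForm (IsForm.sum _ fun i _ => ?_)
  · exact isForm_wedgeD (analytic_eta j) (analytic_qc j _)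
  · exact isForm_wedgeD (analytic_hamUn hF i l s) (analytic_thetaUn i l s _)
  · exact isForm_wedgeD (analytic_hamRa hF (Finset.mem_filter.mp hi).2 l) (analytic_thetaRa i l _)
  · exact isForm_wedgeD (analytic_hamT hF i) (analytic_pos i _)

lemma wedgeD_of_vertical {f g : S.Total → ℂ} {m v : S.Total} (h : fderiv ℂ g m v = 0)
    (w : S.Total) : wedgeD f g m v w = fderiv ℂ f m v * fderiv ℂ g m w := by
  rw [wedgeD, h, mul_zero, sub_zero]

/-- The contributions of the apparent singularities. -/
lemma sum_apparent (hF : F.IsCompatible) {m : S.Total} (hm : m ∈ phaseSpace S) (v w : S.Total) :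
    (1 / 2) * ∑ j, resWedge (varMat (fun m' => qc m' j) (omApp j) m)
        (fun v => varMat (fun m' => qc m' j) (psiQ F j) m v * (psiQ F j m)⁻¹) v w
      = ∑ j, wedgeD (eta j) (fun m' => qc m' j) m v w := by
  have hη : ∀ j (v : S.Total), fderiv ℂ (eta j) m v
      = -fderiv ℂ (fun m' => (omElem j m' 1 1).coeff 0) m v - fderiv ℂ (pairSum j) m v := by
    intro j v
    have e : eta j =ᶠ[nhds m] fun m' => -(omElem j m' 1 1).coeff 0 - pairSum j m' :=
      Filter.eventuallyEq_of_mem (isOpen_phaseSpace.mem_nhds hm) fun m' hm' => eta_eq j hm'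
    have h := ((analytic_omElem j m hm).differentiableAt.hasFDerivAt.neg).sub
      (analytic_pairSum j m hm).differentiableAt.hasFDerivAt
    rw [e.fderiv_eq]
    exact congrArg (fun L : S.Total →L[ℂ] ℂ => L v) h.fderiv
  rw [← add_zero (∑ j, wedgeD (eta j) (fun m' => qc m' j) m v w), ← sum_wedgeD_pairSum hm v w,
    ← Finset.sum_add_distrib, Finset.mul_sum]
  refine Finset.sum_congr rfl fun j _ => ?_
  rw [apparent_contribution hF (holFam_omApp j) (fun m hm => omElem_ge j hm)
    (fun m hm => (omApp_zero_one_val j hm).1) hm, wedgeD, wedgeD, hη, hη]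
  ring

/-- The contributions of the regular and unramified poles, for a first argument along the
fibre. -/
lemma sum_unram (hF : F.IsCompatible) {m v : S.Total} (hm : m ∈ phaseSpace S) (hv : v.2 = 0)
    (w : S.Total) :
    (1 / 2) * ∑ i with S.kind i ≠ Kind.ra, resWedge (varMat (center i) (omPole i) m)
        (logVar (center i) (frameZ F i) (omDiag F i) m) v w
      = ∑ i with S.kind i = Kind.un, ∑ l ∈ Finset.range (S.ord i - 1), ∑ s : Fin 2,
          wedgeD (hamUn F i l s) (fun m' => thetaUn m'.2 i l s) m v w
        + ∑ i : Fin ν with 2 ≤ i.val ∧ S.kind (some i) ≠ Kind.ra,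
          wedgeD (hamT F i) (fun m' => pos m'.2 i) m v w := by
  let f : Option (Fin ν) → ℂ := fun i => ∑ l ∈ Finset.range (S.ord i - 1), ∑ s : Fin 2,
    wedgeD (hamUn F i l s) (fun m' => thetaUn m'.2 i l s) m v w
  let g : Option (Fin ν) → ℂ := fun i => fderiv ℂ (center i) m w
    * ∑ l ∈ Finset.range (S.ord i), ∑ s : Fin 2,
        thetaHat F i l s m * fderiv ℂ (thetaHat F i (2 * S.ord i - l - 1) s) m v
  have h1 : ∀ i ∈ Finset.univ.filter (fun i => S.kind i ≠ Kind.ra),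
      (1 / 2) * resWedge (varMat (center i) (omPole i) m)
        (logVar (center i) (frameZ F i) (omDiag F i) m) v w = f i + g i := by
    intro i hi
    rw [unram_contribution hF (Finset.mem_filter.mp hi).2 (holFam_omPole i)
      (fun m hm m' hm' h => omPole_sub_ge i hm hm' h) hm hv w]
    have : f i = ∑ l ∈ Finset.range (S.ord i - 1), ∑ s : Fin 2,
        fderiv ℂ (thetaHat F i (2 * S.ord i - l - 2) s) m v / ((S.ord i : ℂ) - l - 1)
          * fderiv ℂ (fun m : S.Total => thetaUn m.2 i l s) m w :=
      Finset.sum_congr rfl fun l _ => Finset.sum_congr rfl fun s _ => by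
        rw [wedgeD_of_vertical (fderiv_thetaUn_vertical i l s hv), fderiv_hamUn hF i l s hm]
    rw [this]
    ring
  rw [Finset.mul_sum, Finset.sum_congr rfl h1, Finset.sum_add_distrib]
  congr 1
  · -- a regular pole has no free exponents
    refine (Finset.sum_subset (fun i hi => ?_) fun i hi hi' => ?_).symm
    · rw [Finset.mem_filter] at hi ⊢
      exact ⟨hi.1, by rw [hi.2]; decide⟩
    · have hreg : S.kind i = Kind.reg := by
        rw [Finset.mem_filter] at hi hi'
        cases hk : S.kind i with
        | reg => rfl
        | un => exact absurd ⟨hi.1, hk⟩ hi'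
        | ra => exact absurd hk hi.2
      simp only [f, S.ord_reg i hreg, Nat.sub_self, Finset.range_zero, Finset.sum_empty]
  · -- the points `0`, `1` and `∞` do not move
    rw [Finset.sum_filter, Finset.sum_filter, Fintype.sum_option]
    have h0 : g none = 0 := by
      have : fderiv ℂ (center none : S.Total → ℂ) m w = 0 := fderiv_zero_fun m w
      simp only [g, this, zero_mul]
    rw [h0, ite_self, zero_add]
    refine Finset.sum_congr rfl fun i _ => ?_
    by_cases hi : S.kind (some i) = Kind.ra
    · rw [if_neg (not_not.mpr hi), if_neg fun h => h.2 hi]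
    by_cases h2 : 2 ≤ i.val
    · rw [if_pos hi, if_pos ⟨h2, hi⟩, wedgeD_of_vertical (g := fun m' : S.Total => pos m'.2 i)
          (fderiv_center_vertical (some i) hv),
        fderiv_hamT hF hi hm hv, mul_comm]
      rfl
    · rw [if_pos hi, if_neg fun h => h2 h.1]
      have : ∃ c : ℂ, center (some i) = fun _ : S.Total => c := by
        refine ⟨if i.val = 0 then 0 else 1, funext fun m' => ?_⟩
        rw [center, pos]
        by_cases h : i.val = 0
        · rw [if_pos h, if_pos h]
        · rw [if_neg h, if_neg h, if_pos (by omega)]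
      obtain ⟨c, hc⟩ := this
      simp only [g, hc, fderiv_fun_const]
      exact zero_mul _

/-- The contributions of the ramified poles, for a first argument along the fibre. -/
lemma sum_ram (hF : F.IsCompatible) {m v : S.Total} (hm : m ∈ phaseSpace S) (hv : v.2 = 0)
    (w : S.Total) :
    (1 / 4) * ∑ i with S.kind i = Kind.ra, resWedge (varMat 0 (fun m' => ramify (omPole i m')) m)
        (logVar 0 (frameZeta F i) (omDiagZeta F i) m) v w
      = ∑ i with S.kind i = Kind.ra, ∑ l ∈ Finset.range (2 * S.ord i - 2),
          wedgeD (hamRa F i l) (fun m' => thetaRa m'.2 i l) m v w := by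
  rw [Finset.mul_sum]
  refine Finset.sum_congr rfl fun i hi => ?_
  have hi' := (Finset.mem_filter.mp hi).2
  have hn := S.ord_irr i (by rw [hi']; decide)
  rw [ram_contribution hF hi' (holFam_omPole i)
    (fun m hm m' hm' h => omPole_sub_ge i hm hm' h) hm hv w]
  have h1 : ∀ l ∈ Finset.range (2 * S.ord i - 2),
      wedgeD (hamRa F i l) (fun m' => thetaRa m'.2 i l) m v w
      = fderiv ℂ (thetaHatRa F i (4 * (S.ord i - 1) - l)) m v / (2 * ((S.ord i : ℂ) - 1) - l)
          * fderiv ℂ (fun m : S.Total => thetaRa m.2 i l) m w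
        - if l = 0 then 1 / 2 * (fderiv ℂ (thetaHatRa F i (2 * S.ord i - 1)) m v
          / thetaHatRa F i 1 m) * fderiv ℂ (fun m : S.Total => thetaRa m.2 i 0) m w else 0 := by
    intro l _
    rw [wedgeD_of_vertical (fderiv_thetaRa_vertical i l hv), fderiv_hamRa hF hi' l hm hv]
    split_ifs with h
    · subst h
      ring
    · ring
  rw [Finset.sum_congr rfl h1, Finset.sum_sub_distrib, Finset.sum_ite_eq' (Finset.range _) 0,
    if_pos (Finset.mem_range.mpr (by omega))]
  ring

/-- The two forms agree when one argument is tangent to the fibre. -/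
lemma omegaHat_eq_of_vertical (hF : F.IsCompatible) {m v : S.Total} (hm : m ∈ phaseSpace S)
    (hv : v.2 = 0) (w : S.Total) : omegaHat F m v w = omegaExplicit F m v w := by
  rw [omegaHat, omegaExplicit, sum_unram hF hm hv, sum_ram hF hm hv, sum_apparent hF hm]
  ring

end Comparison

end

end Isomonodromy

theorem theorem2020p1p29p11 {ν : ℕ} (S : Isomonodromy.SingularData ν) :
    (∀ m ∈ Isomonodromy.phaseSpace S, ∃! c, Isomonodromy.IsNormalForm m c) ∧
    (∃ F : Isomonodromy.Frames S, F.IsCompatible) ∧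
    ∀ F : Isomonodromy.Frames S, F.IsCompatible →
      ((∀ j, AnalyticOnNhd ℂ (Isomonodromy.eta j) (Isomonodromy.phaseSpace S)) ∧
        (∀ i, S.kind i = Isomonodromy.Kind.un → ∀ l < S.ord i - 1, ∀ s : Fin 2,
          AnalyticOnNhd ℂ (Isomonodromy.hamUn F i l s) (Isomonodromy.phaseSpace S)) ∧
        (∀ i, S.kind i = Isomonodromy.Kind.ra → ∀ l < 2 * S.ord i - 2,
          AnalyticOnNhd ℂ (Isomonodromy.hamRa F i l) (Isomonodromy.phaseSpace S)) ∧
        (∀ i : Fin ν, 2 ≤ i.val → S.kind (some i) ≠ Isomonodromy.Kind.ra →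
          AnalyticOnNhd ℂ (Isomonodromy.hamT F i) (Isomonodromy.phaseSpace S))) ∧
      ∃ τ : S.Total → S.Base [⋀^Fin 2]→L[ℂ] ℂ,
        AnalyticOnNhd ℂ τ (Isomonodromy.phaseSpace S) ∧
        ∀ m ∈ Isomonodromy.phaseSpace S, ∀ v₁ v₂ : S.Total,
          Isomonodromy.omegaHat F m v₁ v₂ - Isomonodromy.omegaExplicit F m v₁ v₂
            = τ m ![v₁.2, v₂.2] := by
  refine ⟨fun m hm => ⟨_, Isomonodromy.explicit_isNormalForm hm, fun c hc => hc.eq_explicit hm⟩,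
    Isomonodromy.exists_isCompatible, fun F hF => ⟨⟨Isomonodromy.analytic_eta,
      fun i _ l _ s => Isomonodromy.analytic_hamUn hF i l s,
      fun i hi l _ => Isomonodromy.analytic_hamRa hF hi l,
      fun i _ _ => Isomonodromy.analytic_hamT hF i⟩, ?_⟩⟩
  have h := (Isomonodromy.isForm_omegaHat hF).addForm
    ((Isomonodromy.isForm_omegaExplicit hF).constMul (-1))
  obtain ⟨τ, hτ, hω⟩ := h.exists_section fun m hm v w hv => by
    rw [Isomonodromy.omegaHat_eq_of_vertical hF hm hv]
    ring
  refine ⟨τ, hτ, fun m hm v₁ v₂ => ?_⟩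
  rw [← hω m hm v₁ v₂]
  ring
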